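/- Let $\Omega\subset\mathbb R^2$ be a bounded Lipschitz domain whose boundary is split into a closed part $\Gamma^c$ and $\Gamma^s=\partial\Omega\setminus\Gamma^c$. Put $V=H^2_{\Gamma^c}(\Omega)\cap H^1_0(\Omega)$ (with $v=\partial_n v=0$ on $\Gamma^c$) and $Q=H^1_{\Gamma^s}(\Omega)$. Fix degrees $k\ge 2$ and $1\le\ell\le k$, and $\rho>0$. Let $\mathcal T_h$ be a partition of $\overline\Omega$ into finitely many simple polygons $K$ of diameter $h_K$ (two cells meet in common edges and vertices only, hanging nodes being counted as vertices; every boundary edge lies in $\Gamma^c$ or, up to end points, in $\Gamma^s$) such that every $K$ is star-shaped with respect to every point of a ball of radius at least $\rho h_K$ and every edge of $K$ has length at least $\rho h_K$. *Projections.* $\Pi_m$ is the (componentwise) $L^2(K)$-projection onto $\mathbb P_m(K)$ ($\mathbb P_m=\{0\}$ for $m<0$). $\Pi^{\nabla^2}_kv\in\mathbb P_k(K)$ is defined by $(\nabla^2\Pi^{\nabla^2}_kv,\nabla^2\chi)_K=(\nabla^2v,\nabla^2\chi)_K$ for $\chi\in\mathbb P_k(K)$, equality of the averages over the vertices of $K$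 of $\Pi^{\nabla^2}_kv$ and $v$, and equality of the vertex averages (conforming case), respectively of the integrals over $\partial K$ (nonconforming case), of their gradients. $\Pi^{\nabla}_\ell q\in\mathbb P_\ell(K)$ is defined by $(\nabla\Pi^\nabla_\ell q,\nabla\chi)_K=(\nabla q,\nabla\chi)_K$ for $\chi\in\mathbb P_\ell(K)$ and equality of the vertex averages (conforming), respectively of the integrals over $\partial K$ (nonconforming), of $\Pi^\nabla_\ell q$ and $q$. Write $w\perp_{m,d}$ if $w$ is $L^2(K)$-orthogonal to all monomials centred at the barycentre of $K$ of degree $>m-d$ and $\le m$. *Local spaces.* $V_h^{k,c}(K)$: all $v\in H^2(K)\cap C^1(\partial K)$ with $\Delta^2v\in\mathbb P_k(K)$, $v|_e\in\mathbb P_{\max\{k,3\}}(e)$ and $\partial_nv|_e\in\mathbb P_{k-1}(e)$ on every edge $e$, and $v-\Pi^{\nabla^2}_kv\perp_{k,4}$. $V_h^{k,nc}(K)$: all $v\in H^2(K)$ with $\Delta^2v\in\mathbb P_k(K)$, $v|_e\in\mathbb P_k(e)$ and $\Delta v|_e\in\mathbb P_{k-2}(e)$ on every edge, $v$ of class $C^1$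 on every side of $K$ (a side is a maximal straight part of $\partial K$), $\int_e(v-\Pi^{\nabla^2}_kv)\chi\,ds=0$ for all $\chi\in\mathbb P_{k-3}(e)$ on every edge and for all $\chi\in\mathbb P_{k-2}(e)$ on the first edge of every side (in counterclockwise order), and $v-\Pi^{\nabla^2}_kv\perp_{k,4}$. $Q_h^{\ell,c}(K)$: all $q\in H^1(K)\cap C^0(\partial K)$ with $\Delta q\in\mathbb P_\ell(K)$, $q|_e\in\mathbb P_\ell(e)$ on every edge, and $q-\Pi^\nabla_\ell q\perp_{\ell,2}$. $Q_h^{\ell,nc}(K)$: the same with $\partial_nq|_e\in\mathbb P_{\ell-1}(e)$ in place of $q|_e\in\mathbb P_\ell(e)$. *Global spaces.* $V_h^{k,c}$ and $Q_h^{\ell,c}$ are the sets of all functions in $V$, respectively $Q$, whose restriction to every $K$ lies in $V_h^{k,c}(K)$, respectively $Q_h^{\ell,c}(K)$. $V_h^{k,nc}$ is the set of all $v\in L^2(\Omega)$ with $v|_K\in V_h^{k,nc}(K)$ for all $K$ that are continuous at interior vertices, zero at boundary vertices, and satisfy $\int_e[\partial_nv]\chi\,ds=0$ for $\chi\in\mathbb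 P_{k-2}(e)$ on all edges $e$ that are interior or in $\Gamma^c$ and $\int_e[v]\chi\,ds=0$ for $\chi\in\mathbb P_{k-3}(e)$ on all edges. $Q_h^{\ell,nc}$ is the set of all $q\in L^2(\Omega)$ with $q|_K\in Q_h^{\ell,nc}(K)$ for all $K$ and $\int_e[q]\chi\,ds=0$ for $\chi\in\mathbb P_{\ell-1}(e)$ on all edges that are interior or in $\Gamma^s$. (Jumps on boundary edges are the functions themselves.) *Discrete problem.* Let $0\le\alpha\le1\le\gamma$ and $\beta>0$. For each $K$ let $S^K_{\nabla^2},S^K_{1,0}$ on the local displacement space and $S^K_{\nabla},S^K_{2,0}$ on the local pressure space be symmetric positive definite bilinear forms such that, with positive constants $C_{\nabla^2},C_{1,0},C_\nabla,C_{2,0}$, $$C_{\nabla^2}^{-1}|v|_{2,K}^2\le S^K_{\nabla^2}(v,v)\le C_{\nabla^2}|v|_{2,K}^2\quad(\Pi^{\nabla^2}_kv=0),\qquad C_{1,0}^{-1}\|v\|_K^2\le S^K_{1,0}(v,v)\le C_{1,0}\|v\|_K^2\quad(\Pi_kv=0),$$ $$C_{\nabla}^{-1}\gamma|q|_{1,K}^2\le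 S^K_{\nabla}(q,q)\le C_{\nabla}\gamma|q|_{1,K}^2\quad(\Pi^{\nabla}_\ell q=0),\qquad C_{2,0}^{-1}\beta\|q\|_K^2\le S^K_{2,0}(q,q)\le C_{2,0}\beta\|q\|_K^2\quad(\Pi_\ell q=0).$$ Summing over $K\in\mathcal T_h$, define $$a_1^h(u,v)=\sum_K(\Pi_ku,\Pi_kv)_K+S^K_{1,0}((1-\Pi_k)u,(1-\Pi_k)v)+(\Pi_{k-2}\nabla^2u,\Pi_{k-2}\nabla^2v)_K+S^K_{\nabla^2}((1-\Pi^{\nabla^2}_k)u,(1-\Pi^{\nabla^2}_k)v),$$ $$a_2^h(p,v)=\alpha\sum_K(\Pi_{\ell-1}\nabla p,\Pi_{k-1}\nabla v)_K,$$ $$a_3^h(p,q)=\sum_K\beta(\Pi_\ell p,\Pi_\ell q)_K+S^K_{2,0}((1-\Pi_\ell)p,(1-\Pi_\ell)q)+\gamma(\Pi_{\ell-1}\nabla p,\Pi_{\ell-1}\nabla q)_K+S^K_\nabla((1-\Pi^\nabla_\ell)p,(1-\Pi^\nabla_\ell)q),$$ $\langle\mathcal A_h(u,p),(v,q)\rangle=a_1^h(u,v)-a_2^h(p,v)+a_2^h(q,u)+a_3^h(p,q)$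 and, for $\tilde f,\tilde g\in L^2(\Omega)$, $\mathcal F_h(v,q)=\sum_K(\tilde f,\Pi_kv)_K+(\tilde g,\Pi_\ell q)_K$. Let $\mathbf H^h$ be $V_h^{k,c}\times Q_h^{\ell,c}$ with the norm $\|(u,p)\|^2=\|u\|_\Omega^2+|u|_{2,\Omega}^2+\beta\|p\|_\Omega^2+\gamma|p|_{1,\Omega}^2$ (conforming case), or $V_h^{k,nc}\times Q_h^{\ell,nc}$ with the norm $\|(u,p)\|^2=\sum_K(\|u\|_K^2+|u|_{2,K}^2+\beta\|p\|_K^2+\gamma|p|_{1,K}^2)$ (nonconforming case). **Theorem.** There are constants $M,c>0$ depending only on $\Omega,\Gamma^c,k,\ell,\rho$ and $C_{\nabla^2},C_{1,0},C_\nabla,C_{2,0}$, hence not on the mesh or on $\alpha,\beta,\gamma$, such that in both cases $\mathcal A_h$ is bilinear on $\mathbf H^h$ with $$|\langle\mathcal A_h\vec u,\vec v\rangle|\le M\|\vec u\|\,\|\vec v\|,\qquad \langle\mathcal A_h\vec v,\vec v\rangle\ge c\,\|\vec v\|^2\qquad\text{for all }\vec u,\vec v\in\mathbf H^h,$$ and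 the discrete problem is well posed: for all $\tilde f,\tilde g\in L^2(\Omega)$ the functional $\mathcal F_h$ is bounded on $\mathbf H^h$, there is exactly one $\vec u_h\in\mathbf H^h$ with $\langle\mathcal A_h\vec u_h,\vec v\rangle=\mathcal F_h(\vec v)$ for all $\vec v\in\mathbf H^h$, and $c\,\|\vec u_h\|\le C$ whenever $C\ge0$ and $|\mathcal F_h(\vec v)|\le C\|\vec v\|$ for all $\vec v\in\mathbf H^h$. -/

import Mathlib

open MeasureTheory Set Topology
open scoped ENNReal NNReal ContDiff RealInnerProductSpace

noncomputable section

namespace PlateVEM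

/-! ### Sobolev spaces on planar open sets, through weak derivatives -/

/-- The Euclidean plane. -/
abbrev Plane : Type := EuclideanSpace ℝ (Fin 2)

/-- The Hilbert space of (classes of) square integrable functions on `U`. -/
abbrev L2 (U : Set Plane) : Type := Lp ℝ 2 (volume.restrict U)

/-- Classical partial derivative in the `i`-th coordinate direction. -/
def pd (i : Fin 2) (φ : Plane → ℝ) (x : Plane) : ℝ := fderiv ℝ φ x (EuclideanSpace.single i 1)

/-- Test functions: smooth with compact support in `U`. -/
def IsTest (U : Set Plane) (φ : Plane → ℝ) : Prop :=
  ContDiff ℝ ∞ φ ∧ HasCompactSupport φ ∧ tsupport φ ⊆ U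

/-- `w` is the weak partial derivative of `v` on `U` in direction `i`. -/
def HasWeakD (U : Set Plane) (i : Fin 2) (v w : L2 U) : Prop :=
  ∀ φ, IsTest U φ → ∫ x in U, v x * pd i φ x = - ∫ x in U, w x * φ x

/-- The Sobolev space `H¹(U)`. -/
def MemH1 (U : Set Plane) (v : L2 U) : Prop := ∀ i, ∃ w, HasWeakD U i v w

open Classical in
/-- The weak partial derivative (the value `0` is used if there is none in `L²`). -/
def weakD (U : Set Plane) (i : Fin 2) (v : L2 U) : L2 U :=
  if h : ∃ w, HasWeakD U i v w then h.choose else 0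

/-- The Sobolev space `H²(U)`. -/
def MemH2 (U : Set Plane) (v : L2 U) : Prop := MemH1 U v ∧ ∀ i, MemH1 U (weakD U i v)

/-- The Laplacian of an `H²` function. -/
def lap (U : Set Plane) (v : L2 U) : L2 U := ∑ i, weakD U i (weakD U i v)

/-- `(∇ u, ∇ v)` in `L²(U)`. -/
def gradForm (U : Set Plane) (u v : L2 U) : ℝ := ∑ i, ⟪weakD U i u, weakD U i v⟫

/-- `(∇² u, ∇² v)` in `L²(U)`. -/
def hessForm (U : Set Plane) (u v : L2 U) : ℝ :=
  ∑ i, ∑ j, ⟪weakD U j (weakD U i u), weakD U j (weakD U i v)⟫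

/-! Helper facts: test functions, uniqueness and linearity of weak derivatives. -/

theorem continuous_pd {φ : Plane → ℝ} (h : ContDiff ℝ ∞ φ) (i : Fin 2) : Continuous (pd i φ) :=
  (h.continuous_fderiv (by simp)).clm_apply continuous_const

theorem memLp_of_bounded {U : Set Plane} (hU : Bornology.IsBounded U) {f : Plane → ℝ}
    (hf : Continuous f) : MemLp f 2 (volume.restrict U) := by
  have hc : IsCompact (closure U) := hU.isCompact_closure
  obtain ⟨C, hC⟩ := hc.exists_bound_of_continuousOn hf.continuousOn
  have : IsFiniteMeasure (volume.restrict (closure U)) :=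
    ⟨by simpa using hc.measure_lt_top⟩
  have h : MemLp f 2 (volume.restrict (closure U)) := by
    refine MemLp.of_bound hf.aestronglyMeasurable C ?_
    exact (ae_restrict_iff' isClosed_closure.measurableSet).2 (Filter.Eventually.of_forall hC)
  exact h.mono_measure (Measure.restrict_mono subset_closure le_rfl)

theorem IsTest.memLp {U : Set Plane} {φ : Plane → ℝ} (h : IsTest U φ) :
    MemLp φ 2 (volume.restrict U) :=
  h.1.continuous.memLp_of_hasCompactSupport h.2.1

theorem IsTest.memLp_pd {U : Set Plane} {φ : Plane → ℝ} (h : IsTest U φ) (i : Fin 2) :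
    MemLp (pd i φ) 2 (volume.restrict U) := by
  refine (continuous_pd h.1 i).memLp_of_hasCompactSupport ?_
  exact (h.2.1.fderiv (𝕜 := ℝ)).comp_left (g := fun L => L (EuclideanSpace.single i 1)) rfl

theorem contDiff_pd {φ : Plane → ℝ} (h : ContDiff ℝ ∞ φ) (i : Fin 2) : ContDiff ℝ ∞ (pd i φ) :=
  (h.fderiv_right (m := ∞) (by simp)).clm_apply contDiff_const

theorem int_add {U : Set Plane} {ψ : Plane → ℝ} (hψ : MemLp ψ 2 (volume.restrict U))
    (u v : L2 U) :
    ∫ x in U, (u + v : L2 U) x * ψ x = (∫ x in U, u x * ψ x) + ∫ x in U, v x * ψ x := by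
  have hu : Integrable (fun x => u x * ψ x) (volume.restrict U) := (Lp.memLp u).integrable_mul hψ
  have hv : Integrable (fun x => v x * ψ x) (volume.restrict U) := (Lp.memLp v).integrable_mul hψ
  rw [← integral_add hu hv]
  refine integral_congr_ae ?_
  filter_upwards [Lp.coeFn_add u v] with x hx
  rw [hx, Pi.add_apply, add_mul]

theorem int_smul {U : Set Plane} (ψ : Plane → ℝ) (c : ℝ) (u : L2 U) :
    ∫ x in U, (c • u : L2 U) x * ψ x = c * ∫ x in U, u x * ψ x := by
  rw [← integral_const_mul]
  refine integral_congr_ae ?_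
  filter_upwards [Lp.coeFn_smul c u] with x hx
  simp [hx, mul_assoc]

theorem int_zero {U : Set Plane} (ψ : Plane → ℝ) :
    ∫ x in U, (0 : L2 U) x * ψ x = 0 := by
  have := int_smul ψ 0 (0 : L2 U)
  simpa using this

theorem HasWeakD.add {U : Set Plane} {i : Fin 2} {v w v' w' : L2 U} (h : HasWeakD U i v w)
    (h' : HasWeakD U i v' w') : HasWeakD U i (v + v') (w + w') := by
  intro φ hφ
  rw [int_add (hφ.memLp_pd i), int_add hφ.memLp, h φ hφ, h' φ hφ]
  ring

theorem HasWeakD.smul {U : Set Plane} {i : Fin 2} {v w : L2 U} (c : ℝ) (h : HasWeakD U i v w) :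
    HasWeakD U i (c • v) (c • w) := by
  intro φ hφ
  rw [int_smul, int_smul, h φ hφ]
  ring

theorem HasWeakD.zero {U : Set Plane} {i : Fin 2} : HasWeakD U i 0 0 := by
  intro φ _
  rw [int_zero, int_zero, neg_zero]

theorem HasWeakD.unique {U : Set Plane} (hU : IsOpen U) {i : Fin 2} {v w w' : L2 U}
    (h : HasWeakD U i v w) (h' : HasWeakD U i v w') : w = w' := by
  have h0 : ∀ φ, IsTest U φ → ∫ x in U, (w + (-1 : ℝ) • w' : L2 U) x * φ x = 0 := by
    intro φ hφ
    rw [int_add hφ.memLp, int_smul]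
    linarith [h φ hφ, h' φ hφ]
  have hl : LocallyIntegrableOn (fun x => (w + (-1 : ℝ) • w' : L2 U) x) U
      (volume.restrict U) :=
    ((Lp.memLp _).locallyIntegrable (by norm_num)).locallyIntegrableOn U
  have := hU.ae_eq_zero_of_integral_contDiff_smul_eq_zero hl (fun g h1 h2 h3 => by
    simpa [mul_comm] using h0 g ⟨h1, h2, h3⟩)
  have hz : w + (-1 : ℝ) • w' = 0 := by
    rw [Lp.eq_zero_iff_ae_eq_zero]
    filter_upwards [this, ae_restrict_mem hU.measurableSet] with x hx hxU
    simpa using hx hxU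
  have : w - w' = 0 := by simpa [sub_eq_add_neg] using hz
  exact sub_eq_zero.1 this

theorem weakD_spec {U : Set Plane} {v : L2 U} (h : MemH1 U v) (i : Fin 2) :
    HasWeakD U i v (weakD U i v) := by
  unfold weakD
  rw [dif_pos (h i)]
  exact (h i).choose_spec

theorem weakD_eq {U : Set Plane} (hU : IsOpen U) {i : Fin 2} {v w : L2 U}
    (h : HasWeakD U i v w) : weakD U i v = w := by
  have h' : ∃ w, HasWeakD U i v w := ⟨w, h⟩
  unfold weakD
  rw [dif_pos h']
  exact h'.choose_spec.unique hU h

theorem MemH1.add {U : Set Plane} {u v : L2 U} (hu : MemH1 U u) (hv : MemH1 U v) :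
    MemH1 U (u + v) := fun i => ⟨_, (weakD_spec hu i).add (weakD_spec hv i)⟩

theorem MemH1.smul {U : Set Plane} {u : L2 U} (c : ℝ) (hu : MemH1 U u) :
    MemH1 U (c • u) := fun i => ⟨_, (weakD_spec hu i).smul c⟩

theorem MemH1.zero {U : Set Plane} : MemH1 U 0 := fun _ => ⟨0, HasWeakD.zero⟩

theorem weakD_add {U : Set Plane} (hU : IsOpen U) {u v : L2 U} (hu : MemH1 U u)
    (hv : MemH1 U v) (i : Fin 2) : weakD U i (u + v) = weakD U i u + weakD U i v :=
  weakD_eq hU ((weakD_spec hu i).add (weakD_spec hv i))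

theorem weakD_smul {U : Set Plane} (hU : IsOpen U) {u : L2 U} (c : ℝ) (hu : MemH1 U u)
    (i : Fin 2) : weakD U i (c • u) = c • weakD U i u :=
  weakD_eq hU ((weakD_spec hu i).smul c)

theorem weakD_zero {U : Set Plane} (hU : IsOpen U) (i : Fin 2) : weakD U i 0 = 0 :=
  weakD_eq hU HasWeakD.zero

theorem MemH2.add {U : Set Plane} (hU : IsOpen U) {u v : L2 U} (hu : MemH2 U u)
    (hv : MemH2 U v) : MemH2 U (u + v) :=
  ⟨hu.1.add hv.1, fun i => by rw [weakD_add hU hu.1 hv.1]; exact (hu.2 i).add (hv.2 i)⟩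

theorem MemH2.smul {U : Set Plane} (hU : IsOpen U) {u : L2 U} (c : ℝ) (hu : MemH2 U u) :
    MemH2 U (c • u) :=
  ⟨hu.1.smul c, fun i => by rw [weakD_smul hU c hu.1]; exact (hu.2 i).smul c⟩

theorem MemH2.zero {U : Set Plane} (hU : IsOpen U) : MemH2 U 0 :=
  ⟨MemH1.zero, fun i => by rw [weakD_zero hU]; exact MemH1.zero⟩

theorem lap_add {U : Set Plane} (hU : IsOpen U) {u v : L2 U} (hu : MemH2 U u)
    (hv : MemH2 U v) : lap U (u + v) = lap U u + lap U v := by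
  unfold lap
  rw [← Finset.sum_add_distrib]
  refine Finset.sum_congr rfl fun i _ => ?_
  rw [weakD_add hU hu.1 hv.1, weakD_add hU (hu.2 i) (hv.2 i)]

theorem lap_smul {U : Set Plane} (hU : IsOpen U) {u : L2 U} (c : ℝ) (hu : MemH2 U u) :
    lap U (c • u) = c • lap U u := by
  unfold lap
  rw [Finset.smul_sum]
  refine Finset.sum_congr rfl fun i _ => ?_
  rw [weakD_smul hU c hu.1, weakD_smul hU c (hu.2 i)]

theorem lap_zero {U : Set Plane} (hU : IsOpen U) : lap U 0 = 0 := by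
  unfold lap
  refine Finset.sum_eq_zero fun i _ => ?_
  rw [weakD_zero hU, weakD_zero hU]

theorem gradForm_add {U : Set Plane} (hU : IsOpen U) {u v : L2 U} (hu : MemH1 U u)
    (hv : MemH1 U v) (z : L2 U) : gradForm U (u + v) z = gradForm U u z + gradForm U v z := by
  unfold gradForm
  rw [← Finset.sum_add_distrib]
  refine Finset.sum_congr rfl fun i _ => ?_
  rw [weakD_add hU hu hv, inner_add_left]

theorem gradForm_smul {U : Set Plane} (hU : IsOpen U) {u : L2 U} (c : ℝ) (hu : MemH1 U u)
    (z : L2 U) : gradForm U (c • u) z = c * gradForm U u z := by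
  unfold gradForm
  rw [Finset.mul_sum]
  refine Finset.sum_congr rfl fun i _ => ?_
  rw [weakD_smul hU c hu, real_inner_smul_left]

theorem gradForm_zero {U : Set Plane} (hU : IsOpen U) (z : L2 U) : gradForm U 0 z = 0 := by
  unfold gradForm
  refine Finset.sum_eq_zero fun i _ => ?_
  rw [weakD_zero hU, inner_zero_left]

theorem hessForm_add {U : Set Plane} (hU : IsOpen U) {u v : L2 U} (hu : MemH2 U u)
    (hv : MemH2 U v) (z : L2 U) : hessForm U (u + v) z = hessForm U u z + hessForm U v z := by
  unfold hessForm
  simp only [← Finset.sum_add_distrib]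
  refine Finset.sum_congr rfl fun i _ => Finset.sum_congr rfl fun j _ => ?_
  rw [weakD_add hU hu.1 hv.1, weakD_add hU (hu.2 i) (hv.2 i), inner_add_left]

theorem hessForm_smul {U : Set Plane} (hU : IsOpen U) {u : L2 U} (c : ℝ) (hu : MemH2 U u)
    (z : L2 U) : hessForm U (c • u) z = c * hessForm U u z := by
  unfold hessForm
  simp only [Finset.mul_sum]
  refine Finset.sum_congr rfl fun i _ => Finset.sum_congr rfl fun j _ => ?_
  rw [weakD_smul hU c hu.1, weakD_smul hU c (hu.2 i), real_inner_smul_left]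

theorem hessForm_zero {U : Set Plane} (hU : IsOpen U) (z : L2 U) : hessForm U 0 z = 0 := by
  unfold hessForm
  refine Finset.sum_eq_zero fun i _ => Finset.sum_eq_zero fun j _ => ?_
  rw [weakD_zero hU, weakD_zero hU, inner_zero_left]

/-! ### Polygons -/

/-- A polygon: the bounded, connected open region enclosed by a simple closed polygonal line with
`m + 3` distinct vertices, listed counterclockwise (the region lies to the left of every edge).
Consecutive edges may be collinear (hanging nodes). Indices are cyclic. -/
structure Polygon where
  m : ℕ
  vert : Fin (m + 3) → Plane
  carrier : Set Plane
  isOpen : IsOpen carrier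
  isConnected : IsConnected carrier
  isBounded : Bornology.IsBounded carrier
  vert_injective : Function.Injective vert
  simple : ∀ i j, i ≠ j → ∀ x, x ∈ segment ℝ (vert i) (vert (i + 1)) →
    x ∈ segment ℝ (vert j) (vert (j + 1)) →
      (j = i + 1 ∧ x = vert j) ∨ (i = j + 1 ∧ x = vert i)
  frontier_eq : frontier carrier = ⋃ i, segment ℝ (vert i) (vert (i + 1))
  counterclockwise : ∀ i, ∀ x ∈ openSegment ℝ (vert i) (vert (i + 1)), ∀ᶠ t in 𝓝[>] (0 : ℝ),
    x + t • !₂[-(vert (i + 1) - vert i) 1, (vert (i + 1) - vert i) 0] ∈ carrier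

namespace Polygon

variable (K : Polygon)

/-- The `i`-th edge, joining the vertices `i` and `i + 1`. -/
def edge (i : Fin (K.m + 3)) : Set Plane := segment ℝ (K.vert i) (K.vert (i + 1))

/-- Length of the `i`-th edge. -/
def len (i : Fin (K.m + 3)) : ℝ := dist (K.vert i) (K.vert (i + 1))

/-- Unit tangent along the `i`-th edge. -/
def tangent (i : Fin (K.m + 3)) : Plane := (K.len i)⁻¹ • (K.vert (i + 1) - K.vert i)

/-- Outward unit normal on the `i`-th edge. -/
def normal (i : Fin (K.m + 3)) : Plane := !₂[K.tangent i 1, -K.tangent i 0]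

/-- Affine parametrisation of the `i`-th edge by `[0, 1]`. -/
def pt (i : Fin (K.m + 3)) (t : ℝ) : Plane := AffineMap.lineMap (K.vert i) (K.vert (i + 1)) t

/-- `∫_e f ds` over the `i`-th edge, `f` being given in the parameter. -/
def edgeInt (i : Fin (K.m + 3)) (f : ℝ → ℝ) : ℝ := K.len i * ∫ t in (0 : ℝ)..1, f t

/-- The diameter `h_K`. -/
def h : ℝ := Metric.diam K.carrier

/-- The vertex `i` is a corner: the two edges meeting there are not aligned. -/
def IsCorner (i : Fin (K.m + 3)) : Prop :=
  ¬ Collinear ℝ {K.vert (i - 1), K.vert i, K.vert (i + 1)}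

/-- The barycentre. -/
def bary : Plane := ⨍ x in K.carrier, x

/-- The boundary function `g` is, on the `i`-th edge, a polynomial of degree less than `n`. -/
def IsPolyOn (g : Plane → ℝ) (i : Fin (K.m + 3)) (n : ℕ) : Prop :=
  ∃ q ∈ Polynomial.degreeLT ℝ n, ∀ t ∈ Icc (0 : ℝ) 1, g (K.pt i t) = q.eval t

/-- The boundary function `g` is square integrable on each edge. -/
def MemL2Bdry (g : Plane → ℝ) : Prop :=
  ∀ i, MemLp (fun t => g (K.pt i t)) 2 (volume.restrict (Icc (0 : ℝ) 1))

/-- `g` is the boundary trace of `v ∈ H¹(K)`, characterised by the Gauss-Green formula against all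
smooth functions on the plane. -/
def IsTrace (v : L2 K.carrier) (g : Plane → ℝ) : Prop :=
  MemH1 K.carrier v ∧ K.MemL2Bdry g ∧ ∀ (j : Fin 2) (φ : Plane → ℝ), ContDiff ℝ ∞ φ →
    (∫ x in K.carrier, v x * pd j φ x) + (∫ x in K.carrier, weakD K.carrier j v x * φ x) =
      ∑ i, K.edgeInt i fun t => g (K.pt i t) * (φ (K.pt i t) * K.normal i j)

/-- Pointwise and boundary values of `v ∈ H²(K)`: `w` is the representative of `v` that is
continuous on the closed polygon, and `G` is the trace of the gradient of `v`. -/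
def IsH2Trace (v : L2 K.carrier) (w : Plane → ℝ) (G : Fin 2 → Plane → ℝ) : Prop :=
  MemH2 K.carrier v ∧ ContinuousOn w (closure K.carrier) ∧
    (∀ᵐ x ∂volume.restrict K.carrier, v x = w x) ∧ K.IsTrace v w ∧
      ∀ i, K.IsTrace (weakD K.carrier i v) (G i)

/-- The normal component on the `i`-th edge of a boundary vector field. -/
def normalPart (G : Fin 2 → Plane → ℝ) (i : Fin (K.m + 3)) (x : Plane) : ℝ :=
  ∑ j, G j x * K.normal i j

/-- The element of `L²(K)` given by a polynomial. -/
def poly : MvPolynomial (Fin 2) ℝ →ₗ[ℝ] L2 K.carrier where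
  toFun p := (memLp_of_bounded K.isBounded (f := fun x => MvPolynomial.eval (fun i => x i) p)
    ((MvPolynomial.continuous_eval p).comp (by fun_prop))).toLp
  map_add' p q := by
    rw [← MemLp.toLp_add]
    congr 1
    ext x
    simp
  map_smul' c p := by
    rw [RingHom.id_apply, ← MemLp.toLp_const_smul]
    congr 1
    ext x
    simp [MvPolynomial.smul_eval]

/-- Polynomials in two variables of total degree at most `k`. -/
abbrev P (k : ℕ) : Submodule ℝ (MvPolynomial (Fin 2) ℝ) :=
  MvPolynomial.restrictTotalDegree (Fin 2) ℝ k

/-- The subspace `P_k(K)` of `L²(K)`. -/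
def polySpace (k : ℕ) : Submodule ℝ (L2 K.carrier) := (P k).map K.poly

instance (k : ℕ) : FiniteDimensional ℝ (K.polySpace k) := by
  unfold polySpace; infer_instance

/-- The `L²`-orthogonal projection onto `P_k(K)`. -/
def proj (k : ℕ) : L2 K.carrier →L[ℝ] L2 K.carrier := (K.polySpace k).starProjection

/-- The scaled monomial `((x - x_K) / h_K) ^ (a, b)`. -/
def monomial (a b : ℕ) (x : Plane) : ℝ :=
  ((x 0 - K.bary 0) / K.h) ^ a * ((x 1 - K.bary 1) / K.h) ^ b

/-- `v` is orthogonal in `L²(K)` to all scaled monomials of degree at most `k` and greater than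
`k - d`, that is, to `P_k(K) \ P_{k-d}(K)`. -/
def OrthTop (k d : ℕ) (v : L2 K.carrier) : Prop :=
  ∀ a b : ℕ, a + b ≤ k → k < a + b + d → ∫ x in K.carrier, v x * K.monomial a b x = 0

/-! ### Polynomial projections -/

/-- `p` is the Hessian energy projection of `v` on `P_k(K)`, up to affine functions. -/
def IsHessOrth (k : ℕ) (v : L2 K.carrier) (p : MvPolynomial (Fin 2) ℝ) : Prop :=
  p ∈ P k ∧ ∀ χ ∈ P k, hessForm K.carrier (K.poly p) (K.poly χ) = hessForm K.carrier v (K.poly χ)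

/-- `p` is the conforming Hessian projection of `v`: the averages over the vertices of `p` and of
its gradient agree with those of `v`. -/
def IsHessProjC (k : ℕ) (v : L2 K.carrier) (p : MvPolynomial (Fin 2) ℝ) : Prop :=
  K.IsHessOrth k v p ∧ ∃ w G, K.IsH2Trace v w G ∧
    (∀ j, ContinuousOn (G j) (frontier K.carrier)) ∧
    (∑ i, p.eval (fun l => K.vert i l)) / (K.m + 3) = (∑ i, w (K.vert i)) / (K.m + 3) ∧
    ∀ j, (∑ i, (MvPolynomial.pderiv j p).eval (fun l => K.vert i l)) / (K.m + 3) =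
      (∑ i, G j (K.vert i)) / (K.m + 3)

/-- `p` is the nonconforming Hessian projection of `v`: the vertex averages of `p` and `v` agree,
and so do the boundary integrals of their gradients. -/
def IsHessProjNC (k : ℕ) (v : L2 K.carrier) (p : MvPolynomial (Fin 2) ℝ) : Prop :=
  K.IsHessOrth k v p ∧ ∃ w G, K.IsH2Trace v w G ∧
    (∑ i, p.eval (fun l => K.vert i l)) / (K.m + 3) = (∑ i, w (K.vert i)) / (K.m + 3) ∧
    ∀ j, (∑ i, K.edgeInt i fun t => (MvPolynomial.pderiv j p).eval (fun l => K.pt i t l)) =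
      ∑ i, K.edgeInt i fun t => G j (K.pt i t)

/-- `p` is the gradient energy projection of `q` on `P_ℓ(K)`, up to constants. -/
def IsGradOrth (ℓ : ℕ) (q : L2 K.carrier) (p : MvPolynomial (Fin 2) ℝ) : Prop :=
  p ∈ P ℓ ∧ ∀ χ ∈ P ℓ, gradForm K.carrier (K.poly p) (K.poly χ) = gradForm K.carrier q (K.poly χ)

/-- `p` is the conforming gradient projection of `q` (equal vertex averages). -/
def IsGradProjC (ℓ : ℕ) (q : L2 K.carrier) (p : MvPolynomial (Fin 2) ℝ) : Prop :=
  K.IsGradOrth ℓ q p ∧ ∃ g, K.IsTrace q g ∧ ContinuousOn g (frontier K.carrier) ∧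
    (∑ i, p.eval (fun l => K.vert i l)) / (K.m + 3) = (∑ i, g (K.vert i)) / (K.m + 3)

/-- `p` is the nonconforming gradient projection of `q` (equal boundary integrals). -/
def IsGradProjNC (ℓ : ℕ) (q : L2 K.carrier) (p : MvPolynomial (Fin 2) ℝ) : Prop :=
  K.IsGradOrth ℓ q p ∧ ∃ g, K.IsTrace q g ∧
    (∑ i, K.edgeInt i fun t => p.eval (fun l => K.pt i t l)) =
      ∑ i, K.edgeInt i fun t => g (K.pt i t)

open Classical in
/-- The function of `L²(K)` given by the polynomial that a relation singles out. -/
def pick (R : MvPolynomial (Fin 2) ℝ → Prop) : L2 K.carrier :=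
  if h : ∃ p, R p then K.poly h.choose else 0

/-! ### Local virtual element spaces -/

/-- `Δ² v = f` in `K`, with `f` a polynomial. -/
def IsBilap (v : L2 K.carrier) (f : MvPolynomial (Fin 2) ℝ) : Prop :=
  ∀ φ, IsTest K.carrier φ →
    ∫ x in K.carrier, lap K.carrier v x * (pd 0 (pd 0 φ) x + pd 1 (pd 1 φ) x) =
      ∫ x in K.carrier, K.poly f x * φ x

/-- The trace of `Δ v` on the `i`-th edge is the polynomial `g i`, for `v ∈ H²(K)` with
`Δ² v = f`. As `Δ v` and `Δ² v` are merely square integrable, this trace is the one of Green's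
formula `(Δ v, Δ z)_K - (Δ² v, z)_K = (Δ v, ∂ₙ z)_{∂K}` for all `z ∈ H²(K)` that vanish
on `∂K`. -/
def IsLapTrace (v : L2 K.carrier) (f : MvPolynomial (Fin 2) ℝ)
    (g : Fin (K.m + 3) → Polynomial ℝ) : Prop :=
  ∀ z w G, K.IsH2Trace z w G → (∀ x ∈ frontier K.carrier, w x = 0) →
    ⟪lap K.carrier v, lap K.carrier z⟫ - ⟪K.poly f, z⟫ =
      ∑ i, K.edgeInt i fun t => (g i).eval t * K.normalPart G i (K.pt i t)

/-- `Δ q = f` in `K`, with `f` a polynomial. -/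
def IsLap (q : L2 K.carrier) (f : MvPolynomial (Fin 2) ℝ) : Prop :=
  ∀ φ, IsTest K.carrier φ →
    ∑ i, ∫ x in K.carrier, weakD K.carrier i q x * pd i φ x =
      - ∫ x in K.carrier, K.poly f x * φ x

/-- The trace of `∂ₙ q` on the `i`-th edge is the polynomial `g i`, for `q ∈ H¹(K)` with
`Δ q = f`, in the sense of Green's formula
`(∇ q, ∇ z)_K + (Δ q, z)_K = (∂ₙ q, z)_{∂K}` for all `z ∈ H¹(K)`. -/
def IsNormalTrace (q : L2 K.carrier) (f : MvPolynomial (Fin 2) ℝ)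
    (g : Fin (K.m + 3) → Polynomial ℝ) : Prop :=
  ∀ z gz, K.IsTrace z gz → gradForm K.carrier q z + ⟪K.poly f, z⟫ =
    ∑ i, K.edgeInt i fun t => (g i).eval t * gz (K.pt i t)

/-- Membership in the local conforming displacement space of degree `k`. The requirement that
`v` be `C¹` on `∂K` means that `v` and (the trace of) `∇ v` are continuous on `∂K`. -/
def MemVc (k : ℕ) (v : L2 K.carrier) : Prop :=
  ∃ w G f p, K.IsH2Trace v w G ∧ (∀ j, ContinuousOn (G j) (frontier K.carrier)) ∧
    f ∈ P k ∧ K.IsBilap v f ∧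
    (∀ i, K.IsPolyOn w i (max k 3 + 1)) ∧ (∀ i, K.IsPolyOn (K.normalPart G i) i k) ∧
    K.IsHessProjC k v p ∧ K.OrthTop k 4 (v - K.poly p)

/-- Membership in the local nonconforming displacement space of degree `k`. On every edge, the
moments of `v` of degree `≤ k - 3` are those of its projection, and on the first edge of every
side (the one starting at a corner) also those of degree `k - 2`. -/
def MemVnc (k : ℕ) (v : L2 K.carrier) : Prop :=
  ∃ w G f g p, K.IsH2Trace v w G ∧ f ∈ P k ∧ K.IsBilap v f ∧
    (∀ i, K.IsPolyOn w i (k + 1)) ∧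
    (∀ i, g i ∈ Polynomial.degreeLT ℝ (k - 1)) ∧ K.IsLapTrace v f g ∧
    (∀ i, ¬ K.IsCorner i → ContDiffOn ℝ 1 (fun t : ℝ => w (K.vert i + t • K.tangent i))
      (Icc (-K.len (i - 1)) (K.len i))) ∧
    K.IsHessProjNC k v p ∧
    (∀ i, K.IsCorner i → ∀ χ ∈ Polynomial.degreeLT ℝ (k - 1),
      K.edgeInt i (fun t => w (K.pt i t) * χ.eval t) =
        K.edgeInt i (fun t => p.eval (fun l => K.pt i t l) * χ.eval t)) ∧
    (∀ i, ∀ χ ∈ Polynomial.degreeLT ℝ (k - 2),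
      K.edgeInt i (fun t => w (K.pt i t) * χ.eval t) =
        K.edgeInt i (fun t => p.eval (fun l => K.pt i t l) * χ.eval t)) ∧
    K.OrthTop k 4 (v - K.poly p)

/-- Membership in the local conforming pressure space of degree `ℓ`. -/
def MemQc (ℓ : ℕ) (q : L2 K.carrier) : Prop :=
  ∃ g f p, K.IsTrace q g ∧ ContinuousOn g (frontier K.carrier) ∧ f ∈ P ℓ ∧ K.IsLap q f ∧
    (∀ i, K.IsPolyOn g i (ℓ + 1)) ∧
    K.IsGradProjC ℓ q p ∧ K.OrthTop ℓ 2 (q - K.poly p)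

/-- Membership in the local nonconforming pressure space of degree `ℓ`. -/
def MemQnc (ℓ : ℕ) (q : L2 K.carrier) : Prop :=
  ∃ g f r p, K.IsTrace q g ∧ ContinuousOn g (frontier K.carrier) ∧ f ∈ P ℓ ∧ K.IsLap q f ∧
    (∀ i, r i ∈ Polynomial.degreeLT ℝ ℓ) ∧ K.IsNormalTrace q f r ∧
    K.IsGradProjNC ℓ q p ∧ K.OrthTop ℓ 2 (q - K.poly p)

/-! Helper facts: the relations above are linear. -/

section Linearity

variable {K}

theorem edgeInt_add {i : Fin (K.m + 3)} {f g : ℝ → ℝ} (hf : IntervalIntegrable f volume 0 1)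
    (hg : IntervalIntegrable g volume 0 1) :
    K.edgeInt i (fun t => f t + g t) = K.edgeInt i f + K.edgeInt i g := by
  unfold edgeInt
  rw [intervalIntegral.integral_add hf hg, mul_add]

theorem edgeInt_smul {i : Fin (K.m + 3)} (c : ℝ) (f : ℝ → ℝ) :
    K.edgeInt i (fun t => c * f t) = c * K.edgeInt i f := by
  unfold edgeInt
  rw [intervalIntegral.integral_const_mul]
  ring

theorem continuous_pt (i : Fin (K.m + 3)) : Continuous (K.pt i) := by
  unfold pt
  exact AffineMap.lineMap_continuous

theorem MemL2Bdry.integrable {g : Plane → ℝ} (hg : K.MemL2Bdry g) (i : Fin (K.m + 3))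
    {f : ℝ → ℝ} (hf : Continuous f) :
    IntervalIntegrable (fun t => g (K.pt i t) * f t) volume 0 1 := by
  rw [intervalIntegrable_iff_integrableOn_Icc_of_le zero_le_one]
  have h1 : IntegrableOn (fun t => g (K.pt i t)) (Icc (0 : ℝ) 1) :=
    (hg i).integrable (by norm_num)
  exact h1.mul_continuousOn hf.continuousOn isCompact_Icc

theorem MemL2Bdry.add {g g' : Plane → ℝ} (hg : K.MemL2Bdry g) (hg' : K.MemL2Bdry g') :
    K.MemL2Bdry (g + g') := fun i => (hg i).add (hg' i)

theorem MemL2Bdry.smul {g : Plane → ℝ} (c : ℝ) (hg : K.MemL2Bdry g) :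
    K.MemL2Bdry (c • g) := fun i => (hg i).const_smul c

theorem MemL2Bdry.zero : K.MemL2Bdry 0 := fun _ => MemLp.zero

theorem IsTrace.add {v v' : L2 K.carrier} {g g' : Plane → ℝ} (h : K.IsTrace v g)
    (h' : K.IsTrace v' g') : K.IsTrace (v + v') (g + g') := by
  refine ⟨h.1.add h'.1, h.2.1.add h'.2.1, fun j φ hφ => ?_⟩
  have e : ∀ i, K.edgeInt i (fun t => (g + g') (K.pt i t) * (φ (K.pt i t) * K.normal i j)) =
      K.edgeInt i (fun t => g (K.pt i t) * (φ (K.pt i t) * K.normal i j)) +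
      K.edgeInt i (fun t => g' (K.pt i t) * (φ (K.pt i t) * K.normal i j)) := by
    intro i
    have hc : Continuous fun t => φ (K.pt i t) * K.normal i j :=
      (hφ.continuous.comp (continuous_pt i)).mul continuous_const
    rw [← edgeInt_add (h.2.1.integrable i hc) (h'.2.1.integrable i hc)]
    simp [add_mul]
  rw [Finset.sum_congr rfl fun i _ => e i, Finset.sum_add_distrib, ← h.2.2 j φ hφ,
    ← h'.2.2 j φ hφ, weakD_add K.isOpen h.1 h'.1,
    int_add (memLp_of_bounded K.isBounded (continuous_pd hφ j)),
    int_add (memLp_of_bounded K.isBounded hφ.continuous)]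
  ring

theorem IsTrace.smul {v : L2 K.carrier} {g : Plane → ℝ} (c : ℝ) (h : K.IsTrace v g) :
    K.IsTrace (c • v) (c • g) := by
  refine ⟨h.1.smul c, h.2.1.smul c, fun j φ hφ => ?_⟩
  have e : ∀ i, K.edgeInt i (fun t => (c • g) (K.pt i t) * (φ (K.pt i t) * K.normal i j)) =
      c * K.edgeInt i (fun t => g (K.pt i t) * (φ (K.pt i t) * K.normal i j)) := by
    intro i
    rw [← edgeInt_smul]
    simp [mul_assoc]
  rw [Finset.sum_congr rfl fun i _ => e i, ← Finset.mul_sum, ← h.2.2 j φ hφ,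
    weakD_smul K.isOpen c h.1, int_smul, int_smul]
  ring

theorem IsTrace.zero : K.IsTrace 0 0 := by
  refine ⟨MemH1.zero, MemL2Bdry.zero, fun j φ _ => ?_⟩
  rw [weakD_zero K.isOpen, int_zero, int_zero]
  simp [edgeInt]

theorem IsH2Trace.add {v v' : L2 K.carrier} {w w' : Plane → ℝ} {G G' : Fin 2 → Plane → ℝ}
    (h : K.IsH2Trace v w G) (h' : K.IsH2Trace v' w' G') :
    K.IsH2Trace (v + v') (w + w') (G + G') := by
  refine ⟨h.1.add K.isOpen h'.1, h.2.1.add h'.2.1, ?_, h.2.2.2.1.add h'.2.2.2.1, fun i => ?_⟩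
  · filter_upwards [h.2.2.1, h'.2.2.1, Lp.coeFn_add v v'] with x h1 h2 h3
    rw [h3, Pi.add_apply, Pi.add_apply, h1, h2]
  · rw [weakD_add K.isOpen h.1.1 h'.1.1]
    exact (h.2.2.2.2 i).add (h'.2.2.2.2 i)

theorem IsH2Trace.smul {v : L2 K.carrier} {w : Plane → ℝ} {G : Fin 2 → Plane → ℝ} (c : ℝ)
    (h : K.IsH2Trace v w G) : K.IsH2Trace (c • v) (c • w) (c • G) := by
  refine ⟨h.1.smul K.isOpen c, h.2.1.const_smul c, ?_, h.2.2.2.1.smul c, fun i => ?_⟩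
  · filter_upwards [h.2.2.1, Lp.coeFn_smul c v] with x h1 h3
    rw [h3, Pi.smul_apply, Pi.smul_apply, h1]
  · rw [weakD_smul K.isOpen c h.1.1]
    exact (h.2.2.2.2 i).smul c

theorem IsH2Trace.zero : K.IsH2Trace 0 0 0 := by
  refine ⟨MemH2.zero K.isOpen, continuousOn_const, ?_, IsTrace.zero, fun i => ?_⟩
  · exact Lp.coeFn_zero _ _ _
  · rw [weakD_zero K.isOpen]
    exact IsTrace.zero

theorem IsH2Trace.normalL2 {v : L2 K.carrier} {w : Plane → ℝ} {G : Fin 2 → Plane → ℝ}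
    (h : K.IsH2Trace v w G) (i : Fin (K.m + 3)) {f : ℝ → ℝ} (hf : Continuous f) :
    IntervalIntegrable (fun t => f t * K.normalPart G i (K.pt i t)) volume 0 1 := by
  have h0 := (h.2.2.2.2 0).2.1.integrable i (hf.mul (continuous_const (y := K.normal i 0)))
  have h1 := (h.2.2.2.2 1).2.1.integrable i (hf.mul (continuous_const (y := K.normal i 1)))
  refine (h0.add h1).congr fun t _ => ?_
  simp [normalPart, Fin.sum_univ_two]
  ring

theorem normalPart_add (G G' : Fin 2 → Plane → ℝ) (i : Fin (K.m + 3)) :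
    K.normalPart (G + G') i = K.normalPart G i + K.normalPart G' i := by
  ext x
  simp [normalPart, add_mul, Finset.sum_add_distrib]

theorem normalPart_smul (c : ℝ) (G : Fin 2 → Plane → ℝ) (i : Fin (K.m + 3)) :
    K.normalPart (c • G) i = c • K.normalPart G i := by
  ext x
  simp [normalPart, mul_add, mul_assoc]

theorem normalPart_zero (i : Fin (K.m + 3)) : K.normalPart 0 i = 0 := by
  ext x
  simp [normalPart]

theorem IsPolyOn.add {g g' : Plane → ℝ} {i : Fin (K.m + 3)} {n : ℕ} (h : K.IsPolyOn g i n)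
    (h' : K.IsPolyOn g' i n) : K.IsPolyOn (g + g') i n := by
  obtain ⟨q, hq, e⟩ := h
  obtain ⟨q', hq', e'⟩ := h'
  exact ⟨q + q', Submodule.add_mem _ hq hq', fun t ht => by simp [e t ht, e' t ht]⟩

theorem IsPolyOn.smul {g : Plane → ℝ} {i : Fin (K.m + 3)} {n : ℕ} (c : ℝ)
    (h : K.IsPolyOn g i n) : K.IsPolyOn (c • g) i n := by
  obtain ⟨q, hq, e⟩ := h
  exact ⟨c • q, Submodule.smul_mem _ c hq, fun t ht => by simp [e t ht]⟩

theorem IsPolyOn.zero {i : Fin (K.m + 3)} {n : ℕ} : K.IsPolyOn 0 i n :=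
  ⟨0, Submodule.zero_mem _, fun t _ => by simp⟩

theorem continuous_monomial (a b : ℕ) : Continuous (K.monomial a b) := by
  unfold monomial
  fun_prop

theorem OrthTop.add {k d : ℕ} {v v' : L2 K.carrier} (h : K.OrthTop k d v)
    (h' : K.OrthTop k d v') : K.OrthTop k d (v + v') := fun a b h1 h2 => by
  rw [int_add (memLp_of_bounded K.isBounded (continuous_monomial a b)), h a b h1 h2,
    h' a b h1 h2, add_zero]

theorem OrthTop.smul {k d : ℕ} {v : L2 K.carrier} (c : ℝ) (h : K.OrthTop k d v) :
    K.OrthTop k d (c • v) := fun a b h1 h2 => by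
  rw [int_smul, h a b h1 h2, mul_zero]

theorem OrthTop.zero {k d : ℕ} : K.OrthTop k d 0 := fun _ _ _ _ => int_zero _

theorem contDiff_eval (p : MvPolynomial (Fin 2) ℝ) :
    ContDiff ℝ ∞ fun x : Plane => p.eval (fun l => x l) := by
  induction p using MvPolynomial.induction_on with
  | C a => simpa using contDiff_const
  | add p q hp hq => simpa using hp.add hq
  | mul_X p i hp =>
    have hi : ContDiff ℝ ∞ fun x : Plane => x i := by fun_prop
    simpa using hp.mul hi

theorem pd_eval (p : MvPolynomial (Fin 2) ℝ) (i : Fin 2) (x : Plane) :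
    pd i (fun x : Plane => p.eval (fun l => x l)) x =
      (MvPolynomial.pderiv i p).eval (fun l => x l) := by
  have hd : ∀ q : MvPolynomial (Fin 2) ℝ,
      DifferentiableAt ℝ (fun x : Plane => q.eval (fun l => x l)) x := fun q =>
    (contDiff_eval q).differentiable (by simp) x
  unfold pd
  induction p using MvPolynomial.induction_on with
  | C a => simp
  | add p q hp hq =>
    have : (fun x : Plane => (p + q).eval (fun l => x l)) =
      (fun x : Plane => p.eval (fun l => x l)) + fun x : Plane => q.eval (fun l => x l) := by
      ext x; simp
    rw [this, fderiv_add (hd p) (hd q)]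
    simp [hp, hq]
  | mul_X p j hp =>
    have hj : HasFDerivAt (fun x : Plane => x j)
        (EuclideanSpace.proj j : Plane →L[ℝ] ℝ) x :=
      (EuclideanSpace.proj j : Plane →L[ℝ] ℝ).hasFDerivAt
    have : (fun x : Plane => (p * MvPolynomial.X j).eval (fun l => x l)) =
      (fun x : Plane => p.eval (fun l => x l)) * fun x : Plane => x j := by
      ext x; simp
    rw [this, ((hd p).hasFDerivAt.mul hj).fderiv]
    simp only [Derivation.leibniz, smul_eq_mul, MvPolynomial.pderiv_X, map_add, map_mul,
      MvPolynomial.eval_X, add_apply, smul_apply, hp]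
    by_cases hij : i = j
    · subst hij; simp
    · simp [Ne.symm hij]

theorem poly_ae (p : MvPolynomial (Fin 2) ℝ) :
    ∀ᵐ x ∂volume.restrict K.carrier, K.poly p x = p.eval (fun l => x l) :=
  MemLp.coeFn_toLp (memLp_of_bounded K.isBounded (contDiff_eval p).continuous)

theorem hasWeakD_poly (p : MvPolynomial (Fin 2) ℝ) (i : Fin 2) :
    HasWeakD K.carrier i (K.poly p) (K.poly (MvPolynomial.pderiv i p)) := by
  intro φ hφ
  have e1 : ∫ x in K.carrier, K.poly p x * pd i φ x =
      ∫ x in K.carrier, p.eval (fun l => x l) * pd i φ x :=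
    integral_congr_ae (by filter_upwards [poly_ae p] with x hx; rw [hx])
  have e2 : ∫ x in K.carrier, K.poly (MvPolynomial.pderiv i p) x * φ x =
      ∫ x in K.carrier, (MvPolynomial.pderiv i p).eval (fun l => x l) * φ x :=
    integral_congr_ae (by filter_upwards [poly_ae (MvPolynomial.pderiv i p)] with x hx; rw [hx])
  have z1 : ∀ x, x ∉ K.carrier → φ x = 0 := fun x hx =>
    image_eq_zero_of_notMem_tsupport fun h => hx (hφ.2.2 h)
  have s2 : ∀ x, x ∉ K.carrier → pd i φ x = 0 := fun x hx => by
    have : x ∉ tsupport (fderiv ℝ φ) := fun h => hx (hφ.2.2 (tsupport_fderiv_subset ℝ h))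
    simp [pd, image_eq_zero_of_notMem_tsupport this]
  rw [e1, e2, setIntegral_eq_integral_of_forall_compl_eq_zero (fun x hx => by simp [s2 x hx]),
    setIntegral_eq_integral_of_forall_compl_eq_zero (fun x hx => by simp [z1 x hx])]
  have hc := hφ.2.1
  have hcf : HasCompactSupport (pd i φ) :=
    (hc.fderiv (𝕜 := ℝ)).comp_left
      (g := fun L : Plane →L[ℝ] ℝ => L (EuclideanSpace.single i 1)) rfl
  have hp := contDiff_eval p
  have hdp := contDiff_pd hp i
  have key := integral_mul_fderiv_eq_neg_fderiv_mul_of_integrable (𝕜 := ℝ) (μ := volume)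
    (f := fun x : Plane => p.eval (fun l => x l)) (g := φ) (v := EuclideanSpace.single i 1)
    ((hdp.continuous.mul hφ.1.continuous).integrable_of_hasCompactSupport hc.mul_left)
    ((hp.continuous.mul (continuous_pd hφ.1 i)).integrable_of_hasCompactSupport hcf.mul_left)
    ((hp.continuous.mul hφ.1.continuous).integrable_of_hasCompactSupport hc.mul_left)
    (fun x _ => hp.differentiable (by simp) x) (fun x _ => hφ.1.differentiable (by simp) x)
  refine key.trans ?_
  congr 1
  refine integral_congr_ae (Filter.Eventually.of_forall fun x => ?_)
  have := pd_eval p i x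
  simp only [pd] at this
  simp only [this]

theorem memH1_poly (p : MvPolynomial (Fin 2) ℝ) : MemH1 K.carrier (K.poly p) :=
  fun i => ⟨_, hasWeakD_poly p i⟩

theorem memH2_poly (p : MvPolynomial (Fin 2) ℝ) : MemH2 K.carrier (K.poly p) :=
  ⟨memH1_poly p, fun i => by
    rw [weakD_eq K.isOpen (hasWeakD_poly p i)]; exact memH1_poly _⟩

theorem IsHessOrth.add {k : ℕ} {v v' : L2 K.carrier} {p p' : MvPolynomial (Fin 2) ℝ}
    (hv : MemH2 K.carrier v) (hv' : MemH2 K.carrier v') (h : K.IsHessOrth k v p)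
    (h' : K.IsHessOrth k v' p') : K.IsHessOrth k (v + v') (p + p') := by
  refine ⟨Submodule.add_mem _ h.1 h'.1, fun χ hχ => ?_⟩
  rw [map_add, hessForm_add K.isOpen (memH2_poly p) (memH2_poly p'),
    hessForm_add K.isOpen hv hv', h.2 χ hχ, h'.2 χ hχ]

theorem IsHessOrth.smul {k : ℕ} {v : L2 K.carrier} {p : MvPolynomial (Fin 2) ℝ} (c : ℝ)
    (hv : MemH2 K.carrier v) (h : K.IsHessOrth k v p) : K.IsHessOrth k (c • v) (c • p) := by
  refine ⟨Submodule.smul_mem _ c h.1, fun χ hχ => ?_⟩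
  rw [map_smul, hessForm_smul K.isOpen c (memH2_poly p), hessForm_smul K.isOpen c hv, h.2 χ hχ]

theorem IsHessOrth.zero {k : ℕ} : K.IsHessOrth k 0 0 :=
  ⟨Submodule.zero_mem _, fun χ _ => by rw [map_zero]⟩

theorem IsGradOrth.add {k : ℕ} {v v' : L2 K.carrier} {p p' : MvPolynomial (Fin 2) ℝ}
    (hv : MemH1 K.carrier v) (hv' : MemH1 K.carrier v') (h : K.IsGradOrth k v p)
    (h' : K.IsGradOrth k v' p') : K.IsGradOrth k (v + v') (p + p') := by
  refine ⟨Submodule.add_mem _ h.1 h'.1, fun χ hχ => ?_⟩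
  rw [map_add, gradForm_add K.isOpen (memH1_poly p) (memH1_poly p'),
    gradForm_add K.isOpen hv hv', h.2 χ hχ, h'.2 χ hχ]

theorem IsGradOrth.smul {k : ℕ} {v : L2 K.carrier} {p : MvPolynomial (Fin 2) ℝ} (c : ℝ)
    (hv : MemH1 K.carrier v) (h : K.IsGradOrth k v p) : K.IsGradOrth k (c • v) (c • p) := by
  refine ⟨Submodule.smul_mem _ c h.1, fun χ hχ => ?_⟩
  rw [map_smul, gradForm_smul K.isOpen c (memH1_poly p), gradForm_smul K.isOpen c hv, h.2 χ hχ]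

theorem IsGradOrth.zero {k : ℕ} : K.IsGradOrth k 0 0 :=
  ⟨Submodule.zero_mem _, fun χ _ => by rw [map_zero]⟩

theorem continuous_eval_pt (p : MvPolynomial (Fin 2) ℝ) (i : Fin (K.m + 3)) :
    Continuous fun t => p.eval (fun l => K.pt i t l) :=
  (contDiff_eval p).continuous.comp (continuous_pt i)

theorem sum_edge_add {g g' : Plane → ℝ} (h : K.MemL2Bdry g) (h' : K.MemL2Bdry g') :
    (∑ i, K.edgeInt i fun t => (g + g') (K.pt i t)) =
      (∑ i, K.edgeInt i fun t => g (K.pt i t)) + ∑ i, K.edgeInt i fun t => g' (K.pt i t) := by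
  rw [← Finset.sum_add_distrib]
  refine Finset.sum_congr rfl fun i _ => ?_
  have a := h.integrable i (continuous_const (y := (1 : ℝ)))
  have b := h'.integrable i (continuous_const (y := (1 : ℝ)))
  simp only [mul_one] at a b
  exact edgeInt_add a b

theorem sum_edge_smul {g : Plane → ℝ} (c : ℝ) :
    (∑ i, K.edgeInt i fun t => (c • g) (K.pt i t)) =
      c * ∑ i, K.edgeInt i fun t => g (K.pt i t) := by
  rw [Finset.mul_sum]
  exact Finset.sum_congr rfl fun i _ => edgeInt_smul c _

theorem sum_eval_add (p p' : MvPolynomial (Fin 2) ℝ) :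
    (∑ i, K.edgeInt i fun t => (p + p').eval (fun l => K.pt i t l)) =
      (∑ i, K.edgeInt i fun t => p.eval (fun l => K.pt i t l)) +
        ∑ i, K.edgeInt i fun t => p'.eval (fun l => K.pt i t l) := by
  rw [← Finset.sum_add_distrib]
  refine Finset.sum_congr rfl fun i _ => ?_
  simp only [map_add]
  exact edgeInt_add ((continuous_eval_pt p i).intervalIntegrable _ _)
    ((continuous_eval_pt p' i).intervalIntegrable _ _)

theorem sum_eval_smul (c : ℝ) (p : MvPolynomial (Fin 2) ℝ) :
    (∑ i, K.edgeInt i fun t => (c • p).eval (fun l => K.pt i t l)) =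
      c * ∑ i, K.edgeInt i fun t => p.eval (fun l => K.pt i t l) := by
  rw [Finset.mul_sum]
  refine Finset.sum_congr rfl fun i _ => ?_
  simp only [MvPolynomial.smul_eval]
  exact edgeInt_smul c _

theorem IsHessProjC.add {k : ℕ} {v v' : L2 K.carrier} {p p' : MvPolynomial (Fin 2) ℝ}
    (h : K.IsHessProjC k v p) (h' : K.IsHessProjC k v' p') :
    K.IsHessProjC k (v + v') (p + p') := by
  obtain ⟨o, w, G, t, c, a, b⟩ := h
  obtain ⟨o', w', G', t', c', a', b'⟩ := h'
  refine ⟨o.add t.1 t'.1 o', _, _, t.add t', fun j => (c j).add (c' j), ?_, fun j => ?_⟩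
  · simp only [map_add, Pi.add_apply, Finset.sum_add_distrib, add_div, a, a']
  · simp only [map_add, Pi.add_apply, Finset.sum_add_distrib, add_div, b j, b' j]

theorem IsHessProjC.smul {k : ℕ} {v : L2 K.carrier} {p : MvPolynomial (Fin 2) ℝ} (c : ℝ)
    (h : K.IsHessProjC k v p) : K.IsHessProjC k (c • v) (c • p) := by
  obtain ⟨o, w, G, t, d, a, b⟩ := h
  refine ⟨o.smul c t.1, _, _, t.smul c, fun j => (d j).const_smul c, ?_, fun j => ?_⟩
  · simp only [MvPolynomial.smul_eval, Pi.smul_apply, smul_eq_mul, ← Finset.mul_sum,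
      mul_div_assoc, a]
  · simp only [Derivation.map_smul, MvPolynomial.smul_eval, Pi.smul_apply, smul_eq_mul,
      ← Finset.mul_sum, mul_div_assoc, b j]

theorem IsHessProjC.zero {k : ℕ} : K.IsHessProjC k 0 0 :=
  ⟨IsHessOrth.zero, 0, 0, IsH2Trace.zero, fun _ => continuousOn_const, by simp, by simp⟩

theorem IsHessProjNC.add {k : ℕ} {v v' : L2 K.carrier} {p p' : MvPolynomial (Fin 2) ℝ}
    (h : K.IsHessProjNC k v p) (h' : K.IsHessProjNC k v' p') :
    K.IsHessProjNC k (v + v') (p + p') := by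
  obtain ⟨o, w, G, t, a, b⟩ := h
  obtain ⟨o', w', G', t', a', b'⟩ := h'
  refine ⟨o.add t.1 t'.1 o', _, _, t.add t', ?_, fun j => ?_⟩
  · simp only [map_add, Pi.add_apply, Finset.sum_add_distrib, add_div, a, a']
  · rw [map_add, sum_eval_add, Pi.add_apply,
      sum_edge_add (t.2.2.2.2 j).2.1 (t'.2.2.2.2 j).2.1, b j, b' j]

theorem IsHessProjNC.smul {k : ℕ} {v : L2 K.carrier} {p : MvPolynomial (Fin 2) ℝ} (c : ℝ)
    (h : K.IsHessProjNC k v p) : K.IsHessProjNC k (c • v) (c • p) := by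
  obtain ⟨o, w, G, t, a, b⟩ := h
  refine ⟨o.smul c t.1, _, _, t.smul c, ?_, fun j => ?_⟩
  · simp only [MvPolynomial.smul_eval, Pi.smul_apply, smul_eq_mul, ← Finset.mul_sum,
      mul_div_assoc, a]
  · rw [Derivation.map_smul, sum_eval_smul, Pi.smul_apply, sum_edge_smul, b j]

theorem IsHessProjNC.zero {k : ℕ} : K.IsHessProjNC k 0 0 :=
  ⟨IsHessOrth.zero, 0, 0, IsH2Trace.zero, by simp, by simp [edgeInt]⟩

theorem IsGradProjC.add {k : ℕ} {v v' : L2 K.carrier} {p p' : MvPolynomial (Fin 2) ℝ}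
    (h : K.IsGradProjC k v p) (h' : K.IsGradProjC k v' p') :
    K.IsGradProjC k (v + v') (p + p') := by
  obtain ⟨o, g, t, c, a⟩ := h
  obtain ⟨o', g', t', c', a'⟩ := h'
  refine ⟨o.add t.1 t'.1 o', _, t.add t', c.add c', ?_⟩
  simp only [map_add, Pi.add_apply, Finset.sum_add_distrib, add_div, a, a']

theorem IsGradProjC.smul {k : ℕ} {v : L2 K.carrier} {p : MvPolynomial (Fin 2) ℝ} (c : ℝ)
    (h : K.IsGradProjC k v p) : K.IsGradProjC k (c • v) (c • p) := by
  obtain ⟨o, g, t, d, a⟩ := h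
  refine ⟨o.smul c t.1, _, t.smul c, d.const_smul c, ?_⟩
  simp only [MvPolynomial.smul_eval, Pi.smul_apply, smul_eq_mul, ← Finset.mul_sum,
    mul_div_assoc, a]

theorem IsGradProjC.zero {k : ℕ} : K.IsGradProjC k 0 0 :=
  ⟨IsGradOrth.zero, 0, IsTrace.zero, continuousOn_const, by simp⟩

theorem IsGradProjNC.add {k : ℕ} {v v' : L2 K.carrier} {p p' : MvPolynomial (Fin 2) ℝ}
    (h : K.IsGradProjNC k v p) (h' : K.IsGradProjNC k v' p') :
    K.IsGradProjNC k (v + v') (p + p') := by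
  obtain ⟨o, g, t, a⟩ := h
  obtain ⟨o', g', t', a'⟩ := h'
  refine ⟨o.add t.1 t'.1 o', _, t.add t', ?_⟩
  rw [sum_eval_add, sum_edge_add t.2.1 t'.2.1, a, a']

theorem IsGradProjNC.smul {k : ℕ} {v : L2 K.carrier} {p : MvPolynomial (Fin 2) ℝ} (c : ℝ)
    (h : K.IsGradProjNC k v p) : K.IsGradProjNC k (c • v) (c • p) := by
  obtain ⟨o, g, t, a⟩ := h
  refine ⟨o.smul c t.1, _, t.smul c, ?_⟩
  rw [sum_eval_smul, sum_edge_smul, a]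

theorem IsGradProjNC.zero {k : ℕ} : K.IsGradProjNC k 0 0 :=
  ⟨IsGradOrth.zero, 0, IsTrace.zero, by simp [edgeInt]⟩

theorem IsBilap.add {v v' : L2 K.carrier} {f f' : MvPolynomial (Fin 2) ℝ}
    (hv : MemH2 K.carrier v) (hv' : MemH2 K.carrier v') (h : K.IsBilap v f)
    (h' : K.IsBilap v' f') : K.IsBilap (v + v') (f + f') := by
  intro φ hφ
  have hc : Continuous fun x => pd 0 (pd 0 φ) x + pd 1 (pd 1 φ) x :=
    (continuous_pd (contDiff_pd hφ.1 0) 0).add (continuous_pd (contDiff_pd hφ.1 1) 1)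
  rw [lap_add K.isOpen hv hv', map_add, int_add (memLp_of_bounded K.isBounded hc),
    int_add hφ.memLp, h φ hφ, h' φ hφ]

theorem IsBilap.smul {v : L2 K.carrier} {f : MvPolynomial (Fin 2) ℝ} (c : ℝ)
    (hv : MemH2 K.carrier v) (h : K.IsBilap v f) : K.IsBilap (c • v) (c • f) := by
  intro φ hφ
  rw [lap_smul K.isOpen c hv, map_smul, int_smul, int_smul, h φ hφ]

theorem IsBilap.zero : K.IsBilap 0 0 := by
  intro φ _
  rw [lap_zero K.isOpen, map_zero, int_zero, int_zero]

theorem IsLap.add {v v' : L2 K.carrier} {f f' : MvPolynomial (Fin 2) ℝ}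
    (hv : MemH1 K.carrier v) (hv' : MemH1 K.carrier v') (h : K.IsLap v f)
    (h' : K.IsLap v' f') : K.IsLap (v + v') (f + f') := by
  intro φ hφ
  have e : ∀ i, ∫ x in K.carrier, weakD K.carrier i (v + v') x * pd i φ x =
      (∫ x in K.carrier, weakD K.carrier i v x * pd i φ x) +
        ∫ x in K.carrier, weakD K.carrier i v' x * pd i φ x := fun i => by
    rw [weakD_add K.isOpen hv hv', int_add (hφ.memLp_pd i)]
  rw [Finset.sum_congr rfl fun i _ => e i, Finset.sum_add_distrib, h φ hφ, h' φ hφ, map_add,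
    int_add hφ.memLp]
  ring

theorem IsLap.smul {v : L2 K.carrier} {f : MvPolynomial (Fin 2) ℝ} (c : ℝ)
    (hv : MemH1 K.carrier v) (h : K.IsLap v f) : K.IsLap (c • v) (c • f) := by
  intro φ hφ
  have e : ∀ i, ∫ x in K.carrier, weakD K.carrier i (c • v) x * pd i φ x =
      c * ∫ x in K.carrier, weakD K.carrier i v x * pd i φ x := fun i => by
    rw [weakD_smul K.isOpen c hv, int_smul]
  rw [Finset.sum_congr rfl fun i _ => e i, ← Finset.mul_sum, h φ hφ, map_smul, int_smul]
  ring

theorem IsLap.zero : K.IsLap 0 0 := by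
  intro φ _
  rw [map_zero, int_zero, neg_zero]
  exact Finset.sum_eq_zero fun i _ => by rw [weakD_zero K.isOpen, int_zero]

theorem IsLapTrace.add {v v' : L2 K.carrier} {f f' : MvPolynomial (Fin 2) ℝ}
    {g g' : Fin (K.m + 3) → Polynomial ℝ}
    (hv : MemH2 K.carrier v) (hv' : MemH2 K.carrier v') (h : K.IsLapTrace v f g)
    (h' : K.IsLapTrace v' f' g') : K.IsLapTrace (v + v') (f + f') (g + g') := by
  intro z w G hz h0
  have e : ∀ i, K.edgeInt i (fun t => ((g + g') i).eval t * K.normalPart G i (K.pt i t)) =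
      K.edgeInt i (fun t => (g i).eval t * K.normalPart G i (K.pt i t)) +
        K.edgeInt i (fun t => (g' i).eval t * K.normalPart G i (K.pt i t)) := fun i => by
    rw [← edgeInt_add (hz.normalL2 i (g i).continuous) (hz.normalL2 i (g' i).continuous)]
    simp [add_mul]
  rw [Finset.sum_congr rfl fun i _ => e i, Finset.sum_add_distrib, ← h z w G hz h0,
    ← h' z w G hz h0, lap_add K.isOpen hv hv', map_add, inner_add_left, inner_add_left]
  ring

theorem IsLapTrace.smul {v : L2 K.carrier} {f : MvPolynomial (Fin 2) ℝ}
    {g : Fin (K.m + 3) → Polynomial ℝ} (c : ℝ)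
    (hv : MemH2 K.carrier v) (h : K.IsLapTrace v f g) :
    K.IsLapTrace (c • v) (c • f) (c • g) := by
  intro z w G hz h0
  have e : ∀ i, K.edgeInt i (fun t => ((c • g) i).eval t * K.normalPart G i (K.pt i t)) =
      c * K.edgeInt i (fun t => (g i).eval t * K.normalPart G i (K.pt i t)) := fun i => by
    rw [← edgeInt_smul]
    simp [mul_assoc]
  rw [Finset.sum_congr rfl fun i _ => e i, ← Finset.mul_sum, ← h z w G hz h0,
    lap_smul K.isOpen c hv, map_smul, real_inner_smul_left, real_inner_smul_left]
  ring

theorem IsLapTrace.zero : K.IsLapTrace 0 0 0 := by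
  intro z w G _ _
  rw [lap_zero K.isOpen]
  simp [edgeInt]

theorem IsNormalTrace.add {v v' : L2 K.carrier} {f f' : MvPolynomial (Fin 2) ℝ}
    {g g' : Fin (K.m + 3) → Polynomial ℝ}
    (hv : MemH1 K.carrier v) (hv' : MemH1 K.carrier v') (h : K.IsNormalTrace v f g)
    (h' : K.IsNormalTrace v' f' g') : K.IsNormalTrace (v + v') (f + f') (g + g') := by
  intro z gz hz
  have e : ∀ i, K.edgeInt i (fun t => ((g + g') i).eval t * gz (K.pt i t)) =
      K.edgeInt i (fun t => (g i).eval t * gz (K.pt i t)) +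
        K.edgeInt i (fun t => (g' i).eval t * gz (K.pt i t)) := fun i => by
    have a := hz.2.1.integrable i (g i).continuous
    have b := hz.2.1.integrable i (g' i).continuous
    simp only [mul_comm (gz _)] at a b
    rw [← edgeInt_add a b]
    simp [add_mul]
  rw [Finset.sum_congr rfl fun i _ => e i, Finset.sum_add_distrib, ← h z gz hz,
    ← h' z gz hz, gradForm_add K.isOpen hv hv', map_add, inner_add_left]
  ring

theorem IsNormalTrace.smul {v : L2 K.carrier} {f : MvPolynomial (Fin 2) ℝ}
    {g : Fin (K.m + 3) → Polynomial ℝ} (c : ℝ)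
    (hv : MemH1 K.carrier v) (h : K.IsNormalTrace v f g) :
    K.IsNormalTrace (c • v) (c • f) (c • g) := by
  intro z gz hz
  have e : ∀ i, K.edgeInt i (fun t => ((c • g) i).eval t * gz (K.pt i t)) =
      c * K.edgeInt i (fun t => (g i).eval t * gz (K.pt i t)) := fun i => by
    rw [← edgeInt_smul]
    simp [mul_assoc]
  rw [Finset.sum_congr rfl fun i _ => e i, ← Finset.mul_sum, ← h z gz hz,
    gradForm_smul K.isOpen c hv, map_smul, real_inner_smul_left]
  ring

theorem IsNormalTrace.zero : K.IsNormalTrace 0 0 0 := by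
  intro z gz _
  rw [gradForm_zero K.isOpen]
  simp [edgeInt]

theorem moment_add {g g' : Plane → ℝ} (hg : K.MemL2Bdry g) (hg' : K.MemL2Bdry g')
    (i : Fin (K.m + 3)) (χ : Polynomial ℝ) :
    K.edgeInt i (fun t => (g + g') (K.pt i t) * χ.eval t) =
      K.edgeInt i (fun t => g (K.pt i t) * χ.eval t) +
        K.edgeInt i (fun t => g' (K.pt i t) * χ.eval t) := by
  rw [← edgeInt_add (hg.integrable i χ.continuous) (hg'.integrable i χ.continuous)]
  simp [add_mul]

theorem moment_smul {g : Plane → ℝ} (c : ℝ) (i : Fin (K.m + 3)) (χ : Polynomial ℝ) :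
    K.edgeInt i (fun t => (c • g) (K.pt i t) * χ.eval t) =
      c * K.edgeInt i (fun t => g (K.pt i t) * χ.eval t) := by
  rw [← edgeInt_smul]
  simp [mul_assoc]

theorem memL2Bdry_of_continuous {g : Plane → ℝ} (hg : Continuous g) : K.MemL2Bdry g := fun i => by
  have hc := hg.comp (continuous_pt (K := K) i)
  obtain ⟨C, hC⟩ := (isCompact_Icc (a := (0 : ℝ)) (b := 1)).exists_bound_of_continuousOn
    hc.continuousOn
  exact MemLp.of_bound hc.aestronglyMeasurable C
    ((ae_restrict_iff' measurableSet_Icc).2 (Filter.Eventually.of_forall hC))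

theorem moment_eval_add (p p' : MvPolynomial (Fin 2) ℝ) (i : Fin (K.m + 3)) (χ : Polynomial ℝ) :
    K.edgeInt i (fun t => (p + p').eval (fun l => K.pt i t l) * χ.eval t) =
      K.edgeInt i (fun t => p.eval (fun l => K.pt i t l) * χ.eval t) +
        K.edgeInt i (fun t => p'.eval (fun l => K.pt i t l) * χ.eval t) := by
  have := moment_add (memL2Bdry_of_continuous (K := K) (contDiff_eval p).continuous)
    (memL2Bdry_of_continuous (contDiff_eval p').continuous) i χ
  simpa using this

theorem moment_eval_smul (c : ℝ) (p : MvPolynomial (Fin 2) ℝ) (i : Fin (K.m + 3))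
    (χ : Polynomial ℝ) :
    K.edgeInt i (fun t => (c • p).eval (fun l => K.pt i t l) * χ.eval t) =
      c * K.edgeInt i (fun t => p.eval (fun l => K.pt i t l) * χ.eval t) := by
  rw [← edgeInt_smul]
  simp [mul_assoc, MvPolynomial.smul_eval]

theorem MemVc.add {k : ℕ} {v v' : L2 K.carrier} (h : K.MemVc k v) (h' : K.MemVc k v') :
    K.MemVc k (v + v') := by
  obtain ⟨w, G, f, p, t, c, a1, a2, a3, a4, a5, a6⟩ := h
  obtain ⟨w', G', f', p', t', c', b1, b2, b3, b4, b5, b6⟩ := h'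
  refine ⟨_, _, _, _, t.add t', fun j => (c j).add (c' j), Submodule.add_mem _ a1 b1,
    a2.add t.1 t'.1 b2, fun i => (a3 i).add (b3 i), fun i => ?_, a5.add b5, ?_⟩
  · rw [normalPart_add]
    exact (a4 i).add (b4 i)
  · rw [map_add, add_sub_add_comm]
    exact a6.add b6

theorem MemVc.smul {k : ℕ} {v : L2 K.carrier} (r : ℝ) (h : K.MemVc k v) :
    K.MemVc k (r • v) := by
  obtain ⟨w, G, f, p, t, c, a1, a2, a3, a4, a5, a6⟩ := h
  refine ⟨_, _, _, _, t.smul r, fun j => (c j).const_smul r, Submodule.smul_mem _ r a1,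
    a2.smul r t.1, fun i => (a3 i).smul r, fun i => ?_, a5.smul r, ?_⟩
  · rw [normalPart_smul]
    exact (a4 i).smul r
  · rw [map_smul, ← smul_sub]
    exact a6.smul r

theorem MemVc.zero {k : ℕ} : K.MemVc k 0 := by
  refine ⟨0, 0, 0, 0, IsH2Trace.zero, fun _ => continuousOn_const, Submodule.zero_mem _,
    IsBilap.zero, fun _ => IsPolyOn.zero, fun i => ?_, IsHessProjC.zero, ?_⟩
  · rw [normalPart_zero]
    exact IsPolyOn.zero
  · rw [map_zero, sub_zero]
    exact OrthTop.zero

theorem MemVnc.add {k : ℕ} {v v' : L2 K.carrier} (h : K.MemVnc k v) (h' : K.MemVnc k v') :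
    K.MemVnc k (v + v') := by
  obtain ⟨w, G, f, g, p, t, a1, a2, a3, a4, a5, a6, a7, a8, a9, a10⟩ := h
  obtain ⟨w', G', f', g', p', t', b1, b2, b3, b4, b5, b6, b7, b8, b9, b10⟩ := h'
  refine ⟨_, _, _, g + g', _, t.add t', Submodule.add_mem _ a1 b1, a2.add t.1 t'.1 b2,
    fun i => (a3 i).add (b3 i), fun i => Submodule.add_mem _ (a4 i) (b4 i),
    a5.add t.1 t'.1 b5, fun i hi => (a6 i hi).add (b6 i hi), a7.add b7,
    fun i hi χ hχ => ?_, fun i χ hχ => ?_, ?_⟩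
  · rw [moment_add t.2.2.2.1.2.1 t'.2.2.2.1.2.1, moment_eval_add, a8 i hi χ hχ, b8 i hi χ hχ]
  · rw [moment_add t.2.2.2.1.2.1 t'.2.2.2.1.2.1, moment_eval_add, a9 i χ hχ, b9 i χ hχ]
  · rw [map_add, add_sub_add_comm]
    exact a10.add b10

theorem MemVnc.smul {k : ℕ} {v : L2 K.carrier} (r : ℝ) (h : K.MemVnc k v) :
    K.MemVnc k (r • v) := by
  obtain ⟨w, G, f, g, p, t, a1, a2, a3, a4, a5, a6, a7, a8, a9, a10⟩ := h
  refine ⟨_, _, _, r • g, _, t.smul r, Submodule.smul_mem _ r a1, a2.smul r t.1,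
    fun i => (a3 i).smul r, fun i => Submodule.smul_mem _ r (a4 i),
    a5.smul r t.1, fun i hi => (a6 i hi).const_smul r, a7.smul r,
    fun i hi χ hχ => ?_, fun i χ hχ => ?_, ?_⟩
  · rw [moment_smul, moment_eval_smul, a8 i hi χ hχ]
  · rw [moment_smul, moment_eval_smul, a9 i χ hχ]
  · rw [map_smul, ← smul_sub]
    exact a10.smul r

theorem MemVnc.zero {k : ℕ} : K.MemVnc k 0 := by
  refine ⟨0, 0, 0, 0, 0, IsH2Trace.zero, Submodule.zero_mem _, IsBilap.zero,
    fun _ => IsPolyOn.zero, fun _ => Submodule.zero_mem _, IsLapTrace.zero,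
    fun _ _ => contDiffOn_const, IsHessProjNC.zero, fun _ _ _ _ => by simp,
    fun _ _ _ => by simp, ?_⟩
  rw [map_zero, sub_zero]
  exact OrthTop.zero

theorem MemQc.add {ℓ : ℕ} {v v' : L2 K.carrier} (h : K.MemQc ℓ v) (h' : K.MemQc ℓ v') :
    K.MemQc ℓ (v + v') := by
  obtain ⟨g, f, p, t, c, a1, a2, a3, a4, a5⟩ := h
  obtain ⟨g', f', p', t', c', b1, b2, b3, b4, b5⟩ := h'
  refine ⟨_, _, _, t.add t', c.add c', Submodule.add_mem _ a1 b1, a2.add t.1 t'.1 b2,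
    fun i => (a3 i).add (b3 i), a4.add b4, ?_⟩
  rw [map_add, add_sub_add_comm]
  exact a5.add b5

theorem MemQc.smul {ℓ : ℕ} {v : L2 K.carrier} (r : ℝ) (h : K.MemQc ℓ v) :
    K.MemQc ℓ (r • v) := by
  obtain ⟨g, f, p, t, c, a1, a2, a3, a4, a5⟩ := h
  refine ⟨_, _, _, t.smul r, c.const_smul r, Submodule.smul_mem _ r a1, a2.smul r t.1,
    fun i => (a3 i).smul r, a4.smul r, ?_⟩
  rw [map_smul, ← smul_sub]
  exact a5.smul r

theorem MemQc.zero {ℓ : ℕ} : K.MemQc ℓ 0 := by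
  refine ⟨0, 0, 0, IsTrace.zero, continuousOn_const, Submodule.zero_mem _, IsLap.zero,
    fun _ => IsPolyOn.zero, IsGradProjC.zero, ?_⟩
  rw [map_zero, sub_zero]
  exact OrthTop.zero

theorem MemQnc.add {ℓ : ℕ} {v v' : L2 K.carrier} (h : K.MemQnc ℓ v) (h' : K.MemQnc ℓ v') :
    K.MemQnc ℓ (v + v') := by
  obtain ⟨g, f, r, p, t, c, a1, a2, a3, a4, a5, a6⟩ := h
  obtain ⟨g', f', r', p', t', c', b1, b2, b3, b4, b5, b6⟩ := h'
  refine ⟨_, _, r + r', _, t.add t', c.add c', Submodule.add_mem _ a1 b1, a2.add t.1 t'.1 b2,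
    fun i => Submodule.add_mem _ (a3 i) (b3 i), a4.add t.1 t'.1 b4, a5.add b5, ?_⟩
  rw [map_add, add_sub_add_comm]
  exact a6.add b6

theorem MemQnc.smul {ℓ : ℕ} {v : L2 K.carrier} (s : ℝ) (h : K.MemQnc ℓ v) :
    K.MemQnc ℓ (s • v) := by
  obtain ⟨g, f, r, p, t, c, a1, a2, a3, a4, a5, a6⟩ := h
  refine ⟨_, _, s • r, _, t.smul s, c.const_smul s, Submodule.smul_mem _ s a1, a2.smul s t.1,
    fun i => Submodule.smul_mem _ s (a3 i), a4.smul s t.1, a5.smul s, ?_⟩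
  rw [map_smul, ← smul_sub]
  exact a6.smul s

theorem MemQnc.zero {ℓ : ℕ} : K.MemQnc ℓ 0 := by
  refine ⟨0, 0, 0, 0, IsTrace.zero, continuousOn_const, Submodule.zero_mem _, IsLap.zero,
    fun _ => Submodule.zero_mem _, IsNormalTrace.zero, IsGradProjNC.zero, ?_⟩
  rw [map_zero, sub_zero]
  exact OrthTop.zero

end Linearity

/-- The local conforming displacement space of degree `k`. -/
def Vc (k : ℕ) : Submodule ℝ (L2 K.carrier) where
  carrier := {v | K.MemVc k v}
  add_mem' := MemVc.add
  zero_mem' := MemVc.zero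
  smul_mem' r _ := MemVc.smul r

/-- The local nonconforming displacement space of degree `k`. -/
def Vnc (k : ℕ) : Submodule ℝ (L2 K.carrier) where
  carrier := {v | K.MemVnc k v}
  add_mem' := MemVnc.add
  zero_mem' := MemVnc.zero
  smul_mem' r _ := MemVnc.smul r

/-- The local conforming pressure space of degree `ℓ`. -/
def Qc (ℓ : ℕ) : Submodule ℝ (L2 K.carrier) where
  carrier := {q | K.MemQc ℓ q}
  add_mem' := MemQc.add
  zero_mem' := MemQc.zero
  smul_mem' r _ := MemQc.smul r

/-- The local nonconforming pressure space of degree `ℓ`. -/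
def Qnc (ℓ : ℕ) : Submodule ℝ (L2 K.carrier) where
  carrier := {q | K.MemQnc ℓ q}
  add_mem' := MemQnc.add
  zero_mem' := MemQnc.zero
  smul_mem' r _ := MemQnc.smul r

end Polygon

/-! ### Stabilisation and local discrete forms -/

/-- The local ingredients of a method on `K`: the displacement space `V`, the pressure space `Q`,
the Hessian projection `PH` and the gradient projection `PG`. -/
structure LocalScheme (K : Polygon) where
  V : Submodule ℝ (L2 K.carrier)
  Q : Submodule ℝ (L2 K.carrier)
  PH : L2 K.carrier → L2 K.carrier
  PG : L2 K.carrier → L2 K.carrier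

/-- The conforming method of degrees `k` and `ℓ` on `K`. -/
def Polygon.conforming (K : Polygon) (k ℓ : ℕ) : LocalScheme K where
  V := K.Vc k
  Q := K.Qc ℓ
  PH v := K.pick (K.IsHessProjC k v)
  PG q := K.pick (K.IsGradProjC ℓ q)

/-- The nonconforming method of degrees `k` and `ℓ` on `K`. -/
def Polygon.nonconforming (K : Polygon) (k ℓ : ℕ) : LocalScheme K where
  V := K.Vnc k
  Q := K.Qnc ℓ
  PH v := K.pick (K.IsHessProjNC k v)
  PG q := K.pick (K.IsGradProjNC ℓ q)

/-- The four stabilisation bilinear forms on the local spaces: `SH` and `S0` on the displacement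
space (Hessian and `L²` scaling), `SG` and `R0` on the pressure space (gradient and `L²`
scaling). -/
structure Stabilisation {K : Polygon} (L : LocalScheme K) where
  SH : LinearMap.BilinForm ℝ L.V
  S0 : LinearMap.BilinForm ℝ L.V
  SG : LinearMap.BilinForm ℝ L.Q
  R0 : LinearMap.BilinForm ℝ L.Q

/-- A symmetric positive definite bilinear form. -/
def IsSPD {E : Type} [AddCommGroup E] [Module ℝ E] (S : LinearMap.BilinForm ℝ E) : Prop :=
  S.IsSymm ∧ ∀ v, v ≠ 0 → 0 < S v v

/-- The constants of the stabilisation bounds. -/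
structure StabConstants where
  CH : ℝ
  C0 : ℝ
  CG : ℝ
  D0 : ℝ
  CH_pos : 0 < CH
  C0_pos : 0 < C0
  CG_pos : 0 < CG
  D0_pos : 0 < D0

/-- The stabilisation forms are symmetric positive definite and are, on the kernels of the
respective projections, equivalent to `|·|²_{2,K}`, `‖·‖²_K`, `γ |·|²_{1,K}` and `β ‖·‖²_K`. -/
structure Stabilisation.Admissible {K : Polygon} {L : LocalScheme K} (S : Stabilisation L)
    (k ℓ : ℕ) (β γ : ℝ) (C : StabConstants) : Prop where
  spd_SH : IsSPD S.SH
  spd_S0 : IsSPD S.S0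
  spd_SG : IsSPD S.SG
  spd_R0 : IsSPD S.R0
  s1 : ∀ v : L.V, L.PH v = 0 →
    C.CH⁻¹ * hessForm K.carrier v v ≤ S.SH v v ∧ S.SH v v ≤ C.CH * hessForm K.carrier v v
  s2 : ∀ v : L.V, K.proj k v = 0 →
    C.C0⁻¹ * ‖(v : L2 K.carrier)‖ ^ 2 ≤ S.S0 v v ∧ S.S0 v v ≤ C.C0 * ‖(v : L2 K.carrier)‖ ^ 2
  s3 : ∀ q : L.Q, L.PG q = 0 →
    C.CG⁻¹ * (γ * gradForm K.carrier q q) ≤ S.SG q q ∧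
      S.SG q q ≤ C.CG * (γ * gradForm K.carrier q q)
  s4 : ∀ q : L.Q, K.proj ℓ q = 0 →
    C.D0⁻¹ * (β * ‖(q : L2 K.carrier)‖ ^ 2) ≤ S.R0 q q ∧
      S.R0 q q ≤ C.D0 * (β * ‖(q : L2 K.carrier)‖ ^ 2)

open Classical in
/-- Evaluation of a bilinear form on a subspace `X` at elements of the ambient space. It is only
used at elements of `X` (the local spaces contain the polynomials, so that `v - Π v` lies in `X`
for `v` in `X`); the value elsewhere is irrelevant. -/
def evalOn {E : Type} [AddCommGroup E] [Module ℝ E] {X : Submodule ℝ E}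
    (S : LinearMap.BilinForm ℝ X) (u v : E) : ℝ :=
  if h : u ∈ X ∧ v ∈ X then S ⟨u, h.1⟩ ⟨v, h.2⟩ else 0

section Forms

variable {K : Polygon} {L : LocalScheme K}

/-- The local discrete form `a₁ʰ`. -/
def a1h (S : Stabilisation L) (k : ℕ) (u v : L2 K.carrier) : ℝ :=
  ⟪K.proj k u, K.proj k v⟫ + evalOn S.S0 (u - K.proj k u) (v - K.proj k v) +
    (∑ i, ∑ j, ⟪K.proj (k - 2) (weakD K.carrier j (weakD K.carrier i u)),
      K.proj (k - 2) (weakD K.carrier j (weakD K.carrier i v))⟫) +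
    evalOn S.SH (u - L.PH u) (v - L.PH v)

/-- The local discrete form `a₂ʰ`. -/
def a2h (K : Polygon) (k ℓ : ℕ) (α : ℝ) (p v : L2 K.carrier) : ℝ :=
  α * ∑ i, ⟪K.proj (ℓ - 1) (weakD K.carrier i p), K.proj (k - 1) (weakD K.carrier i v)⟫

/-- The local discrete form `a₃ʰ`. -/
def a3h (S : Stabilisation L) (ℓ : ℕ) (β γ : ℝ) (p q : L2 K.carrier) : ℝ :=
  β * ⟪K.proj ℓ p, K.proj ℓ q⟫ + evalOn S.R0 (p - K.proj ℓ p) (q - K.proj ℓ q) +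
    γ * (∑ i, ⟪K.proj (ℓ - 1) (weakD K.carrier i p), K.proj (ℓ - 1) (weakD K.carrier i q)⟫) +
    evalOn S.SG (p - L.PG p) (q - L.PG q)

end Forms

/-- The square of the weighted norm:
`‖u‖² + |u|₂² + β ‖p‖² + γ |p|₁²` on the set `U`. -/
def normSq (U : Set Plane) (β γ : ℝ) (u p : L2 U) : ℝ :=
  ‖u‖ ^ 2 + hessForm U u u + β * ‖p‖ ^ 2 + γ * gradForm U p p

/-! ### The domain and the continuous spaces -/

/-- A bounded domain with Lipschitz boundary (locally the region above a Lipschitz graph, in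
suitable Cartesian coordinates), whose boundary is split into a closed part `Γc` (clamped) and its
complement (simply supported). -/
structure PlateDomain where
  Ω : Set Plane
  Γc : Set Plane
  isOpen : IsOpen Ω
  isConnected : IsConnected Ω
  isBounded : Bornology.IsBounded Ω
  lipschitz : ∀ x ∈ frontier Ω, ∃ (T : Plane ≃ₗᵢ[ℝ] Plane) (f : ℝ → ℝ) (C : ℝ≥0) (r : ℝ),
    LipschitzWith C f ∧ 0 < r ∧ ∀ y ∈ Metric.ball x r, (y ∈ Ω ↔ f (T y 0) < T y 1)
  isClosed_Γc : IsClosed Γc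
  Γc_subset : Γc ⊆ frontier Ω

namespace PlateDomain

variable (D : PlateDomain)

/-- The simply supported part of the boundary. -/
def Γs : Set Plane := frontier D.Ω \ D.Γc

/-- `H¹₀(Ω)`: the closure of the test functions in the norm of `H¹(Ω)`. -/
def MemH10 (v : L2 D.Ω) : Prop :=
  MemH1 D.Ω v ∧ ∀ ε : ℝ≥0∞, ε ≠ 0 → ∃ φ, IsTest D.Ω φ ∧
    eLpNorm ((v : Plane → ℝ) - φ) 2 (volume.restrict D.Ω) ≤ ε ∧
      ∀ i, eLpNorm ((weakD D.Ω i v : Plane → ℝ) - pd i φ) 2 (volume.restrict D.Ω) ≤ ε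

/-- `∂ₙ v = 0` on `Γc` for `v ∈ H²(Ω)`, that is, `∫_Ω (∇ v · ∇ φ + Δ v φ) = 0` for all smooth `φ`
vanishing near `Γs`. -/
def NormalZero (v : L2 D.Ω) : Prop :=
  ∀ φ, ContDiff ℝ ∞ φ → Disjoint (tsupport φ) (closure D.Γs) →
    (∑ i, ∫ x in D.Ω, weakD D.Ω i v x * pd i φ x) + ∫ x in D.Ω, lap D.Ω v x * φ x = 0

/-- `q = 0` on `Γs` for `q ∈ H¹(Ω)`, that is, `∫_Ω (q ∂ᵢ φ + ∂ᵢ q φ) = 0` for all smooth `φ`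
vanishing near `Γc`. -/
def ZeroOnΓs (q : L2 D.Ω) : Prop :=
  ∀ φ, ContDiff ℝ ∞ φ → Disjoint (tsupport φ) D.Γc → ∀ i,
    (∫ x in D.Ω, q x * pd i φ x) + ∫ x in D.Ω, weakD D.Ω i q x * φ x = 0

theorem MemH10.add {v v' : L2 D.Ω} (h : D.MemH10 v) (h' : D.MemH10 v') :
    D.MemH10 (v + v') := by
  refine ⟨h.1.add h'.1, fun ε hε => ?_⟩
  have hε2 : ε / 2 ≠ 0 := by simpa using hε
  obtain ⟨φ, t, a, b⟩ := h.2 _ hε2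
  obtain ⟨φ', t', a', b'⟩ := h'.2 _ hε2
  refine ⟨φ + φ', ⟨t.1.add t'.1, t.2.1.add t'.2.1,
    (tsupport_add φ φ').trans (union_subset t.2.2 t'.2.2)⟩, ?_, fun i => ?_⟩
  · have e : ((v + v' : L2 D.Ω) - (φ + φ') : Plane → ℝ) =ᵐ[volume.restrict D.Ω]
        ((v : Plane → ℝ) - φ) + ((v' : Plane → ℝ) - φ') := by
      filter_upwards [Lp.coeFn_add v v'] with x hx
      rw [Pi.sub_apply, hx]
      simp only [Pi.add_apply, Pi.sub_apply]
      ring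
    rw [eLpNorm_congr_ae e]
    refine (eLpNorm_add_le ((Lp.memLp v).sub t.memLp).1 ((Lp.memLp v').sub t'.memLp).1
      (by norm_num)).trans ?_
    exact (add_le_add a a').trans (ENNReal.add_halves ε).le
  · have e : ((weakD D.Ω i (v + v') : L2 D.Ω) - pd i (φ + φ') : Plane → ℝ)
        =ᵐ[volume.restrict D.Ω] ((weakD D.Ω i v : Plane → ℝ) - pd i φ) +
          ((weakD D.Ω i v' : Plane → ℝ) - pd i φ') := by
      rw [weakD_add D.isOpen h.1 h'.1]
      filter_upwards [Lp.coeFn_add (weakD D.Ω i v) (weakD D.Ω i v')] with x hx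
      rw [Pi.sub_apply, hx]
      have : pd i (φ + φ') x = pd i φ x + pd i φ' x := by
        unfold pd
        rw [fderiv_add (t.1.differentiable (by simp) x) (t'.1.differentiable (by simp) x)]
        simp
      rw [this]
      simp only [Pi.add_apply, Pi.sub_apply]
      ring
    rw [eLpNorm_congr_ae e]
    refine (eLpNorm_add_le ((Lp.memLp _).sub (t.memLp_pd i)).1
      ((Lp.memLp _).sub (t'.memLp_pd i)).1 (by norm_num)).trans ?_
    exact (add_le_add (b i) (b' i)).trans (ENNReal.add_halves ε).le

theorem MemH10.smul {v : L2 D.Ω} (c : ℝ) (h : D.MemH10 v) : D.MemH10 (c • v) := by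
  refine ⟨h.1.smul c, fun ε hε => ?_⟩
  have hε2 : ε / ‖c‖ₑ ≠ 0 := by simpa using hε
  obtain ⟨φ, t, a, b⟩ := h.2 _ hε2
  refine ⟨c • φ, ⟨t.1.const_smul c, t.2.1.smul_left,
    (tsupport_smul_subset_right (fun _ => c) φ).trans t.2.2⟩, ?_, fun i => ?_⟩
  · have e : ((c • v : L2 D.Ω) - (c • φ) : Plane → ℝ) =ᵐ[volume.restrict D.Ω]
        c • ((v : Plane → ℝ) - φ) := by
      filter_upwards [Lp.coeFn_smul c v] with x hx
      rw [Pi.sub_apply, hx]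
      simp only [Pi.smul_apply, Pi.sub_apply, smul_eq_mul]
      ring
    rw [eLpNorm_congr_ae e, eLpNorm_const_smul]
    exact (mul_le_mul_right a _).trans ENNReal.mul_div_le
  · have e : ((weakD D.Ω i (c • v) : L2 D.Ω) - pd i (c • φ) : Plane → ℝ)
        =ᵐ[volume.restrict D.Ω] c • ((weakD D.Ω i v : Plane → ℝ) - pd i φ) := by
      rw [weakD_smul D.isOpen c h.1]
      filter_upwards [Lp.coeFn_smul c (weakD D.Ω i v)] with x hx
      rw [Pi.sub_apply, hx]
      have : pd i (c • φ) x = c * pd i φ x := by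
        unfold pd
        rw [fderiv_const_smul (t.1.differentiable (by simp) x)]
        simp
      rw [this]
      simp only [Pi.smul_apply, Pi.sub_apply, smul_eq_mul]
      ring
    rw [eLpNorm_congr_ae e, eLpNorm_const_smul]
    exact (mul_le_mul_right (b i) _).trans ENNReal.mul_div_le

theorem MemH10.zero : D.MemH10 0 := by
  refine ⟨MemH1.zero, fun ε _ => ⟨0, ⟨contDiff_const, HasCompactSupport.zero, by simp⟩, ?_,
    fun i => ?_⟩⟩
  · rw [sub_zero, eLpNorm_congr_ae (Lp.coeFn_zero ℝ 2 _)]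
    simp
  · have : pd i (0 : Plane → ℝ) = 0 := by
      ext x
      simp [pd]
    rw [weakD_zero D.isOpen, this, sub_zero, eLpNorm_congr_ae (Lp.coeFn_zero ℝ 2 _)]
    simp

/-- The displacement space `V = H²_{Γc}(Ω) ∩ H¹₀(Ω)`. -/
def V : Submodule ℝ (L2 D.Ω) where
  carrier := {v | MemH2 D.Ω v ∧ D.MemH10 v ∧ D.NormalZero v}
  add_mem' {v v'} h h' := by
    refine ⟨h.1.add D.isOpen h'.1, h.2.1.add D h'.2.1, fun φ hφ hs => ?_⟩
    have e : ∀ i, ∫ x in D.Ω, weakD D.Ω i (v + v') x * pd i φ x =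
        (∫ x in D.Ω, weakD D.Ω i v x * pd i φ x) +
          ∫ x in D.Ω, weakD D.Ω i v' x * pd i φ x := fun i => by
      rw [weakD_add D.isOpen h.1.1 h'.1.1,
        int_add (memLp_of_bounded D.isBounded (continuous_pd hφ i))]
    rw [Finset.sum_congr rfl fun i _ => e i, Finset.sum_add_distrib,
      lap_add D.isOpen h.1 h'.1, int_add (memLp_of_bounded D.isBounded hφ.continuous)]
    linarith [h.2.2 φ hφ hs, h'.2.2 φ hφ hs]
  zero_mem' := by
    refine ⟨MemH2.zero D.isOpen, MemH10.zero D, fun φ _ _ => ?_⟩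
    rw [lap_zero D.isOpen, int_zero, add_zero]
    exact Finset.sum_eq_zero fun i _ => by rw [weakD_zero D.isOpen, int_zero]
  smul_mem' c v h := by
    refine ⟨h.1.smul D.isOpen c, h.2.1.smul D c, fun φ hφ hs => ?_⟩
    have e : ∀ i, ∫ x in D.Ω, weakD D.Ω i (c • v) x * pd i φ x =
        c * ∫ x in D.Ω, weakD D.Ω i v x * pd i φ x := fun i => by
      rw [weakD_smul D.isOpen c h.1.1, int_smul]
    rw [Finset.sum_congr rfl fun i _ => e i, ← Finset.mul_sum, lap_smul D.isOpen c h.1,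
      int_smul, ← mul_add, h.2.2 φ hφ hs, mul_zero]

/-- The pressure space `Q = H¹_{Γs}(Ω)`. -/
def Q : Submodule ℝ (L2 D.Ω) where
  carrier := {q | MemH1 D.Ω q ∧ D.ZeroOnΓs q}
  add_mem' {v v'} h h' := by
    refine ⟨h.1.add h'.1, fun φ hφ hs i => ?_⟩
    rw [weakD_add D.isOpen h.1 h'.1,
      int_add (memLp_of_bounded D.isBounded (continuous_pd hφ i)),
      int_add (memLp_of_bounded D.isBounded hφ.continuous)]
    linarith [h.2 φ hφ hs i, h'.2 φ hφ hs i]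
  zero_mem' := by
    refine ⟨MemH1.zero, fun φ _ _ i => ?_⟩
    rw [weakD_zero D.isOpen, int_zero, int_zero, add_zero]
  smul_mem' c v h := by
    refine ⟨h.1.smul c, fun φ hφ hs i => ?_⟩
    rw [weakD_smul D.isOpen c h.1, int_smul, int_smul, ← mul_add, h.2 φ hφ hs i, mul_zero]

/-- The weighted norm of a pair `(u, p)` on `Ω`. -/
def normH (β γ : ℝ) (x : L2 D.Ω × L2 D.Ω) : ℝ := √(normSq D.Ω β γ x.1 x.2)

end PlateDomain

/-! ### Meshes and global virtual element spaces -/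

/-- The `i`-th edge of `K` is the `j`-th edge of the neighbour `K'`. As both boundaries are listed
counterclockwise, the common edge is traversed in opposite directions. -/
def SharedEdge (K K' : Polygon) (i : Fin (K.m + 3)) (j : Fin (K'.m + 3)) : Prop :=
  K.vert i = K'.vert (j + 1) ∧ K.vert (i + 1) = K'.vert j

/-- A polygonal partition of `Ω`. Edges of two cells either coincide or meet at most in a common
end point (so a vertex of one cell inside a side of a neighbour is a vertex of that neighbour as
well), and every boundary edge lies in one of the two parts of the boundary. -/
structure Mesh (D : PlateDomain) where
  N : ℕ
  cell : Fin N → Polygon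
  subset : ∀ a, (cell a).carrier ⊆ D.Ω
  disjoint : ∀ a b, a ≠ b → Disjoint (cell a).carrier (cell b).carrier
  cover : closure D.Ω = ⋃ a, closure (cell a).carrier
  conformity : ∀ a b, a ≠ b → ∀ i j, SharedEdge (cell a) (cell b) i j ∨
    ∀ x, x ∈ (cell a).edge i → x ∈ (cell b).edge j →
      (x = (cell a).vert i ∨ x = (cell a).vert (i + 1)) ∧
        (x = (cell b).vert j ∨ x = (cell b).vert (j + 1))
  boundary : ∀ a i, (cell a).edge i ⊆ frontier D.Ω → (cell a).edge i ⊆ D.Γc ∨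
    openSegment ℝ ((cell a).vert i) ((cell a).vert (i + 1)) ⊆ D.Γs

namespace Mesh

variable {D : PlateDomain} (T : Mesh D)

/-- Shape regularity with parameter `ρ`: every cell is star-shaped with respect to every point of
a ball of radius at least `ρ h_K`, and every edge of it has length at least `ρ h_K`. -/
def ShapeRegular (ρ : ℝ) : Prop :=
  ∀ a, (∃ x r, ρ * (T.cell a).h ≤ r ∧
      ∀ y ∈ Metric.ball x r, StarConvex ℝ y (T.cell a).carrier) ∧
    ∀ i, ρ * (T.cell a).h ≤ (T.cell a).len i

/-- Restriction to a cell. -/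
def res (a : Fin T.N) : L2 D.Ω →ₗ[ℝ] L2 (T.cell a).carrier where
  toFun v := ((Lp.memLp v).mono_measure
    (Measure.restrict_mono (T.subset a) (le_refl volume))).toLp
  map_add' u v := by
    rw [← MemLp.toLp_add]
    exact MemLp.toLp_congr _ _
      (ae_mono (Measure.restrict_mono (T.subset a) (le_refl volume)) (Lp.coeFn_add u v))
  map_smul' c v := by
    rw [RingHom.id_apply, ← MemLp.toLp_const_smul]
    exact MemLp.toLp_congr _ _
      (ae_mono (Measure.restrict_mono (T.subset a) (le_refl volume)) (Lp.coeFn_smul c v))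

/-- The global conforming displacement space. -/
def Vc (k : ℕ) : Submodule ℝ (L2 D.Ω) := D.V ⊓ ⨅ a, ((T.cell a).Vc k).comap (T.res a)

/-- The global conforming pressure space. -/
def Qc (ℓ : ℕ) : Submodule ℝ (L2 D.Ω) := D.Q ⊓ ⨅ a, ((T.cell a).Qc ℓ).comap (T.res a)

/-- The interelement and boundary conditions of the nonconforming displacement space, for the
cellwise values `w` and gradients `G`: continuity at interior vertices and zero values at boundary
vertices; jumps of `∂ₙ v` orthogonal to `P_{k-2}(e)` on interior and clamped edges; jumps of `v`
orthogonal to `P_{k-3}(e)` on all edges. The jump on a boundary edge is the function itself. -/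
def VJumps (k : ℕ) (w : Fin T.N → Plane → ℝ) (G : Fin T.N → Fin 2 → Plane → ℝ) : Prop :=
  (∀ a b i j, (T.cell a).vert i = (T.cell b).vert j →
    w a ((T.cell a).vert i) = w b ((T.cell b).vert j)) ∧
  (∀ a i, (T.cell a).vert i ∈ frontier D.Ω → w a ((T.cell a).vert i) = 0) ∧
  (∀ a b i j, a ≠ b → SharedEdge (T.cell a) (T.cell b) i j →
    ∀ χ ∈ Polynomial.degreeLT ℝ (k - 1), (T.cell a).edgeInt i (fun t =>
      (T.cell a).normalPart (G a - G b) i ((T.cell a).pt i t) * χ.eval t) = 0) ∧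
  (∀ a i, (T.cell a).edge i ⊆ D.Γc →
    ∀ χ ∈ Polynomial.degreeLT ℝ (k - 1), (T.cell a).edgeInt i (fun t =>
      (T.cell a).normalPart (G a) i ((T.cell a).pt i t) * χ.eval t) = 0) ∧
  (∀ a b i j, a ≠ b → SharedEdge (T.cell a) (T.cell b) i j →
    ∀ χ ∈ Polynomial.degreeLT ℝ (k - 2), (T.cell a).edgeInt i (fun t =>
      (w a - w b) ((T.cell a).pt i t) * χ.eval t) = 0) ∧
  (∀ a i, (T.cell a).edge i ⊆ frontier D.Ω →
    ∀ χ ∈ Polynomial.degreeLT ℝ (k - 2), (T.cell a).edgeInt i (fun t =>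
      w a ((T.cell a).pt i t) * χ.eval t) = 0)

/-- The interelement and boundary conditions of the nonconforming pressure space: jumps of `q`
orthogonal to `P_{ℓ-1}(e)` on interior and simply supported edges. -/
def QJumps (ℓ : ℕ) (g : Fin T.N → Plane → ℝ) : Prop :=
  (∀ a b i j, a ≠ b → SharedEdge (T.cell a) (T.cell b) i j →
    ∀ χ ∈ Polynomial.degreeLT ℝ ℓ, (T.cell a).edgeInt i (fun t =>
      (g a - g b) ((T.cell a).pt i t) * χ.eval t) = 0) ∧
  (∀ a i, openSegment ℝ ((T.cell a).vert i) ((T.cell a).vert (i + 1)) ⊆ D.Γs →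
    ∀ χ ∈ Polynomial.degreeLT ℝ ℓ, (T.cell a).edgeInt i (fun t =>
      g a ((T.cell a).pt i t) * χ.eval t) = 0)

/-- Membership in the global nonconforming displacement space. -/
def MemVnc (k : ℕ) (v : L2 D.Ω) : Prop :=
  (∀ a, T.res a v ∈ (T.cell a).Vnc k) ∧
    ∃ w G, (∀ a, (T.cell a).IsH2Trace (T.res a v) (w a) (G a)) ∧ T.VJumps k w G

/-- Membership in the global nonconforming pressure space. -/
def MemQnc (ℓ : ℕ) (q : L2 D.Ω) : Prop :=
  (∀ a, T.res a q ∈ (T.cell a).Qnc ℓ) ∧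
    ∃ g, (∀ a, (T.cell a).IsTrace (T.res a q) (g a)) ∧ T.QJumps ℓ g

/-! Helper facts: these conditions are linear. -/

theorem shared_integrable {K K' : Polygon} {i : Fin (K.m + 3)} {j : Fin (K'.m + 3)}
    (hs : SharedEdge K K' i j) {H : Plane → ℝ} (hH : K'.MemL2Bdry H) {f : ℝ → ℝ}
    (hf : Continuous f) : IntervalIntegrable (fun t => H (K.pt i t) * f t) volume 0 1 := by
  have h1 := hH.integrable j (f := fun t => f (1 - t)) (by fun_prop)
  have h2 := (h1.comp_sub_left 1).symm
  simp only [sub_self, sub_zero, sub_sub_cancel] at h2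
  refine h2.congr fun t _ => ?_
  have : K'.pt j (1 - t) = K.pt i t := by
    unfold Polygon.pt
    rw [hs.1, hs.2, AffineMap.lineMap_apply_one_sub]
  simp only [this]

theorem normal_integrable {K : Polygon} {i : Fin (K.m + 3)} {G : Fin 2 → Plane → ℝ}
    (hG : ∀ l, ∀ f : ℝ → ℝ, Continuous f →
      IntervalIntegrable (fun t => G l (K.pt i t) * f t) volume 0 1) (χ : Polynomial ℝ) :
    IntervalIntegrable (fun t => K.normalPart G i (K.pt i t) * χ.eval t) volume 0 1 := by
  have h0 := hG 0 (fun t => K.normal i 0 * χ.eval t) (continuous_const.mul χ.continuous)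
  have h1 := hG 1 (fun t => K.normal i 1 * χ.eval t) (continuous_const.mul χ.continuous)
  refine (h0.add h1).congr fun t _ => ?_
  simp [Polygon.normalPart, Fin.sum_univ_two]
  ring

theorem moment_lin {K : Polygon} {i : Fin (K.m + 3)} {A B : Plane → ℝ} {χ : Polynomial ℝ}
    (hA : IntervalIntegrable (fun t => A (K.pt i t) * χ.eval t) volume 0 1)
    (hB : IntervalIntegrable (fun t => B (K.pt i t) * χ.eval t) volume 0 1)
    (a : K.edgeInt i (fun t => A (K.pt i t) * χ.eval t) = 0)
    (b : K.edgeInt i (fun t => B (K.pt i t) * χ.eval t) = 0) :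
    K.edgeInt i (fun t => (A + B) (K.pt i t) * χ.eval t) = 0 := by
  have := Polygon.edgeInt_add (K := K) (i := i) hA hB
  rw [a, b, add_zero] at this
  rw [← this]
  simp [add_mul]

theorem VJumps.add {k : ℕ} {w w' : Fin T.N → Plane → ℝ} {G G' : Fin T.N → Fin 2 → Plane → ℝ}
    (t : ∀ a, (T.cell a).MemL2Bdry (w a)) (t' : ∀ a, (T.cell a).MemL2Bdry (w' a))
    (s : ∀ a l, (T.cell a).MemL2Bdry (G a l)) (s' : ∀ a l, (T.cell a).MemL2Bdry (G' a l))
    (h : T.VJumps k w G) (h' : T.VJumps k w' G') : T.VJumps k (w + w') (G + G') := by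
  obtain ⟨h1, h2, h3, h4, h5, h6⟩ := h
  obtain ⟨h1', h2', h3', h4', h5', h6'⟩ := h'
  have nj : ∀ {G : Fin T.N → Fin 2 → Plane → ℝ} (_ : ∀ a l, (T.cell a).MemL2Bdry (G a l))
      (a b i j) (_ : SharedEdge (T.cell a) (T.cell b) i j) (χ : Polynomial ℝ),
      IntervalIntegrable (fun t => (T.cell a).normalPart (G a - G b) i ((T.cell a).pt i t) *
        χ.eval t) volume 0 1 := by
    intro G s a b i j e χ
    refine normal_integrable (fun l f hf => ?_) χ
    refine (((s a l).integrable i hf).sub (shared_integrable e (s b l) hf)).congr fun t _ => ?_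
    simp [sub_mul]
  have vj : ∀ {w : Fin T.N → Plane → ℝ} (_ : ∀ a, (T.cell a).MemL2Bdry (w a))
      (a b i j) (_ : SharedEdge (T.cell a) (T.cell b) i j) (χ : Polynomial ℝ),
      IntervalIntegrable (fun t => (w a - w b) ((T.cell a).pt i t) * χ.eval t) volume 0 1 := by
    intro w s a b i j e χ
    refine (((s a).integrable i χ.continuous).sub
      (shared_integrable e (s b) χ.continuous)).congr fun t _ => ?_
    simp [sub_mul]
  refine ⟨fun a b i j e => ?_, fun a i e => ?_, fun a b i j hab e χ hχ => ?_,
    fun a i e χ hχ => ?_, fun a b i j hab e χ hχ => ?_, fun a i e χ hχ => ?_⟩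
  · simp only [Pi.add_apply, h1 a b i j e, h1' a b i j e]
  · simp only [Pi.add_apply, h2 a i e, h2' a i e, add_zero]
  · have := moment_lin (nj s a b i j e χ) (nj s' a b i j e χ) (h3 a b i j hab e χ hχ)
      (h3' a b i j hab e χ hχ)
    rw [← Polygon.normalPart_add, sub_add_sub_comm] at this
    exact this
  · have := moment_lin (normal_integrable (fun l f hf => (s a l).integrable i hf) χ)
      (normal_integrable (fun l f hf => (s' a l).integrable i hf) χ) (h4 a i e χ hχ)
      (h4' a i e χ hχ)
    rw [← Polygon.normalPart_add] at this
    exact this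
  · have := moment_lin (vj t a b i j e χ) (vj t' a b i j e χ) (h5 a b i j hab e χ hχ)
      (h5' a b i j hab e χ hχ)
    rw [sub_add_sub_comm] at this
    exact this
  · exact moment_lin ((t a).integrable i χ.continuous) ((t' a).integrable i χ.continuous)
      (h6 a i e χ hχ) (h6' a i e χ hχ)

theorem VJumps.smul {k : ℕ} {w : Fin T.N → Plane → ℝ} {G : Fin T.N → Fin 2 → Plane → ℝ} (c : ℝ)
    (h : T.VJumps k w G) : T.VJumps k (c • w) (c • G) := by
  obtain ⟨h1, h2, h3, h4, h5, h6⟩ := h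
  refine ⟨fun a b i j e => ?_, fun a i e => ?_, fun a b i j hab e χ hχ => ?_,
    fun a i e χ hχ => ?_, fun a b i j hab e χ hχ => ?_, fun a i e χ hχ => ?_⟩
  · simp only [Pi.smul_apply, h1 a b i j e]
  · simp only [Pi.smul_apply, h2 a i e, smul_zero]
  · rw [Pi.smul_apply, Pi.smul_apply, ← smul_sub, Polygon.normalPart_smul, Polygon.moment_smul,
      h3 a b i j hab e χ hχ, mul_zero]
  · rw [Pi.smul_apply, Polygon.normalPart_smul, Polygon.moment_smul, h4 a i e χ hχ, mul_zero]
  · rw [Pi.smul_apply, Pi.smul_apply, ← smul_sub, Polygon.moment_smul,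
      h5 a b i j hab e χ hχ, mul_zero]
  · rw [Pi.smul_apply, Polygon.moment_smul, h6 a i e χ hχ, mul_zero]

theorem VJumps.zero {k : ℕ} : T.VJumps k 0 0 :=
  ⟨by simp, by simp, by simp [Polygon.edgeInt, Polygon.normalPart_zero],
    by simp [Polygon.edgeInt, Polygon.normalPart_zero], by simp [Polygon.edgeInt],
    by simp [Polygon.edgeInt]⟩

theorem QJumps.add {ℓ : ℕ} {g g' : Fin T.N → Plane → ℝ}
    (t : ∀ a, (T.cell a).MemL2Bdry (g a)) (t' : ∀ a, (T.cell a).MemL2Bdry (g' a))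
    (h : T.QJumps ℓ g) (h' : T.QJumps ℓ g') : T.QJumps ℓ (g + g') := by
  have vj : ∀ {w : Fin T.N → Plane → ℝ} (_ : ∀ a, (T.cell a).MemL2Bdry (w a))
      (a b i j) (_ : SharedEdge (T.cell a) (T.cell b) i j) (χ : Polynomial ℝ),
      IntervalIntegrable (fun t => (w a - w b) ((T.cell a).pt i t) * χ.eval t) volume 0 1 := by
    intro w s a b i j e χ
    refine (((s a).integrable i χ.continuous).sub
      (shared_integrable e (s b) χ.continuous)).congr fun t _ => ?_
    simp [sub_mul]
  refine ⟨fun a b i j hab e χ hχ => ?_, fun a i e χ hχ => ?_⟩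
  · have := moment_lin (vj t a b i j e χ) (vj t' a b i j e χ) (h.1 a b i j hab e χ hχ)
      (h'.1 a b i j hab e χ hχ)
    rw [sub_add_sub_comm] at this
    exact this
  · exact moment_lin ((t a).integrable i χ.continuous) ((t' a).integrable i χ.continuous)
      (h.2 a i e χ hχ) (h'.2 a i e χ hχ)

theorem QJumps.smul {ℓ : ℕ} {g : Fin T.N → Plane → ℝ} (c : ℝ) (h : T.QJumps ℓ g) :
    T.QJumps ℓ (c • g) := by
  refine ⟨fun a b i j hab e χ hχ => ?_, fun a i e χ hχ => ?_⟩
  · rw [Pi.smul_apply, Pi.smul_apply, ← smul_sub, Polygon.moment_smul,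
      h.1 a b i j hab e χ hχ, mul_zero]
  · rw [Pi.smul_apply, Polygon.moment_smul, h.2 a i e χ hχ, mul_zero]

theorem QJumps.zero {ℓ : ℕ} : T.QJumps ℓ 0 :=
  ⟨by simp [Polygon.edgeInt], by simp [Polygon.edgeInt]⟩

/-- The global nonconforming displacement space. -/
def Vnc (k : ℕ) : Submodule ℝ (L2 D.Ω) where
  carrier := {v | T.MemVnc k v}
  add_mem' {v v'} := by
    rintro ⟨h, w, G, t, j⟩ ⟨h', w', G', t', j'⟩
    refine ⟨fun a => ?_, w + w', G + G', fun a => ?_, VJumps.add T (fun a => (t a).2.2.2.1.2.1)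
      (fun a => (t' a).2.2.2.1.2.1) (fun a l => ((t a).2.2.2.2 l).2.1)
      (fun a l => ((t' a).2.2.2.2 l).2.1) j j'⟩
    · rw [map_add]
      exact Submodule.add_mem _ (h a) (h' a)
    · rw [map_add]
      exact (t a).add (t' a)
  zero_mem' := by
    refine ⟨fun a => ?_, 0, 0, fun a => ?_, VJumps.zero T⟩
    · rw [map_zero]
      exact Submodule.zero_mem _
    · rw [map_zero]
      exact Polygon.IsH2Trace.zero
  smul_mem' c v := by
    rintro ⟨h, w, G, t, j⟩
    refine ⟨fun a => ?_, c • w, c • G, fun a => ?_, VJumps.smul T c j⟩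
    · rw [map_smul]
      exact Submodule.smul_mem _ c (h a)
    · rw [map_smul]
      exact (t a).smul c

/-- The global nonconforming pressure space. -/
def Qnc (ℓ : ℕ) : Submodule ℝ (L2 D.Ω) where
  carrier := {q | T.MemQnc ℓ q}
  add_mem' {v v'} := by
    rintro ⟨h, g, t, j⟩ ⟨h', g', t', j'⟩
    refine ⟨fun a => ?_, g + g', fun a => ?_, QJumps.add T (fun a => (t a).2.1)
      (fun a => (t' a).2.1) j j'⟩
    · rw [map_add]
      exact Submodule.add_mem _ (h a) (h' a)
    · rw [map_add]
      exact (t a).add (t' a)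
  zero_mem' := by
    refine ⟨fun a => ?_, 0, fun a => ?_, QJumps.zero T⟩
    · rw [map_zero]
      exact Submodule.zero_mem _
    · rw [map_zero]
      exact Polygon.IsTrace.zero
  smul_mem' c v := by
    rintro ⟨h, g, t, j⟩
    refine ⟨fun a => ?_, c • g, fun a => ?_, QJumps.smul T c j⟩
    · rw [map_smul]
      exact Submodule.smul_mem _ c (h a)
    · rw [map_smul]
      exact (t a).smul c

/-! ### The discrete problems -/

/-- The conforming method on every cell. -/
def conforming (k ℓ : ℕ) (a : Fin T.N) : LocalScheme (T.cell a) := (T.cell a).conforming k ℓ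

/-- The nonconforming method on every cell. -/
def nonconforming (k ℓ : ℕ) (a : Fin T.N) : LocalScheme (T.cell a) :=
  (T.cell a).nonconforming k ℓ

/-- `⟨𝒜_h (u, p), (v, q)⟩ = a₁ʰ(u, v) - a₂ʰ(p, v) + a₂ʰ(q, u) + a₃ʰ(p, q)`. -/
def A {L : ∀ a, LocalScheme (T.cell a)} (S : ∀ a, Stabilisation (L a)) (k ℓ : ℕ) (α β γ : ℝ)
    (x y : L2 D.Ω × L2 D.Ω) : ℝ :=
  (∑ a, a1h (S a) k (T.res a x.1) (T.res a y.1)) -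
    (∑ a, a2h (T.cell a) k ℓ α (T.res a x.2) (T.res a y.1)) +
    (∑ a, a2h (T.cell a) k ℓ α (T.res a y.2) (T.res a x.1)) +
    ∑ a, a3h (S a) ℓ β γ (T.res a x.2) (T.res a y.2)

/-- The right-hand side `(f, Π_k v)_Ω + (g, Π_ℓ q)_Ω`, with cellwise projections. -/
def F (k ℓ : ℕ) (f g : L2 D.Ω) (y : L2 D.Ω × L2 D.Ω) : ℝ :=
  (∑ a, ⟪T.res a f, (T.cell a).proj k (T.res a y.1)⟫) +
    ∑ a, ⟪T.res a g, (T.cell a).proj ℓ (T.res a y.2)⟫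

/-- The piecewise weighted norm. -/
def normPw (β γ : ℝ) (x : L2 D.Ω × L2 D.Ω) : ℝ :=
  √(∑ a, normSq (T.cell a).carrier β γ (T.res a x.1) (T.res a x.2))

end Mesh

/-- The problem "find `x ∈ X` with `A x y = F d y` for all `y ∈ X`" is well posed, with
boundedness constant `M` and coercivity constant `c` in the norm `nrm`: `A` is bilinear, bounded
and coercive on `X`; for every datum `d` the functional `F d` is bounded, there is exactly one
solution, and its norm is at most `1 / c` times any bound of `F d`. -/
def WellPosed {E J : Type} [AddCommGroup E] [Module ℝ E] (X : Submodule ℝ E) (nrm : E → ℝ)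
    (A : E → E → ℝ) (F : J → E → ℝ) (M c : ℝ) : Prop :=
  (∃ B : LinearMap.BilinForm ℝ X, ∀ x y : X, B x y = A x y) ∧
  (∀ x ∈ X, ∀ y ∈ X, |A x y| ≤ M * nrm x * nrm y) ∧
  (∀ x ∈ X, c * nrm x ^ 2 ≤ A x x) ∧
  ∀ d : J, (∃ C : ℝ, 0 ≤ C ∧ ∀ y ∈ X, |F d y| ≤ C * nrm y) ∧
    (∃! x : E, x ∈ X ∧ ∀ y ∈ X, A x y = F d y) ∧
    ∀ x ∈ X, (∀ y ∈ X, A x y = F d y) →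
      ∀ C : ℝ, 0 ≤ C → (∀ y ∈ X, |F d y| ≤ C * nrm y) → c * nrm x ≤ C

end PlateVEM

end

noncomputable section

namespace PlateVEM

/-! ### Star-shaped polygons -/

/-! The discrete form is a symmetric part, the sum of a₁ʰ and a₃ʰ, plus a coupling in which a₂ʰ
occurs with both signs. On the diagonal the coupling cancels, so coercivity is decided cell by cell.
There a function is split into its polynomial projection and a remainder. The L² projection and the
energy projection both satisfy Pythagoras' identity. The energy of the polynomial part is controlled
by the projected derivatives, since derivatives of a polynomial of degree k lie in the spaces onto
which these derivatives are projected. The remainder lies in the kernel of the projection, where the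
stabilisation is equivalent to the seminorm. This gives `le_a1h`, `a1h_le`, `le_a3h`, `a3h_le` with
the single constant `StabConstants.kappa`. It requires that the projections are well-defined linear
maps of the local space onto polynomials contained in it (`LinearRel.isProjOn`, `polySpace_le_Vc`
and its companions).

Boundedness of the symmetric part is the Cauchy-Schwarz inequality. The coupling needs more: it
contains the first-order seminorm of the displacement, which is absent from the norm. What is
missing is the interpolation inequality Σ|v|₁² ≤ C Σ(‖v‖² + |v|₂²) with C independent of the mesh.
For conforming functions it follows by one integration by parts, v being in H¹₀. For nonconforming
functions Green's formula on a cell leaves the terms (v, ∂ₙv)_e. Let m_e be the mean of the two end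
point values of v on the edge e. The terms m_e ∫_e ∂ₙv cancel in the sum over all cells, because
vertex values are single valued and vanish on the boundary while the mean flux across a common edge
does not jump (`sum_boundary_eq_zero`). In the rest, (v - m_e, ∂ₙv)_e, the gradient is compared with
a constant vector c. The deviation from c is small by the trace and Poincaré inequalities. Against
the constant part only the mean of v - m_e counts, and this is the error of the trapezoidal rule,
which again sees only the deviation of ∇v from c (`abs_inner_edgeOne_le`, `edge_est_sm`). After
Young's inequality half of |v|₁² is absorbed (`local_interp`).

The analysis on a polygon rests on star-shapedness with respect to a ball alone. Sectors with apex
at the centre x₀ yield the Gauss-Green formula (`StarBall.green`). The field x - x₀ has normal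
component at least r on the boundary, whence the trace inequality (`StarBall.trace_ineq`). Averaging
over base points in the ball gives the Poincaré inequality (`StarBall.poincare`). Averaging v((1 -
e)x + ey) over y in the ball regularises: for e > 0 only values inside the polygon are used, so
smooth functions are dense. For e < 0 the result is a test function, which serves functions with
vanishing traces.

Finally, each local space is finite-dimensional, because its elements are determined by their
polynomial data through an energy argument, with one scalar added in the Neumann case (`finite_Vc`,
`finite_Vnc`, `finite_Qc`, `finite_Qnc`). The global spaces are then finite-dimensional too, and
coercivity gives unique solvability by linear algebra (`wellPosed_of_coercive`). -/

/-- The planar cross product. -/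
def cross (a b : Plane) : ℝ := a 0 * b 1 - a 1 * b 0

namespace Polygon

variable {K : Polygon} {x₀ : Plane} {r : ℝ}

/-- `K` is star-shaped with respect to every point of the ball of centre `x₀` and radius `r`. -/
def StarBall (K : Polygon) (x₀ : Plane) (r : ℝ) : Prop :=
  0 < r ∧ ∀ y ∈ Metric.ball x₀ r, StarConvex ℝ y K.carrier

/-- The direction of the `i`-th edge. -/
def dir (K : Polygon) (i : Fin (K.m + 3)) : Plane := K.vert (i + 1) - K.vert i

theorem pt_eq (i : Fin (K.m + 3)) (t : ℝ) : K.pt i t = K.vert i + t • K.dir i := by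
  simp [pt, dir, AffineMap.lineMap_apply, add_comm]

theorem pt_apply (i : Fin (K.m + 3)) (t : ℝ) (j : Fin 2) :
    K.pt i t j = K.vert i j + t * K.dir i j := by
  simp [pt_eq]

theorem pt_mem_edge (i : Fin (K.m + 3)) {t : ℝ} (ht : t ∈ Icc (0 : ℝ) 1) : K.pt i t ∈ K.edge i := by
  rw [edge, segment_eq_image_lineMap]
  exact ⟨t, ht, rfl⟩

theorem edge_subset_frontier (i : Fin (K.m + 3)) : K.edge i ⊆ frontier K.carrier := by
  rw [K.frontier_eq]
  exact subset_iUnion (fun i => segment ℝ (K.vert i) (K.vert (i + 1))) i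

theorem pt_mem_frontier (i : Fin (K.m + 3)) {t : ℝ} (ht : t ∈ Icc (0 : ℝ) 1) :
    K.pt i t ∈ frontier K.carrier := edge_subset_frontier i (pt_mem_edge i ht)

theorem pt_mem_closure (i : Fin (K.m + 3)) {t : ℝ} (ht : t ∈ Icc (0 : ℝ) 1) :
    K.pt i t ∈ closure K.carrier := frontier_subset_closure (pt_mem_frontier i ht)

theorem notMem_of_frontier {x : Plane} (hx : x ∈ frontier K.carrier) : x ∉ K.carrier := by
  rw [K.isOpen.frontier_eq] at hx
  exact hx.2

theorem exists_pt_of_frontier {x : Plane} (hx : x ∈ frontier K.carrier) :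
    ∃ i, ∃ t ∈ Icc (0 : ℝ) 1, x = K.pt i t := by
  rw [K.frontier_eq] at hx
  obtain ⟨i, hi⟩ := mem_iUnion.1 hx
  rw [segment_eq_image_lineMap] at hi
  obtain ⟨t, ht, e⟩ := hi
  exact ⟨i, t, ht, e.symm⟩

@[simp] theorem pt_zero (i : Fin (K.m + 3)) : K.pt i 0 = K.vert i := by simp [pt_eq]

@[simp] theorem pt_one (i : Fin (K.m + 3)) : K.pt i 1 = K.vert (i + 1) := by simp [pt_eq, dir]

theorem vert_mem_frontier (i : Fin (K.m + 3)) : K.vert i ∈ frontier K.carrier := by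
  simpa using pt_mem_frontier (K := K) i (t := 0) (by simp)

theorem vert_succ_ne (i : Fin (K.m + 3)) : K.vert (i + 1) ≠ K.vert i := by
  intro h
  have := K.vert_injective h
  simp at this

theorem len_pos (i : Fin (K.m + 3)) : 0 < K.len i :=
  dist_pos.2 (vert_succ_ne i).symm

theorem len_sq (i : Fin (K.m + 3)) : K.len i ^ 2 = K.dir i 0 ^ 2 + K.dir i 1 ^ 2 := by
  rw [len, dist_comm, dist_eq_norm, EuclideanSpace.norm_sq_eq]
  simp [Fin.sum_univ_two, dir]

theorem len_mul_normal_zero (i : Fin (K.m + 3)) : K.len i * K.normal i 0 = K.dir i 1 := by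
  have := (len_pos (K := K) i).ne'
  simp [normal, tangent, dir]
  field_simp

theorem len_mul_normal_one (i : Fin (K.m + 3)) : K.len i * K.normal i 1 = -K.dir i 0 := by
  have := (len_pos (K := K) i).ne'
  simp [normal, tangent, dir]
  field_simp
  ring

theorem norm_normal_sq (i : Fin (K.m + 3)) : K.normal i 0 ^ 2 + K.normal i 1 ^ 2 = 1 := by
  have h := (len_pos (K := K) i).ne'
  have h2 := len_sq (K := K) i
  have a := len_mul_normal_zero (K := K) i
  have b := len_mul_normal_one (K := K) i
  have : K.len i ^ 2 * (K.normal i 0 ^ 2 + K.normal i 1 ^ 2) = K.len i ^ 2 * 1 := by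
    rw [mul_one]
    conv_rhs => rw [h2]
    linear_combination (K.len i * K.normal i 0 + K.dir i 1) * a + (K.len i * K.normal i 1 - K.dir i 0) * b
  exact mul_left_cancel₀ (pow_ne_zero 2 h) this

/-- The direction of the `i`-th edge, rotated to the left. -/
def perp (K : Polygon) (i : Fin (K.m + 3)) : Plane := !₂[-K.dir i 1, K.dir i 0]

theorem StarBall.mem (hs : K.StarBall x₀ r) {y : Plane} (hy : y ∈ Metric.ball x₀ r) :
    y ∈ K.carrier := (hs.2 y hy).mem K.isConnected.nonempty

/-- For z in the interior this is star-shapedness. For z in the closure, replace z by a nearby point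
z' of the polygon and shift y by a multiple of z - z', so that the convex combination does not
change. The ball leaves room for the shifted point. -/
theorem StarBall.mem_combo (hs : K.StarBall x₀ r) {y z : Plane} (hy : y ∈ Metric.ball x₀ r)
    (hz : z ∈ closure K.carrier) {e : ℝ} (h0 : 0 < e) (h1 : e ≤ 1) :
    (1 - e) • z + e • y ∈ K.carrier := by
  have hy' : dist y x₀ < r := hy
  obtain ⟨z', hz', hd⟩ := Metric.mem_closure_iff.1 hz (e * (r - dist y x₀)) (by
    have : 0 < r - dist y x₀ := by linarith
    positivity)
  set y' := y + ((1 - e) / e) • (z - z') with hy'_def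
  have hmem : y' ∈ Metric.ball x₀ r := by
    rw [Metric.mem_ball]
    have e1 : dist y' x₀ ≤ dist y x₀ + (1 - e) / e * dist z z' := by
      rw [hy'_def, dist_eq_norm, dist_eq_norm, dist_eq_norm, add_sub_right_comm]
      refine (norm_add_le _ _).trans ?_
      rw [norm_smul, Real.norm_of_nonneg (div_nonneg (by linarith) h0.le)]
    have e2 : (1 - e) / e * dist z z' < r - dist y x₀ := by
      rw [div_mul_eq_mul_div, div_lt_iff₀ h0]
      have : (1 - e) * dist z z' ≤ dist z z' :=
        mul_le_of_le_one_left dist_nonneg (by linarith)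
      linarith
    linarith
  have key := hs.2 y' hmem hz' h0.le (by linarith : (0 : ℝ) ≤ 1 - e) (by ring)
  convert key using 1
  rw [hy'_def, smul_add, smul_smul, mul_div_cancel₀ _ h0.ne']
  module

/-- A segment joining points on the two sides of an edge, close to an inner point of the edge at
one end, meets the edge. -/
theorem eventually_crossing (i : Fin (K.m + 3)) {t : ℝ} (ht : t ∈ Ioo (0 : ℝ) 1) (y : Plane)
    (hy : cross (K.pt i t - y) (K.dir i) ≠ 0) :
    ∀ᶠ s in 𝓝 (0 : ℝ), s * cross (K.pt i t - y) (K.dir i) < 0 →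
      ∃ e ∈ Ioo (0 : ℝ) 1, (1 - e) • (K.pt i t + s • K.perp i) + e • y ∈ K.edge i := by
  set x := K.pt i t
  set b := K.dir i
  set f := cross (x - y) b with hf
  set L := b 0 ^ 2 + b 1 ^ 2 with hL
  have hLpos : 0 < L := by rw [hL, ← len_sq]; exact pow_pos (len_pos i) 2
  set A := (y 0 - x 0) * b 0 + (y 1 - x 1) * b 1
  -- The segment from x + s • perp to y crosses the line of the edge at e = sL/(sL - f), and the
  -- crossing point has edge parameter t + e·A/L. As s → 0 this tends to t, hence stays within the
  -- edge.
  have hlim : Filter.Tendsto (fun s : ℝ => t + s * L / (s * L - f) * (A / L)) (𝓝 0) (𝓝 t) := by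
    have : ContinuousAt (fun s : ℝ => t + s * L / (s * L - f) * (A / L)) 0 := by
      refine continuousAt_const.add (ContinuousAt.mul (ContinuousAt.div (by fun_prop) (by fun_prop)
        (by simpa using hy)) continuousAt_const)
    simpa [ContinuousAt] using this
  filter_upwards [hlim (Ioo_mem_nhds ht.1 ht.2)] with s hs hneg
  have hne : s * L - f ≠ 0 := by
    intro h
    have hsf : s * L = f := by linarith
    have : s * f = s ^ 2 * L := by rw [← hsf]; ring
    nlinarith [mul_nonneg (sq_nonneg s) hLpos.le]
  have hpos : 0 < s * L / (s * L - f) ∧ s * L / (s * L - f) < 1 := by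
    rcases lt_trichotomy s 0 with h | h | h
    · have hf0 : 0 < f := by by_contra! h'; nlinarith
      have hd : s * L - f < 0 := by nlinarith
      refine ⟨div_pos_of_neg_of_neg (by nlinarith) hd, ?_⟩
      rw [div_lt_one_of_neg hd]; linarith
    · simp [h] at hneg
    · have hf0 : f < 0 := by by_contra! h'; nlinarith
      have hd : 0 < s * L - f := by nlinarith
      refine ⟨div_pos (by nlinarith) hd, ?_⟩
      rw [div_lt_one hd]; linarith
  refine ⟨_, hpos, ?_⟩
  have : (1 - s * L / (s * L - f)) • (x + s • K.perp i) + (s * L / (s * L - f)) • y =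
      K.pt i (t + s * L / (s * L - f) * (A / L)) := by
    have hx : ∀ j, x j = K.vert i j + t * b j := fun j => pt_apply i t j
    have hfe : f = (x 0 - y 0) * b 1 - (x 1 - y 1) * b 0 := by simp [hf, cross]
    ext j
    rw [pt_apply]
    fin_cases j
    · simp only [perp, Fin.zero_eta, PiLp.add_apply, PiLp.smul_apply, smul_eq_mul]
      simp only [Matrix.cons_val_zero]
      have h0 := hx 0
      have : K.vert i 0 + (t + s * L / (s * L - f) * (A / L)) * K.dir i 0 =
        x 0 + s * L / (s * L - f) * (A / L) * b 0 := by rw [h0]; ring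
      rw [this]
      field_simp
      rw [hfe]
      simp only [A, hL, b]
      ring
    · simp only [perp, Fin.mk_one, PiLp.add_apply, PiLp.smul_apply, smul_eq_mul]
      simp only [Matrix.cons_val_one]
      have h0 := hx 1
      have : K.vert i 1 + (t + s * L / (s * L - f) * (A / L)) * K.dir i 1 =
        x 1 + s * L / (s * L - f) * (A / L) * b 1 := by rw [h0]; ring
      rw [this]
      field_simp
      rw [hfe]
      simp only [A, hL, b]
      simp
      ring
  rw [this]
  exact pt_mem_edge i ⟨hs.1.le, hs.2.le⟩

theorem cross_pt_sub (i : Fin (K.m + 3)) (t : ℝ) (y : Plane) :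
    cross (K.pt i t - y) (K.dir i) = cross (K.vert i - y) (K.dir i) := by
  simp [cross, pt_apply]
  ring

theorem eventually_perp_mem (i : Fin (K.m + 3)) {t : ℝ} (ht : t ∈ Ioo (0 : ℝ) 1) :
    ∀ᶠ s in 𝓝[>] (0 : ℝ), K.pt i t + s • K.perp i ∈ K.carrier := by
  refine K.counterclockwise i (K.pt i t) ?_
  rw [openSegment_eq_image_lineMap]
  exact ⟨t, ht, rfl⟩

/-- Points just to the left of the edge lie in the polygon. Were y strictly to the right, the
segment from such a point to y would meet the edge, while star-shapedness keeps it in the open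
polygon. -/
theorem StarBall.cross_nonneg (hs : K.StarBall x₀ r) (i : Fin (K.m + 3)) {y : Plane}
    (hy : y ∈ Metric.ball x₀ r) : 0 ≤ cross (K.vert i - y) (K.dir i) := by
  by_contra! hneg
  have ht : (1 / 2 : ℝ) ∈ Ioo (0 : ℝ) 1 := by norm_num
  rw [← cross_pt_sub i (1 / 2) y] at hneg
  have h1 := (eventually_crossing i ht y hneg.ne).filter_mono (nhdsWithin_le_nhds (s := Ioi 0))
  obtain ⟨s, ⟨hs1, hs2⟩, hs3⟩ :=
    ((h1.and (eventually_perp_mem i ht)).and self_mem_nhdsWithin).exists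
  obtain ⟨e, he, hmem⟩ := hs1 (mul_neg_of_pos_of_neg hs3 hneg)
  refine notMem_of_frontier (edge_subset_frontier i hmem) ?_
  exact hs.mem_combo hy (subset_closure hs2) he.1 he.2.le

/-- The distance of `x₀` to the line through an edge is at least `r`. -/
theorem StarBall.le_cross (hs : K.StarBall x₀ r) (i : Fin (K.m + 3)) :
    r * K.len i ≤ cross (K.vert i - x₀) (K.dir i) := by
  have hl := len_pos (K := K) i
  have key : ∀ q ∈ Ioo (0 : ℝ) r, q * K.len i ≤ cross (K.vert i - x₀) (K.dir i) := by
    intro q hq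
    have hn : ‖K.normal i‖ = 1 := by
      have := norm_normal_sq (K := K) i
      rw [EuclideanSpace.norm_eq, Fin.sum_univ_two]
      simp [this]
    -- Move from x₀ towards the line of the edge by q < r. The point is still in the open ball,
    -- hence not beyond the line. The bound with r itself is obtained in the limit q → r.
    have h := hs.cross_nonneg i (y := x₀ + q • K.normal i) (by
      rw [Metric.mem_ball, dist_eq_norm, add_sub_cancel_left, norm_smul, hn, mul_one,
        Real.norm_of_nonneg hq.1.le]
      exact hq.2)
    have e : cross (K.vert i - (x₀ + q • K.normal i)) (K.dir i) =
        cross (K.vert i - x₀) (K.dir i) - q * K.len i := by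
      have a := len_mul_normal_zero (K := K) i
      have b := len_mul_normal_one (K := K) i
      have c := norm_normal_sq (K := K) i
      simp only [cross, PiLp.sub_apply, PiLp.add_apply, PiLp.smul_apply, smul_eq_mul]
      rw [← a, show K.dir i 0 = -(K.len i * K.normal i 1) by linarith]
      linear_combination (-q * K.len i) * c
    linarith
  refine le_of_tendsto (x := 𝓝[<] r) (f := fun q => q * K.len i) ?_ ?_
  · exact ((continuous_id.mul continuous_const).tendsto r).mono_left nhdsWithin_le_nhds
  · filter_upwards [Ioo_mem_nhdsLT hs.1] with q hq using key q hq

theorem StarBall.cross_pos (hs : K.StarBall x₀ r) (i : Fin (K.m + 3)) :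
    0 < cross (K.vert i - x₀) (K.dir i) :=
  (mul_pos hs.1 (len_pos i)).trans_le (hs.le_cross i)

/-- Points of the plane just beyond an inner point of an edge are not in the closed polygon. -/
theorem StarBall.eventually_notMem_closure (hs : K.StarBall x₀ r) (i : Fin (K.m + 3)) {t : ℝ}
    (ht : t ∈ Ioo (0 : ℝ) 1) :
    ∀ᶠ s in 𝓝[<] (0 : ℝ), K.pt i t + s • K.perp i ∉ closure K.carrier := by
  have hpos := hs.cross_pos i
  rw [← cross_pt_sub i t x₀] at hpos
  have h1 := (eventually_crossing i ht x₀ hpos.ne').filter_mono (nhdsWithin_le_nhds (s := Iio 0))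
  filter_upwards [h1, self_mem_nhdsWithin] with s h2 h3 h4
  obtain ⟨e, he, hmem⟩ := h2 (mul_neg_of_neg_of_pos h3 hpos)
  refine notMem_of_frontier (edge_subset_frontier i hmem) ?_
  exact hs.mem_combo (Metric.mem_ball_self hs.1) h4 he.1 he.2.le

/-- A ray from x₀ leaves the polygon once and for all: of two boundary points on the same ray, the
nearer one would be a proper convex combination of the other and x₀, hence an interior point by
`mem_combo`. -/
theorem StarBall.eq_of_ray (hs : K.StarBall x₀ r) {p q : Plane} (hp : p ∈ frontier K.carrier)
    (hq : q ∈ frontier K.carrier) {s s' : ℝ} (h0 : 0 < s) (h0' : 0 < s')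
    (h : s • (p - x₀) = s' • (q - x₀)) : s = s' ∧ p = q := by
  have aux : ∀ {p q : Plane} (_ : p ∈ frontier K.carrier) (_ : q ∈ frontier K.carrier) {s s' : ℝ}
      (_ : 0 < s) (_ : 0 < s') (_ : s • (p - x₀) = s' • (q - x₀)), s' ≤ s := by
    intro p q hp hq s s' h0 h0' h
    by_contra! hlt
    refine notMem_of_frontier hq ?_
    have := hs.mem_combo (Metric.mem_ball_self hs.1) (frontier_subset_closure hp)
      (e := 1 - s / s') (by rw [sub_pos, div_lt_one h0']; exact hlt)
      (by have := div_pos h0 h0'; linarith)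
    convert this using 1
    have h2 : q - x₀ = (s / s') • (p - x₀) := by
      rw [div_eq_inv_mul, mul_smul, h, smul_smul, inv_mul_cancel₀ h0'.ne', one_smul]
    have : q = x₀ + (s / s') • (p - x₀) := by rw [← h2]; abel
    rw [this]
    module
  have e : s = s' := le_antisymm (aux hq hp h0' h0 h.symm) (aux hp hq h0 h0' h)
  refine ⟨e, ?_⟩
  subst e
  have := smul_right_injective Plane h0.ne' h
  exact sub_left_injective this

theorem segment_null (a b : Plane) : volume (segment ℝ a b) = 0 := by
  refine measure_mono_null (t := (line[ℝ, a, b] : Set Plane)) ?_ ?_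
  · rw [← convexHull_pair]
    exact convexHull_subset_affineSpan _
  · refine Measure.addHaar_affineSubspace _ _ ?_
    intro h
    have h1 : Module.finrank ℝ (line[ℝ, a, b]).direction = 2 := by
      rw [h, AffineSubspace.direction_top, finrank_top]
      simp
    have h2 : Collinear ℝ {a, b} := collinear_pair ℝ a b
    have h3 := h2.finrank_le_one
    rw [direction_affineSpan] at h1
    omega

theorem volume_frontier : volume (frontier K.carrier) = 0 := by
  rw [K.frontier_eq]
  exact measure_iUnion_null fun i => segment_null _ _

/-- The sector between `x₀` and the `i`-th edge. -/
def sector (K : Polygon) (x₀ : Plane) (i : Fin (K.m + 3)) : Set Plane :=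
  (fun u : Plane => x₀ + u 0 • (K.pt i (u 1) - x₀)) '' {u | u 0 ∈ Ioo (0 : ℝ) 1 ∧ u 1 ∈ Ioo (0 : ℝ) 1}

theorem StarBall.sector_subset (hs : K.StarBall x₀ r) (i : Fin (K.m + 3)) :
    K.sector x₀ i ⊆ K.carrier := by
  rintro _ ⟨u, ⟨h0, h1⟩, rfl⟩
  have := hs.mem_combo (Metric.mem_ball_self hs.1)
    (pt_mem_closure i ⟨h1.1.le, h1.2.le⟩) (e := 1 - u 0) (by linarith [h0.2]) (by linarith [h0.1])
  convert this using 1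
  module

theorem pt_injective (i : Fin (K.m + 3)) : Function.Injective (K.pt i) :=
  AffineMap.lineMap_injective ℝ (vert_succ_ne i).symm

theorem pt_eq_pt {i j : Fin (K.m + 3)} {t t' : ℝ} (ht : t ∈ Ioo (0 : ℝ) 1)
    (ht' : t' ∈ Icc (0 : ℝ) 1) (h : K.pt i t = K.pt j t') : i = j ∧ t = t' := by
  have hij : i = j := by
    by_contra hne
    rcases K.simple i j hne _ (pt_mem_edge i ⟨ht.1.le, ht.2.le⟩) (h ▸ pt_mem_edge j ht') with
      ⟨e, hx⟩ | ⟨e, hx⟩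
    · rw [e, ← pt_one] at hx
      exact ht.2.ne (pt_injective i hx)
    · rw [← pt_zero] at hx
      exact ht.1.ne' (pt_injective i hx)
  subst hij
  exact ⟨rfl, pt_injective i h⟩

theorem StarBall.sector_inj (hs : K.StarBall x₀ r) {i j : Fin (K.m + 3)} {u v : Plane}
    (hu0 : u 0 ∈ Ioo (0 : ℝ) 1) (hu1 : u 1 ∈ Ioo (0 : ℝ) 1)
    (hv0 : v 0 ∈ Ioo (0 : ℝ) 1) (hv1 : v 1 ∈ Ioo (0 : ℝ) 1)
    (h : x₀ + u 0 • (K.pt i (u 1) - x₀) = x₀ + v 0 • (K.pt j (v 1) - x₀)) : i = j ∧ u = v := by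
  obtain ⟨e1, e2⟩ := hs.eq_of_ray (pt_mem_frontier i ⟨hu1.1.le, hu1.2.le⟩)
    (pt_mem_frontier j ⟨hv1.1.le, hv1.2.le⟩) hu0.1 hv0.1 (add_left_cancel h)
  obtain ⟨e3, e4⟩ := pt_eq_pt hu1 ⟨hv1.1.le, hv1.2.le⟩ e2
  refine ⟨e3, ?_⟩
  ext l
  fin_cases l
  · exact e1
  · exact e4

/-- The ray from x₀ through x exits the polygon at a boundary point, at a factor l > 1. If that
point is inside an edge, x lies in the sector of the edge. If it is a vertex, x lies on the spoke
from x₀ to it, and the spokes form a null set. -/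
theorem StarBall.carrier_subset (hs : K.StarBall x₀ r) :
    K.carrier ⊆ (⋃ i, K.sector x₀ i) ∪ ⋃ i, segment ℝ x₀ (K.vert i) := by
  intro x hx
  by_cases hxx : x = x₀
  · right
    exact mem_iUnion.2 ⟨0, hxx ▸ left_mem_segment ℝ _ _⟩
  -- the last point of the ray in the closed polygon
  have hne : x - x₀ ≠ 0 := sub_ne_zero.2 hxx
  set S : Set ℝ := {l | 0 ≤ l ∧ x₀ + l • (x - x₀) ∉ K.carrier}
  have hS : S.Nonempty := by
    obtain ⟨R, hR⟩ := K.isBounded.subset_closedBall x₀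
    refine ⟨(|R| + 1) / ‖x - x₀‖, by positivity, fun h => ?_⟩
    have := hR h
    rw [Metric.mem_closedBall, dist_eq_norm, add_sub_cancel_left, norm_smul,
      Real.norm_of_nonneg (by positivity), div_mul_cancel₀ _ (norm_ne_zero_iff.2 hne)] at this
    linarith [le_abs_self R]
  have hcl : IsClosed S := by
    have : Continuous fun l : ℝ => x₀ + l • (x - x₀) := by fun_prop
    exact isClosed_Ici.inter (K.isOpen.preimage this).isClosed_compl
  have hbd : BddBelow S := ⟨0, fun l hl => hl.1⟩
  set l := sInf S
  have hl : l ∈ S := hcl.csInf_mem hS hbd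
  have h1 : 1 < l := by
    by_contra! hle
    refine hl.2 ?_
    have := hs.2 x₀ (Metric.mem_ball_self hs.1) hx (sub_nonneg.2 hle) hl.1 (by ring)
    convert this using 1
    module
  have hfr : x₀ + l • (x - x₀) ∈ frontier K.carrier := by
    rw [K.isOpen.frontier_eq]
    refine ⟨?_, hl.2⟩
    have hc : Continuous fun l : ℝ => x₀ + l • (x - x₀) := by fun_prop
    have : l ∈ closure (Ico 0 l) := by
      rw [closure_Ico (by linarith : (0 : ℝ) ≠ l)]
      exact right_mem_Icc.2 (by linarith)
    refine closure_mono ?_ (image_closure_subset_closure_image hc ⟨l, this, rfl⟩)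
    rintro _ ⟨q, hq, rfl⟩
    by_contra hn
    exact absurd (csInf_le hbd ⟨hq.1, hn⟩) (not_le.2 hq.2)
  obtain ⟨i, t, ht, e⟩ := exists_pt_of_frontier hfr
  have hx' : x = x₀ + l⁻¹ • (K.pt i t - x₀) := by
    rw [← e, add_sub_cancel_left, smul_smul, inv_mul_cancel₀ (by linarith), one_smul]
    abel
  have hseg : ∀ j, K.pt i t = K.vert j → x ∈ segment ℝ x₀ (K.vert j) := by
    intro j hj
    refine ⟨1 - l⁻¹, l⁻¹, ?_, by positivity, by ring, ?_⟩
    · rw [sub_nonneg]; exact inv_le_one_of_one_le₀ h1.le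
    · rw [hx', hj]; module
  rcases eq_or_lt_of_le ht.1 with h0 | h0
  · right
    exact mem_iUnion.2 ⟨i, hseg i (by rw [← h0, pt_zero])⟩
  rcases eq_or_lt_of_le ht.2 with h0' | h0'
  · right
    exact mem_iUnion.2 ⟨i + 1, hseg (i + 1) (by rw [h0', pt_one])⟩
  left
  refine mem_iUnion.2 ⟨i, !₂[l⁻¹, t], ⟨?_, ?_⟩, ?_⟩
  · simpa using ⟨by linarith, inv_lt_one_of_one_lt₀ h1⟩
  · simpa using ⟨h0, h0'⟩
  · simpa using hx'.symm

end Polygon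

/-! ### Integration over sectors and the Gauss-Green formula -/

theorem setIntegral_plane (g : ℝ × ℝ → ℝ) (s : Set (ℝ × ℝ)) :
    ∫ u in {u : Plane | (u 0, u 1) ∈ s}, g (u 0, u 1) = ∫ p in s, g p := by
  set e : Plane ≃ᵐ ℝ × ℝ := (MeasurableEquiv.toLp 2 (Fin 2 → ℝ)).symm.trans MeasurableEquiv.finTwoArrow
  have he : MeasurePreserving e volume volume :=
    (volume_preserving_finTwoArrow ℝ).comp
      (EuclideanSpace.volume_preserving_symm_measurableEquiv_toLp (Fin 2))
  exact he.setIntegral_preimage_emb e.measurableEmbedding g s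

namespace Polygon

variable {K : Polygon} {x₀ : Plane} {r : ℝ}

theorem hasFDerivAt_sector (i : Fin (K.m + 3)) (u : Plane) :
    HasFDerivAt (fun u : Plane => x₀ + u 0 • (K.pt i (u 1) - x₀))
      (u 0 • (EuclideanSpace.proj 1 : Plane →L[ℝ] ℝ).smulRight (K.dir i) +
        (EuclideanSpace.proj 0 : Plane →L[ℝ] ℝ).smulRight (K.pt i (u 1) - x₀)) u := by
  have h0 : HasFDerivAt (fun u : Plane => u 0) (EuclideanSpace.proj 0 : Plane →L[ℝ] ℝ) u :=
    (EuclideanSpace.proj 0 : Plane →L[ℝ] ℝ).hasFDerivAt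
  have h1 : HasFDerivAt (fun u : Plane => u 1) (EuclideanSpace.proj 1 : Plane →L[ℝ] ℝ) u :=
    (EuclideanSpace.proj 1 : Plane →L[ℝ] ℝ).hasFDerivAt
  have h2 : HasFDerivAt (fun u : Plane => K.pt i (u 1) - x₀)
      ((EuclideanSpace.proj 1 : Plane →L[ℝ] ℝ).smulRight (K.dir i)) u := by
    simp only [pt_eq]
    exact ((h1.smul_const (K.dir i)).const_add (K.vert i)).sub_const x₀
  exact (h0.smul h2).const_add x₀

/-- The Jacobian does not depend on the position along the edge: moving along the edge adds a
multiple of its direction, which the cross product does not see. By `StarBall.cross_pos` it is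
positive on the parameter square, so no absolute value survives. -/
theorem det_sector (i : Fin (K.m + 3)) (u : Plane) :
    (u 0 • (EuclideanSpace.proj 1 : Plane →L[ℝ] ℝ).smulRight (K.dir i) +
        (EuclideanSpace.proj 0 : Plane →L[ℝ] ℝ).smulRight (K.pt i (u 1) - x₀)).det =
      u 0 * cross (K.vert i - x₀) (K.dir i) := by
  rw [← cross_pt_sub i (u 1) x₀, ContinuousLinearMap.det,
    ← LinearMap.det_toMatrix (EuclideanSpace.basisFun (Fin 2) ℝ).toBasis, Matrix.det_fin_two]
  simp [LinearMap.toMatrix_apply, cross]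
  ring

theorem StarBall.sector_integral (hs : K.StarBall x₀ r) (i : Fin (K.m + 3)) (f : Plane → ℝ) :
    MeasurableSet (K.sector x₀ i) ∧ ∫ x in K.sector x₀ i, f x =
      ∫ p in Ioo (0 : ℝ) 1 ×ˢ Ioo (0 : ℝ) 1, p.1 * cross (K.vert i - x₀) (K.dir i) *
        f (x₀ + p.1 • (K.pt i p.2 - x₀)) := by
  have hc0 : Continuous fun u : Plane => u 0 := by fun_prop
  have hc1 : Continuous fun u : Plane => u 1 := by fun_prop
  have hm : MeasurableSet {u : Plane | u 0 ∈ Ioo (0 : ℝ) 1 ∧ u 1 ∈ Ioo (0 : ℝ) 1} :=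
    (measurableSet_Ioo.preimage hc0.measurable).inter (measurableSet_Ioo.preimage hc1.measurable)
  have hinj : InjOn (fun u : Plane => x₀ + u 0 • (K.pt i (u 1) - x₀))
      {u : Plane | u 0 ∈ Ioo (0 : ℝ) 1 ∧ u 1 ∈ Ioo (0 : ℝ) 1} :=
    fun u hu v hv h => (hs.sector_inj hu.1 hu.2 hv.1 hv.2 h).2
  refine ⟨measurable_image_of_fderivWithin hm
    (fun u _ => (hasFDerivAt_sector i u).hasFDerivWithinAt) hinj, ?_⟩
  rw [sector, integral_image_eq_integral_abs_det_fderiv_smul volume hm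
    (fun u _ => (hasFDerivAt_sector i u).hasFDerivWithinAt) hinj,
    ← setIntegral_plane (fun p => p.1 * cross (K.vert i - x₀) (K.dir i) *
        f (x₀ + p.1 • (K.pt i p.2 - x₀)))]
  refine setIntegral_congr_fun hm fun u hu => ?_
  simp only [smul_eq_mul]
  rw [det_sector, abs_of_nonneg (mul_nonneg hu.1.1.le (hs.cross_pos i).le)]

/-- The sectors exhaust the polygon up to the spokes, and they are disjoint because boundary points
are determined by their rays. -/
theorem StarBall.integral_eq_sum_sector (hs : K.StarBall x₀ r) {f : Plane → ℝ}
    (hf : IntegrableOn f K.carrier) :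
    ∫ x in K.carrier, f x = ∑ i, ∫ x in K.sector x₀ i, f x := by
  have hsub : (⋃ i, K.sector x₀ i) ⊆ K.carrier := iUnion_subset fun i => hs.sector_subset i
  have hae : K.carrier =ᵐ[volume] ⋃ i, K.sector x₀ i := by
    refine (ae_eq_set.2 ⟨?_, ?_⟩)
    · refine measure_mono_null (t := ⋃ i, segment ℝ x₀ (K.vert i)) ?_
        (measure_iUnion_null fun i => segment_null _ _)
      intro x hx
      exact (hs.carrier_subset hx.1).resolve_left hx.2
    · rw [sdiff_eq_empty.2 hsub, measure_empty]
  rw [setIntegral_congr_set hae, integral_iUnion_fintype (fun i => (hs.sector_integral i f).1)]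
  · intro i j hij
    rw [Function.onFun, disjoint_left]
    rintro _ ⟨u, hu, rfl⟩ ⟨v, hv, e⟩
    exact hij (hs.sector_inj hu.1 hu.2 hv.1 hv.2 e.symm).1
  · exact fun i => hf.mono_set (hs.sector_subset i)

theorem dir_of_basis (i : Fin (K.m + 3)) (j : Fin 2) :
    cross (EuclideanSpace.single j 1) (K.dir i) = K.len i * K.normal i j := by
  fin_cases j
  · simp [cross, len_mul_normal_zero]
  · simp [cross, len_mul_normal_one]

theorem integrableOn_of_continuous {f : Plane → ℝ} (hf : Continuous f) :
    IntegrableOn f K.carrier :=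
  (hf.locallyIntegrable.integrableOn_isCompact K.isBounded.isCompact_closure).mono_set subset_closure

/-- The divergence theorem on the parameter square, for the pull-back (A, B) of the field φ eⱼ under
the sector map. The side s = 1 gives the edge term, the side s = 0 collapses to x₀ and contributes
nothing, and the other two sides give integrals over the spokes. The spoke terms have the same form
at both ends of the edge, so that they telescope around the polygon. -/
theorem StarBall.sector_green (hs : K.StarBall x₀ r) (i : Fin (K.m + 3)) (j : Fin 2)
    {φ : Plane → ℝ} (hφ : ContDiff ℝ ∞ φ) :
    ∫ x in K.sector x₀ i, pd j φ x =
      K.edgeInt i (fun t => φ (K.pt i t) * K.normal i j) +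
      ((∫ s in (0 : ℝ)..1, cross (K.vert (i + 1) - x₀) (EuclideanSpace.single j 1) *
        φ (x₀ + s • (K.vert (i + 1) - x₀))) -
      ∫ s in (0 : ℝ)..1, cross (K.vert i - x₀) (EuclideanSpace.single j 1) *
        φ (x₀ + s • (K.vert i - x₀))) := by
  rw [(hs.sector_integral i _).2]
  set b := K.dir i with hb
  set e : Plane := EuclideanSpace.single j 1 with he
  set c := cross (K.vert i - x₀) b with hc
  set ψ : ℝ × ℝ → ℝ := fun p => φ (x₀ + p.1 • (K.pt i p.2 - x₀)) with hψ
  set m : ℝ → Plane := fun t => K.pt i t - x₀ with hm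
  have hptd : ∀ t, HasDerivAt m b t := by
    intro t
    have : HasDerivAt (fun t : ℝ => K.vert i + t • b - x₀) ((1 : ℝ) • b) t :=
      (((hasDerivAt_id t).smul_const b).const_add _).sub_const _
    simpa [hm, pt_eq] using this
  have hD : ∀ p : ℝ × ℝ, HasFDerivAt ψ ((fderiv ℝ φ (x₀ + p.1 • m p.2)).comp
      (p.1 • ((ContinuousLinearMap.snd ℝ ℝ ℝ).smulRight b) +
        (ContinuousLinearMap.fst ℝ ℝ ℝ).smulRight (m p.2))) p := by
    intro p
    have h1 : HasFDerivAt (fun p : ℝ × ℝ => m p.2)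
        ((ContinuousLinearMap.snd ℝ ℝ ℝ).smulRight b) p := by
      have := (hptd p.2).hasFDerivAt.comp p (hasFDerivAt_snd (𝕜 := ℝ) (E := ℝ) (F := ℝ) (p := p))
      refine this.congr_fderiv ?_
      ext <;> simp
    have h2 := (((hasFDerivAt_fst (𝕜 := ℝ) (E := ℝ) (F := ℝ) (p := p)).smul h1).const_add x₀)
    exact ((hφ.differentiable (by simp)) _).hasFDerivAt.comp p h2
  have hψc : Continuous ψ := by
    rw [continuous_iff_continuousAt]; exact fun p => (hD p).continuousAt
  have hmc : Continuous m := by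
    rw [continuous_iff_continuousAt]; exact fun p => (hptd p).continuousAt
  -- the two components of the vector field
  set A : ℝ × ℝ → ℝ := fun p => cross e b * (p.1 * ψ p) with hA
  set B : ℝ × ℝ → ℝ := fun p => (cross (K.vert i - x₀) e - p.2 * cross e b) * ψ p with hB
  have hDA : ∀ p, HasFDerivAt A (cross e b • (p.1 • (fderiv ℝ ψ p) +
      ψ p • ContinuousLinearMap.fst ℝ ℝ ℝ)) p := by
    intro p
    have := ((hasFDerivAt_fst (𝕜 := ℝ) (E := ℝ) (F := ℝ) (p := p)).mul
      (hD p).differentiableAt.hasFDerivAt).const_mul (cross e b)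
    exact this
  have hDB : ∀ p, HasFDerivAt B ((cross (K.vert i - x₀) e - p.2 * cross e b) • (fderiv ℝ ψ p) +
      ψ p • (-(cross e b • ContinuousLinearMap.snd ℝ ℝ ℝ))) p := by
    intro p
    have h1 := ((hasFDerivAt_snd (𝕜 := ℝ) (E := ℝ) (F := ℝ) (p := p)).mul_const
      (cross e b)).const_sub (cross (K.vert i - x₀) e)
    exact h1.mul (hD p).differentiableAt.hasFDerivAt
  have hdiv : ∀ p : ℝ × ℝ, (cross e b • (p.1 • (fderiv ℝ ψ p) +
      ψ p • ContinuousLinearMap.fst ℝ ℝ ℝ)) (1, 0) +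
      ((cross (K.vert i - x₀) e - p.2 * cross e b) • (fderiv ℝ ψ p) +
      ψ p • (-(cross e b • ContinuousLinearMap.snd ℝ ℝ ℝ))) (0, 1) =
      p.1 * c * pd j φ (x₀ + p.1 • m p.2) := by
    intro p
    rw [(hD p).fderiv]
    simp only [add_apply, smul_apply, ContinuousLinearMap.comp_apply, neg_apply,
      ContinuousLinearMap.smulRight_apply, ContinuousLinearMap.coe_fst', smul_eq_mul,
      ContinuousLinearMap.coe_snd', zero_smul, one_smul, smul_zero, add_zero, zero_add, map_smul, pd]
    -- Cramer's rule: eⱼ is expanded in the two columns of the Jacobian matrix of the sector map.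
    have key : c • e = cross e b • m p.2 + (cross (K.vert i - x₀) e - p.2 * cross e b) • b := by
      ext l
      simp only [hm, hc, PiLp.smul_apply, PiLp.add_apply, PiLp.sub_apply, smul_eq_mul, pt_apply,
        cross, ← hb]
      fin_cases l
      · simp; ring
      · simp; ring
    have := congrArg (fderiv ℝ φ (x₀ + p.1 • m p.2)) key
    simp only [map_add, map_smul, smul_eq_mul] at this
    rw [← he]
    linear_combination (-p.1) * this
  have hcont : Continuous fun p : ℝ × ℝ => p.1 * c * pd j φ (x₀ + p.1 • m p.2) := by
    have := continuous_pd hφ j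
    fun_prop
  have key := integral2_divergence_prod_of_hasFDerivAt A B _ _ 0 0 1 1
    (continuous_iff_continuousAt.2 fun p => (hDA p).continuousAt).continuousOn
    (continuous_iff_continuousAt.2 fun p => (hDB p).continuousAt).continuousOn
    (fun p _ => hDA p) (fun p _ => hDB p) (by
      simp only [hdiv]
      exact hcont.continuousOn.integrableOn_compact (isCompact_uIcc.prod isCompact_uIcc))
  have e1 : ∫ p in Ioo (0 : ℝ) 1 ×ˢ Ioo (0 : ℝ) 1, p.1 * c * pd j φ (x₀ + p.1 • (K.pt i p.2 - x₀)) =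
      ∫ s in (0 : ℝ)..1, ∫ t in (0 : ℝ)..1, s * c * pd j φ (x₀ + s • m t) := by
    rw [Measure.volume_eq_prod, setIntegral_prod]
    · simp only [intervalIntegral.integral_of_le zero_le_one, integral_Ioc_eq_integral_Ioo]
      rfl
    · exact (hcont.continuousOn.integrableOn_compact
        (isCompact_Icc (a := (0 : ℝ)) (b := 1) |>.prod (isCompact_Icc (a := (0 : ℝ)) (b := 1)))).mono_set
        (prod_mono Ioo_subset_Icc_self Ioo_subset_Icc_self)
  rw [e1]
  have hdiv' := fun s t => hdiv (s, t)
  dsimp only at hdiv' key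
  simp only [hdiv'] at key
  rw [key]
  have f1 : ∀ s, B (s, 1) = cross (K.vert (i + 1) - x₀) e * φ (x₀ + s • (K.vert (i + 1) - x₀)) := by
    intro s
    simp only [hB, hψ, pt_one]
    congr 1
    simp only [hb, dir, cross, PiLp.sub_apply]; ring
  have f2 : ∀ s, B (s, 0) = cross (K.vert i - x₀) e * φ (x₀ + s • (K.vert i - x₀)) := by
    intro s
    simp [hB, hψ, pt_zero]
  have f3 : ∀ t, A (1, t) = K.len i * (φ (K.pt i t) * K.normal i j) := by
    intro t
    simp only [hA, hψ]
    rw [dir_of_basis]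
    simp
    ring
  have f4 : ∀ t, A (0, t) = 0 := by intro t; simp [hA]
  simp only [f1, f2, f3, f4, edgeInt, intervalIntegral.integral_const_mul, intervalIntegral.integral_zero]
  ring

/-- The Gauss-Green formula for smooth functions. -/
theorem StarBall.green (hs : K.StarBall x₀ r) (j : Fin 2) {φ : Plane → ℝ} (hφ : ContDiff ℝ ∞ φ) :
    ∫ x in K.carrier, pd j φ x = ∑ i, K.edgeInt i (fun t => φ (K.pt i t) * K.normal i j) := by
  rw [hs.integral_eq_sum_sector (integrableOn_of_continuous (continuous_pd hφ j)),
    Finset.sum_congr rfl fun i _ => hs.sector_green i j hφ, Finset.sum_add_distrib,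
    Finset.sum_sub_distrib]
  -- A cyclic shift of the index shows that the spoke integrals of neighbouring sectors cancel.
  have := Equiv.sum_comp (Equiv.addRight (1 : Fin (K.m + 3))) fun i =>
    ∫ s in (0 : ℝ)..1, cross (K.vert i - x₀) (EuclideanSpace.single j 1) *
        φ (x₀ + s • (K.vert i - x₀))
  simp only [Equiv.coe_addRight] at this
  rw [this, sub_self, add_zero]

end Polygon

theorem inner_eq_integral {U : Set Plane} (u v : L2 U) : ⟪u, v⟫ = ∫ x in U, u x * v x := by
  rw [L2.inner_def]
  refine integral_congr_ae (Filter.Eventually.of_forall fun x => ?_)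
  simp [mul_comm]

namespace Polygon

variable {K : Polygon} {x₀ : Plane} {r : ℝ}

/-! ### Smooth functions as elements of the Sobolev spaces -/

/-- The class in `L²(K)` of a continuous function on the plane. -/
def sm (K : Polygon) (φ : Plane → ℝ) (hφ : Continuous φ) : L2 K.carrier :=
  (memLp_of_bounded K.isBounded hφ).toLp

theorem sm_ae {φ : Plane → ℝ} (hφ : Continuous φ) :
    ∀ᵐ x ∂volume.restrict K.carrier, K.sm φ hφ x = φ x :=
  MemLp.coeFn_toLp _

theorem inner_sm (u : L2 K.carrier) {φ : Plane → ℝ} (hφ : Continuous φ) :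
    ⟪u, K.sm φ hφ⟫ = ∫ x in K.carrier, u x * φ x := by
  rw [inner_eq_integral]
  refine integral_congr_ae ?_
  filter_upwards [sm_ae hφ] with x hx
  rw [hx]

theorem norm_sm_sq {φ : Plane → ℝ} (hφ : Continuous φ) :
    ‖K.sm φ hφ‖ ^ 2 = ∫ x in K.carrier, φ x ^ 2 := by
  rw [← real_inner_self_eq_norm_sq, inner_sm]
  refine integral_congr_ae ?_
  filter_upwards [sm_ae hφ] with x hx
  rw [hx, sq]

theorem sm_congr {φ ψ : Plane → ℝ} (hφ : Continuous φ) (hψ : Continuous ψ)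
    (h : ∀ x ∈ K.carrier, φ x = ψ x) : K.sm φ hφ = K.sm ψ hψ := by
  refine MemLp.toLp_congr _ _ ?_
  filter_upwards [ae_restrict_mem K.isOpen.measurableSet] with x hx using h x hx

theorem sm_sub {φ ψ : Plane → ℝ} (hφ : Continuous φ) (hψ : Continuous ψ) :
    K.sm (fun x => φ x - ψ x) (hφ.sub hψ) = K.sm φ hφ - K.sm ψ hψ :=
  MemLp.toLp_sub _ _

theorem sm_smul {φ : Plane → ℝ} (hφ : Continuous φ) (c : ℝ) :
    K.sm (fun x => c * φ x) (continuous_const.mul hφ) = c • K.sm φ hφ :=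
  (MemLp.toLp_const_smul c _)

theorem poly_eq_sm (p : MvPolynomial (Fin 2) ℝ) :
    K.poly p = K.sm (fun x => p.eval fun l => x l) (contDiff_eval p).continuous := rfl

theorem hasWeakD_sm {φ : Plane → ℝ} (hφ : ContDiff ℝ ∞ φ) (i : Fin 2) :
    HasWeakD K.carrier i (K.sm φ hφ.continuous) (K.sm (pd i φ) (continuous_pd hφ i)) := by
  intro ψ hψ
  have e1 : ∫ x in K.carrier, K.sm φ hφ.continuous x * pd i ψ x =
      ∫ x in K.carrier, φ x * pd i ψ x :=
    integral_congr_ae (by filter_upwards [sm_ae hφ.continuous] with x hx; rw [hx])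
  have e2 : ∫ x in K.carrier, K.sm (pd i φ) (continuous_pd hφ i) x * ψ x =
      ∫ x in K.carrier, pd i φ x * ψ x :=
    integral_congr_ae (by filter_upwards [sm_ae (continuous_pd hφ i)] with x hx; rw [hx])
  have z1 : ∀ x, x ∉ K.carrier → ψ x = 0 := fun x hx =>
    image_eq_zero_of_notMem_tsupport fun h => hx (hψ.2.2 h)
  have s2 : ∀ x, x ∉ K.carrier → pd i ψ x = 0 := fun x hx => by
    have : x ∉ tsupport (fderiv ℝ ψ) := fun h => hx (hψ.2.2 (tsupport_fderiv_subset ℝ h))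
    simp [pd, image_eq_zero_of_notMem_tsupport this]
  rw [e1, e2, setIntegral_eq_integral_of_forall_compl_eq_zero (fun x hx => by simp [s2 x hx]),
    setIntegral_eq_integral_of_forall_compl_eq_zero (fun x hx => by simp [z1 x hx])]
  have hc := hψ.2.1
  have hcf : HasCompactSupport (pd i ψ) :=
    (hc.fderiv (𝕜 := ℝ)).comp_left
      (g := fun L : Plane →L[ℝ] ℝ => L (EuclideanSpace.single i 1)) rfl
  exact integral_mul_fderiv_eq_neg_fderiv_mul_of_integrable (𝕜 := ℝ) (μ := volume)
    (f := φ) (g := ψ) (v := EuclideanSpace.single i 1)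
    (((continuous_pd hφ i).mul hψ.1.continuous).integrable_of_hasCompactSupport hc.mul_left)
    ((hφ.continuous.mul (continuous_pd hψ.1 i)).integrable_of_hasCompactSupport hcf.mul_left)
    ((hφ.continuous.mul hψ.1.continuous).integrable_of_hasCompactSupport hc.mul_left)
    (fun x _ => hφ.differentiable (by simp) x) (fun x _ => hψ.1.differentiable (by simp) x)

theorem memH1_sm {φ : Plane → ℝ} (hφ : ContDiff ℝ ∞ φ) : MemH1 K.carrier (K.sm φ hφ.continuous) :=
  fun i => ⟨_, hasWeakD_sm hφ i⟩

theorem weakD_sm {φ : Plane → ℝ} (hφ : ContDiff ℝ ∞ φ) (i : Fin 2) :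
    weakD K.carrier i (K.sm φ hφ.continuous) = K.sm (pd i φ) (continuous_pd hφ i) :=
  weakD_eq K.isOpen (hasWeakD_sm hφ i)

theorem memH2_sm {φ : Plane → ℝ} (hφ : ContDiff ℝ ∞ φ) : MemH2 K.carrier (K.sm φ hφ.continuous) :=
  ⟨memH1_sm hφ, fun i => by rw [weakD_sm hφ]; exact memH1_sm (contDiff_pd hφ i)⟩

theorem pd_mul {φ ψ : Plane → ℝ} (hφ : ContDiff ℝ ∞ φ) (hψ : ContDiff ℝ ∞ ψ) (j : Fin 2)
    (x : Plane) : pd j (fun x => φ x * ψ x) x = φ x * pd j ψ x + pd j φ x * ψ x := by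
  unfold pd
  rw [fderiv_fun_mul (hφ.differentiable (by simp) x) (hψ.differentiable (by simp) x)]
  simp [mul_comm]

theorem StarBall.isTrace_sm (hs : K.StarBall x₀ r) {φ : Plane → ℝ} (hφ : ContDiff ℝ ∞ φ) :
    K.IsTrace (K.sm φ hφ.continuous) φ := by
  refine ⟨memH1_sm hφ, memL2Bdry_of_continuous hφ.continuous, fun j ψ hψ => ?_⟩
  have e1 : ∫ x in K.carrier, K.sm φ hφ.continuous x * pd j ψ x =
      ∫ x in K.carrier, φ x * pd j ψ x :=
    integral_congr_ae (by filter_upwards [sm_ae hφ.continuous] with x hx; rw [hx])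
  have e2 : ∫ x in K.carrier, weakD K.carrier j (K.sm φ hφ.continuous) x * ψ x =
      ∫ x in K.carrier, pd j φ x * ψ x := by
    rw [weakD_sm hφ]
    exact integral_congr_ae (by filter_upwards [sm_ae (continuous_pd hφ j)] with x hx; rw [hx])
  have e3 : ∫ x in K.carrier, (φ x * pd j ψ x + pd j φ x * ψ x) =
      (∫ x in K.carrier, φ x * pd j ψ x) + ∫ x in K.carrier, pd j φ x * ψ x := integral_add
    (integrableOn_of_continuous (hφ.continuous.mul (continuous_pd hψ j)))
    (integrableOn_of_continuous ((continuous_pd hφ j).mul hψ.continuous))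
  have := hs.green j (hφ.mul hψ)
  rw [e1, e2, ← e3, ← funext fun x => pd_mul hφ hψ j x]
  simp only [← mul_assoc]
  exact this

theorem StarBall.isH2Trace_sm (hs : K.StarBall x₀ r) {φ : Plane → ℝ} (hφ : ContDiff ℝ ∞ φ) :
    K.IsH2Trace (K.sm φ hφ.continuous) φ (fun i => pd i φ) :=
  ⟨memH2_sm hφ, hφ.continuous.continuousOn, sm_ae _, hs.isTrace_sm hφ, fun i => by
    rw [weakD_sm hφ]; exact hs.isTrace_sm (contDiff_pd hφ i)⟩

/-! ### Traces in `L²` of the edges -/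

/-- Square integrable functions of the edge parameter. -/
abbrev EdgeL2 : Type := Lp ℝ 2 (volume.restrict (Icc (0 : ℝ) 1))

/-- A boundary function on the `i`-th edge. -/
def etr {g : Plane → ℝ} (hg : K.MemL2Bdry g) (i : Fin (K.m + 3)) : EdgeL2 := (hg i).toLp

theorem etr_ae {g : Plane → ℝ} (hg : K.MemL2Bdry g) (i : Fin (K.m + 3)) :
    ∀ᵐ t ∂volume.restrict (Icc (0 : ℝ) 1), etr hg i t = g (K.pt i t) := MemLp.coeFn_toLp _

/-- The trace of a continuous function. -/
abbrev ctr (K : Polygon) {φ : Plane → ℝ} (hφ : Continuous φ) (i : Fin (K.m + 3)) : EdgeL2 :=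
  etr (memL2Bdry_of_continuous hφ) i

theorem edgeInt_eq (i : Fin (K.m + 3)) (f : ℝ → ℝ) :
    K.edgeInt i f = K.len i * ∫ t in Icc (0 : ℝ) 1, f t := by
  rw [edgeInt, intervalIntegral.integral_of_le zero_le_one, integral_Icc_eq_integral_Ioc]

theorem edgeL2_inner (u v : EdgeL2) : ⟪u, v⟫ = ∫ t in Icc (0 : ℝ) 1, u t * v t := by
  rw [L2.inner_def]
  refine integral_congr_ae (Filter.Eventually.of_forall fun x => ?_)
  simp [mul_comm]

theorem edgeInt_mul {g f : Plane → ℝ} (hg : K.MemL2Bdry g) (hf : K.MemL2Bdry f)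
    (i : Fin (K.m + 3)) :
    K.edgeInt i (fun t => g (K.pt i t) * f (K.pt i t)) = K.len i * ⟪etr hg i, etr hf i⟫ := by
  rw [edgeInt_eq, edgeL2_inner]
  congr 1
  refine integral_congr_ae ?_
  filter_upwards [etr_ae hg i, etr_ae hf i] with t h1 h2
  rw [h1, h2]

theorem edgeInt_mul_normal {g f : Plane → ℝ} (hg : K.MemL2Bdry g) (hf : K.MemL2Bdry f)
    (i : Fin (K.m + 3)) (c : ℝ) :
    K.edgeInt i (fun t => g (K.pt i t) * (f (K.pt i t) * c)) =
      K.len i * c * ⟪etr hg i, etr hf i⟫ := by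
  rw [mul_right_comm, ← edgeInt_mul hg hf, mul_comm, ← edgeInt_smul]
  congr 1
  ext t
  ring

theorem IsTrace.green {v : L2 K.carrier} {g : Plane → ℝ} (h : K.IsTrace v g) (j : Fin 2)
    {φ : Plane → ℝ} (hφ : ContDiff ℝ ∞ φ) :
    ⟪v, K.sm (pd j φ) (continuous_pd hφ j)⟫ + ⟪weakD K.carrier j v, K.sm φ hφ.continuous⟫ =
      ∑ i, K.len i * K.normal i j * ⟪etr h.2.1 i, K.ctr hφ.continuous i⟫ := by
  rw [inner_sm, inner_sm, h.2.2 j φ hφ]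
  exact Finset.sum_congr rfl fun i _ => edgeInt_mul_normal _ _ i _

theorem exists_normal_ne (i : Fin (K.m + 3)) : ∃ j, K.normal i j ≠ 0 := by
  by_contra! h
  have := norm_normal_sq (K := K) i
  simp [h 0, h 1] at this

/-- Boundary functions are determined by their moments against smooth functions. -/
theorem edge_unique (δ : Fin (K.m + 3) → EdgeL2)
    (h : ∀ (j : Fin 2) (φ : Plane → ℝ) (hφ : ContDiff ℝ ∞ φ),
      ∑ i, K.len i * K.normal i j * ⟪δ i, K.ctr hφ.continuous i⟫ = 0) (i : Fin (K.m + 3)) :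
    δ i = 0 := by
  -- The moments carry the factor of the normal component, so a direction j in which the normal of
  -- this edge does not vanish is fixed.
  obtain ⟨j, hj⟩ := exists_normal_ne (K := K) i
  have hloc : LocallyIntegrableOn (δ i : ℝ → ℝ) (Ioo (0 : ℝ) 1) (volume.restrict (Icc (0 : ℝ) 1)) :=
    ((Lp.memLp _).locallyIntegrable (by norm_num)).locallyIntegrableOn _
  have key := isOpen_Ioo.ae_eq_zero_of_integral_contDiff_smul_eq_zero hloc (fun g hg hc hsub => by
    set Z : Set Plane := ⋃ l ∈ ({i}ᶜ : Set (Fin (K.m + 3))), K.edge l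
    have hZ : IsClosed Z := by
      refine Set.Finite.isClosed_biUnion (Set.toFinite _) fun l _ => ?_
      rw [edge, segment_eq_image_lineMap]
      exact (isCompact_Icc.image AffineMap.lineMap_continuous).isClosed
    have hC : IsCompact (K.pt i '' tsupport g) := IsCompact.image hc (continuous_pt i)
    have hdisj : Disjoint Z (K.pt i '' tsupport g) := by
      rw [disjoint_right]
      rintro _ ⟨t, ht, rfl⟩ hmem
      simp only [Z, mem_iUnion] at hmem
      obtain ⟨l, hl, hx⟩ := hmem
      rw [edge, segment_eq_image_lineMap] at hx
      obtain ⟨t', ht', e⟩ := hx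
      exact hl (pt_eq_pt (hsub ht) ht' e.symm).1.symm
    -- A smooth cutoff which is one on the image of the support of g and zero on all other edges. It
    -- exists since an inner point of an edge lies on no other edge.
    obtain ⟨θ, hθ0, hθ1, -⟩ := exists_contMDiffMap_zero_one_of_isClosed (n := (⊤ : ℕ∞))
      (modelWithCornersSelf ℝ Plane) hZ hC.isClosed hdisj
    have hθ : ContDiff ℝ ∞ θ := θ.contMDiff.contDiff
    -- The edge parameter, extended to the plane by orthogonal projection. Thus g ∘ τ times θ is a
    -- smooth function on the plane whose trace is g on this edge and zero on the others.
    set τ : Plane → ℝ := fun x => ((x 0 - K.vert i 0) * K.dir i 0 +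
      (x 1 - K.vert i 1) * K.dir i 1) / K.len i ^ 2 with hτ
    have hτc : ContDiff ℝ ∞ τ := by fun_prop
    have hτt : ∀ t, τ (K.pt i t) = t := by
      intro t
      have := (len_pos (K := K) i).ne'
      simp only [hτ, pt_apply]
      rw [div_eq_iff (pow_ne_zero 2 this), len_sq]
      ring
    have hφ : ContDiff ℝ ∞ fun x => g (τ x) * θ x := (hg.comp hτc).mul hθ
    have hsum := h j _ hφ
    have hz : ∀ l, l ≠ i → K.ctr hφ.continuous l = 0 := by
      intro l hl
      rw [Lp.eq_zero_iff_ae_eq_zero]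
      filter_upwards [etr_ae (memL2Bdry_of_continuous (K := K) hφ.continuous) l,
        ae_restrict_mem measurableSet_Icc] with t ht htI
      rw [ht]
      have : K.pt l t ∈ Z := mem_iUnion₂.2 ⟨l, hl, pt_mem_edge l htI⟩
      simp [hθ0 this]
    rw [Finset.sum_eq_single i (fun l _ hl => by rw [hz l hl, inner_zero_right, mul_zero])
      (by simp)] at hsum
    have hne : K.len i * K.normal i j ≠ 0 := mul_ne_zero (len_pos i).ne' hj
    have h0 := (mul_eq_zero.1 hsum).resolve_left hne
    rw [edgeL2_inner] at h0
    refine Eq.trans ?_ h0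
    refine integral_congr_ae ?_
    filter_upwards [etr_ae (memL2Bdry_of_continuous (K := K) hφ.continuous) i] with t ht
    rw [ht, hτt, smul_eq_mul, mul_comm]
    by_cases htg : t ∈ tsupport g
    · rw [hθ1 ⟨t, htg, rfl⟩]
      simp
    · simp [image_eq_zero_of_notMem_tsupport htg])
  rw [Lp.eq_zero_iff_ae_eq_zero]
  have hIoo : ∀ᵐ t ∂volume.restrict (Icc (0 : ℝ) 1), t ∈ Ioo (0 : ℝ) 1 := by
    rw [← restrict_Ioo_eq_restrict_Icc]
    exact ae_restrict_mem measurableSet_Ioo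
  filter_upwards [key, hIoo] with t h1 h2 using h1 h2

/-- The Gauss-Green formula fixes a trace only almost everywhere on each edge, so uniqueness is
expressed through the classes `etr`. -/
theorem IsTrace.unique {v : L2 K.carrier} {g g' : Plane → ℝ} (h : K.IsTrace v g)
    (h' : K.IsTrace v g') (i : Fin (K.m + 3)) : etr h.2.1 i = etr h'.2.1 i := by
  refine sub_eq_zero.1 (edge_unique (K := K) (fun i => etr h.2.1 i - etr h'.2.1 i)
    (fun j φ hφ => ?_) i)
  simp only [inner_sub_left, mul_sub, Finset.sum_sub_distrib]
  rw [← h.green j hφ, ← h'.green j hφ, sub_self]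

theorem dist_le_h {x y : Plane} (hx : x ∈ K.carrier) (hy : y ∈ K.carrier) : dist x y ≤ K.h :=
  Metric.dist_le_diam_of_mem K.isBounded hx hy

theorem cross_dir (i : Fin (K.m + 3)) (a : Plane) :
    cross a (K.dir i) = K.len i * (a 0 * K.normal i 0 + a 1 * K.normal i 1) := by
  rw [cross, ← len_mul_normal_zero, show K.dir i 0 = -(K.len i * K.normal i 1) by
    rw [len_mul_normal_one]; ring]
  ring

/-- The trace inequality for smooth functions. -/
theorem StarBall.trace_ineq_sm (hs : K.StarBall x₀ r) {φ : Plane → ℝ} (hφ : ContDiff ℝ ∞ φ) :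
    r * ∑ i, K.len i * ‖K.ctr hφ.continuous i‖ ^ 2 ≤ 3 * ‖K.sm φ hφ.continuous‖ ^ 2 +
      K.h ^ 2 * ∑ j, ‖K.sm (pd j φ) (continuous_pd hφ j)‖ ^ 2 := by
  have hc : ∀ j : Fin 2, ContDiff ℝ ∞ fun x : Plane => x j - x₀ j := fun j => by fun_prop
  -- The field φ²(x - x₀) enters the Gauss-Green formula. Its normal component on the boundary is at
  -- least r φ² by `StarBall.le_cross`.
  have hψ : ∀ j : Fin 2, ContDiff ℝ ∞ fun x : Plane => φ x * φ x * (x j - x₀ j) :=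
    fun j => (hφ.mul hφ).mul (hc j)
  have hpd : ∀ (j : Fin 2) (x : Plane), pd j (fun x : Plane => φ x * φ x * (x j - x₀ j)) x =
      φ x ^ 2 + 2 * φ x * pd j φ x * (x j - x₀ j) := by
    intro j x
    rw [pd_mul (hφ.mul hφ) (hc j), pd_mul hφ hφ]
    have : pd j (fun x : Plane => x j - x₀ j) x = 1 := by
      unfold pd
      have h1 : HasFDerivAt (fun x : Plane => x j - x₀ j) (EuclideanSpace.proj j : Plane →L[ℝ] ℝ) x :=
        (EuclideanSpace.proj j : Plane →L[ℝ] ℝ).hasFDerivAt.sub_const _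
      rw [h1.fderiv]
      simp
    rw [this]
    ring
  have hbdry : r * ∑ i, K.len i * ‖K.ctr hφ.continuous i‖ ^ 2 ≤
      ∑ j, ∑ i, K.edgeInt i (fun t => (fun x : Plane => φ x * φ x * (x j - x₀ j)) (K.pt i t) *
        K.normal i j) := by
    rw [Finset.sum_comm, Finset.mul_sum]
    refine Finset.sum_le_sum fun i _ => ?_
    rw [← real_inner_self_eq_norm_sq, ← edgeInt_mul, Fin.sum_univ_two]
    have hcp := continuous_pt (K := K) i
    have hcφ := hφ.continuous
    rw [← edgeInt_add (Continuous.intervalIntegrable (by fun_prop) _ _)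
      (Continuous.intervalIntegrable (by fun_prop) _ _), ← edgeInt_smul]
    unfold edgeInt
    refine mul_le_mul_of_nonneg_left (intervalIntegral.integral_mono_on zero_le_one
      (Continuous.intervalIntegrable (by fun_prop) _ _)
      (Continuous.intervalIntegrable (by fun_prop) _ _) fun t _ => ?_) (len_pos i).le
    have h1 := hs.le_cross i
    rw [← cross_pt_sub i t x₀, cross_dir, mul_comm] at h1
    have h2 := le_of_mul_le_mul_left h1 (len_pos i)
    simp only [PiLp.sub_apply] at h2
    nlinarith [mul_le_mul_of_nonneg_right h2 (mul_self_nonneg (φ (K.pt i t)))]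
  refine hbdry.trans ?_
  rw [Finset.sum_congr rfl fun j _ => (hs.green j (hψ j)).symm, Fin.sum_univ_two, Fin.sum_univ_two,
    norm_sm_sq, norm_sm_sq, norm_sm_sq]
  have c0 := continuous_pd hφ 0
  have c1 := continuous_pd hφ 1
  have cφ := hφ.continuous
  rw [← integral_add (integrableOn_of_continuous (continuous_pd (hψ 0) 0))
    (integrableOn_of_continuous (continuous_pd (hψ 1) 1)),
    ← integral_add (integrableOn_of_continuous (by fun_prop))
      (integrableOn_of_continuous (by fun_prop)), ← integral_const_mul, ← integral_const_mul,
    ← integral_add (integrableOn_of_continuous (by fun_prop))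
      (integrableOn_of_continuous (by fun_prop))]
  refine setIntegral_mono_on (integrableOn_of_continuous
    ((continuous_pd (hψ 0) 0).add (continuous_pd (hψ 1) 1)))
    (integrableOn_of_continuous (by fun_prop)) K.isOpen.measurableSet fun x hx => ?_
  rw [hpd, hpd]
  have hd := dist_le_h hx (hs.mem (Metric.mem_ball_self hs.1))
  rw [EuclideanSpace.dist_eq, Fin.sum_univ_two] at hd
  have hd2 : (x 0 - x₀ 0) ^ 2 + (x 1 - x₀ 1) ^ 2 ≤ K.h ^ 2 := by
    have := Real.sqrt_le_left (y := K.h) (Metric.diam_nonneg) |>.1 hd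
    simpa [Real.dist_eq, sq_abs] using this
  set a := pd 0 φ x
  set b := pd 1 φ x
  set p := x 0 - x₀ 0
  set q := x 1 - x₀ 1
  -- The divergence is 2φ² + 2φ ∇φ·(x - x₀). Young's inequality bounds it by 3φ² + (∇φ·(x - x₀))²,
  -- and then the Cauchy-Schwarz inequality and |x - x₀| ≤ h apply.
  nlinarith [sq_nonneg (φ x - (a * p + b * q)), sq_nonneg (a * q - b * p),
    mul_le_mul_of_nonneg_right hd2 (add_nonneg (sq_nonneg a) (sq_nonneg b))]

end Polygon

/-! ### Regularisation by averaged dilations -/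

/-- A smooth probability density supported in a ball. -/
structure Density (x₀ : Plane) (r : ℝ) where
  η : Plane → ℝ
  smooth : ContDiff ℝ ∞ η
  nonneg : ∀ y, 0 ≤ η y
  integral_eq : ∫ y, η y = 1
  support : ∀ y, η y ≠ 0 → y ∈ Metric.closedBall x₀ (r / 2)

theorem exists_density (x₀ : Plane) {r : ℝ} (hr : 0 < r) : Nonempty (Density x₀ r) := by
  let f : ContDiffBump x₀ := ⟨r / 4, r / 2, by positivity, by linarith⟩
  refine ⟨⟨f.normed volume, f.contDiff_normed, f.nonneg_normed, f.integral_normed, fun y hy => ?_⟩⟩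
  have : y ∈ Function.support (f.normed volume) := hy
  rw [f.support_normed_eq] at this
  exact Metric.ball_subset_closedBall this

theorem lintegral_affine {F : Plane → ℝ≥0∞} (hF : Measurable F) {a : ℝ} (ha : a ≠ 0) (b : Plane) :
    ∫⁻ z, F (a • z + b) = ENNReal.ofReal ((a ^ 2)⁻¹) * ∫⁻ z, F z := by
  have h1 : ∫⁻ z, F (a • z + b) = ∫⁻ z, F (z + b) ∂(Measure.map (a • ·) volume) := by
    rw [lintegral_map (by fun_prop) (measurable_const_smul a)]
  rw [h1, Measure.map_addHaar_smul volume ha, lintegral_smul_measure,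
    lintegral_add_right_eq_self (fun z => F z) b]
  simp [abs_of_nonneg (sq_nonneg a)]

/-- The Cauchy-Schwarz inequality after writing k as the product of two square roots. For a
probability density k this is Jensen's inequality. -/
theorem sq_lintegral_mul_le {α : Type*} [MeasurableSpace α] {μ : Measure α} {f k : α → ℝ≥0∞}
    (hf : AEMeasurable f μ) (hk : Measurable k) :
    (∫⁻ z, f z * k z ∂μ) ^ 2 ≤ (∫⁻ z, f z ^ 2 * k z ∂μ) * ∫⁻ z, k z ∂μ := by
  have h := ENNReal.lintegral_mul_le_Lp_mul_Lq μ Real.HolderConjugate.two_two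
    (f := fun z => f z * k z ^ (1 / 2 : ℝ)) (g := fun z => k z ^ (1 / 2 : ℝ))
    (hf.mul (hk.pow_const _).aemeasurable) (hk.pow_const _).aemeasurable
  have hsq : ∀ z, k z ^ (1 / 2 : ℝ) * k z ^ (1 / 2 : ℝ) = k z := fun z => by
    rw [← ENNReal.rpow_add_of_nonneg _ _ (by norm_num) (by norm_num)]; norm_num
  have e1 : ∫⁻ z, ((fun z => f z * k z ^ (1 / 2 : ℝ)) * fun z => k z ^ (1 / 2 : ℝ)) z ∂μ =
      ∫⁻ z, f z * k z ∂μ := by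
    refine lintegral_congr fun z => ?_
    simp only [Pi.mul_apply]
    rw [mul_assoc, hsq]
  have e2 : ∀ z, (f z * k z ^ (1 / 2 : ℝ)) ^ (2 : ℝ) = f z ^ 2 * k z := fun z => by
    rw [ENNReal.rpow_two, mul_pow, sq (k z ^ _), hsq]
  have e3 : ∀ z, (k z ^ (1 / 2 : ℝ)) ^ (2 : ℝ) = k z := fun z => by
    rw [ENNReal.rpow_two, sq, hsq]
  rw [e1] at h
  simp only [e2, e3] at h
  refine (pow_le_pow_left' h 2).trans (le_of_eq ?_)
  rw [mul_pow, ← ENNReal.rpow_two, ← ENNReal.rpow_two, ← ENNReal.rpow_mul, ← ENNReal.rpow_mul]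
  norm_num

namespace Density

variable {x₀ : Plane} {r : ℝ} (B : Density x₀ r)

/-- The averaging kernel: the density of `(1 - e) x + e y`, with `y` distributed by `η`. -/
def ker (e : ℝ) (x z : Plane) : ℝ := (e ^ 2)⁻¹ * B.η (e⁻¹ • (z - (1 - e) • x))

theorem ker_nonneg (e : ℝ) (x z : Plane) : 0 ≤ B.ker e x z :=
  mul_nonneg (by positivity) (B.nonneg _)

theorem contDiff_ker (e : ℝ) (x : Plane) : ContDiff ℝ ∞ (B.ker e x) :=
  contDiff_const.mul (B.smooth.comp (by fun_prop))

theorem continuous_ker (e : ℝ) : Continuous fun p : Plane × Plane => B.ker e p.1 p.2 :=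
  continuous_const.mul (B.smooth.continuous.comp (by fun_prop))

theorem exists_of_ker_ne {e : ℝ} (he : e ≠ 0) {x z : Plane} (h : B.ker e x z ≠ 0) :
    ∃ y ∈ Metric.closedBall x₀ (r / 2), z = (1 - e) • x + e • y := by
  refine ⟨_, B.support _ (right_ne_zero_of_mul h), ?_⟩
  rw [smul_smul, mul_inv_cancel₀ he, one_smul]
  abel

theorem hasCompactSupport_ker {e : ℝ} (he : e ≠ 0) (x : Plane) :
    IsCompact ((fun y => (1 - e) • x + e • y) '' Metric.closedBall x₀ (r / 2)) ∧
    tsupport (B.ker e x) ⊆ (fun y => (1 - e) • x + e • y) '' Metric.closedBall x₀ (r / 2) ∧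
    HasCompactSupport (B.ker e x) := by
  have hc : IsCompact ((fun y => (1 - e) • x + e • y) '' Metric.closedBall x₀ (r / 2)) :=
    (isCompact_closedBall x₀ (r / 2)).image (by fun_prop)
  have hsub : Function.support (B.ker e x) ⊆
      (fun y => (1 - e) • x + e • y) '' Metric.closedBall x₀ (r / 2) := by
    intro z hz
    obtain ⟨y, hy, e⟩ := B.exists_of_ker_ne he hz
    exact ⟨y, hy, e.symm⟩
  exact ⟨hc, closure_minimal hsub hc.isClosed, HasCompactSupport.of_support_subset_isCompact hc hsub⟩

theorem integrable_ker {e : ℝ} (he : e ≠ 0) (x : Plane) : Integrable (B.ker e x) :=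
  (B.contDiff_ker e x).continuous.integrable_of_hasCompactSupport (B.hasCompactSupport_ker he x).2.2

theorem integral_ker {e : ℝ} (he : e ≠ 0) (x : Plane) : ∫ z, B.ker e x z = 1 := by
  unfold ker
  rw [integral_const_mul, integral_sub_right_eq_self (fun z => B.η (e⁻¹ • z)) ((1 - e) • x),
    Measure.integral_comp_inv_smul, B.integral_eq]
  simp [he]

theorem lintegral_ker {e : ℝ} (he : e ≠ 0) (x : Plane) :
    ∫⁻ z, ENNReal.ofReal (B.ker e x z) = 1 := by
  rw [← ofReal_integral_eq_lintegral_ofReal (B.integrable_ker he x)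
    (Filter.Eventually.of_forall (B.ker_nonneg e x)), B.integral_ker he, ENNReal.ofReal_one]

theorem integrable_η : Integrable B.η := by
  have := B.integrable_ker one_ne_zero 0
  have h : B.ker 1 0 = B.η := by ext; simp [ker]
  rwa [h] at this

/-- As a function of z the kernel has mass one. As a function of x its mass is (1 - e)⁻², which is
at most 4 as long as |e| ≤ 1/2. Both signs of e are admitted since both are needed later. -/
theorem lintegral_ker_left {e : ℝ} (he : e ≠ 0) (h2 : |e| ≤ 1 / 2) (z : Plane) :
    ∫⁻ x, ENNReal.ofReal (B.ker e x z) ≤ 4 := by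
  have hle := abs_le.1 h2
  have h1 : (1 - e) ≠ 0 := by linarith
  have ha : -(e⁻¹ * (1 - e)) ≠ 0 := neg_ne_zero.2 (mul_ne_zero (inv_ne_zero he) h1)
  have := lintegral_affine (F := fun y => ENNReal.ofReal ((e ^ 2)⁻¹ * B.η y))
    (by have := B.smooth.continuous.measurable; fun_prop) ha (e⁻¹ • z)
  have e1 : ∀ x, -(e⁻¹ * (1 - e)) • x + e⁻¹ • z = e⁻¹ • (z - (1 - e) • x) := fun x => by module
  simp only [e1] at this
  unfold ker
  rw [this]
  simp only [ENNReal.ofReal_mul (inv_nonneg.2 (sq_nonneg e))]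
  rw [lintegral_const_mul _ (by have := B.smooth.continuous.measurable; fun_prop),
    ← ofReal_integral_eq_lintegral_ofReal B.integrable_η (Filter.Eventually.of_forall B.nonneg),
    B.integral_eq, ENNReal.ofReal_one, mul_one, ← ENNReal.ofReal_mul (by positivity)]
  refine ENNReal.ofReal_le_of_le_toReal ?_
  have : ((-(e⁻¹ * (1 - e))) ^ 2)⁻¹ * (e ^ 2)⁻¹ = ((1 - e) ^ 2)⁻¹ := by
    field_simp
  rw [this]
  have h3 : (1 / 4 : ℝ) ≤ (1 - e) ^ 2 := by nlinarith
  calc ((1 - e) ^ 2)⁻¹ ≤ (1 / 4 : ℝ)⁻¹ := inv_anti₀ (by norm_num) h3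
    _ = _ := by norm_num

/-- The regularisation of a function on the plane. -/
def mol (e : ℝ) (v : Plane → ℝ) (x : Plane) : ℝ := ∫ z, v z * B.ker e x z

/-- The profile of the kernel. -/
def profile (e : ℝ) (u : Plane) : ℝ := (e ^ 2)⁻¹ * B.η (-e⁻¹ • u)

theorem ker_eq_profile (e : ℝ) (x z : Plane) : B.ker e x z = B.profile e ((1 - e) • x - z) := by
  unfold ker profile
  congr 2
  module

theorem contDiff_profile (e : ℝ) : ContDiff ℝ ∞ (B.profile e) :=
  contDiff_const.mul (B.smooth.comp (by fun_prop))

theorem hasCompactSupport_profile {e : ℝ} (he : e ≠ 0) : HasCompactSupport (B.profile e) := by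
  have h := (B.hasCompactSupport_ker he 0).2.2
  have h2 : B.profile e = B.ker e 0 ∘ Homeomorph.neg Plane := by
    ext u
    simp [ker_eq_profile]
  rw [h2]
  exact h.comp_homeomorph _

/-- The kernel depends only on (1 - e)x - z, so the regularisation is an ordinary convolution
followed by a dilation and inherits smoothness and the formula for derivatives. -/
theorem mol_eq_convolution (e : ℝ) (v : Plane → ℝ) (x : Plane) :
    B.mol e v x = convolution v (B.profile e) (ContinuousLinearMap.mul ℝ ℝ) volume ((1 - e) • x) := by
  unfold mol convolution
  simp [ker_eq_profile]

theorem contDiff_mol {e : ℝ} (he : e ≠ 0) {v : Plane → ℝ} (hv : LocallyIntegrable v) :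
    ContDiff ℝ ∞ (B.mol e v) := by
  have h := (B.hasCompactSupport_profile he).contDiff_convolution_right
    (ContinuousLinearMap.mul ℝ ℝ) hv (B.contDiff_profile e)
  have h2 : B.mol e v = (convolution v (B.profile e) (ContinuousLinearMap.mul ℝ ℝ) volume) ∘
      fun x => (1 - e) • x := funext (B.mol_eq_convolution e v)
  rw [h2]
  exact h.comp (by fun_prop)

theorem pd_ker (e : ℝ) (i : Fin 2) (x z : Plane) :
    pd i (B.ker e x) z = - pd i (B.profile e) ((1 - e) • x - z) := by
  have h : B.ker e x = fun z => B.profile e ((1 - e) • x - z) := funext fun z => B.ker_eq_profile e x z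
  have h1 : HasFDerivAt (fun z : Plane => (1 - e) • x - z) (-ContinuousLinearMap.id ℝ Plane) z :=
    (ContinuousLinearMap.id ℝ Plane).hasFDerivAt.const_sub _
  have h2 := (((B.contDiff_profile e).differentiable (by simp)) ((1 - e) • x - z)).hasFDerivAt.comp z h1
  unfold pd
  rw [h, show (fun z => B.profile e ((1 - e) • x - z)) = B.profile e ∘ fun z => (1 - e) • x - z from
    rfl, h2.fderiv]
  simp

/-- A derivative in x falls on the kernel, where it equals -(1 - e) times the derivative in z. This
puts the integral into the form in which a weak derivative of v can be inserted. -/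
theorem pd_mol {e : ℝ} (he : e ≠ 0) {v : Plane → ℝ} (hv : LocallyIntegrable v) (i : Fin 2)
    (x : Plane) : pd i (B.mol e v) x = -((1 - e) * ∫ z, v z * pd i (B.ker e x) z) := by
  have hc := B.hasCompactSupport_profile he
  have h1 := hc.hasFDerivAt_convolution_right (ContinuousLinearMap.mul ℝ ℝ) hv
    ((B.contDiff_profile e).of_le (by exact_mod_cast le_top)) ((1 - e) • x)
  have h2 : HasFDerivAt (fun x : Plane => (1 - e) • x) ((1 - e) • ContinuousLinearMap.id ℝ Plane) x :=
    (ContinuousLinearMap.id ℝ Plane).hasFDerivAt.const_smul (1 - e)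
  have h3 := h1.comp x h2
  have h4 : B.mol e v = (convolution v (B.profile e) (ContinuousLinearMap.mul ℝ ℝ) volume) ∘
      fun x => (1 - e) • x := funext (B.mol_eq_convolution e v)
  rw [pd, h4, h3.fderiv]
  simp only [ContinuousLinearMap.comp_apply, smul_apply, ContinuousLinearMap.id_apply, map_smul,
    smul_eq_mul]
  rw [convolution_precompR_apply _ hv (hc.fderiv ℝ) ((B.contDiff_profile e).continuous_fderiv
    (by simp))]
  unfold convolution
  simp only [pd_ker, ContinuousLinearMap.mul_apply']
  rw [← mul_neg, ← integral_neg]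
  simp [pd]

theorem enorm_mol_sq_le {e : ℝ} (he : e ≠ 0) {v : Plane → ℝ} (hv : AEStronglyMeasurable v)
    (x : Plane) : ‖B.mol e v x‖ₑ ^ 2 ≤ ∫⁻ z, ‖v z‖ₑ ^ 2 * ENNReal.ofReal (B.ker e x z) := by
  have h1 : ‖B.mol e v x‖ₑ ≤ ∫⁻ z, ‖v z‖ₑ * ENNReal.ofReal (B.ker e x z) := by
    refine (enorm_integral_le_lintegral_enorm _).trans (le_of_eq (lintegral_congr fun z => ?_))
    rw [enorm_mul, Real.enorm_of_nonneg (B.ker_nonneg e x z)]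
  refine (pow_le_pow_left' h1 2).trans ?_
  have h2 := sq_lintegral_mul_le (f := fun z => ‖v z‖ₑ)
    (k := fun z => ENNReal.ofReal (B.ker e x z)) hv.enorm
    (by have := (B.contDiff_ker e x).continuous.measurable; fun_prop)
  rwa [B.lintegral_ker he, mul_one] at h2

/-- Schur's test: Jensen's inequality in z uses that the kernel has mass one there, and after
Tonelli's theorem the mass in x is at most 4. -/
theorem lintegral_mol_sq_le {e : ℝ} (he : e ≠ 0) (h2 : |e| ≤ 1 / 2) {v : Plane → ℝ}
    (hv : AEStronglyMeasurable v) : ∫⁻ x, ‖B.mol e v x‖ₑ ^ 2 ≤ 4 * ∫⁻ z, ‖v z‖ₑ ^ 2 := by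
  have hm : Measurable fun p : Plane × Plane => ENNReal.ofReal (B.ker e p.1 p.2) :=
    (B.continuous_ker e).measurable.ennreal_ofReal
  calc ∫⁻ x, ‖B.mol e v x‖ₑ ^ 2
      ≤ ∫⁻ x, ∫⁻ z, ‖v z‖ₑ ^ 2 * ENNReal.ofReal (B.ker e x z) :=
        lintegral_mono fun x => B.enorm_mol_sq_le he hv x
    _ = ∫⁻ z, ∫⁻ x, ‖v z‖ₑ ^ 2 * ENNReal.ofReal (B.ker e x z) := by
        refine lintegral_lintegral_swap ?_
        exact ((hv.enorm.pow_const 2).comp_quasiMeasurePreserving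
          Measure.quasiMeasurePreserving_snd).mul hm.aemeasurable
    _ ≤ ∫⁻ z, 4 * ‖v z‖ₑ ^ 2 := by
        refine lintegral_mono fun z => ?_
        rw [lintegral_const_mul' _ _ (by simp), mul_comm]
        exact mul_le_mul_left (B.lintegral_ker_left he h2 z) _
    _ = _ := lintegral_const_mul' _ _ (by norm_num)

theorem eLpNorm_mol_le {e : ℝ} (he : e ≠ 0) (h2 : |e| ≤ 1 / 2) {v : Plane → ℝ}
    (hv : AEStronglyMeasurable v) : eLpNorm (B.mol e v) 2 volume ≤ 2 * eLpNorm v 2 volume := by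
  rw [eLpNorm_eq_lintegral_rpow_enorm_toReal (by norm_num) (by norm_num),
    eLpNorm_eq_lintegral_rpow_enorm_toReal (by norm_num) (by norm_num)]
  have h := ENNReal.rpow_le_rpow (B.lintegral_mol_sq_le he h2 hv) (z := 1 / 2) (by norm_num)
  rw [ENNReal.mul_rpow_of_nonneg _ _ (by norm_num)] at h
  have h4 : (4 : ℝ≥0∞) ^ (1 / 2 : ℝ) = 2 := by
    rw [show (4 : ℝ≥0∞) = 2 ^ (2 : ℝ) by norm_num, ← ENNReal.rpow_mul]
    norm_num
  rw [h4] at h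
  simpa using h

theorem integrable_mul_ker {e : ℝ} (he : e ≠ 0) {v : Plane → ℝ} (hv : LocallyIntegrable v)
    (x : Plane) : Integrable fun z => v z * B.ker e x z := by
  have := hv.integrable_smul_left_of_hasCompactSupport (B.contDiff_ker e x).continuous
    (B.hasCompactSupport_ker he x).2.2
  simpa [mul_comm] using this

theorem abs_mol_sub_le {e : ℝ} (he : e ≠ 0) {v : Plane → ℝ} (hv : LocallyIntegrable v) (x : Plane)
    {a δ : ℝ} (h : ∀ᵐ z, B.ker e x z ≠ 0 → |v z - a| ≤ δ) : |B.mol e v x - a| ≤ δ := by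
  have e1 : B.mol e v x - a = ∫ z, (v z - a) * B.ker e x z := by
    simp only [sub_mul]
    rw [integral_sub (B.integrable_mul_ker he hv x) ((B.integrable_ker he x).const_mul a),
      integral_const_mul, B.integral_ker he, mul_one]
    rfl
  have e2 : δ = ∫ z, δ * B.ker e x z := by rw [integral_const_mul, B.integral_ker he, mul_one]
  rw [e1, e2, ← Real.norm_eq_abs]
  refine norm_integral_le_of_norm_le ((B.integrable_ker he x).const_mul δ) ?_
  filter_upwards [h] with z hz
  rw [norm_mul, Real.norm_of_nonneg (B.ker_nonneg e x z), Real.norm_eq_abs]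
  by_cases h0 : B.ker e x z = 0
  · simp [h0]
  · exact mul_le_mul_of_nonneg_right (hz h0) (B.ker_nonneg e x z)

theorem mol_sub {e : ℝ} (he : e ≠ 0) {v w : Plane → ℝ} (hv : LocallyIntegrable v)
    (hw : LocallyIntegrable w) (x : Plane) :
    B.mol e (v - w) x = B.mol e v x - B.mol e w x := by
  unfold mol
  rw [← integral_sub (B.integrable_mul_ker he hv x) (B.integrable_mul_ker he hw x)]
  simp [sub_mul]

/-- The regularisations converge in `L²` on bounded sets. -/
theorem tendsto_mol {e : ℕ → ℝ} (he : ∀ n, e n ≠ 0) (h2 : ∀ n, |e n| ≤ 1 / 2)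
    (h0 : Filter.Tendsto e Filter.atTop (𝓝 0)) {v : Plane → ℝ} (hv : MemLp v 2 volume)
    {U : Set Plane} (hU : Bornology.IsBounded U) (hUm : MeasurableSet U) :
    Filter.Tendsto (fun n => eLpNorm (B.mol (e n) v - v) 2 (volume.restrict U)) Filter.atTop
      (𝓝 0) := by
  have hfin : volume U < (⊤ : ℝ≥0∞) := hU.measure_lt_top
  rw [ENNReal.tendsto_atTop_zero]
  intro ε hε
  -- The factor 4 is spent as 2 + 1 + 1: the regularisation of v - f costs its operator norm 2, the
  -- two other errors cost one each.
  obtain ⟨ε', hε', hle⟩ : ∃ ε' : ℝ≥0, 0 < ε' ∧ (4 : ℝ≥0∞) * ε' ≤ ε := by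
    obtain ⟨q, hq, hq2⟩ := ENNReal.lt_iff_exists_nnreal_btwn.1 hε
    refine ⟨q / 4, by have := ENNReal.coe_pos.1 hq; positivity, ?_⟩
    rw [ENNReal.coe_div (by norm_num)]
    refine (ENNReal.mul_div_le).trans hq2.le
  have hε0 : (ε' : ℝ≥0∞) ≠ 0 := by simpa using hε'.ne'
  obtain ⟨f, hfc, hfv, hcont, hfL⟩ := hv.exists_hasCompactSupport_eLpNorm_sub_le (by norm_num) hε0
  have hvl : LocallyIntegrable v := hv.locallyIntegrable (by norm_num)
  have hfl : LocallyIntegrable f := hcont.locallyIntegrable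
  -- uniform smallness of `mol f - f` on `U`
  obtain ⟨δ, hδ, hδle⟩ : ∃ δ : ℝ, 0 < δ ∧
      (volume.restrict U univ) ^ ((2 : ℝ≥0∞).toReal)⁻¹ * ENNReal.ofReal δ ≤ ε' := by
    rw [Measure.restrict_apply_univ]
    have hne : volume U ^ ((2 : ℝ≥0∞).toReal)⁻¹ ≠ (⊤ : ℝ≥0∞) :=
      ENNReal.rpow_ne_top_of_nonneg (by positivity) hfin.ne
    lift volume U ^ ((2 : ℝ≥0∞).toReal)⁻¹ to ℝ≥0 using hne with c
    refine ⟨ε' / (c + 1), by positivity, ?_⟩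
    rw [← ENNReal.ofReal_coe_nnreal, ← ENNReal.ofReal_mul (NNReal.coe_nonneg c), ← ENNReal.ofReal_coe_nnreal (p := ε')]
    refine ENNReal.ofReal_le_ofReal ?_
    rw [mul_div_assoc', div_le_iff₀ (by positivity)]
    nlinarith [c.2, ε'.2, NNReal.coe_nonneg c, NNReal.coe_nonneg ε']
  have huc := hfc.uniformContinuous_of_continuous hcont
  obtain ⟨τ, hτ, hτf⟩ := Metric.uniformContinuous_iff.1 huc δ hδ
  obtain ⟨R, hR⟩ := (hU.union (Metric.isBounded_closedBall (x := x₀) (r := r / 2))).subset_closedBall 0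
  have hR0 : 0 < |R| + 1 := by positivity
  obtain ⟨N, hN⟩ := (Metric.tendsto_atTop.1 h0) (τ / (2 * (|R| + 1))) (by positivity)
  refine ⟨N, fun n hn => ?_⟩
  have hen : |e n| < τ / (2 * (|R| + 1)) := by simpa [Real.dist_eq] using hN n hn
  have hmid : ∀ x ∈ U, |B.mol (e n) f x - f x| ≤ δ := by
    intro x hx
    refine B.abs_mol_sub_le (he n) hfl x (Filter.Eventually.of_forall fun z hz => ?_)
    obtain ⟨y, hy, rfl⟩ := B.exists_of_ker_ne (he n) hz
    have hd : dist ((1 - e n) • x + e n • y) x < τ := by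
      rw [dist_eq_norm, show (1 - e n) • x + e n • y - x = e n • (y - x) by module, norm_smul,
        Real.norm_eq_abs]
      have hx' : ‖x‖ ≤ R := by simpa using hR (Or.inl hx)
      have hy' : ‖y‖ ≤ R := by simpa using hR (Or.inr hy)
      have : ‖y - x‖ ≤ 2 * (|R| + 1) := (norm_sub_le _ _).trans (by linarith [le_abs_self R])
      calc |e n| * ‖y - x‖ ≤ |e n| * (2 * (|R| + 1)) := by gcongr
        _ < τ / (2 * (|R| + 1)) * (2 * (|R| + 1)) := by gcongr
        _ = τ := by field_simp
    have := hτf hd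
    rw [Real.dist_eq] at this
    exact this.le
  have hmeas : AEStronglyMeasurable (B.mol (e n) f - f) (volume.restrict U) :=
    ((B.contDiff_mol (he n) hfl).continuous.sub hcont).aestronglyMeasurable
  have b1 : eLpNorm (B.mol (e n) (v - f)) 2 (volume.restrict U) ≤ 2 * ε' :=
    (eLpNorm_mono_measure _ Measure.restrict_le_self).trans
      ((B.eLpNorm_mol_le (he n) (h2 n) (hv.1.sub hcont.aestronglyMeasurable)).trans (by gcongr))
  have b2 : eLpNorm (B.mol (e n) f - f) 2 (volume.restrict U) ≤ ε' := by
    refine (eLpNorm_le_of_ae_bound (C := δ) ?_).trans hδle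
    exact ae_restrict_of_forall_mem hUm hmid
  have b3 : eLpNorm (f - v) 2 (volume.restrict U) ≤ ε' := by
    rw [eLpNorm_sub_comm]
    exact (eLpNorm_mono_measure _ Measure.restrict_le_self).trans hfv
  -- The density argument: f is continuous with compact support and close to v in L². It is
  -- uniformly continuous, and on U the kernel averages over points at a distance proportional to |e
  -- n|.
  have hdec : B.mol (e n) v - v = B.mol (e n) (v - f) + ((B.mol (e n) f - f) + (f - v)) := by
    ext x
    simp only [Pi.sub_apply, Pi.add_apply, B.mol_sub (he n) hvl hfl]
    ring
  have hmol : AEStronglyMeasurable (B.mol (e n) (v - f)) (volume.restrict U) :=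
    (B.contDiff_mol (he n) (hvl.sub hfl)).continuous.aestronglyMeasurable
  have hfv' : AEStronglyMeasurable (f - v) (volume.restrict U) :=
    (hcont.aestronglyMeasurable.sub hv.1).mono_measure Measure.restrict_le_self
  rw [hdec]
  refine (eLpNorm_add_le hmol (hmeas.add hfv') (by norm_num)).trans ?_
  refine (add_le_add b1 ((eLpNorm_add_le hmeas hfv' (by norm_num)).trans (add_le_add b2 b3))).trans ?_
  refine le_trans (le_of_eq ?_) hle
  ring

end Density

/-! ### Smooth approximation on star-shaped polygons -/

namespace Polygon

variable {K : Polygon} {x₀ : Plane} {r : ℝ}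

/-- The regularisation of an element of `L²(K)`, extended by zero. -/
def mo (B : Density x₀ r) (e : ℝ) (v : L2 K.carrier) : Plane → ℝ :=
  B.mol e (K.carrier.indicator v)

theorem memLp_indicator (v : L2 K.carrier) : MemLp (K.carrier.indicator v) 2 volume :=
  (memLp_indicator_iff_restrict K.isOpen.measurableSet).2 (Lp.memLp v)

theorem locInt_indicator (v : L2 K.carrier) : LocallyIntegrable (K.carrier.indicator v) :=
  (memLp_indicator v).locallyIntegrable (by norm_num)

theorem integral_indicator_mul (v : L2 K.carrier) (k : Plane → ℝ) :
    ∫ z, K.carrier.indicator v z * k z = ∫ z in K.carrier, v z * k z := by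
  rw [← integral_indicator K.isOpen.measurableSet]
  refine integral_congr_ae (Filter.Eventually.of_forall fun z => ?_)
  by_cases hz : z ∈ K.carrier <;> simp [hz]

theorem mo_eq (B : Density x₀ r) (e : ℝ) (v : L2 K.carrier) (x : Plane) :
    mo B e v x = ∫ z in K.carrier, v z * B.ker e x z := integral_indicator_mul v _

theorem contDiff_mo (B : Density x₀ r) {e : ℝ} (he : e ≠ 0) (v : L2 K.carrier) :
    ContDiff ℝ ∞ (mo B e v) := B.contDiff_mol he (locInt_indicator v)

theorem tendsto_mo (B : Density x₀ r) {e : ℕ → ℝ} (he : ∀ n, e n ≠ 0) (h2 : ∀ n, |e n| ≤ 1 / 2)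
    (h0 : Filter.Tendsto e Filter.atTop (𝓝 0)) (v : L2 K.carrier) :
    Filter.Tendsto (fun n => K.sm (mo B (e n) v) (contDiff_mo B (he n) v).continuous)
      Filter.atTop (𝓝 v) := by
  have h := B.tendsto_mol he h2 h0 (memLp_indicator v) K.isBounded K.isOpen.measurableSet
  rw [Lp.tendsto_Lp_iff_tendsto_eLpNorm']
  refine h.congr fun n => eLpNorm_congr_ae ?_
  filter_upwards [sm_ae (contDiff_mo B (he n) v).continuous,
    ae_restrict_mem K.isOpen.measurableSet] with x h1 h2
  rw [Pi.sub_apply, Pi.sub_apply, h1, indicator_of_mem h2, mo]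

/-- Regularisation commutes with differentiation up to the factor 1 - e whenever integration by
parts against the kernel leaves no boundary term. This happens in two situations: the kernel is a
test function, or the trace of v vanishes. -/
theorem pd_mo_of_zero (B : Density x₀ r) {e : ℝ} (he : e ≠ 0) {v w : L2 K.carrier} {i : Fin 2}
    (x : Plane) (h : ∫ z in K.carrier, v z * pd i (B.ker e x) z =
      -∫ z in K.carrier, w z * B.ker e x z) : pd i (mo B e v) x = (1 - e) * mo B e w x := by
  unfold mo
  rw [B.pd_mol he (locInt_indicator v), integral_indicator_mul, h]
  change _ = (1 - e) * mo B e w x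
  rw [mo_eq]
  ring

/-- For e > 0 the kernel lives on proper convex combinations of x with points of the ball, which lie
in the open polygon even when x is a boundary point. Hence no boundary values of v are involved. -/
theorem StarBall.isTest_ker (hs : K.StarBall x₀ r) (B : Density x₀ r) {e : ℝ} (he : 0 < e)
    (he1 : e ≤ 1) {x : Plane} (hx : x ∈ closure K.carrier) : IsTest K.carrier (B.ker e x) := by
  obtain ⟨-, h2, h3⟩ := B.hasCompactSupport_ker he.ne' x
  refine ⟨B.contDiff_ker e x, h3, h2.trans ?_⟩
  rintro _ ⟨y, hy, rfl⟩
  exact hs.mem_combo (Metric.closedBall_subset_ball (by linarith [hs.1]) hy) hx he he1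

theorem StarBall.pd_mo (hs : K.StarBall x₀ r) (B : Density x₀ r) {e : ℝ} (he : 0 < e) (he1 : e ≤ 1)
    {v w : L2 K.carrier} {i : Fin 2} (h : HasWeakD K.carrier i v w) {x : Plane}
    (hx : x ∈ closure K.carrier) : pd i (mo B e v) x = (1 - e) * mo B e w x :=
  pd_mo_of_zero B he.ne' x (h _ (hs.isTest_ker B he he1 hx))

/-- For e < 0 the dilation is reversed: if z = (1 - e)x + ey then x is the convex combination of z
and y with weight -e/(1 - e) at y. If z is in the closed polygon and y in the ball, x therefore
stays in a compact subset of the open polygon. -/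
theorem StarBall.isTest_mo (hs : K.StarBall x₀ r) (B : Density x₀ r) {e : ℝ} (he : e < 0)
    (v : L2 K.carrier) : IsTest K.carrier (mo B e v) := by
  have h1 : 0 < 1 - e := by linarith
  set C : Set Plane := (fun p : Plane × Plane => (1 - -e / (1 - e)) • p.1 + (-e / (1 - e)) • p.2) ''
    (closure K.carrier ×ˢ Metric.closedBall x₀ (r / 2))
  have hC : IsCompact C :=
    (K.isBounded.isCompact_closure.prod (isCompact_closedBall x₀ (r / 2))).image (by fun_prop)
  have hCK : C ⊆ K.carrier := by
    rintro _ ⟨⟨z, y⟩, ⟨hz, hy⟩, rfl⟩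
    exact hs.mem_combo (Metric.closedBall_subset_ball (by linarith [hs.1]) hy) hz
      (div_pos (by linarith) h1) (by rw [div_le_one h1]; linarith)
  have hsupp : Function.support (mo B e v) ⊆ C := by
    intro x hx
    by_contra hn
    refine hx ?_
    rw [mo_eq]
    refine setIntegral_eq_zero_of_forall_eq_zero fun z hz => ?_
    by_contra hne
    obtain ⟨y, hy, rfl⟩ := B.exists_of_ker_ne he.ne (right_ne_zero_of_mul hne)
    refine hn ⟨⟨_, y⟩, ⟨subset_closure hz, hy⟩, ?_⟩
    simp only [smul_add, smul_smul]
    have e1 : (1 - -e / (1 - e)) * (1 - e) = 1 := by field_simp; ring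
    have e2 : (1 - -e / (1 - e)) * e + -e / (1 - e) = 0 := by field_simp; ring
    rw [e1, one_smul, add_assoc, ← add_smul, e2, zero_smul, add_zero]
  refine ⟨contDiff_mo B he.ne v, HasCompactSupport.of_support_subset_isCompact hC hsupp, ?_⟩
  exact (closure_minimal hsupp hC.isClosed).trans hCK

/-- A sequence of dilation parameters. -/
def eps (n : ℕ) : ℝ := 1 / ((n : ℝ) + 2)

theorem eps_pos (n : ℕ) : 0 < eps n := by unfold eps; positivity

theorem eps_le (n : ℕ) : eps n ≤ 1 / 2 := by
  unfold eps
  gcongr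
  linarith [Nat.cast_nonneg (α := ℝ) n]

theorem tendsto_eps : Filter.Tendsto eps Filter.atTop (𝓝 0) := by
  have := (tendsto_one_div_add_atTop_nhds_zero_nat (𝕜 := ℝ)).comp (Filter.tendsto_add_atTop_nat 1)
  refine this.congr fun n => ?_
  simp only [Function.comp, eps]
  push_cast
  ring

theorem StarBall.tendsto_pd_mo (hs : K.StarBall x₀ r) (B : Density x₀ r)
    {v w : L2 K.carrier} {i : Fin 2} (h : HasWeakD K.carrier i v w) :
    Filter.Tendsto (fun n => K.sm (pd i (mo B (eps n) v))
      (continuous_pd (contDiff_mo B (eps_pos n).ne' v) i)) Filter.atTop (𝓝 w) := by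
  have h1 : Filter.Tendsto (fun n => (1 - eps n) • K.sm (mo B (eps n) w)
      (contDiff_mo B (eps_pos n).ne' w).continuous) Filter.atTop (𝓝 ((1 - 0 : ℝ) • w)) :=
    (tendsto_const_nhds.sub tendsto_eps).smul (tendsto_mo B (fun n => (eps_pos n).ne')
      (fun n => by rw [abs_of_pos (eps_pos n)]; exact eps_le n) tendsto_eps w)
  rw [sub_zero, one_smul] at h1
  refine h1.congr fun n => ?_
  rw [← sm_smul]
  refine sm_congr _ _ fun x hx => ?_
  exact (hs.pd_mo B (eps_pos n) ((eps_le n).trans (by norm_num)) h (subset_closure hx)).symm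

theorem pd_congr_of_mem {φ ψ : Plane → ℝ} (h : ∀ x ∈ K.carrier, φ x = ψ x) (i : Fin 2) {x : Plane}
    (hx : x ∈ K.carrier) : pd i φ x = pd i ψ x := by
  have : φ =ᶠ[𝓝 x] ψ := by
    filter_upwards [K.isOpen.mem_nhds hx] with y hy using h y hy
  unfold pd
  rw [this.fderiv_eq]

/-- On the polygon the first derivative of the regularisation is, up to a factor tending to one, the
regularisation of the weak derivative. The first-order result is applied to the latter. -/
theorem StarBall.tendsto_pd_pd_mo (hs : K.StarBall x₀ r) (B : Density x₀ r)
    {v w z : L2 K.carrier} {i j : Fin 2} (h : HasWeakD K.carrier i v w)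
    (h' : HasWeakD K.carrier j w z) :
    Filter.Tendsto (fun n => K.sm (pd j (pd i (mo B (eps n) v)))
      (continuous_pd (contDiff_pd (contDiff_mo B (eps_pos n).ne' v) i) j)) Filter.atTop (𝓝 z) := by
  have h1 := (tendsto_const_nhds (x := (1 : ℝ)).sub tendsto_eps).smul (hs.tendsto_pd_mo B h')
  rw [sub_zero, one_smul] at h1
  refine h1.congr fun n => ?_
  rw [← sm_smul]
  refine sm_congr _ _ fun x hx => ?_
  have hc : ContDiff ℝ ∞ (mo B (eps n) w) := contDiff_mo B (eps_pos n).ne' w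
  have e1 : pd j (fun x => (1 - eps n) * mo B (eps n) w x) x =
      (1 - eps n) * pd j (mo B (eps n) w) x := by
    unfold pd
    rw [fderiv_const_mul (hc.differentiable (by simp) x)]
    simp
  rw [← e1]
  exact pd_congr_of_mem (fun y hy => (hs.pd_mo B (eps_pos n) ((eps_le n).trans (by norm_num)) h
    (subset_closure hy)).symm) j hx

/-- The kernel at x averages over points of the polygon within distance eps n times R of x, so
continuity up to the boundary suffices. Pointwise convergence is needed at the vertices, which no L²
statement can see. -/
theorem StarBall.tendsto_mo_point (hs : K.StarBall x₀ r) (B : Density x₀ r) {v : L2 K.carrier}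
    {w : Plane → ℝ} (hw : ContinuousOn w (closure K.carrier))
    (hv : ∀ᵐ x ∂volume.restrict K.carrier, v x = w x) {x : Plane} (hx : x ∈ closure K.carrier) :
    Filter.Tendsto (fun n => mo B (eps n) v x) Filter.atTop (𝓝 (w x)) := by
  rw [Metric.tendsto_atTop]
  intro δ hδ
  obtain ⟨τ, hτ, hτw⟩ := Metric.continuousWithinAt_iff.1 (hw x hx) (δ / 2) (by positivity)
  set R := dist x x₀ + r
  have hR : 0 < R := add_pos_of_nonneg_of_pos dist_nonneg hs.1
  obtain ⟨N, hN⟩ := (Metric.tendsto_atTop.1 tendsto_eps) (τ / R) (by positivity)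
  refine ⟨N, fun n hn => ?_⟩
  have hen : eps n < τ / R := by
    have := hN n hn
    rwa [Real.dist_eq, sub_zero, abs_of_pos (eps_pos n)] at this
  refine lt_of_le_of_lt ?_ (half_lt_self hδ)
  rw [Real.dist_eq]
  refine B.abs_mol_sub_le (eps_pos n).ne' (locInt_indicator v) x ?_
  rw [ae_restrict_iff' K.isOpen.measurableSet] at hv
  filter_upwards [hv] with z hz hne
  obtain ⟨y, hy, e⟩ := B.exists_of_ker_ne (eps_pos n).ne' hne
  have hzK : z ∈ K.carrier := e ▸ hs.mem_combo (Metric.closedBall_subset_ball (by linarith [hs.1]) hy)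
    hx (eps_pos n) ((eps_le n).trans (by norm_num))
  rw [indicator_of_mem hzK, hz hzK, ← Real.dist_eq]
  refine (hτw (subset_closure hzK) ?_).le
  rw [e, dist_eq_norm, show (1 - eps n) • x + eps n • y - x = eps n • (y - x) by module, norm_smul,
    Real.norm_of_nonneg (eps_pos n).le, ← dist_eq_norm]
  have : dist y x ≤ R := by
    have h1 := dist_triangle y x₀ x
    have h2 : dist y x₀ ≤ r / 2 := hy
    rw [dist_comm x₀ x] at h1
    have := hs.1
    simp only [R]
    linarith
  calc eps n * dist y x ≤ eps n * R := by gcongr; exact (eps_pos n).le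
    _ < τ / R * R := by gcongr
    _ = τ := by field_simp

/-- Functions of `H¹(K)` are limits of smooth functions. -/
theorem StarBall.exists_approx_H1 (hs : K.StarBall x₀ r) {v : L2 K.carrier}
    (hv : MemH1 K.carrier v) : ∃ (Φ : ℕ → Plane → ℝ) (hΦ : ∀ n, ContDiff ℝ ∞ (Φ n)),
      Filter.Tendsto (fun n => K.sm (Φ n) (hΦ n).continuous) Filter.atTop (𝓝 v) ∧
      ∀ i, Filter.Tendsto (fun n => K.sm (pd i (Φ n)) (continuous_pd (hΦ n) i)) Filter.atTop
        (𝓝 (weakD K.carrier i v)) := by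
  obtain ⟨B⟩ := exists_density x₀ hs.1
  exact ⟨fun n => mo B (eps n) v, fun n => contDiff_mo B (eps_pos n).ne' v,
    tendsto_mo B (fun n => (eps_pos n).ne')
      (fun n => by rw [abs_of_pos (eps_pos n)]; exact eps_le n) tendsto_eps v,
    fun i => hs.tendsto_pd_mo B (weakD_spec hv i)⟩

/-- Functions of `H²(K)` are limits of smooth functions, also pointwise. -/
theorem StarBall.exists_approx_H2 (hs : K.StarBall x₀ r) {v : L2 K.carrier} {w : Plane → ℝ}
    {G : Fin 2 → Plane → ℝ} (hv : K.IsH2Trace v w G) :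
    ∃ (Φ : ℕ → Plane → ℝ) (hΦ : ∀ n, ContDiff ℝ ∞ (Φ n)),
      Filter.Tendsto (fun n => K.sm (Φ n) (hΦ n).continuous) Filter.atTop (𝓝 v) ∧
      (∀ i, Filter.Tendsto (fun n => K.sm (pd i (Φ n)) (continuous_pd (hΦ n) i)) Filter.atTop
        (𝓝 (weakD K.carrier i v))) ∧
      (∀ i j, Filter.Tendsto (fun n => K.sm (pd j (pd i (Φ n)))
        (continuous_pd (contDiff_pd (hΦ n) i) j)) Filter.atTop
        (𝓝 (weakD K.carrier j (weakD K.carrier i v)))) ∧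
      ∀ x ∈ closure K.carrier, Filter.Tendsto (fun n => Φ n x) Filter.atTop (𝓝 (w x)) := by
  obtain ⟨B⟩ := exists_density x₀ hs.1
  exact ⟨fun n => mo B (eps n) v, fun n => contDiff_mo B (eps_pos n).ne' v,
    tendsto_mo B (fun n => (eps_pos n).ne')
      (fun n => by rw [abs_of_pos (eps_pos n)]; exact eps_le n) tendsto_eps v,
    fun i => hs.tendsto_pd_mo B (weakD_spec hv.1.1 i),
    fun i j => hs.tendsto_pd_pd_mo B (weakD_spec hv.1.1 i) (weakD_spec (hv.1.2 i) j),
    fun x hx => hs.tendsto_mo_point B hv.2.1 hv.2.2.1 hx⟩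

/-! ### Traces of functions of `H¹(K)` -/

theorem ctr_sub {φ ψ : Plane → ℝ} (hφ : Continuous φ) (hψ : Continuous ψ) (i : Fin (K.m + 3)) :
    K.ctr (hφ.sub hψ) i = K.ctr hφ i - K.ctr hψ i := MemLp.toLp_sub _ _

/-- The trace of the limit is the limit of the traces. -/
theorem StarBall.tendsto_ctr (hs : K.StarBall x₀ r) {v : L2 K.carrier} {g : Plane → ℝ}
    (h : K.IsTrace v g) {Φ : ℕ → Plane → ℝ} (hΦ : ∀ n, ContDiff ℝ ∞ (Φ n))
    (h0 : Filter.Tendsto (fun n => K.sm (Φ n) (hΦ n).continuous) Filter.atTop (𝓝 v))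
    (h1 : ∀ i, Filter.Tendsto (fun n => K.sm (pd i (Φ n)) (continuous_pd (hΦ n) i)) Filter.atTop
        (𝓝 (weakD K.carrier i v))) (i : Fin (K.m + 3)) :
    Filter.Tendsto (fun n => K.ctr (hΦ n).continuous i) Filter.atTop (𝓝 (etr h.2.1 i)) := by
  have hcau : ∀ i, CauchySeq fun n => K.ctr (hΦ n).continuous i := by
    intro i
    have c0 := h0.cauchySeq
    have c1 := fun i => (h1 i).cauchySeq
    rw [Metric.cauchySeq_iff'] 
    intro ε hε
    have hl := len_pos (K := K) i
    have hr := hs.1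
    -- Chosen so that the right-hand side of the trace inequality for Φ n - Φ m, at most (3 +
    -- 2h²)δ², equals r · len · ε²/4.
    set δ := ε * √(r * K.len i / (3 + 2 * K.h ^ 2)) / 2 with hδ_def
    have hq : 0 < r * K.len i / (3 + 2 * K.h ^ 2) := by positivity
    have hδ : 0 < δ := by positivity
    obtain ⟨N0, hN0⟩ := Metric.cauchySeq_iff.1 c0 δ hδ
    obtain ⟨N1, hN1⟩ := Metric.cauchySeq_iff.1 (c1 0) δ hδ
    obtain ⟨N2, hN2⟩ := Metric.cauchySeq_iff.1 (c1 1) δ hδ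
    refine ⟨max N0 (max N1 N2), fun n hn => ?_⟩
    set m := max N0 (max N1 N2)
    have m0 : N0 ≤ m := le_max_left _ _
    have m1 : N1 ≤ m := (le_max_left _ _).trans (le_max_right _ _)
    have m2 : N2 ≤ m := (le_max_right _ _).trans (le_max_right _ _)
    have a0 := hN0 n (m0.trans hn) m m0
    have a1 := hN1 n (m1.trans hn) m m1
    have a2 := hN2 n (m2.trans hn) m m2
    have key := hs.trace_ineq_sm ((hΦ n).sub (hΦ m))
    have hpd : ∀ j, K.sm (pd j (fun x => Φ n x - Φ m x)) (continuous_pd ((hΦ n).sub (hΦ m)) j) =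
        K.sm (pd j (Φ n)) (continuous_pd (hΦ n) j) - K.sm (pd j (Φ m)) (continuous_pd (hΦ m) j) := by
      intro j
      rw [← sm_sub]
      refine sm_congr _ _ fun x _ => ?_
      unfold pd
      rw [fderiv_fun_sub ((hΦ n).differentiable (by simp) x) ((hΦ m).differentiable (by simp) x)]
      rfl
    rw [Fin.sum_univ_two, hpd, hpd, sm_sub (hΦ n).continuous (hΦ m).continuous] at key
    simp only [dist_eq_norm] at a0 a1 a2 ⊢
    have b0 := pow_le_pow_left₀ (norm_nonneg _) a0.le 2
    have b1 := pow_le_pow_left₀ (norm_nonneg _) a1.le 2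
    have b2 := pow_le_pow_left₀ (norm_nonneg _) a2.le 2
    have hsingle : K.len i * ‖K.ctr (hΦ n).continuous i - K.ctr (hΦ m).continuous i‖ ^ 2 ≤
        ∑ l, K.len l * ‖K.ctr ((hΦ n).continuous.sub (hΦ m).continuous) l‖ ^ 2 := by
      rw [← ctr_sub]
      exact Finset.single_le_sum (f := fun l => K.len l *
        ‖K.ctr ((hΦ n).continuous.sub (hΦ m).continuous) l‖ ^ 2)
        (fun l _ => mul_nonneg (len_pos l).le (sq_nonneg _)) (Finset.mem_univ i)
    have hfin : r * (K.len i * ‖K.ctr (hΦ n).continuous i - K.ctr (hΦ m).continuous i‖ ^ 2) ≤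
        3 * δ ^ 2 + K.h ^ 2 * (δ ^ 2 + δ ^ 2) :=
      (mul_le_mul_of_nonneg_left hsingle hr.le).trans (key.trans (by gcongr))
    have hδ2 : δ ^ 2 * (3 + 2 * K.h ^ 2) = ε ^ 2 / 4 * (r * K.len i) := by
      rw [hδ_def, div_pow, mul_pow, Real.sq_sqrt hq.le]
      field_simp
      ring
    have h3 : (r * K.len i) * ‖K.ctr (hΦ n).continuous i - K.ctr (hΦ m).continuous i‖ ^ 2 ≤
        (r * K.len i) * (ε ^ 2 / 4) := by nlinarith
    have h4 := le_of_mul_le_mul_left h3 (by positivity)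
    exact lt_of_pow_lt_pow_left₀ 2 hε.le (lt_of_le_of_lt h4 (by nlinarith [sq_pos_of_pos hε]))
  choose γ hγ using fun i => cauchySeq_tendsto_of_complete (hcau i)
  -- The limits of the traces satisfy the same Gauss-Green formula as g, and `edge_unique`
  -- identifies them.
  have heq : ∀ i, γ i - etr h.2.1 i = 0 := by
    refine edge_unique (K := K) (fun i => γ i - etr h.2.1 i) fun j φ hφ => ?_
    simp only [inner_sub_left, mul_sub, Finset.sum_sub_distrib]
    rw [← h.green j hφ, sub_eq_zero]
    have t1 : Filter.Tendsto (fun n => ∑ i, K.len i * K.normal i j *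
        ⟪K.ctr (hΦ n).continuous i, K.ctr hφ.continuous i⟫) Filter.atTop
        (𝓝 (∑ i, K.len i * K.normal i j * ⟪γ i, K.ctr hφ.continuous i⟫)) :=
      tendsto_finsetSum _ fun i _ => ((hγ i).inner tendsto_const_nhds).const_mul _
    have t2 : Filter.Tendsto (fun n => ⟪K.sm (Φ n) (hΦ n).continuous,
          K.sm (pd j φ) (continuous_pd hφ j)⟫ +
        ⟪K.sm (pd j (Φ n)) (continuous_pd (hΦ n) j), K.sm φ hφ.continuous⟫) Filter.atTop
        (𝓝 (⟪v, K.sm (pd j φ) (continuous_pd hφ j)⟫ +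
          ⟪weakD K.carrier j v, K.sm φ hφ.continuous⟫)) :=
      (h0.inner tendsto_const_nhds).add ((h1 j).inner tendsto_const_nhds)
    refine tendsto_nhds_unique t1 (t2.congr fun n => ?_)
    have := (hs.isTrace_sm (hΦ n)).green j hφ
    rw [weakD_sm (hΦ n)] at this
    exact this
  rw [← sub_eq_zero.1 (heq i)]
  exact hγ i

/-- The definition of a trace only allows smooth second factors. Density of smooth functions,
together with convergence of their traces, extends the formula to two functions of H¹. -/
theorem StarBall.green_H1 (hs : K.StarBall x₀ r) {v u : L2 K.carrier} {g f : Plane → ℝ}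
    (h : K.IsTrace v g) (h' : K.IsTrace u f) (j : Fin 2) :
    ⟪v, weakD K.carrier j u⟫ + ⟪weakD K.carrier j v, u⟫ =
      ∑ i, K.len i * K.normal i j * ⟪etr h.2.1 i, etr h'.2.1 i⟫ := by
  obtain ⟨Φ, hΦ, h0, h1⟩ := hs.exists_approx_H1 h'.1
  have h2 := hs.tendsto_ctr h' hΦ h0 h1
  refine tendsto_nhds_unique
    (((tendsto_const_nhds (x := v)).inner (h1 j)).add
      ((tendsto_const_nhds (x := weakD K.carrier j v)).inner h0))
    (Filter.Tendsto.congr (fun n => (h.green j (hΦ n)).symm)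
      (tendsto_finsetSum _ fun i _ => ((tendsto_const_nhds.inner (h2 i)).const_mul _)))

theorem gradForm_self {U : Set Plane} (v : L2 U) : gradForm U v v = ∑ i, ‖weakD U i v‖ ^ 2 := by
  unfold gradForm
  exact Finset.sum_congr rfl fun i _ => real_inner_self_eq_norm_sq _

/-- The trace inequality. -/
theorem StarBall.trace_ineq (hs : K.StarBall x₀ r) {v : L2 K.carrier} {g : Plane → ℝ}
    (h : K.IsTrace v g) : r * ∑ i, K.len i * ‖etr h.2.1 i‖ ^ 2 ≤ 3 * ‖v‖ ^ 2 +
      K.h ^ 2 * gradForm K.carrier v v := by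
  obtain ⟨Φ, hΦ, h0, h1⟩ := hs.exists_approx_H1 h.1
  have h2 := hs.tendsto_ctr h hΦ h0 h1
  rw [gradForm_self]
  refine le_of_tendsto_of_tendsto'
    ((tendsto_finsetSum _ fun i _ => (((h2 i).norm.pow 2).const_mul (K.len i))).const_mul r)
    (((h0.norm.pow 2).const_mul 3).add
      ((tendsto_finsetSum _ fun j _ => ((h1 j).norm.pow 2)).const_mul (K.h ^ 2)))
    fun n => hs.trace_ineq_sm (hΦ n)

end Polygon

/-! ### The Poincaré inequality -/

theorem fderiv_eq_pd (φ : Plane → ℝ) (x u : Plane) :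
    fderiv ℝ φ x u = u 0 * pd 0 φ x + u 1 * pd 1 φ x := by
  have : u = u 0 • EuclideanSpace.single 0 1 + u 1 • EuclideanSpace.single 1 1 := by
    ext j; fin_cases j <;> simp
  conv_lhs => rw [this]
  simp [pd]

/-- The squared length of the gradient. -/
def gradSq (φ : Plane → ℝ) (x : Plane) : ℝ := pd 0 φ x ^ 2 + pd 1 φ x ^ 2

theorem fderiv_sq_le (φ : Plane → ℝ) (x u : Plane) :
    (fderiv ℝ φ x u) ^ 2 ≤ ‖u‖ ^ 2 * gradSq φ x := by
  rw [fderiv_eq_pd, EuclideanSpace.norm_sq_eq, Fin.sum_univ_two, gradSq]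
  simp only [Real.norm_eq_abs, sq_abs]
  nlinarith [sq_nonneg (u 0 * pd 1 φ x - u 1 * pd 0 φ x)]

/-- Difference of values in terms of the gradient on the joining segment. -/
theorem sq_sub_le_lintegral {φ : Plane → ℝ} (hφ : ContDiff ℝ ∞ φ) (x y : Plane) :
    ENNReal.ofReal ((φ x - φ y) ^ 2) ≤ ENNReal.ofReal (dist x y ^ 2) *
      ∫⁻ s in Icc (0 : ℝ) 1, ENNReal.ofReal (gradSq φ (y + s • (x - y))) := by
  set d : ℝ → ℝ := fun s => fderiv ℝ φ (y + s • (x - y)) (x - y) with hd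
  have hdc : Continuous d :=
    ((hφ.continuous_fderiv (by simp)).comp (by fun_prop)).clm_apply continuous_const
  have hder : ∀ s, HasDerivAt (fun s : ℝ => φ (y + s • (x - y))) (d s) s := by
    intro s
    have h1 : HasDerivAt (fun s : ℝ => y + s • (x - y)) ((1 : ℝ) • (x - y)) s :=
      ((hasDerivAt_id s).smul_const (x - y)).const_add y
    rw [one_smul] at h1
    exact ((hφ.differentiable (by simp) _).hasFDerivAt).comp_hasDerivAt s h1
  have hftc : ∫ s in Icc (0 : ℝ) 1, d s = φ x - φ y := by
    rw [integral_Icc_eq_integral_Ioc, ← intervalIntegral.integral_of_le zero_le_one,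
      intervalIntegral.integral_eq_sub_of_hasDerivAt (fun s _ => hder s)
        (hdc.intervalIntegrable _ _)]
    simp
  have h1 : ‖φ x - φ y‖ₑ ^ 2 ≤ ∫⁻ s in Icc (0 : ℝ) 1, ‖d s‖ₑ ^ 2 := by
    rw [← hftc]
    refine (pow_le_pow_left' (enorm_integral_le_lintegral_enorm _) 2).trans ?_
    have := sq_lintegral_mul_le (μ := volume.restrict (Icc (0 : ℝ) 1)) (f := fun s => ‖d s‖ₑ)
      (k := fun _ => 1) hdc.measurable.enorm.aemeasurable measurable_const
    simpa using this
  have e1 : ∀ q : ℝ, ‖q‖ₑ ^ 2 = ENNReal.ofReal (q ^ 2) := fun q => by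
    rw [← ofReal_norm, ← ENNReal.ofReal_pow (norm_nonneg _), Real.norm_eq_abs, sq_abs]
  simp only [e1] at h1
  refine h1.trans ?_
  rw [← lintegral_const_mul' _ _ ENNReal.ofReal_ne_top]
  refine lintegral_mono fun s => ?_
  rw [← ENNReal.ofReal_mul (by positivity)]
  refine ENNReal.ofReal_le_ofReal ?_
  rw [dist_eq_norm]
  exact fderiv_sq_le _ _ _

namespace Polygon

variable {K : Polygon} {x₀ : Plane} {r : ℝ}

theorem h_nonneg : 0 ≤ K.h := Metric.diam_nonneg

theorem continuous_gradSq {φ : Plane → ℝ} (hφ : ContDiff ℝ ∞ φ) : Continuous (gradSq φ) :=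
  ((continuous_pd hφ 0).pow 2).add ((continuous_pd hφ 1).pow 2)

/-- The point y + s(x - y) is an affine function of x with Jacobian s² and of y with Jacobian (1 -
s)². One of the two is at least 1/4, and the change of variables is made in that variable. This
avoids the singularity at either end of the segment. -/
theorem StarBall.lintegral_dilation_le (hs : K.StarBall x₀ r) {F : Plane → ℝ≥0∞}
    (hF : Measurable F) {s : ℝ} (h1 : s ≤ 1) :
    ∫⁻ y in Metric.ball x₀ r, ∫⁻ x in K.carrier, F (y + s • (x - y)) ≤
      4 * volume K.carrier * ∫⁻ z, F z := by
  have hsub : Metric.ball x₀ r ⊆ K.carrier := fun y hy => hs.mem hy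
  rcases le_total (1 / 2) s with hs2 | hs2
  · have hne : s ≠ 0 := by linarith
    calc ∫⁻ y in Metric.ball x₀ r, ∫⁻ x in K.carrier, F (y + s • (x - y))
        ≤ ∫⁻ y in Metric.ball x₀ r, 4 * ∫⁻ z, F z := by
          refine lintegral_mono fun y => ?_
          refine (lintegral_mono' Measure.restrict_le_self le_rfl).trans ?_
          have e : ∀ x : Plane, y + s • (x - y) = s • x + (1 - s) • y := fun x => by module
          simp only [e]
          rw [lintegral_affine hF hne]
          refine mul_le_mul_left (ENNReal.ofReal_le_of_le_toReal ?_) _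
          calc (s ^ 2)⁻¹ ≤ (1 / 4 : ℝ)⁻¹ := inv_anti₀ (by norm_num) (by nlinarith)
            _ = _ := by norm_num
      _ = 4 * volume (Metric.ball x₀ r) * ∫⁻ z, F z := by
          rw [lintegral_const, Measure.restrict_apply_univ]; ring
      _ ≤ _ := by gcongr
  · have hne : 1 - s ≠ 0 := by linarith
    have hm : Measurable fun p : Plane × Plane => F (p.1 + s • (p.2 - p.1)) :=
      hF.comp (by fun_prop)
    rw [lintegral_lintegral_swap hm.aemeasurable]
    calc ∫⁻ x in K.carrier, ∫⁻ y in Metric.ball x₀ r, F (y + s • (x - y))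
        ≤ ∫⁻ x in K.carrier, 4 * ∫⁻ z, F z := by
          refine lintegral_mono fun x => ?_
          refine (lintegral_mono' Measure.restrict_le_self le_rfl).trans ?_
          have e : ∀ y : Plane, y + s • (x - y) = (1 - s) • y + s • x := fun y => by module
          simp only [e]
          rw [lintegral_affine hF hne]
          refine mul_le_mul_left (ENNReal.ofReal_le_of_le_toReal ?_) _
          calc ((1 - s) ^ 2)⁻¹ ≤ (1 / 4 : ℝ)⁻¹ := inv_anti₀ (by norm_num) (by nlinarith)
            _ = _ := by norm_num
      _ = _ := by rw [lintegral_const, Measure.restrict_apply_univ]; ring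

theorem StarBall.volume_le (hs : K.StarBall x₀ r) :
    volume K.carrier ≤ ENNReal.ofReal (K.h ^ 2 / r ^ 2) * volume (Metric.ball x₀ r) := by
  have hsub : K.carrier ⊆ Metric.closedBall x₀ K.h := fun x hx =>
    dist_le_h hx (hs.mem (Metric.mem_ball_self hs.1))
  refine (measure_mono hsub).trans (le_of_eq ?_)
  rw [Measure.addHaar_closedBall _ _ h_nonneg, Measure.addHaar_ball_of_pos _ _ hs.1, ← mul_assoc,
    ← ENNReal.ofReal_mul (by positivity), finrank_euclideanSpace_fin, div_mul_cancel₀]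
  exact pow_ne_zero 2 hs.1.ne'

/-- The differences φ(x) - φ(y), with y in the ball, are integrals of the gradient along segments
inside the polygon. Integrating over x and y bounds the average over y of ∫(φ - φ(y))², and some y
does not exceed the average. The constant is φ at that point. -/
theorem StarBall.poincare_sm (hs : K.StarBall x₀ r) {φ : Plane → ℝ} (hφ : ContDiff ℝ ∞ φ) :
    ∃ c : ℝ, ∫ x in K.carrier, (φ x - c) ^ 2 ≤
      4 * K.h ^ 4 / r ^ 2 * ∫ x in K.carrier, gradSq φ x := by
  have hsub : Metric.ball x₀ r ⊆ K.carrier := fun y hy => hs.mem hy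
  set F : Plane → ℝ≥0∞ := K.carrier.indicator fun z => ENNReal.ofReal (gradSq φ z) with hF_def
  have hgm : Measurable fun z => ENNReal.ofReal (gradSq φ z) :=
    (continuous_gradSq hφ).measurable.ennreal_ofReal
  have hF : Measurable F := hgm.indicator K.isOpen.measurableSet
  have hFint : ∫⁻ z, F z = ENNReal.ofReal (∫ x in K.carrier, gradSq φ x) := by
    rw [lintegral_indicator K.isOpen.measurableSet, ofReal_integral_eq_lintegral_ofReal
      (integrableOn_of_continuous (continuous_gradSq hφ))
      (Filter.Eventually.of_forall fun x => add_nonneg (sq_nonneg _) (sq_nonneg _))]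
  have hcc := hφ.continuous
  set I : Plane → ℝ≥0∞ := fun y => ∫⁻ x in K.carrier, ENNReal.ofReal ((φ x - φ y) ^ 2) with hI
  have hIm : Measurable I := by
    have : Measurable fun p : Plane × Plane => ENNReal.ofReal ((φ p.2 - φ p.1) ^ 2) :=
      (by fun_prop : Continuous fun p : Plane × Plane => (φ p.2 - φ p.1) ^ 2).measurable.ennreal_ofReal
    exact this.lintegral_prod_right'
  have hpt : ∀ y ∈ Metric.ball x₀ r, I y ≤ ENNReal.ofReal (K.h ^ 2) *
      ∫⁻ s in Icc (0 : ℝ) 1, ∫⁻ x in K.carrier, F (y + s • (x - y)) := by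
    intro y hy
    have hm : Measurable fun p : ℝ × Plane => F (y + p.1 • (p.2 - y)) := hF.comp (by fun_prop)
    rw [lintegral_lintegral_swap hm.aemeasurable, ← lintegral_const_mul' _ _ ENNReal.ofReal_ne_top]
    refine setLIntegral_mono' K.isOpen.measurableSet fun x hx => ?_
    refine (sq_sub_le_lintegral hφ x y).trans ?_
    have hd := dist_le_h hx (hsub hy)
    refine mul_le_mul' (ENNReal.ofReal_le_ofReal (by gcongr)) (le_of_eq ?_)
    refine setLIntegral_congr_fun measurableSet_Icc fun s hsI => ?_
    have : y + s • (x - y) ∈ K.carrier := by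
      have := hs.2 y hy hx (sub_nonneg.2 hsI.2) hsI.1 (by ring)
      convert this using 1
      module
    simp [hF_def, this]
  have hIint : ∫⁻ y in Metric.ball x₀ r, I y ≤
      ENNReal.ofReal (K.h ^ 2) * (4 * volume K.carrier * ∫⁻ z, F z) := by
    have hm : Measurable fun q : (Plane × ℝ) × Plane => F (q.1.1 + q.1.2 • (q.2 - q.1.1)) :=
      hF.comp (by fun_prop)
    have hm2 : Measurable fun p : Plane × ℝ => ∫⁻ x in K.carrier, F (p.1 + p.2 • (x - p.1)) :=
      hm.lintegral_prod_right'
    calc ∫⁻ y in Metric.ball x₀ r, I y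
        ≤ ∫⁻ y in Metric.ball x₀ r, ENNReal.ofReal (K.h ^ 2) *
            ∫⁻ s in Icc (0 : ℝ) 1, ∫⁻ x in K.carrier, F (y + s • (x - y)) :=
          setLIntegral_mono' Metric.isOpen_ball.measurableSet hpt
      _ = ENNReal.ofReal (K.h ^ 2) * ∫⁻ s in Icc (0 : ℝ) 1, ∫⁻ y in Metric.ball x₀ r,
            ∫⁻ x in K.carrier, F (y + s • (x - y)) := by
          rw [lintegral_const_mul' _ _ ENNReal.ofReal_ne_top,
            lintegral_lintegral_swap hm2.aemeasurable]
      _ ≤ ENNReal.ofReal (K.h ^ 2) * ∫⁻ s in Icc (0 : ℝ) 1, 4 * volume K.carrier * ∫⁻ z, F z := by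
          exact mul_le_mul' le_rfl (setLIntegral_mono' measurableSet_Icc fun s hsI =>
            hs.lintegral_dilation_le hF hsI.2)
      _ = _ := by simp
  have hb0 : volume (Metric.ball x₀ r) ≠ 0 := (Metric.measure_ball_pos volume x₀ hs.1).ne'
  have hbt : volume (Metric.ball x₀ r) ≠ (⊤ : ℝ≥0∞) := measure_ball_lt_top.ne
  obtain ⟨y, -, hyle⟩ := exists_le_setLAverage hb0 hbt hIm.aemeasurable
  refine ⟨φ y, ?_⟩
  rw [setLAverage_eq] at hyle
  have hfin : I y ≤ ENNReal.ofReal (4 * K.h ^ 4 / r ^ 2 * ∫ x in K.carrier, gradSq φ x) := by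
    refine hyle.trans (ENNReal.div_le_of_le_mul (hIint.trans ?_))
    rw [hFint]
    -- One factor h² comes from the squared length of the segments, the factor h²/r² from comparing
    -- the areas of polygon and ball, and 4 from the Jacobian.
    calc ENNReal.ofReal (K.h ^ 2) * (4 * volume K.carrier *
          ENNReal.ofReal (∫ x in K.carrier, gradSq φ x))
        ≤ ENNReal.ofReal (K.h ^ 2) * (4 * (ENNReal.ofReal (K.h ^ 2 / r ^ 2) *
          volume (Metric.ball x₀ r)) * ENNReal.ofReal (∫ x in K.carrier, gradSq φ x)) := by
          gcongr; exact hs.volume_le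
      _ = (ENNReal.ofReal (K.h ^ 2) * ENNReal.ofReal 4 * ENNReal.ofReal (K.h ^ 2 / r ^ 2)) *
          ENNReal.ofReal (∫ x in K.carrier, gradSq φ x) * volume (Metric.ball x₀ r) := by
          rw [show ENNReal.ofReal 4 = 4 by norm_num]; ring
      _ = _ := by
          rw [← ENNReal.ofReal_mul (by positivity), ← ENNReal.ofReal_mul (by positivity),
            ← ENNReal.ofReal_mul (by positivity)]
          congr 3
          ring
  have hI' : I y = ENNReal.ofReal (∫ x in K.carrier, (φ x - φ y) ^ 2) := by
    rw [hI, ofReal_integral_eq_lintegral_ofReal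
      (integrableOn_of_continuous (by fun_prop))
      (Filter.Eventually.of_forall fun x => sq_nonneg _)]
  rw [hI'] at hfin
  refine (ENNReal.ofReal_le_ofReal_iff ?_).1 hfin
  have : 0 ≤ ∫ x in K.carrier, gradSq φ x :=
    integral_nonneg fun x => add_nonneg (sq_nonneg _) (sq_nonneg _)
  positivity

theorem sm_const_mem (c : ℝ) : K.sm (fun _ => c) continuous_const ∈ K.polySpace 0 := by
  refine ⟨MvPolynomial.C c, ?_, ?_⟩
  · rw [SetLike.mem_coe, MvPolynomial.mem_restrictTotalDegree]
    simp
  · rw [poly_eq_sm]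
    exact sm_congr _ _ fun x _ => by simp

theorem exists_of_mem_polySpace_zero {u : L2 K.carrier} (hu : u ∈ K.polySpace 0) :
    ∃ c : ℝ, u = K.sm (fun _ => c) continuous_const := by
  obtain ⟨p, hp, rfl⟩ := hu
  rw [SetLike.mem_coe, MvPolynomial.mem_restrictTotalDegree, Nat.le_zero,
    MvPolynomial.totalDegree_eq_zero_iff_eq_C] at hp
  refine ⟨MvPolynomial.coeff 0 p, ?_⟩
  rw [poly_eq_sm]
  refine sm_congr _ _ fun x _ => ?_
  conv_lhs => rw [hp]
  simp

theorem norm_sub_proj_le {k : ℕ} (u : L2 K.carrier) {w : L2 K.carrier} (hw : w ∈ K.polySpace k) :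
    ‖u - K.proj k u‖ ≤ ‖u - w‖ := by
  rw [proj, Submodule.starProjection_minimal]
  exact ciInf_le ⟨0, by rintro _ ⟨x, rfl⟩; exact norm_nonneg _⟩ (⟨w, hw⟩ : K.polySpace k)

/-- The Poincaré inequality. -/
theorem StarBall.poincare (hs : K.StarBall x₀ r) {v : L2 K.carrier} (hv : MemH1 K.carrier v) :
    ‖v - K.proj 0 v‖ ^ 2 ≤ 4 * K.h ^ 4 / r ^ 2 * gradForm K.carrier v v := by
  obtain ⟨Φ, hΦ, h0, h1⟩ := hs.exists_approx_H1 hv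
  rw [gradForm_self]
  refine le_of_tendsto_of_tendsto' ((h0.sub (((K.proj 0).continuous.tendsto v).comp h0)).norm.pow 2)
    ((tendsto_finsetSum _ fun j _ => ((h1 j).norm.pow 2)).const_mul _) fun n => ?_
  obtain ⟨c, hc⟩ := hs.poincare_sm (hΦ n)
  -- The constant depends on n. By best approximation it is exchanged for the L² projection onto
  -- constants, which is continuous and passes to the limit.
  refine (pow_le_pow_left₀ (norm_nonneg _) (norm_sub_proj_le _ (sm_const_mem c)) 2).trans ?_
  rw [← sm_sub (hΦ n).continuous continuous_const, norm_sm_sq]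
  refine hc.trans (le_of_eq ?_)
  congr 1
  rw [Fin.sum_univ_two, norm_sm_sq, norm_sm_sq]
  exact integral_add (integrableOn_of_continuous ((continuous_pd (hΦ n) 0).pow 2))
    (integrableOn_of_continuous ((continuous_pd (hΦ n) 1).pow 2))

end Polygon

/-! ### Edge estimates and the cellwise interpolation inequality -/

theorem sq_integral_le {g : ℝ → ℝ} (hg : Continuous g) {a b : ℝ} (ha : 0 ≤ a) (hab : a ≤ b)
    (hb : b ≤ 1) : (∫ t in a..b, g t) ^ 2 ≤ ∫ t in (0 : ℝ)..1, g t ^ 2 := by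
  set s := ∫ t in a..b, g t with hs
  -- Expanding this integral gives (2 - (b - a))s² ≤ ∫g² over the interval, and its length is at
  -- most one.
  have h1 : 0 ≤ ∫ t in a..b, (g t - s) ^ 2 :=
    intervalIntegral.integral_nonneg hab fun t _ => sq_nonneg _
  have e : ∫ t in a..b, (g t - s) ^ 2 =
      (∫ t in a..b, g t ^ 2) - 2 * s * s + (b - a) * s ^ 2 := by
    have e1 : ∀ t, (g t - s) ^ 2 = (g t ^ 2 - 2 * s * g t) + s ^ 2 := fun t => by ring
    simp only [e1]
    have c1 : Continuous fun t => g t ^ 2 := by fun_prop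
    have c2 : Continuous fun t => 2 * s * g t := by fun_prop
    have c3 : Continuous fun t => g t ^ 2 - 2 * s * g t := by fun_prop
    rw [intervalIntegral.integral_add (c3.intervalIntegrable _ _)
      (continuous_const.intervalIntegrable _ _), intervalIntegral.integral_sub
      (c1.intervalIntegrable _ _) (c2.intervalIntegrable _ _),
      intervalIntegral.integral_const_mul, intervalIntegral.integral_const, smul_eq_mul]
  have h2 : ∫ t in a..b, g t ^ 2 ≤ ∫ t in (0 : ℝ)..1, g t ^ 2 :=
    intervalIntegral.integral_mono_interval ha hab hb
      (Filter.Eventually.of_forall fun t => sq_nonneg _)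
      ((hg.pow 2).intervalIntegrable _ _)
  nlinarith [sq_nonneg s]

namespace Polygon

variable {K : Polygon} {x₀ : Plane} {r : ℝ}

theorem len_le_h (i : Fin (K.m + 3)) : K.len i ≤ K.h := by
  unfold h
  rw [← Metric.diam_closure]
  exact Metric.dist_le_diam_of_mem K.isBounded.closure
    (frontier_subset_closure (vert_mem_frontier i))
    (frontier_subset_closure (vert_mem_frontier (i + 1)))

theorem h_pos : 0 < K.h := (len_pos 0).trans_le (len_le_h 0)

theorem ctr_ae {φ : Plane → ℝ} (hφ : Continuous φ) (i : Fin (K.m + 3)) :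
    ∀ᵐ t ∂volume.restrict (Icc (0 : ℝ) 1), K.ctr hφ i t = φ (K.pt i t) := etr_ae _ i

/-- The constant function one on the reference edge. -/
def edgeOne : EdgeL2 := (memLp_const (1 : ℝ)).toLp

theorem edgeOne_ae : ∀ᵐ t ∂volume.restrict (Icc (0 : ℝ) 1), edgeOne t = 1 :=
  MemLp.coeFn_toLp _

theorem norm_edgeOne : ‖edgeOne‖ = 1 := by
  have : ‖edgeOne‖ ^ 2 = 1 := by
    rw [← real_inner_self_eq_norm_sq, edgeL2_inner]
    have : ∫ t in Icc (0 : ℝ) 1, edgeOne t * edgeOne t = ∫ t in Icc (0 : ℝ) 1, (1 : ℝ) :=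
      integral_congr_ae (by filter_upwards [edgeOne_ae] with t ht; rw [ht, one_mul])
    rw [this]; simp
  nlinarith [norm_nonneg edgeOne]

/-- Tangential derivative along an edge (with respect to the parameter). -/
theorem hasDerivAt_pt {φ : Plane → ℝ} (hφ : ContDiff ℝ ∞ φ) (i : Fin (K.m + 3)) (t : ℝ) :
    HasDerivAt (fun t => φ (K.pt i t)) (∑ j, K.dir i j * pd j φ (K.pt i t)) t := by
  have h1 : HasDerivAt (K.pt i) (K.dir i) t := by
    have : HasDerivAt (fun t : ℝ => K.vert i + t • K.dir i) ((1 : ℝ) • K.dir i) t :=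
      ((hasDerivAt_id t).smul_const (K.dir i)).const_add _
    rw [one_smul] at this
    exact this.congr_of_eventuallyEq (Filter.Eventually.of_forall fun t => pt_eq i t)
  have := ((hφ.differentiable (by simp) (K.pt i t)).hasFDerivAt).comp_hasDerivAt t h1
  rw [fderiv_eq_pd] at this
  rwa [Fin.sum_univ_two]

/-- The mean value of `φ` at the end points of an edge. -/
def endMean (K : Polygon) (φ : Plane → ℝ) (i : Fin (K.m + 3)) : ℝ :=
  (φ (K.vert i) + φ (K.vert (i + 1))) / 2

theorem sum_smul_ctr_ae {φ : Plane → ℝ} (hφ : ContDiff ℝ ∞ φ) (i : Fin (K.m + 3)) (a : Fin 2 → ℝ) :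
    ∀ᵐ t ∂volume.restrict (Icc (0 : ℝ) 1),
      (∑ j, a j • K.ctr (continuous_pd hφ j) i) t = ∑ j, a j * pd j φ (K.pt i t) := by
  rw [Fin.sum_univ_two]
  filter_upwards [Lp.coeFn_add (a 0 • K.ctr (continuous_pd hφ 0) i)
    (a 1 • K.ctr (continuous_pd hφ 1) i), Lp.coeFn_smul (a 0) (K.ctr (continuous_pd hφ 0) i),
    Lp.coeFn_smul (a 1) (K.ctr (continuous_pd hφ 1) i), ctr_ae (continuous_pd hφ 0) i,
    ctr_ae (continuous_pd hφ 1) i] with t h1 h2 h3 h4 h5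
  rw [h1, Pi.add_apply, h2, h3, Pi.smul_apply, Pi.smul_apply, h4, h5, Fin.sum_univ_two]
  rfl

theorem sub_const_ae (u : EdgeL2) (m : ℝ) :
    ∀ᵐ t ∂volume.restrict (Icc (0 : ℝ) 1), (u - m • edgeOne) t = u t - m := by
  filter_upwards [Lp.coeFn_sub u (m • edgeOne), Lp.coeFn_smul m edgeOne, edgeOne_ae]
    with t h1 h2 h3
  rw [h1, Pi.sub_apply, h2, Pi.smul_apply, h3, smul_eq_mul, mul_one]

theorem continuous_sum_pd_pt {φ : Plane → ℝ} (hφ : ContDiff ℝ ∞ φ) (i : Fin (K.m + 3))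
    (a : Fin 2 → ℝ) : Continuous fun t => ∑ j, a j * pd j φ (K.pt i t) :=
  continuous_finsetSum _ fun j _ =>
    continuous_const.mul ((continuous_pd hφ j).comp (continuous_pt i))

/-- The deviation from the mean of the end values is the mean of the deviations from either end
value, and each of these is an integral of the tangential derivative. -/
theorem norm_sub_endMean_le {φ : Plane → ℝ} (hφ : ContDiff ℝ ∞ φ) (i : Fin (K.m + 3)) :
    ‖K.ctr hφ.continuous i - K.endMean φ i • edgeOne‖ ≤
      ‖∑ j, K.dir i j • K.ctr (continuous_pd hφ j) i‖ := by
  refine le_of_sq_le_sq ?_ (norm_nonneg _)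
  rw [← real_inner_self_eq_norm_sq, ← real_inner_self_eq_norm_sq, edgeL2_inner, edgeL2_inner]
  set d : ℝ → ℝ := fun t => ∑ j, K.dir i j * pd j φ (K.pt i t) with hd
  have hdc : Continuous d := continuous_sum_pd_pt hφ i _
  have e2 : ∫ t in Icc (0 : ℝ) 1, (∑ j, K.dir i j • K.ctr (continuous_pd hφ j) i : EdgeL2) t *
      (∑ j, K.dir i j • K.ctr (continuous_pd hφ j) i : EdgeL2) t = ∫ t in (0 : ℝ)..1, d t ^ 2 := by
    rw [intervalIntegral.integral_of_le zero_le_one, ← integral_Icc_eq_integral_Ioc]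
    refine integral_congr_ae ?_
    filter_upwards [sum_smul_ctr_ae hφ i (fun j => K.dir i j)] with t ht
    rw [ht, ← sq]
  have e1 : ∫ t in Icc (0 : ℝ) 1, (K.ctr hφ.continuous i - K.endMean φ i • edgeOne : EdgeL2) t *
      (K.ctr hφ.continuous i - K.endMean φ i • edgeOne : EdgeL2) t =
      ∫ t in Icc (0 : ℝ) 1, (φ (K.pt i t) - K.endMean φ i) ^ 2 := by
    refine integral_congr_ae ?_
    filter_upwards [sub_const_ae (K.ctr hφ.continuous i) (K.endMean φ i),
      ctr_ae hφ.continuous i] with t ht ht'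
    rw [ht, ht', ← sq]
  rw [e1, e2]
  set X := ∫ t in (0 : ℝ)..1, d t ^ 2 with hX
  have hpt : ∀ t ∈ Icc (0 : ℝ) 1, (φ (K.pt i t) - K.endMean φ i) ^ 2 ≤ X := by
    intro t ht
    have a1 : (φ (K.pt i t) - φ (K.vert i)) ^ 2 ≤ X := by
      have := sq_integral_le hdc le_rfl ht.1 ht.2
      rwa [intervalIntegral.integral_eq_sub_of_hasDerivAt (fun s _ => hasDerivAt_pt hφ i s)
        (hdc.intervalIntegrable _ _), pt_zero] at this
    have a2 : (φ (K.vert (i + 1)) - φ (K.pt i t)) ^ 2 ≤ X := by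
      have := sq_integral_le hdc ht.1 ht.2 le_rfl
      rwa [intervalIntegral.integral_eq_sub_of_hasDerivAt (fun s _ => hasDerivAt_pt hφ i s)
        (hdc.intervalIntegrable _ _), pt_one] at this
    unfold endMean
    nlinarith [sq_nonneg (φ (K.pt i t) - φ (K.vert i) + (φ (K.vert (i + 1)) - φ (K.pt i t)))]
  have hcc : Continuous fun t => (φ (K.pt i t) - K.endMean φ i) ^ 2 :=
    ((hφ.continuous.comp (continuous_pt i)).sub continuous_const).pow 2
  calc ∫ t in Icc (0 : ℝ) 1, (φ (K.pt i t) - K.endMean φ i) ^ 2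
      ≤ ∫ _ in Icc (0 : ℝ) 1, X := setIntegral_mono_on (hcc.integrableOn_Icc)
        (continuous_const.integrableOn_Icc) measurableSet_Icc hpt
    _ = X := by simp

/-- The left side is the error of the trapezoidal rule, which is exact for affine functions.
Integration by parts represents it by the tangential derivative against 1/2 - t. As 1/2 - t has mean
zero, any constant a may be subtracted from the derivative. -/
theorem abs_inner_edgeOne_le {φ : Plane → ℝ} (hφ : ContDiff ℝ ∞ φ) (i : Fin (K.m + 3)) (a : ℝ) :
    |⟪K.ctr hφ.continuous i - K.endMean φ i • edgeOne, edgeOne⟫| ≤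
      ‖(∑ j, K.dir i j • K.ctr (continuous_pd hφ j) i) - a • edgeOne‖ := by
  set d : ℝ → ℝ := fun t => ∑ j, K.dir i j * pd j φ (K.pt i t) with hd
  have hdc : Continuous d := continuous_sum_pd_pt hφ i _
  have hT : MemLp (fun t : ℝ => 1 / 2 - t) 2 (volume.restrict (Icc (0 : ℝ) 1)) := by
    refine MemLp.of_bound (by fun_prop) 1 ((ae_restrict_iff' measurableSet_Icc).2
      (Filter.Eventually.of_forall fun t ht => ?_))
    rw [Real.norm_eq_abs, abs_le]
    constructor <;> linarith [ht.1, ht.2]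
  set T : EdgeL2 := hT.toLp with hTd
  have hTn : ‖T‖ ≤ 1 := by
    have : ‖T‖ ^ 2 ≤ 1 := by
      rw [← real_inner_self_eq_norm_sq, edgeL2_inner]
      have e : ∫ t in Icc (0 : ℝ) 1, T t * T t = ∫ t in Icc (0 : ℝ) 1, (1 / 2 - t) ^ 2 :=
        integral_congr_ae (by
          filter_upwards [hT.coeFn_toLp] with t ht
          rw [hTd, ht, ← sq])
      rw [e]
      calc ∫ t in Icc (0 : ℝ) 1, (1 / 2 - t) ^ 2 ≤ ∫ _ in Icc (0 : ℝ) 1, (1 : ℝ) :=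
            setIntegral_mono_on ((by fun_prop : Continuous fun t : ℝ => (1 / 2 - t) ^ 2).integrableOn_Icc)
              continuous_const.integrableOn_Icc measurableSet_Icc fun t ht => by
                nlinarith [ht.1, ht.2]
        _ = 1 := by simp
    nlinarith [norm_nonneg T]
  have key : ⟪K.ctr hφ.continuous i - K.endMean φ i • edgeOne, edgeOne⟫ =
      ⟪T, (∑ j, K.dir i j • K.ctr (continuous_pd hφ j) i) - a • edgeOne⟫ := by
    rw [edgeL2_inner, edgeL2_inner]
    have e1 : ∫ t in Icc (0 : ℝ) 1, (K.ctr hφ.continuous i - K.endMean φ i • edgeOne : EdgeL2) t *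
        edgeOne t = ∫ t in (0 : ℝ)..1, (φ (K.pt i t) - K.endMean φ i) := by
      rw [intervalIntegral.integral_of_le zero_le_one, ← integral_Icc_eq_integral_Ioc]
      refine integral_congr_ae ?_
      filter_upwards [sub_const_ae (K.ctr hφ.continuous i) (K.endMean φ i),
        ctr_ae hφ.continuous i, edgeOne_ae] with t ht ht' h1
      rw [ht, ht', h1, mul_one]
    have e2 : ∫ t in Icc (0 : ℝ) 1, T t *
        ((∑ j, K.dir i j • K.ctr (continuous_pd hφ j) i) - a • edgeOne : EdgeL2) t =
        ∫ t in (0 : ℝ)..1, (1 / 2 - t) * (d t - a) := by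
      rw [intervalIntegral.integral_of_le zero_le_one, ← integral_Icc_eq_integral_Ioc]
      refine integral_congr_ae ?_
      filter_upwards [sub_const_ae (∑ j, K.dir i j • K.ctr (continuous_pd hφ j) i) a,
        sum_smul_ctr_ae hφ i (fun j => K.dir i j), hT.coeFn_toLp] with t ht ht' h1
      rw [ht, ht', hTd, h1]
    rw [e1, e2]
    -- Taking a(t - 1/2) along makes d - a appear in the derivative directly. This affine function
    -- integrates to zero, and the boundary terms cancel by the choice of the end point mean.
    have hder : ∀ t, HasDerivAt (fun t => (1 / 2 - t) * (φ (K.pt i t) - K.endMean φ i - a * (t - 1 / 2)))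
        (-(φ (K.pt i t) - K.endMean φ i - a * (t - 1 / 2)) + (1 / 2 - t) * (d t - a)) t := by
      intro t
      have h1 : HasDerivAt (fun t : ℝ => 1 / 2 - t) (-1) t := by
        exact (hasDerivAt_id t).const_sub (1 / 2)
      have h2 : HasDerivAt (fun t : ℝ => a * (t - 1 / 2)) a t := by
        simpa only [mul_one, id] using ((hasDerivAt_id t).sub_const (1 / 2)).const_mul a
      have := h1.mul (((hasDerivAt_pt hφ i t).sub_const (K.endMean φ i)).sub h2)
      refine this.congr_deriv ?_
      simp only [hd, Pi.sub_apply]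
      ring
    have hf : Continuous fun t => φ (K.pt i t) := hφ.continuous.comp (continuous_pt i)
    have hc1 : Continuous fun t => φ (K.pt i t) - K.endMean φ i := hf.sub continuous_const
    have hc2 : Continuous fun t : ℝ => a * (t - 1 / 2) := by fun_prop
    have hc3 : Continuous fun t => (1 / 2 - t) * (d t - a) := by fun_prop
    have hc4 : Continuous fun t => -(φ (K.pt i t) - K.endMean φ i - a * (t - 1 / 2)) :=
      (hc1.sub hc2).neg
    have hI := intervalIntegral.integral_eq_sub_of_hasDerivAt (a := 0) (b := 1)
      (fun t _ => hder t) ((hc4.add hc3).intervalIntegrable _ _)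
    rw [intervalIntegral.integral_add (hc4.intervalIntegrable _ _)
      (hc3.intervalIntegrable _ _), intervalIntegral.integral_neg, intervalIntegral.integral_sub
      (hc1.intervalIntegrable _ _) (hc2.intervalIntegrable _ _)] at hI
    have hz : ∫ t in (0 : ℝ)..1, a * (t - 1 / 2) = 0 := by
      rw [intervalIntegral.integral_const_mul, intervalIntegral.integral_sub
        ((by fun_prop : Continuous fun t : ℝ => t).intervalIntegrable _ _) (continuous_const.intervalIntegrable _ _)]
      simp
    rw [hz, pt_zero, pt_one] at hI
    unfold endMean at hI ⊢
    linarith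
  rw [key]
  refine (abs_real_inner_le_norm _ _).trans ?_
  nlinarith [norm_nonneg ((∑ j, K.dir i j • K.ctr (continuous_pd hφ j) i) - a • edgeOne)]

theorem norm_combo_sq_le {E : Type*} [NormedAddCommGroup E] [InnerProductSpace ℝ E] (a : Fin 2 → ℝ)
    (x : Fin 2 → E) : ‖∑ j, a j • x j‖ ^ 2 ≤ (a 0 ^ 2 + a 1 ^ 2) * ∑ j, ‖x j‖ ^ 2 := by
  have h : ‖∑ j, a j • x j‖ ≤ |a 0| * ‖x 0‖ + |a 1| * ‖x 1‖ := by
    rw [Fin.sum_univ_two]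
    refine (norm_add_le _ _).trans ?_
    rw [norm_smul, norm_smul, Real.norm_eq_abs, Real.norm_eq_abs]
  refine (pow_le_pow_left₀ (norm_nonneg _) h 2).trans ?_
  rw [Fin.sum_univ_two, ← sq_abs (a 0), ← sq_abs (a 1)]
  nlinarith [sq_nonneg (|a 0| * ‖x 1‖ - |a 1| * ‖x 0‖)]

/-- The edge estimate behind the interpolation inequality for nonconforming functions. -/
theorem edge_est_sm {φ : Plane → ℝ} (hφ : ContDiff ℝ ∞ φ) (i : Fin (K.m + 3)) (c : Fin 2 → ℝ)
    {θ : ℝ} (hθ : 0 < θ) :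
    ⟪K.ctr hφ.continuous i - K.endMean φ i • edgeOne,
      ∑ j, K.normal i j • K.ctr (continuous_pd hφ j) i⟫ ≤
      K.len i * (θ * ∑ j, ‖K.ctr (continuous_pd hφ j) i‖ ^ 2 +
        (1 / θ + 1) * ∑ j, ‖K.ctr (continuous_pd hφ j) i - c j • edgeOne‖ ^ 2) := by
  set F := K.ctr hφ.continuous i - K.endMean φ i • edgeOne with hF
  set γ : Fin 2 → EdgeL2 := fun j => K.ctr (continuous_pd hφ j) i with hγ
  set δ : Fin 2 → EdgeL2 := fun j => γ j - c j • edgeOne with hδ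
  set A := ∑ j, ‖γ j‖ ^ 2 with hA
  set S := ∑ j, ‖δ j‖ ^ 2 with hS
  have hA0 : 0 ≤ A := Finset.sum_nonneg fun j _ => sq_nonneg _
  have hS0 : 0 ≤ S := Finset.sum_nonneg fun j _ => sq_nonneg _
  have hl := len_pos i
  -- The direct estimate ‖F‖ · ‖∂ₙφ‖ would give A with a constant that cannot be absorbed. The
  -- following bounds make every term of the product contain a factor √S, where S measures the
  -- deviation of the gradient from the constant vector c.
  have b1 : ‖F‖ ≤ K.len i * √A := by
    refine (norm_sub_endMean_le hφ i).trans (le_of_sq_le_sq ?_ (by positivity))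
    rw [mul_pow, Real.sq_sqrt hA0, len_sq]
    exact norm_combo_sq_le _ γ
  have b2 : |⟪F, edgeOne⟫| ≤ K.len i * √S := by
    refine (abs_inner_edgeOne_le hφ i (∑ j, K.dir i j * c j)).trans
      (le_of_sq_le_sq ?_ (by positivity))
    rw [mul_pow, Real.sq_sqrt hS0, len_sq]
    have : (∑ j, K.dir i j • K.ctr (continuous_pd hφ j) i) - (∑ j, K.dir i j * c j) • edgeOne =
        ∑ j, K.dir i j • δ j := by
      simp only [hδ, hγ, Fin.sum_univ_two]; module
    rw [this]
    exact norm_combo_sq_le _ δ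
  have b3 : ‖∑ j, K.normal i j • δ j‖ ≤ √S := by
    refine le_of_sq_le_sq ?_ (Real.sqrt_nonneg _)
    rw [Real.sq_sqrt hS0]
    exact (norm_combo_sq_le (fun j => K.normal i j) δ).trans_eq
      (by rw [norm_normal_sq, one_mul])
  have b4 : |∑ j, K.normal i j * c j| ≤ √A + √S := by
    have e : (∑ j, K.normal i j * c j) • edgeOne =
        (∑ j, K.normal i j • γ j) - ∑ j, K.normal i j • δ j := by
      simp only [hδ, Fin.sum_univ_two]; module
    have h1 : |∑ j, K.normal i j * c j| = ‖(∑ j, K.normal i j * c j) • edgeOne‖ := by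
      rw [norm_smul, norm_edgeOne, mul_one, Real.norm_eq_abs]
    rw [h1, e]
    refine (norm_sub_le _ _).trans (add_le_add ?_ b3)
    refine le_of_sq_le_sq ?_ (Real.sqrt_nonneg _)
    rw [Real.sq_sqrt hA0]
    exact (norm_combo_sq_le (fun j => K.normal i j) γ).trans_eq
      (by rw [norm_normal_sq, one_mul])
  -- The normal derivative is its deviation plus the constant n·c. The deviation meets all of F, the
  -- constant only the mean of F, which is itself of size √S.
  have split : ⟪F, ∑ j, K.normal i j • γ j⟫ = ⟪F, ∑ j, K.normal i j • δ j⟫ +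
      (∑ j, K.normal i j * c j) * ⟪F, edgeOne⟫ := by
    rw [← real_inner_smul_right, ← inner_add_right]
    congr 1
    simp only [hδ, Fin.sum_univ_two]; module
  change ⟪F, ∑ j, K.normal i j • γ j⟫ ≤ _
  rw [split]
  have t1 : ⟪F, ∑ j, K.normal i j • δ j⟫ ≤ K.len i * √A * √S :=
    (real_inner_le_norm _ _).trans (mul_le_mul b1 b3 (norm_nonneg _) (by positivity))
  have t2 : (∑ j, K.normal i j * c j) * ⟪F, edgeOne⟫ ≤ (√A + √S) * (K.len i * √S) := by
    refine (le_abs_self _).trans ?_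
    rw [abs_mul]
    exact mul_le_mul b4 b2 (abs_nonneg _) (by positivity)
  -- Young's inequality with a free weight θ. Making θ small later allows the term with A to be
  -- absorbed.
  have y : 2 * (√A * √S) ≤ θ * A + 1 / θ * S := by
    have h1 : 0 ≤ (θ * √A - √S) ^ 2 / θ := by positivity
    have h2 : (θ * √A - √S) ^ 2 / θ = θ * √A ^ 2 - 2 * (√A * √S) + 1 / θ * √S ^ 2 := by
      field_simp; ring
    rw [h2, Real.sq_sqrt hA0, Real.sq_sqrt hS0] at h1
    linarith
  have h3 : √S * √S = S := Real.mul_self_sqrt hS0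
  calc _ ≤ K.len i * (2 * (√A * √S) + √S * √S) := by nlinarith
    _ ≤ K.len i * (θ * A + (1 / θ + 1) * S) := by
      rw [h3]
      exact mul_le_mul_of_nonneg_left (by linarith) hl.le

theorem StarBall.edge_est (hs : K.StarBall x₀ r) {v : L2 K.carrier} {w : Plane → ℝ}
    {G : Fin 2 → Plane → ℝ} (hv : K.IsH2Trace v w G) (i : Fin (K.m + 3)) (c : Fin 2 → ℝ)
    {θ : ℝ} (hθ : 0 < θ) :
    ⟪etr hv.2.2.2.1.2.1 i - K.endMean w i • edgeOne,
      ∑ j, K.normal i j • etr (hv.2.2.2.2 j).2.1 i⟫ ≤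
      K.len i * (θ * ∑ j, ‖etr (hv.2.2.2.2 j).2.1 i‖ ^ 2 +
        (1 / θ + 1) * ∑ j, ‖etr (hv.2.2.2.2 j).2.1 i - c j • edgeOne‖ ^ 2) := by
  obtain ⟨Φ, hΦ, h0, h1, h2, h3⟩ := hs.exists_approx_H2 hv
  have cw := hs.tendsto_ctr hv.2.2.2.1 hΦ h0 h1 i
  have cG : ∀ j, Filter.Tendsto (fun n => K.ctr (continuous_pd (hΦ n) j) i) Filter.atTop
      (𝓝 (etr (hv.2.2.2.2 j).2.1 i)) := fun j =>
    hs.tendsto_ctr (hv.2.2.2.2 j) (fun n => contDiff_pd (hΦ n) j) (h1 j) (h2 j) i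
  have cm : Filter.Tendsto (fun n => K.endMean (Φ n) i) Filter.atTop (𝓝 (K.endMean w i)) :=
    ((h3 _ (frontier_subset_closure (vert_mem_frontier i))).add
      (h3 _ (frontier_subset_closure (vert_mem_frontier (i + 1))))).div_const 2
  refine le_of_tendsto_of_tendsto' ((cw.sub (cm.smul_const _)).inner
    (tendsto_finsetSum _ fun j _ => (cG j).const_smul (K.normal i j)))
    (((tendsto_finsetSum _ fun j _ => ((cG j).norm.pow 2)).const_mul θ |>.add
      ((tendsto_finsetSum _ fun j _ => (((cG j).sub_const (c j • edgeOne)).norm.pow 2)).const_mul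
        (1 / θ + 1))).const_mul (K.len i)) fun n => edge_est_sm (hΦ n) i c hθ

/-- The trace inequality for v minus its mean, which has the same gradient as v. Its L² norm is
bounded by the Poincaré inequality, and 3 · 4h⁴/r² is the first part of the constant. -/
theorem StarBall.exists_trace_mean (hs : K.StarBall x₀ r) {v : L2 K.carrier} {g : Plane → ℝ}
    (h : K.IsTrace v g) : ∃ c : ℝ, r * ∑ i, K.len i * ‖etr h.2.1 i - c • edgeOne‖ ^ 2 ≤
      (12 * K.h ^ 4 / r ^ 2 + K.h ^ 2) * gradForm K.carrier v v := by
  obtain ⟨c, hc⟩ := exists_of_mem_polySpace_zero (K := K)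
    (u := K.proj 0 v) ((K.polySpace 0).starProjection_apply_mem v)
  have hP := hs.poincare h.1
  have hone : K.IsTrace (K.sm (fun _ => c) continuous_const) (fun _ => c) :=
    hs.isTrace_sm (φ := fun _ => c) contDiff_const
  have ht := h.add (hone.smul (-1))
  have hsub : v + (-1 : ℝ) • K.sm (fun _ => c) continuous_const = v - K.proj 0 v := by
    rw [hc]; module
  have hw0 : ∀ j, weakD K.carrier j (K.sm (fun _ => c) continuous_const) = 0 := by
    intro j
    rw [weakD_sm (φ := fun _ => c) contDiff_const]
    have : K.sm (pd j fun _ => c) (continuous_pd contDiff_const j) =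
        K.sm (fun _ => 0) continuous_const := sm_congr _ _ fun x _ => by simp [pd]
    rw [this]
    have := sm_smul (K := K) (φ := fun _ => 0) continuous_const 0
    simpa using this
  have hg : gradForm K.carrier (v + (-1 : ℝ) • K.sm (fun _ => c) continuous_const)
      (v + (-1 : ℝ) • K.sm (fun _ => c) continuous_const) = gradForm K.carrier v v := by
    rw [gradForm_self, gradForm_self]
    refine Finset.sum_congr rfl fun j _ => ?_
    rw [weakD_add K.isOpen h.1 (hone.1.smul _), weakD_smul K.isOpen _ hone.1, hw0]
    simp
  refine ⟨c, ?_⟩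
  have := hs.trace_ineq ht
  rw [hg, show ‖v + (-1 : ℝ) • K.sm (fun _ => c) continuous_const‖ = ‖v - K.proj 0 v‖ by
    rw [hsub]] at this
  have he : ∀ i, etr ht.2.1 i = etr h.2.1 i - c • edgeOne := by
    intro i
    refine Lp.ext ?_
    filter_upwards [etr_ae ht.2.1 i, sub_const_ae (etr h.2.1 i) c, etr_ae h.2.1 i] with t a1 a2 a3
    rw [a1, a2, a3]
    simp [sub_eq_add_neg]
  simp only [he] at this
  refine this.trans ?_
  have : 12 * K.h ^ 4 / r ^ 2 = 3 * (4 * K.h ^ 4 / r ^ 2) := by ring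
  rw [this]
  nlinarith

theorem hessForm_self {U : Set Plane} (v : L2 U) :
    hessForm U v v = ∑ i, ∑ j, ‖weakD U j (weakD U i v)‖ ^ 2 := by
  unfold hessForm
  simp only [real_inner_self_eq_norm_sq]

theorem hessForm_eq_sum {U : Set Plane} (v : L2 U) :
    hessForm U v v = ∑ i, gradForm U (weakD U i v) (weakD U i v) := rfl

theorem norm_lap_sq_le {U : Set Plane} (v : L2 U) : ‖lap U v‖ ^ 2 ≤ 2 * hessForm U v v := by
  have h := norm_combo_sq_le (fun _ => 1) (fun i : Fin 2 => weakD U i (weakD U i v))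
  simp only [one_smul] at h
  refine h.trans ?_
  rw [hessForm_self]
  simp only [Fin.sum_univ_two]
  nlinarith [sq_nonneg ‖weakD U 1 (weakD U 0 v)‖, sq_nonneg ‖weakD U 0 (weakD U 1 v)‖]

theorem edgeInt_normalPart {G : Fin 2 → Plane → ℝ} (hG : ∀ j, K.MemL2Bdry (G j))
    (i : Fin (K.m + 3)) : K.edgeInt i (fun t => K.normalPart G i (K.pt i t)) =
      K.len i * ⟪edgeOne, ∑ j, K.normal i j • etr (hG j) i⟫ := by
  rw [edgeInt_eq, edgeL2_inner]
  congr 1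
  refine integral_congr_ae ?_
  rw [Fin.sum_univ_two]
  filter_upwards [edgeOne_ae, Lp.coeFn_add (K.normal i 0 • etr (hG 0) i)
    (K.normal i 1 • etr (hG 1) i), Lp.coeFn_smul (K.normal i 0) (etr (hG 0) i),
    Lp.coeFn_smul (K.normal i 1) (etr (hG 1) i), etr_ae (hG 0) i, etr_ae (hG 1) i]
    with t h0 h1 h2 h3 h4 h5
  rw [h0, h1, Pi.add_apply, h2, h3, Pi.smul_apply, Pi.smul_apply, h4, h5]
  simp [normalPart, Fin.sum_univ_two, mul_comm]

/-- Green's formula `|v|₁² + (v, Δ v) = (v, ∂ₙ v)_{∂K}`. -/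
theorem StarBall.green_H2 (hs : K.StarBall x₀ r) {v : L2 K.carrier} {w : Plane → ℝ}
    {G : Fin 2 → Plane → ℝ} (hv : K.IsH2Trace v w G) :
    gradForm K.carrier v v + ⟪v, lap K.carrier v⟫ = ∑ i, K.len i *
      ⟪etr hv.2.2.2.1.2.1 i, ∑ j, K.normal i j • etr (hv.2.2.2.2 j).2.1 i⟫ := by
  have h := fun j => hs.green_H1 hv.2.2.2.1 (hv.2.2.2.2 j) j
  unfold gradForm lap
  rw [inner_sum, ← Finset.sum_add_distrib]
  simp_rw [inner_sum, Finset.mul_sum]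
  rw [Finset.sum_comm]
  refine Finset.sum_congr rfl fun j _ => ?_
  rw [add_comm, h j]
  refine Finset.sum_congr rfl fun i _ => ?_
  rw [real_inner_smul_right, mul_assoc]

/-- The constant of the cellwise interpolation inequality. -/
def interpConst (ρ H : ℝ) : ℝ :=
  2 + 2 * (H ^ 2 * (1 / 6 + (1 / ρ) * (6 / ρ + 1) * (12 / ρ ^ 2 + 1)))

/-- Green's formula expresses |v|₁² by (v, Δv) and boundary terms. On each edge the end point mean
is split off from v. What remains is `edge_est`, controlled by the trace inequality for the
gradient. The last sum in the statement has no sign and is not small on a single cell. It is kept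
because it cancels over the mesh. -/
theorem StarBall.local_interp (hs : K.StarBall x₀ r) {ρ H : ℝ} (hρ : 0 < ρ) (hr : ρ * K.h ≤ r)
    (hH : K.h ≤ H) {v : L2 K.carrier} {w : Plane → ℝ}
    {G : Fin 2 → Plane → ℝ} (hv : K.IsH2Trace v w G) :
    gradForm K.carrier v v ≤ ‖v‖ ^ 2 + interpConst ρ H * hessForm K.carrier v v +
      2 * ∑ i, K.endMean w i * K.edgeInt i (fun t => K.normalPart G i (K.pt i t)) := by
  have hh := h_pos (K := K)
  have hr0 := hs.1
  -- With this weight h·θ·A = rA/6, and the trace inequality rA ≤ 3|v|₁² + h²|v|₂² makes it at most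
  -- |v|₁²/2 plus second-order terms. The half is absorbed on the left.
  set θ := r / (6 * K.h) with hθd
  have hθ : 0 < θ := by positivity
  choose c hc using fun j => hs.exists_trace_mean (hv.2.2.2.2 j)
  set γ : Fin 2 → Fin (K.m + 3) → EdgeL2 := fun j i => etr (hv.2.2.2.2 j).2.1 i with hγ
  set g := gradForm K.carrier v v with hg
  set q := hessForm K.carrier v v with hq
  have hq0 : 0 ≤ q := by
    rw [hq, hessForm_self]; positivity
  set b := ∑ i, K.endMean w i * K.edgeInt i (fun t => K.normalPart G i (K.pt i t)) with hb
  set A := ∑ i, K.len i * ∑ j, ‖γ j i‖ ^ 2 with hA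
  set S := ∑ i, K.len i * ∑ j, ‖γ j i - c j • edgeOne‖ ^ 2 with hS
  have hAb : r * A ≤ 3 * g + K.h ^ 2 * q := by
    have := Finset.sum_le_sum fun j (_ : j ∈ Finset.univ) => hs.trace_ineq (hv.2.2.2.2 j)
    rw [← Finset.mul_sum, Finset.sum_comm, Finset.sum_add_distrib, ← Finset.mul_sum,
      ← Finset.mul_sum, ← gradForm_self, ← hessForm_eq_sum] at this
    simpa only [← Finset.mul_sum] using this
  have hSb : r * S ≤ (12 * K.h ^ 4 / r ^ 2 + K.h ^ 2) * q := by
    have := Finset.sum_le_sum fun j (_ : j ∈ Finset.univ) => hc j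
    rw [← Finset.mul_sum, Finset.sum_comm, ← Finset.mul_sum, ← hessForm_eq_sum] at this
    simpa only [← Finset.mul_sum] using this
  have hA0 : 0 ≤ A := Finset.sum_nonneg fun i _ =>
    mul_nonneg (len_pos i).le (Finset.sum_nonneg fun j _ => sq_nonneg _)
  have hS0 : 0 ≤ S := Finset.sum_nonneg fun i _ =>
    mul_nonneg (len_pos i).le (Finset.sum_nonneg fun j _ => sq_nonneg _)
  have hgreen : g + ⟪v, lap K.carrier v⟫ ≤ b + K.h * (θ * A + (1 / θ + 1) * S) := by
    rw [hg, hs.green_H2 hv, hb, hA, hS, Finset.mul_sum, Finset.mul_sum, ← Finset.sum_add_distrib,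
      Finset.mul_sum, ← Finset.sum_add_distrib]
    refine Finset.sum_le_sum fun i _ => ?_
    rw [edgeInt_normalPart fun j => (hv.2.2.2.2 j).2.1]
    have he := hs.edge_est hv i c hθ
    rw [inner_sub_left, real_inner_smul_left] at he
    have hl := len_pos i
    have hlh := len_le_h i
    set X := θ * ∑ j, ‖γ j i‖ ^ 2 + (1 / θ + 1) * ∑ j, ‖γ j i - c j • edgeOne‖ ^ 2 with hX
    have hX0 : 0 ≤ X := by positivity
    have h1 : K.len i * (K.len i * X) ≤ K.h * (K.len i * X) :=
      mul_le_mul_of_nonneg_right hlh (by positivity)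
    have h2 := mul_le_mul_of_nonneg_left he hl.le
    have h3 : K.h * (K.len i * X) = K.h * (θ * (K.len i * ∑ j, ‖γ j i‖ ^ 2) +
      (1 / θ + 1) * (K.len i * ∑ j, ‖γ j i - c j • edgeOne‖ ^ 2)) := by rw [hX]; ring
    rw [← h3]
    change K.len i * ⟪_, _⟫ ≤ _
    nlinarith
  have hlap : -⟪v, lap K.carrier v⟫ ≤ ‖v‖ ^ 2 / 2 + q := by
    have h1 := norm_lap_sq_le v
    have h2 := (abs_le.1 (abs_real_inner_le_norm v (lap K.carrier v))).1
    nlinarith [sq_nonneg (‖v‖ - ‖lap K.carrier v‖)]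
  have eA : K.h * (θ * A) ≤ g / 2 + K.h ^ 2 / 6 * q := by
    have : K.h * (θ * A) = (r * A) / 6 := by rw [hθd]; field_simp
    rw [this]; nlinarith
  -- The deviation term is of pure second order. Everything is expressed through the ratio h/r ≤
  -- 1/ρ, so that only the shape parameter and a factor h² enter.
  have eS : K.h * ((1 / θ + 1) * S) ≤
      K.h ^ 2 * ((1 / ρ) * (6 / ρ + 1) * (12 / ρ ^ 2 + 1)) * q := by
    have hk : K.h / r ≤ 1 / ρ := by
      rw [div_le_div_iff₀ hr0 hρ]; linarith
    have hk0 : 0 ≤ K.h / r := by positivity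
    have e1 : K.h * ((1 / θ + 1) * S) = (K.h / r) * (6 * (K.h / r) + 1) * (r * S) := by
      rw [hθd]; field_simp
    rw [e1]
    have e2 : (12 * K.h ^ 4 / r ^ 2 + K.h ^ 2) * q = K.h ^ 2 * (12 * (K.h / r) ^ 2 + 1) * q := by
      field_simp
    rw [e2] at hSb
    have e3 : r * S ≤ K.h ^ 2 * (12 * (1 / ρ) ^ 2 + 1) * q := by
      refine hSb.trans ?_
      gcongr
    calc (K.h / r) * (6 * (K.h / r) + 1) * (r * S)
        ≤ (1 / ρ) * (6 * (1 / ρ) + 1) * (K.h ^ 2 * (12 * (1 / ρ) ^ 2 + 1) * q) := by gcongr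
      _ = _ := by ring
  have hfin : g ≤ ‖v‖ ^ 2 + (2 + 2 * (K.h ^ 2 * (1 / 6 + (1 / ρ) * (6 / ρ + 1) *
      (12 / ρ ^ 2 + 1)))) * q + 2 * b := by nlinarith
  refine hfin.trans ?_
  unfold interpConst
  gcongr

end Polygon

theorem IsTest.pd {U : Set Plane} {φ : Plane → ℝ} (h : IsTest U φ) (i : Fin 2) :
    IsTest U (pd i φ) := by
  refine ⟨contDiff_pd h.1 i, ?_, ?_⟩
  · exact (h.2.1.fderiv (𝕜 := ℝ)).comp_left
      (g := fun L : Plane →L[ℝ] ℝ => L (EuclideanSpace.single i 1)) rfl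
  · refine Subset.trans ?_ ((tsupport_fderiv_subset ℝ).trans h.2.2)
    exact closure_mono fun x hx => by
      contrapose! hx
      simp only [Function.mem_support, not_not] at hx ⊢
      simp [PlateVEM.pd, hx]

namespace Polygon

variable {K : Polygon} {x₀ : Plane} {r : ℝ}

/-! ### Polynomials -/

theorem mem_P_iff {k : ℕ} {p : MvPolynomial (Fin 2) ℝ} : p ∈ P k ↔ p.totalDegree ≤ k := by
  rw [P, MvPolynomial.mem_restrictTotalDegree]

theorem P_mono {k l : ℕ} (h : k ≤ l) : P k ≤ P l := fun _ hp =>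
  mem_P_iff.2 ((mem_P_iff.1 hp).trans h)

theorem pderiv_mem {k : ℕ} {p : MvPolynomial (Fin 2) ℝ} (hp : p ∈ P k) (i : Fin 2) :
    MvPolynomial.pderiv i p ∈ P (k - 1) := by
  rw [mem_P_iff] at hp ⊢
  refine Finset.sup_le fun s hs => ?_
  rw [MvPolynomial.mem_support_iff, MvPolynomial.coeff_pderiv] at hs
  have h1 := MvPolynomial.le_totalDegree (MvPolynomial.mem_support_iff.2 (left_ne_zero_of_mul hs))
  rw [Finsupp.sum_add_index' (fun _ => rfl) (fun _ _ _ => rfl), Finsupp.sum_single_index rfl] at h1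
  have := h1.trans hp
  omega

/-- The Laplacian of a polynomial. -/
def plap (p : MvPolynomial (Fin 2) ℝ) : MvPolynomial (Fin 2) ℝ :=
  ∑ i, MvPolynomial.pderiv i (MvPolynomial.pderiv i p)

theorem plap_mem {k : ℕ} {p : MvPolynomial (Fin 2) ℝ} (hp : p ∈ P k) : plap p ∈ P (k - 2) :=
  Submodule.sum_mem _ fun i _ => pderiv_mem (pderiv_mem hp i) i

theorem weakD_poly (p : MvPolynomial (Fin 2) ℝ) (i : Fin 2) :
    weakD K.carrier i (K.poly p) = K.poly (MvPolynomial.pderiv i p) :=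
  weakD_eq K.isOpen (hasWeakD_poly p i)

theorem lap_poly (p : MvPolynomial (Fin 2) ℝ) : lap K.carrier (K.poly p) = K.poly (plap p) := by
  unfold lap plap
  rw [map_sum]
  simp only [weakD_poly]

theorem poly_mem {k : ℕ} {p : MvPolynomial (Fin 2) ℝ} (hp : p ∈ P k) : K.poly p ∈ K.polySpace k :=
  Submodule.mem_map_of_mem hp

theorem weakD_mem {k : ℕ} {u : L2 K.carrier} (hu : u ∈ K.polySpace k) (i : Fin 2) :
    weakD K.carrier i u ∈ K.polySpace (k - 1) := by
  obtain ⟨p, hp, rfl⟩ := hu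
  rw [weakD_poly]
  exact poly_mem (pderiv_mem hp i)

/-- The restriction of a polynomial to an edge, in the parameter. -/
def edgePoly (K : Polygon) (i : Fin (K.m + 3)) (p : MvPolynomial (Fin 2) ℝ) : Polynomial ℝ :=
  MvPolynomial.aeval (fun j => Polynomial.C (K.vert i j) + Polynomial.C (K.dir i j) * Polynomial.X) p

theorem eval_edgePoly (i : Fin (K.m + 3)) (p : MvPolynomial (Fin 2) ℝ) (t : ℝ) :
    (K.edgePoly i p).eval t = p.eval fun l => K.pt i t l := by
  unfold edgePoly
  induction p using MvPolynomial.induction_on with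
  | C a => simp
  | add p q hp hq => simp [hp, hq]
  | mul_X p j hp =>
    rw [map_mul, Polynomial.eval_mul, hp, map_mul, MvPolynomial.aeval_X, MvPolynomial.eval_X]
    simp only [Polynomial.eval_add, Polynomial.eval_mul, Polynomial.eval_C, Polynomial.eval_X]
    rw [pt_apply i t j, mul_comm t]

theorem edgePoly_mem {k : ℕ} {p : MvPolynomial (Fin 2) ℝ} (hp : p ∈ P k) (i : Fin (K.m + 3)) {n : ℕ}
    (hn : k < n) : K.edgePoly i p ∈ Polynomial.degreeLT ℝ n := by
  rw [Polynomial.mem_degreeLT]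
  have h := MvPolynomial.aeval_natDegree_le (n := 1) p (mem_P_iff.1 hp)
    (fun j => Polynomial.C (K.vert i j) + Polynomial.C (K.dir i j) * Polynomial.X) fun j => by
      compute_degree
  rw [mul_one] at h
  exact Polynomial.degree_le_natDegree.trans_lt (by exact_mod_cast h.trans_lt hn)

theorem isPolyOn_poly {k : ℕ} {p : MvPolynomial (Fin 2) ℝ} (hp : p ∈ P k) (i : Fin (K.m + 3)) {n : ℕ}
    (hn : k < n) : K.IsPolyOn (fun x => p.eval fun l => x l) i n :=
  ⟨K.edgePoly i p, edgePoly_mem hp i hn, fun t _ => (eval_edgePoly i p t).symm⟩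

/-- The normal derivative of a polynomial on an edge. -/
def normalPoly (K : Polygon) (i : Fin (K.m + 3)) (p : MvPolynomial (Fin 2) ℝ) :
    MvPolynomial (Fin 2) ℝ := ∑ j, K.normal i j • MvPolynomial.pderiv j p

theorem normalPoly_mem {k : ℕ} {p : MvPolynomial (Fin 2) ℝ} (hp : p ∈ P k) (i : Fin (K.m + 3)) :
    K.normalPoly i p ∈ P (k - 1) :=
  Submodule.sum_mem _ fun j _ => Submodule.smul_mem _ _ (pderiv_mem hp j)

theorem StarBall.isTrace_poly (hs : K.StarBall x₀ r) (p : MvPolynomial (Fin 2) ℝ) :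
    K.IsTrace (K.poly p) fun x => p.eval fun l => x l := hs.isTrace_sm (contDiff_eval p)

/-- The gradient of a polynomial, as a pair of functions. -/
def gradEval (p : MvPolynomial (Fin 2) ℝ) (j : Fin 2) (x : Plane) : ℝ :=
  (MvPolynomial.pderiv j p).eval fun l => x l

theorem gradEval_eq (p : MvPolynomial (Fin 2) ℝ) :
    gradEval p = fun i => pd i (fun x : Plane => p.eval fun l => x l) := by
  ext i x
  exact (pd_eval p i x).symm

theorem StarBall.isH2Trace_poly (hs : K.StarBall x₀ r) (p : MvPolynomial (Fin 2) ℝ) :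
    K.IsH2Trace (K.poly p) (fun x => p.eval fun l => x l) (gradEval p) := by
  rw [gradEval_eq]
  exact hs.isH2Trace_sm (contDiff_eval p)

theorem normalPart_gradEval (p : MvPolynomial (Fin 2) ℝ) (i : Fin (K.m + 3)) (x : Plane) :
    K.normalPart (gradEval p) i x = (K.normalPoly i p).eval fun l => x l := by
  simp [normalPart, normalPoly, gradEval, mul_comm, MvPolynomial.smul_eval]

theorem isLap_poly (p : MvPolynomial (Fin 2) ℝ) : K.IsLap (K.poly p) (plap p) := by
  intro φ hφ
  have h : ∀ i, ∫ x in K.carrier, weakD K.carrier i (K.poly p) x * pd i φ x =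
      -⟪K.poly (MvPolynomial.pderiv i (MvPolynomial.pderiv i p)), K.sm φ hφ.1.continuous⟫ := by
    intro i
    rw [weakD_poly, hasWeakD_poly (MvPolynomial.pderiv i p) i φ hφ, inner_sm]
  rw [Finset.sum_congr rfl fun i _ => h i, ← inner_sm _ hφ.1.continuous, plap, map_sum, sum_inner,
    Finset.sum_neg_distrib]

theorem isBilap_poly (p : MvPolynomial (Fin 2) ℝ) : K.IsBilap (K.poly p) (plap (plap p)) := by
  intro φ hφ
  rw [lap_poly]
  have hd : ∀ i, MemLp (pd i (pd i φ)) 2 (volume.restrict K.carrier) := fun i =>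
    ((hφ.pd i).pd i).memLp
  have hi : ∀ i, ∫ x in K.carrier, K.poly (plap p) x * pd i (pd i φ) x =
      ∫ x in K.carrier,
        K.poly (MvPolynomial.pderiv i (MvPolynomial.pderiv i (plap p))) x * φ x := by
    intro i
    rw [hasWeakD_poly (plap p) i _ (hφ.pd i), hasWeakD_poly _ i φ hφ, neg_neg]
  have e : ∫ x in K.carrier, K.poly (plap p) x * (pd 0 (pd 0 φ) x + pd 1 (pd 1 φ) x) =
      (∫ x in K.carrier, K.poly (plap p) x * pd 0 (pd 0 φ) x) +
        ∫ x in K.carrier, K.poly (plap p) x * pd 1 (pd 1 φ) x := by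
    simp only [mul_add]
    exact integral_add ((Lp.memLp _).integrable_mul (hd 0)) ((Lp.memLp _).integrable_mul (hd 1))
  rw [e, hi, hi, ← inner_sm _ hφ.1.continuous, ← inner_sm _ hφ.1.continuous,
    ← inner_sm _ hφ.1.continuous, ← inner_add_left, ← map_add, ← Fin.sum_univ_two (fun i =>
      MvPolynomial.pderiv i (MvPolynomial.pderiv i (plap p)))]
  rfl

theorem etr_eq_zero {g : Plane → ℝ} (hg : K.MemL2Bdry g) {i : Fin (K.m + 3)}
    (h : ∀ t ∈ Icc (0 : ℝ) 1, g (K.pt i t) = 0) : etr hg i = 0 := by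
  rw [Lp.eq_zero_iff_ae_eq_zero]
  filter_upwards [etr_ae hg i, ae_restrict_mem measurableSet_Icc] with t h1 h2
  rw [h1, h t h2]; rfl

/-- With q = Δp, integrating (Δz, q) by parts once gives the boundary term with ∂ₙz. A second
integration by parts leaves no boundary term, because z vanishes on the boundary. -/
theorem StarBall.isLapTrace_poly (hs : K.StarBall x₀ r) (p : MvPolynomial (Fin 2) ℝ) :
    K.IsLapTrace (K.poly p) (plap (plap p)) fun i => K.edgePoly i (plap p) := by
  intro z w G hz hw
  set q := plap p with hq
  have hw0 : ∀ i, etr hz.2.2.2.1.2.1 i = 0 := fun i =>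
    etr_eq_zero _ fun t ht => hw _ (pt_mem_frontier i ht)
  have h1 : ∀ j, ⟪weakD K.carrier j z, K.poly (MvPolynomial.pderiv j q)⟫ +
      ⟪weakD K.carrier j (weakD K.carrier j z), K.poly q⟫ =
      ∑ i, K.edgeInt i fun t => G j (K.pt i t) *
        ((q.eval fun l => K.pt i t l) * K.normal i j) := by
    intro j
    have := hs.green_H1 (hz.2.2.2.2 j) (hs.isTrace_poly q) j
    rw [weakD_poly] at this
    rw [this]
    refine Finset.sum_congr rfl fun i _ => ?_
    rw [← edgeInt_mul_normal]
  have h2 : ∀ j, ⟪z, K.poly (MvPolynomial.pderiv j (MvPolynomial.pderiv j q))⟫ +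
      ⟪weakD K.carrier j z, K.poly (MvPolynomial.pderiv j q)⟫ = 0 := by
    intro j
    have := hs.green_H1 hz.2.2.2.1 (hs.isTrace_poly (MvPolynomial.pderiv j q)) j
    rw [weakD_poly] at this
    rw [this]
    exact Finset.sum_eq_zero fun i _ => by rw [hw0, inner_zero_left, mul_zero]
  have e : ∀ i, K.edgeInt i (fun t => (K.edgePoly i q).eval t * K.normalPart G i (K.pt i t)) =
      ∑ j, K.edgeInt i fun t => G j (K.pt i t) *
        ((q.eval fun l => K.pt i t l) * K.normal i j) := by
    intro i
    have a := fun j => (hz.2.2.2.2 j).2.1.integrable i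
      (f := fun t => (q.eval fun l => K.pt i t l) * K.normal i j)
      ((continuous_eval_pt q i).mul continuous_const)
    rw [Fin.sum_univ_two, ← edgeInt_add (a 0) (a 1)]
    congr 1
    ext t
    rw [eval_edgePoly, normalPart, Fin.sum_univ_two]
    ring
  rw [Finset.sum_congr rfl fun i _ => e i, Finset.sum_comm, ← Finset.sum_congr rfl fun j _ => h1 j,
    lap_poly, ← hq]
  have e2 : ⟪K.poly (plap q), z⟫ = -∑ j, ⟪weakD K.carrier j z, K.poly (MvPolynomial.pderiv j q)⟫ := by
    rw [real_inner_comm, plap, map_sum, inner_sum, ← Finset.sum_neg_distrib]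
    exact Finset.sum_congr rfl fun j _ => by linarith [h2 j]
  rw [e2, Finset.sum_add_distrib, real_inner_comm]
  unfold lap
  rw [sum_inner]
  ring

theorem StarBall.isNormalTrace_poly (hs : K.StarBall x₀ r) (p : MvPolynomial (Fin 2) ℝ) :
    K.IsNormalTrace (K.poly p) (plap p) fun i => K.edgePoly i (K.normalPoly i p) := by
  intro z gz hz
  have h1 : ∀ j, ⟪z, K.poly (MvPolynomial.pderiv j (MvPolynomial.pderiv j p))⟫ +
      ⟪weakD K.carrier j z, K.poly (MvPolynomial.pderiv j p)⟫ =
      ∑ i, K.edgeInt i fun t => gz (K.pt i t) *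
        (((MvPolynomial.pderiv j p).eval fun l => K.pt i t l) * K.normal i j) := by
    intro j
    have := hs.green_H1 hz (hs.isTrace_poly (MvPolynomial.pderiv j p)) j
    rw [weakD_poly] at this
    rw [this]
    refine Finset.sum_congr rfl fun i _ => ?_
    rw [← edgeInt_mul_normal]
  have e : ∀ i, K.edgeInt i (fun t => (K.edgePoly i (K.normalPoly i p)).eval t * gz (K.pt i t)) =
      ∑ j, K.edgeInt i fun t => gz (K.pt i t) *
        (((MvPolynomial.pderiv j p).eval fun l => K.pt i t l) * K.normal i j) := by
    intro i
    have a := fun j => hz.2.1.integrable i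
      (f := fun t => ((MvPolynomial.pderiv j p).eval fun l => K.pt i t l) * K.normal i j)
      ((continuous_eval_pt (MvPolynomial.pderiv j p) i).mul continuous_const)
    rw [Fin.sum_univ_two, ← edgeInt_add (a 0) (a 1)]
    congr 1
    ext t
    rw [eval_edgePoly, normalPoly, Fin.sum_univ_two]
    simp only [map_add, MvPolynomial.smul_eval]
    ring
  rw [Finset.sum_congr rfl fun i _ => e i, Finset.sum_comm, ← Finset.sum_congr rfl fun j _ => h1 j,
    Finset.sum_add_distrib, plap, map_sum, sum_inner, gradForm, add_comm]
  congr 1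
  · exact Finset.sum_congr rfl fun j _ => real_inner_comm _ _
  · exact Finset.sum_congr rfl fun j _ => by rw [weakD_poly, real_inner_comm]

/-! ### Polynomials belong to the local spaces -/

theorem StarBall.isHessProjC_poly (hs : K.StarBall x₀ r) {k : ℕ} {p : MvPolynomial (Fin 2) ℝ}
    (hp : p ∈ P k) : K.IsHessProjC k (K.poly p) p :=
  ⟨⟨hp, fun _ _ => rfl⟩, _, _, hs.isH2Trace_poly p,
    fun j => (contDiff_eval (MvPolynomial.pderiv j p)).continuous.continuousOn, rfl, fun _ => rfl⟩

theorem StarBall.isHessProjNC_poly (hs : K.StarBall x₀ r) {k : ℕ} {p : MvPolynomial (Fin 2) ℝ}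
    (hp : p ∈ P k) : K.IsHessProjNC k (K.poly p) p :=
  ⟨⟨hp, fun _ _ => rfl⟩, _, _, hs.isH2Trace_poly p, rfl, fun _ => rfl⟩

theorem StarBall.isGradProjC_poly (hs : K.StarBall x₀ r) {k : ℕ} {p : MvPolynomial (Fin 2) ℝ}
    (hp : p ∈ P k) : K.IsGradProjC k (K.poly p) p :=
  ⟨⟨hp, fun _ _ => rfl⟩, _, hs.isTrace_poly p, (contDiff_eval p).continuous.continuousOn, rfl⟩

theorem StarBall.isGradProjNC_poly (hs : K.StarBall x₀ r) {k : ℕ} {p : MvPolynomial (Fin 2) ℝ}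
    (hp : p ∈ P k) : K.IsGradProjNC k (K.poly p) p :=
  ⟨⟨hp, fun _ _ => rfl⟩, _, hs.isTrace_poly p, rfl⟩

theorem orthTop_self (k d : ℕ) (v : L2 K.carrier) : K.OrthTop k d (v - v) := by
  rw [sub_self]; exact OrthTop.zero

/-- The inclusion of the polynomials makes v - Πv an element of the local space, as the
stabilisation requires. A polynomial is its own projection, so the orthogonality conditions concern
the zero function. -/
theorem StarBall.polySpace_le_Vc (hs : K.StarBall x₀ r) {k : ℕ} (hk : 2 ≤ k) :
    K.polySpace k ≤ K.Vc k := by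
  rintro _ ⟨p, hp, rfl⟩
  refine ⟨_, _, plap (plap p), p, hs.isH2Trace_poly p,
    fun j => (contDiff_eval (MvPolynomial.pderiv j p)).continuous.continuousOn,
    P_mono (by omega) (plap_mem (plap_mem hp)), isBilap_poly p,
    fun i => isPolyOn_poly hp i (by omega), fun i => ?_, hs.isHessProjC_poly hp, orthTop_self _ _ _⟩
  have : K.normalPart (gradEval p) i = fun x => (K.normalPoly i p).eval fun l => x l := by
    ext x; exact normalPart_gradEval p i x
  rw [this]
  exact isPolyOn_poly (normalPoly_mem hp i) i (by omega)

theorem StarBall.polySpace_le_Vnc (hs : K.StarBall x₀ r) {k : ℕ} (hk : 2 ≤ k) :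
    K.polySpace k ≤ K.Vnc k := by
  rintro _ ⟨p, hp, rfl⟩
  refine ⟨_, _, plap (plap p), _, p, hs.isH2Trace_poly p,
    P_mono (by omega) (plap_mem (plap_mem hp)), isBilap_poly p,
    fun i => isPolyOn_poly hp i (by omega), fun i => edgePoly_mem (plap_mem hp) i (by omega),
    hs.isLapTrace_poly p, fun i _ => ?_, hs.isHessProjNC_poly hp, fun i _ χ _ => rfl,
    fun i χ _ => rfl, orthTop_self _ _ _⟩
  have : ContDiff ℝ ∞ fun t : ℝ => p.eval fun l => (K.vert i + t • K.tangent i) l :=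
    (contDiff_eval p).comp (contDiff_const.add (contDiff_id.smul contDiff_const))
  exact (this.of_le (by simp)).contDiffOn

theorem StarBall.polySpace_le_Qc (hs : K.StarBall x₀ r) (k : ℕ) : K.polySpace k ≤ K.Qc k := by
  rintro _ ⟨p, hp, rfl⟩
  exact ⟨_, plap p, p, hs.isTrace_poly p, (contDiff_eval p).continuous.continuousOn,
    P_mono (by omega) (plap_mem hp), isLap_poly p, fun i => isPolyOn_poly hp i (by omega),
    hs.isGradProjC_poly hp, orthTop_self _ _ _⟩

theorem StarBall.polySpace_le_Qnc (hs : K.StarBall x₀ r) {k : ℕ} (hk : 1 ≤ k) :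
    K.polySpace k ≤ K.Qnc k := by
  rintro _ ⟨p, hp, rfl⟩
  exact ⟨_, plap p, _, p, hs.isTrace_poly p, (contDiff_eval p).continuous.continuousOn,
    P_mono (by omega) (plap_mem hp), isLap_poly p,
    fun i => edgePoly_mem (normalPoly_mem hp i) i (by omega), hs.isNormalTrace_poly p,
    hs.isGradProjNC_poly hp, orthTop_self _ _ _⟩

/-! ### Uniqueness of the projections -/

theorem eqOn_closure_of_ae {f g : Plane → ℝ} (hf : ContinuousOn f (closure K.carrier))
    (hg : ContinuousOn g (closure K.carrier)) (h : ∀ᵐ x ∂volume.restrict K.carrier, f x = g x) :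
    EqOn f g (closure K.carrier) :=
  (Measure.eqOn_open_of_ae_eq h K.isOpen (hf.mono subset_closure)
    (hg.mono subset_closure)).of_subset_closure hf hg subset_closure Subset.rfl

theorem eqOn_closure_of_sm_eq {φ ψ : Plane → ℝ} (hφ : Continuous φ) (hψ : Continuous ψ)
    (h : K.sm φ hφ = K.sm ψ hψ) : EqOn φ ψ (closure K.carrier) :=
  eqOn_closure_of_ae hφ.continuousOn hψ.continuousOn (by
    filter_upwards [sm_ae hφ, sm_ae (K := K) hψ] with x h1 h2
    rw [← h1, ← h2, h])

theorem IsH2Trace.eqOn_zero {w : Plane → ℝ} {G : Fin 2 → Plane → ℝ} (h : K.IsH2Trace 0 w G) :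
    EqOn w 0 (closure K.carrier) :=
  eqOn_closure_of_ae h.2.1 continuousOn_const (by
    filter_upwards [h.2.2.1, Lp.coeFn_zero ℝ 2 (volume.restrict K.carrier)] with x h1 h2
    rw [← h1, h2])

theorem IsTrace.etr_zero {g : Plane → ℝ} (h : K.IsTrace 0 g) (i : Fin (K.m + 3)) :
    etr h.2.1 i = 0 := by
  rw [h.unique IsTrace.zero i]
  exact etr_eq_zero _ fun t _ => rfl

theorem eq_zero_of_etr {g : Plane → ℝ} (hg : K.MemL2Bdry g) {i : Fin (K.m + 3)}
    (h : etr hg i = 0) : ∀ᵐ t ∂volume.restrict (Icc (0 : ℝ) 1), g (K.pt i t) = 0 := by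
  filter_upwards [etr_ae hg i, (Lp.eq_zero_iff_ae_eq_zero).1 h] with t h1 h2
  rw [← h1, h2]; rfl

theorem edgeInt_eq_zero {i : Fin (K.m + 3)} {f : ℝ → ℝ}
    (h : ∀ᵐ t ∂volume.restrict (Icc (0 : ℝ) 1), f t = 0) : K.edgeInt i f = 0 := by
  rw [edgeInt_eq, integral_eq_zero_of_ae h, mul_zero]

/-- A trace class says nothing about single points. For boundary functions continuous on the
boundary the vanishing extends to every point, and the vertices are where this is applied. -/
theorem pt_eq_zero_of_etr {g : Plane → ℝ} (hg : K.MemL2Bdry g)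
    (hc : ContinuousOn g (frontier K.carrier)) {i : Fin (K.m + 3)} (h : etr hg i = 0) {t : ℝ}
    (ht : t ∈ Icc (0 : ℝ) 1) : g (K.pt i t) = 0 := by
  have hcc : ContinuousOn (fun t => g (K.pt i t)) (Icc (0 : ℝ) 1) :=
    hc.comp (continuous_pt i).continuousOn fun t ht => pt_mem_frontier i ht
  exact Measure.eqOn_of_ae_eq (eq_zero_of_etr hg h) hcc continuousOn_const
    (by rw [interior_Icc, closure_Ioo zero_ne_one]) ht

theorem StarBall.exists_const (hs : K.StarBall x₀ r) {v : L2 K.carrier} (hv : MemH1 K.carrier v)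
    (h : gradForm K.carrier v v = 0) : ∃ c : ℝ, v = K.sm (fun _ => c) continuous_const := by
  have := hs.poincare hv
  rw [h, mul_zero] at this
  have h0 : v - K.proj 0 v = 0 := by
    rw [← norm_eq_zero]; nlinarith [norm_nonneg (v - K.proj 0 v)]
  obtain ⟨c, hc⟩ := exists_of_mem_polySpace_zero (K := K)
    (u := K.proj 0 v) ((K.polySpace 0).starProjection_apply_mem v)
  exact ⟨c, by rw [← hc, ← sub_eq_zero, h0]⟩

theorem sm_zero : K.sm (fun _ => 0) continuous_const = 0 := by
  simpa using sm_smul (K := K) (φ := fun _ => 0) continuous_const 0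

theorem gradForm_nonneg {U : Set Plane} (v : L2 U) : 0 ≤ gradForm U v v := by
  rw [gradForm_self]; positivity

theorem hessForm_nonneg {U : Set Plane} (v : L2 U) : 0 ≤ hessForm U v v := by
  rw [hessForm_self]; positivity

/-- A polynomial with vanishing gradient seminorm is constant on the closed polygon. -/
theorem StarBall.exists_eval_const (hs : K.StarBall x₀ r) {p : MvPolynomial (Fin 2) ℝ}
    (h : gradForm K.carrier (K.poly p) (K.poly p) = 0) :
    ∃ c : ℝ, ∀ x ∈ closure K.carrier, p.eval (fun l => x l) = c := by
  obtain ⟨c, hc⟩ := hs.exists_const (memH1_poly p) h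
  exact ⟨c, eqOn_closure_of_sm_eq (contDiff_eval p).continuous continuous_const hc⟩

theorem poly_eq_zero {p : MvPolynomial (Fin 2) ℝ}
    (h : ∀ x ∈ closure K.carrier, p.eval (fun l => x l) = 0) : K.poly p = 0 := by
  rw [poly_eq_sm, ← sm_zero]
  exact sm_congr _ _ fun x hx => h x (subset_closure hx)

theorem vert_mem_closure (i : Fin (K.m + 3)) : K.vert i ∈ closure K.carrier :=
  frontier_subset_closure (vert_mem_frontier i)

theorem eq_zero_of_vert_mean {c : ℝ} {f : Plane → ℝ} (hf : ∀ x ∈ closure K.carrier, f x = c)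
    (h : (∑ i, f (K.vert i)) / (K.m + 3) = 0) : c = 0 := by
  rw [Finset.sum_congr rfl fun i _ => hf _ (vert_mem_closure i)] at h
  simp only [Finset.sum_const, Finset.card_univ, Fintype.card_fin, nsmul_eq_mul] at h
  have h3 : (K.m : ℝ) + 3 ≠ 0 := by positivity
  rw [Nat.cast_add, Nat.cast_ofNat, mul_div_cancel_left₀ _ h3] at h
  exact h

theorem eq_zero_of_bdry_mean {c : ℝ} {f : Plane → ℝ} (hf : ∀ x ∈ closure K.carrier, f x = c)
    (h : (∑ i, K.edgeInt i fun t => f (K.pt i t)) = 0) : c = 0 := by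
  have e : ∀ i, (K.edgeInt i fun t => f (K.pt i t)) = K.len i * c := by
    intro i
    rw [edgeInt_eq, setIntegral_congr_fun measurableSet_Icc fun t ht => hf _ (pt_mem_closure i ht)]
    simp
  rw [Finset.sum_congr rfl fun i _ => e i, ← Finset.sum_mul] at h
  refine (mul_eq_zero.1 h).resolve_left (Finset.sum_pos (fun i _ => len_pos i) ⟨0, by simp⟩).ne'

theorem StarBall.grad_const_of_isHessOrth (hs : K.StarBall x₀ r) {k : ℕ}
    {p : MvPolynomial (Fin 2) ℝ} (h : K.IsHessOrth k 0 p) (j : Fin 2) :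
    ∃ c : ℝ, ∀ x ∈ closure K.carrier, (MvPolynomial.pderiv j p).eval (fun l => x l) = c := by
  have h0 := h.2 p h.1
  rw [hessForm_zero K.isOpen, hessForm_eq_sum, Finset.sum_eq_zero_iff_of_nonneg
    fun i _ => gradForm_nonneg _] at h0
  have := h0 j (Finset.mem_univ j)
  rw [weakD_poly] at this
  exact hs.exists_eval_const this

theorem StarBall.poly_zero_of_grad_zero (hs : K.StarBall x₀ r) {p : MvPolynomial (Fin 2) ℝ}
    (h : ∀ j, ∀ x ∈ closure K.carrier, (MvPolynomial.pderiv j p).eval (fun l => x l) = 0)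
    (hv : (∑ i, p.eval (fun l => K.vert i l)) / (K.m + 3) = 0) : K.poly p = 0 := by
  obtain ⟨c, hc⟩ := hs.exists_eval_const (p := p) (by
    rw [gradForm_self]
    refine Finset.sum_eq_zero fun j _ => ?_
    rw [weakD_poly, poly_eq_zero (h j)]; simp)
  have := eq_zero_of_vert_mean hc hv
  exact poly_eq_zero fun x hx => (hc x hx).trans this

/-- The energy condition with χ = p makes the gradient of p constant. The vertex averages of the
gradient then make it zero, so p is constant, and the vertex average of p makes it zero too. The
data w and G attached to the zero function vanish at the vertices by uniqueness and continuity.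
Together with linearity this makes the projection single valued. -/
theorem StarBall.isHessProjC_zero (hs : K.StarBall x₀ r) {k : ℕ} {p : MvPolynomial (Fin 2) ℝ}
    (h : K.IsHessProjC k 0 p) : K.poly p = 0 := by
  obtain ⟨o, w, G, t, hc, hv, hg⟩ := h
  refine hs.poly_zero_of_grad_zero (fun j => ?_) ?_
  · obtain ⟨c, hcc⟩ := hs.grad_const_of_isHessOrth o j
    have hz : ∀ i, G j (K.vert i) = 0 := fun i => by
      have ht := t.2.2.2.2 j
      have h0 : etr ht.2.1 i = 0 := by
        have hD : weakD K.carrier j 0 = 0 := weakD_zero K.isOpen j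
        have ht' : K.IsTrace 0 (G j) := by rw [← hD]; exact ht
        exact ht'.etr_zero i
      have := pt_eq_zero_of_etr ht.2.1 (hc j) h0 (t := 0) (by simp)
      rwa [pt_zero] at this
    have := hg j
    simp only [hz, Finset.sum_const_zero, zero_div] at this
    have h0 := eq_zero_of_vert_mean hcc this
    exact fun x hx => (hcc x hx).trans h0
  · rw [hv]
    simp [fun i => t.eqOn_zero (vert_mem_closure i)]

/-- As in the conforming case, except that boundary integrals replace the vertex averages of the
gradient. They are determined by the trace class, so continuity of the gradient on the boundary is
not needed. -/
theorem StarBall.isHessProjNC_zero (hs : K.StarBall x₀ r) {k : ℕ} {p : MvPolynomial (Fin 2) ℝ}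
    (h : K.IsHessProjNC k 0 p) : K.poly p = 0 := by
  obtain ⟨o, w, G, t, hv, hg⟩ := h
  refine hs.poly_zero_of_grad_zero (fun j => ?_) ?_
  · obtain ⟨c, hcc⟩ := hs.grad_const_of_isHessOrth o j
    have hz : ∀ i, (K.edgeInt i fun t => G j (K.pt i t)) = 0 := fun i => by
      have ht := t.2.2.2.2 j
      have hD : weakD K.carrier j 0 = 0 := weakD_zero K.isOpen j
      have ht' : K.IsTrace 0 (G j) := by rw [← hD]; exact ht
      exact edgeInt_eq_zero (eq_zero_of_etr ht'.2.1 (ht'.etr_zero i))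
    have := hg j
    simp only [hz, Finset.sum_const_zero] at this
    have h0 := eq_zero_of_bdry_mean hcc this
    exact fun x hx => (hcc x hx).trans h0
  · rw [hv]
    simp [fun i => t.eqOn_zero (vert_mem_closure i)]

theorem StarBall.const_of_isGradOrth (hs : K.StarBall x₀ r) {k : ℕ}
    {p : MvPolynomial (Fin 2) ℝ} (h : K.IsGradOrth k 0 p) :
    ∃ c : ℝ, ∀ x ∈ closure K.carrier, p.eval (fun l => x l) = c := by
  have h0 := h.2 p h.1
  rw [gradForm_zero K.isOpen] at h0
  exact hs.exists_eval_const h0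

theorem StarBall.isGradProjC_zero (hs : K.StarBall x₀ r) {k : ℕ} {p : MvPolynomial (Fin 2) ℝ}
    (h : K.IsGradProjC k 0 p) : K.poly p = 0 := by
  obtain ⟨o, g, t, hc, hv⟩ := h
  obtain ⟨c, hcc⟩ := hs.const_of_isGradOrth o
  have hz : ∀ i, g (K.vert i) = 0 := fun i => by
    have := pt_eq_zero_of_etr t.2.1 hc (t.etr_zero i) (t := 0) (by simp)
    rwa [pt_zero] at this
  simp only [hz, Finset.sum_const_zero, zero_div] at hv
  have h0 := eq_zero_of_vert_mean hcc hv
  exact poly_eq_zero fun x hx => (hcc x hx).trans h0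

theorem StarBall.isGradProjNC_zero (hs : K.StarBall x₀ r) {k : ℕ} {p : MvPolynomial (Fin 2) ℝ}
    (h : K.IsGradProjNC k 0 p) : K.poly p = 0 := by
  obtain ⟨o, g, t, hv⟩ := h
  obtain ⟨c, hcc⟩ := hs.const_of_isGradOrth o
  have hz : ∀ i, (K.edgeInt i fun t => g (K.pt i t)) = 0 := fun i =>
    edgeInt_eq_zero (eq_zero_of_etr t.2.1 (t.etr_zero i))
  simp only [hz, Finset.sum_const_zero] at hv
  have h0 := eq_zero_of_bdry_mean hcc hv
  exact poly_eq_zero fun x hx => (hcc x hx).trans h0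

/-- A relation between functions and polynomials that is linear and single valued. -/
structure LinearRel (K : Polygon) (R : L2 K.carrier → MvPolynomial (Fin 2) ℝ → Prop) : Prop where
  add : ∀ {v v' p p'}, R v p → R v' p' → R (v + v') (p + p')
  smul : ∀ (c : ℝ) {v p}, R v p → R (c • v) (c • p)
  zero : ∀ {p}, R 0 p → K.poly p = 0

/-- Two polynomials related to the same v differ by one related to 0, which represents the zero
function. The arbitrary choice in `pick` is therefore harmless on the level of L²(K). -/
theorem LinearRel.pick_eq {R : L2 K.carrier → MvPolynomial (Fin 2) ℝ → Prop} (hR : K.LinearRel R)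
    {v : L2 K.carrier} {p : MvPolynomial (Fin 2) ℝ} (h : R v p) : K.pick (R v) = K.poly p := by
  have h' : ∃ p, R v p := ⟨p, h⟩
  unfold pick
  rw [dif_pos h']
  have := hR.zero (by
    have := hR.add h'.choose_spec (hR.smul (-1) h)
    rwa [neg_one_smul, add_neg_cancel] at this)
  rw [map_add, map_smul, neg_one_smul, ← sub_eq_add_neg] at this
  exact sub_eq_zero.1 this

theorem StarBall.linearRel_HC (hs : K.StarBall x₀ r) (k : ℕ) : K.LinearRel (K.IsHessProjC k) :=
  ⟨IsHessProjC.add, fun c _ _ h => IsHessProjC.smul c h, hs.isHessProjC_zero⟩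

theorem StarBall.linearRel_HNC (hs : K.StarBall x₀ r) (k : ℕ) : K.LinearRel (K.IsHessProjNC k) :=
  ⟨IsHessProjNC.add, fun c _ _ h => IsHessProjNC.smul c h, hs.isHessProjNC_zero⟩

theorem StarBall.linearRel_GC (hs : K.StarBall x₀ r) (k : ℕ) : K.LinearRel (K.IsGradProjC k) :=
  ⟨IsGradProjC.add, fun c _ _ h => IsGradProjC.smul c h, hs.isGradProjC_zero⟩

theorem StarBall.linearRel_GNC (hs : K.StarBall x₀ r) (k : ℕ) : K.LinearRel (K.IsGradProjNC k) :=
  ⟨IsGradProjNC.add, fun c _ _ h => IsGradProjNC.smul c h, hs.isGradProjNC_zero⟩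

end Polygon

/-! ### Finite dimension of the local spaces -/

/-- A space of functions that are determined by finitely many linear data is finite-dimensional. -/
theorem finiteDimensional_of_rel {E F : Type*} [AddCommGroup E] [Module ℝ E] [AddCommGroup F]
    [Module ℝ F] [FiniteDimensional ℝ F] {V : Submodule ℝ E} (R : Submodule ℝ (E × F))
    (h1 : ∀ v ∈ V, ∃ d, (v, d) ∈ R) (h2 : ∀ v, (v, (0 : F)) ∈ R → v = 0) :
    FiniteDimensional ℝ V := by
  have : FiniteDimensional ℝ R := by
    refine FiniteDimensional.of_injective ((LinearMap.snd ℝ E F).comp R.subtype) ?_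
    rw [← LinearMap.ker_eq_bot, LinearMap.ker_eq_bot']
    rintro ⟨⟨v, d⟩, hx⟩ h0
    have hd : d = 0 := h0
    subst hd
    have := h2 v hx
    subst this
    rfl
  have hle : V ≤ R.map (LinearMap.fst ℝ E F) := fun v hv => by
    obtain ⟨d, hd⟩ := h1 v hv
    exact ⟨(v, d), hd, rfl⟩
  exact Submodule.finiteDimensional_of_le hle

namespace Polygon

variable {K : Polygon} {x₀ : Plane} {r : ℝ}

instance (n : ℕ) : FiniteDimensional ℝ (Polynomial.degreeLT ℝ n) :=
  Module.Finite.equiv (Polynomial.degreeLTEquiv ℝ n).symm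

/-- When the trace vanishes, the kernel itself may be inserted into the Gauss-Green formula,
wherever its support lies: the extension of v by zero is in H¹ of the plane. In contrast to
`StarBall.pd_mo`, the sign of e and the position of x do not matter. -/
theorem IsTrace.pd_mo (B : Density x₀ r) {e : ℝ} (he : e ≠ 0) {v : L2 K.carrier} {g : Plane → ℝ}
    (h : K.IsTrace v g) (h0 : ∀ i, etr h.2.1 i = 0) (j : Fin 2) (x : Plane) :
    pd j (mo B e v) x = (1 - e) * mo B e (weakD K.carrier j v) x := by
  refine pd_mo_of_zero B he x ?_
  have := h.2.2 j (B.ker e x) (B.contDiff_ker e x)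
  rw [Finset.sum_eq_zero fun i _ => edgeInt_eq_zero (by
    filter_upwards [eq_zero_of_etr h.2.1 (h0 i)] with t ht
    rw [ht, zero_mul])] at this
  linarith

theorem neg_eps_ne (n : ℕ) : -eps n ≠ 0 := neg_ne_zero.2 (eps_pos n).ne'

theorem abs_neg_eps_le (n : ℕ) : |-eps n| ≤ 1 / 2 := by
  rw [abs_neg, abs_of_pos (eps_pos n)]; exact eps_le n

theorem tendsto_neg_eps : Filter.Tendsto (fun n => -eps n) Filter.atTop (𝓝 0) := by
  simpa using tendsto_eps.neg

theorem IsTrace.tendsto_pd_mo (B : Density x₀ r) {v : L2 K.carrier} {g : Plane → ℝ}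
    (h : K.IsTrace v g) (h0 : ∀ i, etr h.2.1 i = 0) (j : Fin 2) :
    Filter.Tendsto (fun n => K.sm (pd j (mo B (-eps n) v))
      (continuous_pd (contDiff_mo B (neg_eps_ne n) v) j)) Filter.atTop
      (𝓝 (weakD K.carrier j v)) := by
  have e : ∀ n, K.sm (pd j (mo B (-eps n) v))
      (continuous_pd (contDiff_mo B (neg_eps_ne n) v) j) = (1 - -eps n) •
        K.sm (mo B (-eps n) (weakD K.carrier j v)) (contDiff_mo B (neg_eps_ne n) _).continuous := by
    intro n
    rw [← sm_smul]
    exact sm_congr _ _ fun x _ => h.pd_mo B (neg_eps_ne n) h0 j x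
  simp only [e]
  have := (tendsto_neg_eps.const_sub 1).smul
    (tendsto_mo B neg_eps_ne abs_neg_eps_le tendsto_neg_eps (weakD K.carrier j v))
  simpa using this

theorem StarBall.eq_zero_of_grad (hs : K.StarBall x₀ r) {v : L2 K.carrier} {g : Plane → ℝ}
    (h : K.IsTrace v g) (h0 : ∀ i, etr h.2.1 i = 0) (hg : gradForm K.carrier v v = 0) : v = 0 := by
  obtain ⟨c, rfl⟩ := hs.exists_const h.1 hg
  have h1 : K.IsTrace (K.sm (fun _ => c) continuous_const) (fun _ => c) :=
    hs.isTrace_sm (φ := fun _ => c) contDiff_const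
  have h2 : etr h1.2.1 0 = 0 := (h1.unique h 0).trans (h0 0)
  have := pt_eq_zero_of_etr h1.2.1 continuousOn_const h2 (t := 0) (by simp)
  subst this
  exact sm_zero

/-- The energy argument: the regularisations with negative parameter are test functions whose
gradients converge to ∇v, so harmonicity gives |v|₁² = 0 in the limit. The vanishing trace excludes
nonzero constants. -/
theorem StarBall.eq_zero_of_isLap (hs : K.StarBall x₀ r) {v : L2 K.carrier} {g : Plane → ℝ}
    (h : K.IsTrace v g) (h0 : ∀ i, etr h.2.1 i = 0) (hl : K.IsLap v 0) : v = 0 := by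
  obtain ⟨B⟩ := exists_density (x₀ := x₀) hs.1
  refine hs.eq_zero_of_grad h h0 ?_
  have e : ∀ n, ∑ i, ⟪weakD K.carrier i v, K.sm (pd i (mo B (-eps n) v))
      (continuous_pd (contDiff_mo B (neg_eps_ne n) v) i)⟫ = 0 := by
    intro n
    have := hl _ (hs.isTest_mo B (neg_lt_zero.2 (eps_pos n)) v)
    rw [map_zero, int_zero, neg_zero] at this
    rw [← this]
    exact Finset.sum_congr rfl fun i _ => inner_sm _ _
  have hlim := tendsto_finsetSum Finset.univ fun i _ =>
    (tendsto_const_nhds (x := weakD K.carrier i v)).inner (𝕜 := ℝ) (h.tendsto_pd_mo B h0 i)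
  simp only [e] at hlim
  exact (tendsto_nhds_unique hlim tendsto_const_nhds)

/-- The conforming pressure data. -/
def relQc (K : Polygon) (ℓ : ℕ) :
    Submodule ℝ (L2 K.carrier × P ℓ × (Fin (K.m + 3) → Polynomial.degreeLT ℝ (ℓ + 1))) where
  carrier := {x | ∃ g, K.IsTrace x.1 g ∧ K.IsLap x.1 x.2.1 ∧
    ∀ i, ∀ t ∈ Icc (0 : ℝ) 1, g (K.pt i t) = (x.2.2 i : Polynomial ℝ).eval t}
  add_mem' := by
    rintro _ _ ⟨g, a, b, c⟩ ⟨g', a', b', c'⟩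
    refine ⟨_, a.add a', b.add a.1 a'.1 b', fun i t ht => ?_⟩
    simp [c i t ht, c' i t ht]
  zero_mem' := ⟨0, IsTrace.zero, IsLap.zero, fun i t _ => by simp⟩
  smul_mem' := by
    rintro s _ ⟨g, a, b, c⟩
    refine ⟨_, a.smul s, b.smul s a.1, fun i t ht => ?_⟩
    simp [c i t ht]

/-- Uniqueness for the Dirichlet problem: the polynomials Δq and q on the edges determine q. -/
theorem StarBall.finite_Qc (hs : K.StarBall x₀ r) (ℓ : ℕ) : FiniteDimensional ℝ (K.Qc ℓ) := by
  refine finiteDimensional_of_rel (K.relQc ℓ) ?_ ?_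
  · rintro v ⟨g, f, p, t, -, hf, hl, hp, -⟩
    choose q hq he using hp
    exact ⟨(⟨f, hf⟩, fun i => ⟨q i, hq i⟩), g, t, hl, he⟩
  · rintro v ⟨g, t, hl, he⟩
    exact hs.eq_zero_of_isLap t (fun i => etr_eq_zero _ fun s hsI => by rw [he i s hsI]; simp) hl

/-- The nonconforming pressure data. -/
def relQnc (K : Polygon) (ℓ : ℕ) :
    Submodule ℝ (L2 K.carrier × P ℓ × (Fin (K.m + 3) → Polynomial.degreeLT ℝ ℓ) × ℝ) where
  carrier := {x | (∃ g, K.IsTrace x.1 g) ∧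
    K.IsNormalTrace x.1 x.2.1 (fun i => (x.2.2.1 i : Polynomial ℝ)) ∧
    ⟪x.1, K.sm (fun _ => 1) continuous_const⟫ = x.2.2.2}
  add_mem' := by
    rintro _ _ ⟨⟨g, a⟩, b, c⟩ ⟨⟨g', a'⟩, b', c'⟩
    refine ⟨⟨_, a.add a'⟩, b.add a.1 a'.1 b', ?_⟩
    simp only [Prod.fst_add, Prod.snd_add, inner_add_left, c, c']
  zero_mem' := ⟨⟨0, IsTrace.zero⟩, IsNormalTrace.zero, by simp⟩
  smul_mem' := by
    rintro s _ ⟨⟨g, a⟩, b, c⟩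
    refine ⟨⟨_, a.smul s⟩, b.smul s a.1, ?_⟩
    simp only [Prod.smul_fst, Prod.smul_snd, real_inner_smul_left, c, smul_eq_mul]

/-- Uniqueness for the Neumann problem: the data are Δq, the normal derivatives and, to fix the
additive constant, the integral of q. The function itself is admissible in the Green formula that
defines its normal trace, so no approximation is needed. -/
theorem StarBall.finite_Qnc (hs : K.StarBall x₀ r) (ℓ : ℕ) : FiniteDimensional ℝ (K.Qnc ℓ) := by
  refine finiteDimensional_of_rel (K.relQnc ℓ) ?_ ?_
  · rintro v ⟨g, f, q, p, t, -, hf, -, hq, hn, -⟩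
    exact ⟨(⟨f, hf⟩, fun i => ⟨q i, hq i⟩, ⟪v, K.sm (fun _ => 1) continuous_const⟫), ⟨g, t⟩, hn,
      rfl⟩
  · rintro v ⟨⟨g, t⟩, hn, he⟩
    have h1 := hn v g t
    have h2 : gradForm K.carrier v v = 0 := by
      simpa [edgeInt] using h1
    obtain ⟨c, hc⟩ := hs.exists_const t.1 h2
    have h3 : v = c • K.sm (fun _ => 1) continuous_const := by
      rw [← sm_smul]
      refine hc.trans ?_
      exact sm_congr _ _ fun x _ => by simp
    change ⟪v, _⟫ = 0 at he
    rw [← inner_self_eq_zero (𝕜 := ℝ)]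
    nth_rw 2 [h3]
    rw [real_inner_smul_right, he, mul_zero]

/-- In contrast to `eq_zero_of_isLap` the Laplacian vanishes as an L² function of an H² function,
and Green's formula with v itself gives |v|₁² = 0 at once. -/
theorem StarBall.eq_zero_of_lap (hs : K.StarBall x₀ r) {v : L2 K.carrier} {w : Plane → ℝ}
    {G : Fin 2 → Plane → ℝ} (hv : K.IsH2Trace v w G) (h0 : ∀ i, etr hv.2.2.2.1.2.1 i = 0)
    (hl : lap K.carrier v = 0) : v = 0 := by
  refine hs.eq_zero_of_grad hv.2.2.2.1 h0 ?_
  have := hs.green_H2 hv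
  rw [hl, inner_zero_right, add_zero] at this
  rw [this]
  exact Finset.sum_eq_zero fun i _ => by rw [h0, inner_zero_left, mul_zero]

/-- The nonconforming displacement data. -/
def relVnc (K : Polygon) (k : ℕ) :
    Submodule ℝ (L2 K.carrier × P k × (Fin (K.m + 3) → Polynomial.degreeLT ℝ (k + 1)) ×
      (Fin (K.m + 3) → Polynomial.degreeLT ℝ (k - 1))) where
  carrier := {x | ∃ w G, K.IsH2Trace x.1 w G ∧
    K.IsLapTrace x.1 x.2.1 (fun i => (x.2.2.2 i : Polynomial ℝ)) ∧
    ∀ i, ∀ t ∈ Icc (0 : ℝ) 1, w (K.pt i t) = (x.2.2.1 i : Polynomial ℝ).eval t}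
  add_mem' := by
    rintro _ _ ⟨w, G, a, b, c⟩ ⟨w', G', a', b', c'⟩
    refine ⟨_, _, a.add a', b.add a.1 a'.1 b', fun i t ht => ?_⟩
    simp [c i t ht, c' i t ht]
  zero_mem' := ⟨0, 0, IsH2Trace.zero, IsLapTrace.zero, fun i t _ => by simp⟩
  smul_mem' := by
    rintro s _ ⟨w, G, a, b, c⟩
    refine ⟨_, _, a.smul s, b.smul s a.1, fun i t ht => ?_⟩
    simp [c i t ht]

/-- Uniqueness for the biharmonic problem with v and Δv prescribed on the boundary. With zero data v
vanishes on the boundary, hence may be used as z in the formula defining the trace of Δv. This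
yields ‖Δv‖² = 0. -/
theorem StarBall.finite_Vnc (hs : K.StarBall x₀ r) (k : ℕ) : FiniteDimensional ℝ (K.Vnc k) := by
  refine finiteDimensional_of_rel (K.relVnc k) ?_ ?_
  · rintro v ⟨w, G, f, g, p, t, hf, -, hp, hg, hl, -⟩
    choose q hq he using hp
    exact ⟨(⟨f, hf⟩, fun i => ⟨q i, hq i⟩, fun i => ⟨g i, hg i⟩), w, G, t, hl, he⟩
  · rintro v ⟨w, G, t, hl, he⟩
    have hw : ∀ i, ∀ s ∈ Icc (0 : ℝ) 1, w (K.pt i s) = 0 := fun i s hsI => by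
      rw [he i s hsI]; simp
    refine hs.eq_zero_of_lap t (fun i => etr_eq_zero _ (hw i)) ?_
    have := hl v w G t fun x hx => by
      obtain ⟨i, s, hsI, rfl⟩ := exists_pt_of_frontier hx
      exact hw i s hsI
    simpa [edgeInt] using this

/-- The tangential derivative of a function that vanishes on an edge is zero. -/
theorem StarBall.tangential_zero (hs : K.StarBall x₀ r) {v : L2 K.carrier} {w : Plane → ℝ}
    {G : Fin 2 → Plane → ℝ} (hv : K.IsH2Trace v w G) {i : Fin (K.m + 3)}
    (h0 : etr hv.2.2.2.1.2.1 i = 0) : ∑ j, K.dir i j • etr (hv.2.2.2.2 j).2.1 i = 0 := by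
  obtain ⟨Φ, hΦ, c0, c1, c2, -⟩ := hs.exists_approx_H2 hv
  have cw := hs.tendsto_ctr hv.2.2.2.1 hΦ c0 c1 i
  have cG : ∀ j, Filter.Tendsto (fun n => K.ctr (continuous_pd (hΦ n) j) i) Filter.atTop
      (𝓝 (etr (hv.2.2.2.2 j).2.1 i)) := fun j =>
    hs.tendsto_ctr (hv.2.2.2.2 j) (fun n => contDiff_pd (hΦ n) j) (c1 j) (c2 j) i
  rw [h0] at cw
  set D := ∑ j, K.dir i j • etr (hv.2.2.2.2 j).2.1 i with hD
  -- The derivative along the edge in the sense of distributions. For the smooth approximations this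
  -- is integration by parts on the edge, and both sides converge because the traces of the
  -- functions and of their gradients do.
  have key : ∀ ψ : ℝ → ℝ, ContDiff ℝ ∞ ψ → HasCompactSupport ψ → tsupport ψ ⊆ Ioo 0 1 →
      ∫ t in Icc (0 : ℝ) 1, D t * ψ t = 0 := by
    intro ψ hψ hc hsub
    have hdc : Continuous (deriv ψ) := hψ.continuous_deriv (by simp)
    have m1 : MemLp ψ 2 (volume.restrict (Icc (0 : ℝ) 1)) :=
      hψ.continuous.memLp_of_hasCompactSupport hc
    have m2 : MemLp (deriv ψ) 2 (volume.restrict (Icc (0 : ℝ) 1)) :=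
      hdc.memLp_of_hasCompactSupport hc.deriv
    have z : ∀ t, t ∉ Ioo (0 : ℝ) 1 → ψ t = 0 := fun t ht =>
      image_eq_zero_of_notMem_tsupport fun h => ht (hsub h)
    have hn : ∀ n, ⟪∑ j, K.dir i j • K.ctr (continuous_pd (hΦ n) j) i, m1.toLp⟫ =
        -⟪K.ctr (hΦ n).continuous i, m2.toLp⟫ := by
      intro n
      set d : ℝ → ℝ := fun t => ∑ j, K.dir i j * pd j (Φ n) (K.pt i t) with hd
      have hdd : Continuous d := continuous_sum_pd_pt (hΦ n) i _
      have hf : Continuous fun t => Φ n (K.pt i t) := (hΦ n).continuous.comp (continuous_pt i)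
      have e1 : ⟪∑ j, K.dir i j • K.ctr (continuous_pd (hΦ n) j) i, m1.toLp⟫ =
          ∫ t in (0 : ℝ)..1, d t * ψ t := by
        rw [edgeL2_inner, intervalIntegral.integral_of_le zero_le_one,
          ← integral_Icc_eq_integral_Ioc]
        refine integral_congr_ae ?_
        filter_upwards [sum_smul_ctr_ae (hΦ n) i (fun j => K.dir i j), m1.coeFn_toLp] with t h1 h2
        rw [h1, h2]
      have e2 : ⟪K.ctr (hΦ n).continuous i, m2.toLp⟫ =
          ∫ t in (0 : ℝ)..1, Φ n (K.pt i t) * deriv ψ t := by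
        rw [edgeL2_inner, intervalIntegral.integral_of_le zero_le_one,
          ← integral_Icc_eq_integral_Ioc]
        refine integral_congr_ae ?_
        filter_upwards [ctr_ae (hΦ n).continuous i, m2.coeFn_toLp] with t h1 h2
        rw [h1, h2]
      rw [e1, e2]
      have := intervalIntegral.integral_mul_deriv_eq_deriv_mul (a := 0) (b := 1)
        (u := fun t => Φ n (K.pt i t)) (v := ψ) (u' := d) (v' := deriv ψ)
        (fun t _ => hasDerivAt_pt (hΦ n) i t)
        (fun t _ => (hψ.differentiable (by simp) t).hasDerivAt)
        (hdd.intervalIntegrable _ _) (hdc.intervalIntegrable _ _)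
      rw [z 0 (by simp), z 1 (by simp)] at this
      linarith
    have l1 := (tendsto_finsetSum Finset.univ fun j _ => (cG j).const_smul (K.dir i j)).inner (𝕜 := ℝ)
      (tendsto_const_nhds (x := m1.toLp))
    have l2 := (cw.inner (𝕜 := ℝ) (tendsto_const_nhds (x := m2.toLp))).neg
    have := tendsto_nhds_unique (l1.congr hn) l2
    rw [inner_zero_left, neg_zero, ← hD, edgeL2_inner] at this
    refine (integral_congr_ae ?_).trans this
    filter_upwards [m1.coeFn_toLp] with t ht
    rw [ht]
  have hl : LocallyIntegrableOn (fun t => D t) (Ioo 0 1) (volume.restrict (Icc (0 : ℝ) 1)) :=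
    ((Lp.memLp D).locallyIntegrable (by norm_num)).locallyIntegrableOn _
  have := isOpen_Ioo.ae_eq_zero_of_integral_contDiff_smul_eq_zero hl (fun g h1 h2 h3 => by
    simpa [mul_comm] using key g h1 h2 h3)
  rw [Lp.eq_zero_iff_ae_eq_zero]
  have hIoo : ∀ᵐ t ∂volume.restrict (Icc (0 : ℝ) 1), t ∈ Ioo (0 : ℝ) 1 := by
    rw [← restrict_Ioo_eq_restrict_Icc]
    exact ae_restrict_mem measurableSet_Ioo
  filter_upwards [this, hIoo] with t h1 h2
  exact h1 h2

theorem grad_zero_of_components {a b : EdgeL2} {i : Fin (K.m + 3)}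
    (h1 : K.dir i 0 • a + K.dir i 1 • b = 0) (h2 : K.normal i 0 • a + K.normal i 1 • b = 0) :
    a = 0 ∧ b = 0 := by
  have hl := len_pos i
  have h3 : K.dir i 1 • a - K.dir i 0 • b = 0 := by
    have := congrArg (fun z => K.len i • z) h2
    simp only [smul_add, smul_smul, len_mul_normal_zero, len_mul_normal_one, smul_zero] at this
    rwa [neg_smul, ← sub_eq_add_neg] at this
  have hs : (K.len i ^ 2) ≠ 0 := by positivity
  constructor
  · have : K.len i ^ 2 • a = K.dir i 0 • (K.dir i 0 • a + K.dir i 1 • b) +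
        K.dir i 1 • (K.dir i 1 • a - K.dir i 0 • b) := by rw [len_sq]; module
    rw [h1, h3, smul_zero, smul_zero, add_zero] at this
    exact (smul_eq_zero.1 this).resolve_left hs
  · have : K.len i ^ 2 • b = K.dir i 1 • (K.dir i 0 • a + K.dir i 1 • b) -
        K.dir i 0 • (K.dir i 1 • a - K.dir i 0 • b) := by rw [len_sq]; module
    rw [h1, h3, smul_zero, smul_zero, sub_zero] at this
    exact (smul_eq_zero.1 this).resolve_left hs

/-- Zero boundary values annihilate the tangential derivative, so together with the normal
derivative the whole gradient has zero trace. Then two derivatives commute with the regularisation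
for negative parameters. These test functions give ‖Δv‖² = 0 in the limit. -/
theorem StarBall.eq_zero_of_isBilap (hs : K.StarBall x₀ r) {v : L2 K.carrier} {w : Plane → ℝ}
    {G : Fin 2 → Plane → ℝ} (hv : K.IsH2Trace v w G) (h0 : ∀ i, etr hv.2.2.2.1.2.1 i = 0)
    (hn : ∀ i, ∑ j, K.normal i j • etr (hv.2.2.2.2 j).2.1 i = 0) (hl : K.IsBilap v 0) :
    v = 0 := by
  obtain ⟨B⟩ := exists_density (x₀ := x₀) hs.1
  refine hs.eq_zero_of_lap hv h0 ?_
  have hG : ∀ j i, etr (hv.2.2.2.2 j).2.1 i = 0 := by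
    intro j i
    have h1 := hs.tangential_zero hv (h0 i)
    have h2 := hn i
    rw [Fin.sum_univ_two] at h1 h2
    have := grad_zero_of_components h1 h2
    fin_cases j
    exacts [this.1, this.2]
  have hlim : ∀ j, Filter.Tendsto (fun n => K.sm (pd j (pd j (mo B (-eps n) v)))
      (continuous_pd (contDiff_pd (contDiff_mo B (neg_eps_ne n) v) j) j)) Filter.atTop
      (𝓝 (weakD K.carrier j (weakD K.carrier j v))) := by
    intro j
    have e : ∀ n, K.sm (pd j (pd j (mo B (-eps n) v)))
        (continuous_pd (contDiff_pd (contDiff_mo B (neg_eps_ne n) v) j) j) = (1 - -eps n) •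
        K.sm (pd j (mo B (-eps n) (weakD K.carrier j v)))
          (continuous_pd (contDiff_mo B (neg_eps_ne n) _) j) := by
      intro n
      rw [← sm_smul]
      refine sm_congr _ _ fun x _ => ?_
      have : pd j (mo B (-eps n) v) = fun x => (1 - -eps n) * mo B (-eps n) (weakD K.carrier j v) x :=
        funext fun x => hv.2.2.2.1.pd_mo B (neg_eps_ne n) h0 j x
      rw [this]
      unfold pd
      rw [fderiv_const_mul ((contDiff_mo B (neg_eps_ne n) _).differentiable (by simp) x)]
      rfl
    simp only [e]
    have := (tendsto_neg_eps.const_sub 1).smul ((hv.2.2.2.2 j).tendsto_pd_mo B (hG j) j)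
    simpa using this
  have hz : ∀ n, ∑ j, ⟪lap K.carrier v, K.sm (pd j (pd j (mo B (-eps n) v)))
      (continuous_pd (contDiff_pd (contDiff_mo B (neg_eps_ne n) v) j) j)⟫ = 0 := by
    intro n
    have hc := contDiff_mo B (neg_eps_ne n) v
    have := hl _ (hs.isTest_mo B (neg_lt_zero.2 (eps_pos n)) v)
    rw [map_zero, int_zero] at this
    rw [Fin.sum_univ_two, inner_sm, inner_sm, ← this]
    simp only [mul_add]
    exact (integral_add
      ((Lp.memLp _).integrable_mul (memLp_of_bounded K.isBounded
        (continuous_pd (contDiff_pd hc 0) 0)))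
      ((Lp.memLp _).integrable_mul (memLp_of_bounded K.isBounded
        (continuous_pd (contDiff_pd hc 1) 1)))).symm
  have hsum := tendsto_finsetSum Finset.univ fun j _ =>
    (tendsto_const_nhds (x := lap K.carrier v)).inner (𝕜 := ℝ) (hlim j)
  simp only [hz] at hsum
  have := tendsto_nhds_unique hsum tendsto_const_nhds
  rw [← inner_sum] at this
  exact inner_self_eq_zero.1 this

/-- The conforming displacement data. -/
def relVc (K : Polygon) (k : ℕ) :
    Submodule ℝ (L2 K.carrier × P k × (Fin (K.m + 3) → Polynomial.degreeLT ℝ (max k 3 + 1)) ×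
      (Fin (K.m + 3) → Polynomial.degreeLT ℝ k)) where
  carrier := {x | ∃ w G, K.IsH2Trace x.1 w G ∧ K.IsBilap x.1 x.2.1 ∧
    (∀ i, ∀ t ∈ Icc (0 : ℝ) 1, w (K.pt i t) = (x.2.2.1 i : Polynomial ℝ).eval t) ∧
    ∀ i, ∀ t ∈ Icc (0 : ℝ) 1, K.normalPart G i (K.pt i t) = (x.2.2.2 i : Polynomial ℝ).eval t}
  add_mem' := by
    rintro _ _ ⟨w, G, a, b, c, d⟩ ⟨w', G', a', b', c', d'⟩
    refine ⟨_, _, a.add a', b.add a.1 a'.1 b', fun i t ht => ?_, fun i t ht => ?_⟩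
    · simp [c i t ht, c' i t ht]
    · simp [normalPart_add, d i t ht, d' i t ht]
  zero_mem' := ⟨0, 0, IsH2Trace.zero, IsBilap.zero, fun i t _ => by simp,
    fun i t _ => by simp [normalPart_zero]⟩
  smul_mem' := by
    rintro s _ ⟨w, G, a, b, c, d⟩
    refine ⟨_, _, a.smul s, b.smul s a.1, fun i t ht => ?_, fun i t ht => ?_⟩
    · simp [c i t ht]
    · simp [normalPart_smul, d i t ht]

/-- Uniqueness for the clamped plate: Δ²v and the polynomials v and ∂ₙv on the edges determine v. -/
theorem StarBall.finite_Vc (hs : K.StarBall x₀ r) (k : ℕ) : FiniteDimensional ℝ (K.Vc k) := by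
  refine finiteDimensional_of_rel (K.relVc k) ?_ ?_
  · rintro v ⟨w, G, f, p, t, -, hf, hl, hp, hn, -⟩
    choose q hq he using hp
    choose q' hq' he' using hn
    exact ⟨(⟨f, hf⟩, fun i => ⟨q i, hq i⟩, fun i => ⟨q' i, hq' i⟩), w, G, t, hl, he, he'⟩
  · rintro v ⟨w, G, t, hl, he, he'⟩
    refine hs.eq_zero_of_isBilap t (fun i => etr_eq_zero _ fun s hsI => by
      rw [he i s hsI]; simp) (fun i => ?_) hl
    rw [Lp.eq_zero_iff_ae_eq_zero, Fin.sum_univ_two]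
    have hG := fun j => (t.2.2.2.2 j).2.1
    filter_upwards [Lp.coeFn_add (K.normal i 0 • etr (hG 0) i) (K.normal i 1 • etr (hG 1) i),
      Lp.coeFn_smul (K.normal i 0) (etr (hG 0) i), Lp.coeFn_smul (K.normal i 1) (etr (hG 1) i),
      etr_ae (hG 0) i, etr_ae (hG 1) i, ae_restrict_mem measurableSet_Icc] with s a1 a2 a3 a4 a5 a6
    have := he' i s a6
    rw [normalPart, Fin.sum_univ_two] at this
    rw [a1, Pi.add_apply, a2, a3, Pi.smul_apply, Pi.smul_apply, a4, a5, smul_eq_mul, smul_eq_mul,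
      mul_comm, mul_comm (K.normal i 1), this]
    simp

end Polygon

/-! ### Maps that are linear or bilinear on subspaces -/

/-- `T` is linear on the subspace `V`. -/
structure LinOn {E F : Type*} [AddCommGroup E] [Module ℝ E] [AddCommGroup F] [Module ℝ F]
    (V : Submodule ℝ E) (T : E → F) : Prop where
  add : ∀ u ∈ V, ∀ v ∈ V, T (u + v) = T u + T v
  smul : ∀ (c : ℝ), ∀ v ∈ V, T (c • v) = c • T v

/-- `f` is bilinear on `V × W`. -/
structure BilinOn {E F : Type*} [AddCommGroup E] [Module ℝ E] [AddCommGroup F] [Module ℝ F]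
    (V : Submodule ℝ E) (W : Submodule ℝ F) (f : E → F → ℝ) : Prop where
  left : ∀ w ∈ W, LinOn V fun v => f v w
  right : ∀ v ∈ V, LinOn W (f v)

section Linear

variable {E F G : Type*} [AddCommGroup E] [Module ℝ E] [AddCommGroup F] [Module ℝ F]
  [AddCommGroup G] [Module ℝ G] {V : Submodule ℝ E} {W : Submodule ℝ F}

theorem LinOn.of_linear (T : E →ₗ[ℝ] F) : LinOn V T :=
  ⟨fun _ _ _ _ => map_add T _ _, fun _ _ _ => map_smul T _ _⟩

theorem LinOn.comp {T : E → F} (h : LinOn V T) (L : F →ₗ[ℝ] G) : LinOn V fun v => L (T v) :=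
  ⟨fun u hu v hv => by simp only [h.add u hu v hv, map_add],
    fun c v hv => by simp only [h.smul c v hv, map_smul]⟩

theorem LinOn.comp_mem {T : E → F} (h : LinOn V T) {L : F → G} (hL : LinOn W L)
    (hm : ∀ v ∈ V, T v ∈ W) : LinOn V fun v => L (T v) :=
  ⟨fun u hu v hv => by simp only [h.add u hu v hv, hL.add _ (hm u hu) _ (hm v hv)],
    fun c v hv => by simp only [h.smul c v hv, hL.smul c _ (hm v hv)]⟩

theorem LinOn.add_fun {T T' : E → F} (h : LinOn V T) (h' : LinOn V T') :
    LinOn V fun v => T v + T' v :=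
  ⟨fun u hu v hv => by simp only [h.add u hu v hv, h'.add u hu v hv]; abel,
    fun c v hv => by simp only [h.smul c v hv, h'.smul c v hv, smul_add]⟩

theorem LinOn.sub_fun {T T' : E → F} (h : LinOn V T) (h' : LinOn V T') :
    LinOn V fun v => T v - T' v :=
  ⟨fun u hu v hv => by simp only [h.add u hu v hv, h'.add u hu v hv]; abel,
    fun c v hv => by simp only [h.smul c v hv, h'.smul c v hv, smul_sub]⟩

theorem LinOn.sum {ι : Type*} {s : Finset ι} {T : ι → E → F} (h : ∀ i ∈ s, LinOn V (T i)) :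
    LinOn V fun v => ∑ i ∈ s, T i v :=
  ⟨fun u hu v hv => by
    rw [← Finset.sum_add_distrib]
    exact Finset.sum_congr rfl fun i hi => (h i hi).add u hu v hv,
  fun c v hv => by
    rw [Finset.smul_sum]
    exact Finset.sum_congr rfl fun i hi => (h i hi).smul c v hv⟩

theorem BilinOn.inner {H : Type*} [NormedAddCommGroup H] [InnerProductSpace ℝ H] {T : E → H}
    {T' : F → H} (h : LinOn V T) (h' : LinOn W T') : BilinOn V W fun u v => ⟪T u, T' v⟫ :=
  ⟨fun w _ => ⟨fun u hu v hv => by simp only [h.add u hu v hv, inner_add_left],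
    fun c v hv => by simp only [h.smul c v hv, real_inner_smul_left, smul_eq_mul]⟩,
  fun w _ => ⟨fun u hu v hv => by simp only [h'.add u hu v hv, inner_add_right],
    fun c v hv => by simp only [h'.smul c v hv, real_inner_smul_right, smul_eq_mul]⟩⟩

theorem BilinOn.add {f g : E → F → ℝ} (h : BilinOn V W f) (h' : BilinOn V W g) :
    BilinOn V W fun u v => f u v + g u v :=
  ⟨fun w hw => (h.left w hw).add_fun (h'.left w hw),
    fun v hv => (h.right v hv).add_fun (h'.right v hv)⟩

theorem BilinOn.sub {f g : E → F → ℝ} (h : BilinOn V W f) (h' : BilinOn V W g) :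
    BilinOn V W fun u v => f u v - g u v :=
  ⟨fun w hw => (h.left w hw).sub_fun (h'.left w hw),
    fun v hv => (h.right v hv).sub_fun (h'.right v hv)⟩

theorem BilinOn.sum {ι : Type*} {s : Finset ι} {f : ι → E → F → ℝ}
    (h : ∀ i ∈ s, BilinOn V W (f i)) : BilinOn V W fun u v => ∑ i ∈ s, f i u v :=
  ⟨fun w hw => LinOn.sum fun i hi => (h i hi).left w hw,
    fun v hv => LinOn.sum fun i hi => (h i hi).right v hv⟩

theorem BilinOn.const_mul {f : E → F → ℝ} (c : ℝ) (h : BilinOn V W f) :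
    BilinOn V W fun u v => c * f u v :=
  ⟨fun w hw => (h.left w hw).comp (LinearMap.mulLeft ℝ c),
    fun v hv => (h.right v hv).comp (LinearMap.mulLeft ℝ c)⟩

theorem BilinOn.swap {f : E → F → ℝ} (h : BilinOn V W f) : BilinOn W V fun w v => f v w :=
  ⟨h.right, h.left⟩

theorem BilinOn.comp {E' F' : Type*} [AddCommGroup E'] [Module ℝ E'] [AddCommGroup F']
    [Module ℝ F'] {V' : Submodule ℝ E'} {W' : Submodule ℝ F'} {f : E → F → ℝ} (h : BilinOn V W f)
    {A : E' → E} {B : F' → F} (hA : LinOn V' A) (hB : LinOn W' B) (mA : ∀ v ∈ V', A v ∈ V)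
    (mB : ∀ w ∈ W', B w ∈ W) : BilinOn V' W' fun u v => f (A u) (B v) :=
  ⟨fun w hw => hA.comp_mem (h.left _ (mB w hw)) mA,
    fun v hv => hB.comp_mem (h.right _ (mA v hv)) mB⟩

theorem BilinOn.exists_bilinForm {f : E → E → ℝ} (h : BilinOn V V f) :
    ∃ B : LinearMap.BilinForm ℝ V, ∀ x y : V, B x y = f x y :=
  ⟨LinearMap.mk₂ ℝ (fun x y : V => f x y)
    (fun x x' y => (h.left y y.2).add x x.2 x' x'.2) (fun c x y => (h.left y y.2).smul c x x.2)
    (fun x y y' => (h.right x x.2).add y y.2 y' y'.2) (fun c x y => (h.right x x.2).smul c y y.2),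
    fun _ _ => rfl⟩

theorem BilinOn.cauchy_schwarz {f : E → E → ℝ} (h : BilinOn V V f)
    (hsymm : ∀ u ∈ V, ∀ v ∈ V, f u v = f v u) (hpos : ∀ v ∈ V, 0 ≤ f v v) {u v : E} (hu : u ∈ V)
    (hv : v ∈ V) : f u v ^ 2 ≤ f u u * f v v := by
  obtain ⟨B, hB⟩ := h.exists_bilinForm
  have := LinearMap.BilinForm.apply_sq_le_of_symm B (fun x => by rw [hB]; exact hpos x x.2)
    ⟨fun x y => by rw [hB, hB]; exact hsymm x x.2 y y.2⟩ ⟨u, hu⟩ ⟨v, hv⟩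
  simpa only [hB] using this

/-- `P` is a linear projection of `V` onto the subspace `W`. -/
structure IsProjOn (V W : Submodule ℝ E) (P : E → E) : Prop where
  lin : LinOn V P
  mem : ∀ v ∈ V, P v ∈ W
  id : ∀ w ∈ W, P w = w
  le : W ≤ V

variable {X : Submodule ℝ E} {P : E → E}

theorem IsProjOn.sub_mem (h : IsProjOn V X P) {v : E} (hv : v ∈ V) : v - P v ∈ V :=
  V.sub_mem hv (h.le (h.mem v hv))

/-- The remainder lies in the kernel of the projection, the only place where the stabilisation
bounds are assumed. -/
theorem IsProjOn.apply_sub (h : IsProjOn V X P) {v : E} (hv : v ∈ V) : P (v - P v) = 0 := by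
  have h1 := h.lin.add (v - P v) (h.sub_mem hv) (P v) (h.le (h.mem v hv))
  rw [sub_add_cancel, h.id _ (h.mem v hv)] at h1
  exact right_eq_add.1 h1

end Linear

section EvalOn

variable {E : Type} [AddCommGroup E] [Module ℝ E] {V X : Submodule ℝ E} {P : E → E}

theorem evalOn_eq (S : LinearMap.BilinForm ℝ V) {u v : E} (hu : u ∈ V) (hv : v ∈ V) :
    evalOn S u v = S ⟨u, hu⟩ ⟨v, hv⟩ := dif_pos ⟨hu, hv⟩

theorem bilinOn_evalOn (S : LinearMap.BilinForm ℝ V) : BilinOn V V (evalOn S) where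
  left w hw := ⟨fun u hu v hv => by
      rw [evalOn_eq S hu hw, evalOn_eq S hv hw, evalOn_eq S (V.add_mem hu hv) hw,
        ← LinearMap.add_apply, ← map_add]
      rfl,
    fun c v hv => by
      rw [evalOn_eq S hv hw, evalOn_eq S (V.smul_mem c hv) hw, ← LinearMap.smul_apply, ← map_smul]
      rfl⟩
  right w hw := ⟨fun u hu v hv => by
      rw [evalOn_eq S hw hu, evalOn_eq S hw hv, evalOn_eq S hw (V.add_mem hu hv), ← map_add]
      rfl,
    fun c v hv => by
      rw [evalOn_eq S hw hv, evalOn_eq S hw (V.smul_mem c hv), ← map_smul]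
      rfl⟩

theorem IsProjOn.bilinOn_evalOn (h : IsProjOn V X P) (S : LinearMap.BilinForm ℝ V) :
    BilinOn V V fun u v => evalOn S (u - P u) (v - P v) :=
  have hl : LinOn V fun v => v - P v := (LinOn.of_linear LinearMap.id).sub_fun h.lin
  (PlateVEM.bilinOn_evalOn S).comp hl hl (fun _ hv => h.sub_mem hv) (fun _ hv => h.sub_mem hv)

/-- No membership is required: outside the subspace `evalOn` takes the value zero for either order
of the arguments. -/
theorem IsSPD.evalOn_symm {S : LinearMap.BilinForm ℝ V} (hS : IsSPD S) (u v : E) :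
    evalOn S u v = evalOn S v u := by
  by_cases h : u ∈ V ∧ v ∈ V
  · rw [evalOn_eq S h.1 h.2, evalOn_eq S h.2 h.1]
    exact hS.1.eq _ _
  · unfold evalOn
    rw [dif_neg h, dif_neg fun h' => h h'.symm]

theorem IsSPD.evalOn_nonneg {S : LinearMap.BilinForm ℝ V} (hS : IsSPD S) (v : E) :
    0 ≤ evalOn S v v := by
  by_cases h : v ∈ V ∧ v ∈ V
  · rw [evalOn_eq S h.1 h.1]
    by_cases hv : (⟨v, h.1⟩ : V) = 0
    · rw [hv, map_zero]
    · exact (hS.2 _ hv).le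
  · unfold evalOn
    rw [dif_neg h]

end EvalOn

/-! ### Well-posedness of coercive problems on finite-dimensional spaces -/

/-- The Lax-Milgram theorem in finite dimension. Coercivity makes the induced map into the dual
injective, and equality of dimensions makes it surjective. Testing with the solution gives the
stability estimate. -/
theorem wellPosed_of_coercive {E J : Type} [AddCommGroup E] [Module ℝ E] (X : Submodule ℝ E)
    [FiniteDimensional ℝ X] {nrm : E → ℝ} {A : E → E → ℝ} {F : J → E → ℝ} {M c : ℝ} (hc : 0 < c)
    (hA : BilinOn X X A) (hF : ∀ d, LinOn X (F d)) (hn : ∀ x, 0 ≤ nrm x)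
    (hn0 : ∀ x ∈ X, nrm x = 0 → x = 0)
    (hM : ∀ x ∈ X, ∀ y ∈ X, |A x y| ≤ M * nrm x * nrm y)
    (hcoer : ∀ x ∈ X, c * nrm x ^ 2 ≤ A x x)
    (hFb : ∀ d, ∃ C : ℝ, 0 ≤ C ∧ ∀ y ∈ X, |F d y| ≤ C * nrm y) :
    WellPosed X nrm A F M c := by
  obtain ⟨B, hB⟩ := hA.exists_bilinForm
  refine ⟨⟨B, hB⟩, hM, hcoer, fun d => ⟨hFb d, ?_, ?_⟩⟩
  · have hinj : Function.Injective B := by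
      rw [← LinearMap.ker_eq_bot, LinearMap.ker_eq_bot']
      intro x hx
      have h1 : A x x = 0 := by rw [← hB, hx]; rfl
      have h2 := hcoer x x.2
      rw [h1] at h2
      have h3 : nrm x ^ 2 = 0 := le_antisymm (nonpos_of_mul_nonpos_right h2 hc) (sq_nonneg _)
      exact Subtype.ext (hn0 x x.2 (by simpa using h3))
    have hsurj : Function.Surjective B :=
      (LinearMap.injective_iff_surjective_of_finrank_eq_finrank
        Subspace.dual_finrank_eq.symm).1 hinj
    let f : Module.Dual ℝ X :=
      { toFun := fun y => F d y
        map_add' := fun y y' => (hF d).add y y.2 y' y'.2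
        map_smul' := fun s y => (hF d).smul s y y.2 }
    obtain ⟨x, hx⟩ := hsurj f
    refine ⟨x, ⟨x.2, fun y hy => ?_⟩, ?_⟩
    · exact (hB x ⟨y, hy⟩).symm.trans (LinearMap.congr_fun hx ⟨y, hy⟩)
    · rintro z ⟨hz, hzz⟩
      have : B ⟨z, hz⟩ = f := LinearMap.ext fun y => (hB _ y).trans (hzz y y.2)
      exact congrArg Subtype.val (hinj (this.trans hx.symm))
  · intro x hx hsol C hC hFC
    have h1 := hcoer x hx
    rw [hsol x hx] at h1
    have h2 := h1.trans ((le_abs_self _).trans (hFC x hx))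
    -- If the norm is positive, one power of it is cancelled from the tested equation. If it is
    -- zero, nothing is claimed beyond 0 ≤ C.
    rcases (hn x).eq_or_lt with h0 | h0
    · rw [← h0, mul_zero]; exact hC
    · refine le_of_mul_le_mul_right ?_ h0
      calc c * nrm x * nrm x = c * nrm x ^ 2 := by ring
        _ ≤ C * nrm x := h2

/-! ### Local schemes -/

/-- The properties of the local ingredients on which the analysis rests. -/
structure LocalScheme.Good {K : Polygon} (L : LocalScheme K) (k ℓ : ℕ) : Prop where
  V_H2 : ∀ v ∈ L.V, MemH2 K.carrier v
  Q_H1 : ∀ q ∈ L.Q, MemH1 K.carrier q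
  PH : IsProjOn L.V (K.polySpace k) L.PH
  PG : IsProjOn L.Q (K.polySpace ℓ) L.PG
  PH_orth : ∀ v ∈ L.V, ∀ χ ∈ K.polySpace k,
    hessForm K.carrier (L.PH v) χ = hessForm K.carrier v χ
  PG_orth : ∀ q ∈ L.Q, ∀ χ ∈ K.polySpace ℓ,
    gradForm K.carrier (L.PG q) χ = gradForm K.carrier q χ
  fin_V : FiniteDimensional ℝ L.V
  fin_Q : FiniteDimensional ℝ L.Q

namespace Polygon

variable {K : Polygon} {x₀ : Plane} {r : ℝ}

theorem LinearRel.isProjOn {R : L2 K.carrier → MvPolynomial (Fin 2) ℝ → Prop}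
    (hR : K.LinearRel R) {k : ℕ} {V : Submodule ℝ (L2 K.carrier)} (hle : K.polySpace k ≤ V)
    (hex : ∀ v ∈ V, ∃ p ∈ P k, R v p) (hp : ∀ p ∈ P k, R (K.poly p) p) :
    IsProjOn V (K.polySpace k) fun v => K.pick (R v) where
  lin := ⟨fun u hu v hv => by
      obtain ⟨p, -, h⟩ := hex u hu
      obtain ⟨p', -, h'⟩ := hex v hv
      simp only [hR.pick_eq h, hR.pick_eq h', hR.pick_eq (hR.add h h'), map_add],
    fun c v hv => by
      obtain ⟨p, -, h⟩ := hex v hv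
      simp only [hR.pick_eq h, hR.pick_eq (hR.smul c h), map_smul]⟩
  mem v hv := by
    obtain ⟨p, hpk, h⟩ := hex v hv
    simp only [hR.pick_eq h]
    exact poly_mem hpk
  id := by
    rintro _ ⟨p, hpk, rfl⟩
    exact hR.pick_eq (hp p hpk)
  le := hle

theorem StarBall.good_conforming (hs : K.StarBall x₀ r) {k ℓ : ℕ} (hk : 2 ≤ k) :
    (K.conforming k ℓ).Good k ℓ where
  V_H2 := by rintro v ⟨w, G, f, p, t, -⟩; exact t.1
  Q_H1 := by rintro v ⟨g, f, p, t, -⟩; exact t.1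
  PH := (hs.linearRel_HC k).isProjOn (hs.polySpace_le_Vc hk)
    (by rintro v ⟨w, G, f, p, -, -, -, -, -, -, h, -⟩; exact ⟨p, h.1.1, h⟩)
    fun p hp => hs.isHessProjC_poly hp
  PG := (hs.linearRel_GC ℓ).isProjOn (hs.polySpace_le_Qc ℓ)
    (by rintro v ⟨g, f, p, -, -, -, -, -, h, -⟩; exact ⟨p, h.1.1, h⟩)
    fun p hp => hs.isGradProjC_poly hp
  PH_orth := by
    rintro v ⟨w, G, f, p, -, -, -, -, -, -, h, -⟩ _ ⟨χ, hχ, rfl⟩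
    have : (K.conforming k ℓ).PH v = K.poly p := (hs.linearRel_HC k).pick_eq h
    rw [this]
    exact h.1.2 χ hχ
  PG_orth := by
    rintro v ⟨g, f, p, -, -, -, -, -, h, -⟩ _ ⟨χ, hχ, rfl⟩
    have : (K.conforming k ℓ).PG v = K.poly p := (hs.linearRel_GC ℓ).pick_eq h
    rw [this]
    exact h.1.2 χ hχ
  fin_V := hs.finite_Vc k
  fin_Q := hs.finite_Qc ℓ

theorem StarBall.good_nonconforming (hs : K.StarBall x₀ r) {k ℓ : ℕ} (hk : 2 ≤ k) (hℓ : 1 ≤ ℓ) :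
    (K.nonconforming k ℓ).Good k ℓ where
  V_H2 := by rintro v ⟨w, G, f, g, p, t, -⟩; exact t.1
  Q_H1 := by rintro v ⟨g, f, q, p, t, -⟩; exact t.1
  PH := (hs.linearRel_HNC k).isProjOn (hs.polySpace_le_Vnc hk)
    (by rintro v ⟨w, G, f, g, p, -, -, -, -, -, -, -, h, -⟩; exact ⟨p, h.1.1, h⟩)
    fun p hp => hs.isHessProjNC_poly hp
  PG := (hs.linearRel_GNC ℓ).isProjOn (hs.polySpace_le_Qnc hℓ)
    (by rintro v ⟨g, f, q, p, -, -, -, -, -, -, h, -⟩; exact ⟨p, h.1.1, h⟩)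
    fun p hp => hs.isGradProjNC_poly hp
  PH_orth := by
    rintro v ⟨w, G, f, g, p, -, -, -, -, -, -, -, h, -⟩ _ ⟨χ, hχ, rfl⟩
    have : (K.nonconforming k ℓ).PH v = K.poly p := (hs.linearRel_HNC k).pick_eq h
    rw [this]
    exact h.1.2 χ hχ
  PG_orth := by
    rintro v ⟨g, f, q, p, -, -, -, -, -, -, h, -⟩ _ ⟨χ, hχ, rfl⟩
    have : (K.nonconforming k ℓ).PG v = K.poly p := (hs.linearRel_GNC ℓ).pick_eq h
    rw [this]
    exact h.1.2 χ hχ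
  fin_V := hs.finite_Vnc k
  fin_Q := hs.finite_Qnc ℓ

end Polygon

/-! ### Bounds of the local forms -/

/-- Pythagoras' identity for a symmetric form. It is stated for forms that are bilinear only on a
subspace, as `hessForm` and `gradForm` are additive only where weak derivatives exist. -/
theorem BilinOn.sub_self_of_orth {E : Type*} [AddCommGroup E] [Module ℝ E] {V : Submodule ℝ E}
    {f : E → E → ℝ} (h : BilinOn V V f) (hs : ∀ u v, f u v = f v u) {v p : E} (hv : v ∈ V)
    (hp : p ∈ V) (ho : f p p = f v p) : f (v - p) (v - p) = f v v - f p p := by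
  have hn : (-1 : ℝ) • p ∈ V := V.smul_mem _ hp
  have h1 := (h.left _ (V.add_mem hv hn)).add v hv _ hn
  have h2 := (h.right v hv).add v hv _ hn
  have h3 := (h.right _ hn).add v hv _ hn
  have h4 := (h.right v hv).smul (-1) p hp
  have h5 := (h.left v hv).smul (-1) p hp
  have h6 := (h.left _ hn).smul (-1) p hp
  have h7 := (h.right p hp).smul (-1) p hp
  have h8 := hs p v
  simp only [smul_eq_mul] at h1 h2 h3 h4 h5 h6 h7
  rw [sub_eq_add_neg, ← neg_one_smul ℝ p]
  linarith

/-- A common bound for all constants of the stabilisation bounds. -/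
def StabConstants.kappa (C : StabConstants) : ℝ := 1 + C.CH + C.C0 + C.CG + C.D0

theorem StabConstants.one_le_kappa (C : StabConstants) : 1 ≤ C.kappa := by
  unfold kappa; linarith [C.CH_pos, C.C0_pos, C.CG_pos, C.D0_pos]

namespace Polygon

variable {K : Polygon}

theorem isProjOn_proj {k : ℕ} {V : Submodule ℝ (L2 K.carrier)} (h : K.polySpace k ≤ V) :
    IsProjOn V (K.polySpace k) (K.proj k) where
  lin := LinOn.of_linear (K.proj k : L2 K.carrier →ₗ[ℝ] L2 K.carrier)
  mem v _ := (K.polySpace k).starProjection_apply_mem v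
  id _ hw := Submodule.starProjection_eq_self_iff.2 hw
  le := h

theorem inner_proj {k : ℕ} (u : L2 K.carrier) {w : L2 K.carrier} (hw : w ∈ K.polySpace k) :
    ⟪K.proj k u, w⟫ = ⟪u, w⟫ := by
  have := (K.polySpace k).starProjection_inner_eq_zero u w hw
  rw [inner_sub_left, sub_eq_zero] at this
  exact this.symm

theorem norm_sq_proj (k : ℕ) (u : L2 K.carrier) :
    ‖u‖ ^ 2 = ‖K.proj k u‖ ^ 2 + ‖u - K.proj k u‖ ^ 2 := by
  have h0 := inner_proj u ((K.polySpace k).starProjection_apply_mem u)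
  have h1 := norm_sub_sq_real u (K.proj k u)
  change ⟪K.proj k u, K.proj k u⟫ = ⟪u, K.proj k u⟫ at h0
  rw [real_inner_self_eq_norm_sq] at h0
  linarith

theorem norm_proj_le (k : ℕ) (u : L2 K.carrier) : ‖K.proj k u‖ ≤ ‖u‖ :=
  (K.polySpace k).norm_starProjection_apply_le u

theorem linOn_weakD {V : Submodule ℝ (L2 K.carrier)} (hV : ∀ v ∈ V, MemH1 K.carrier v) (i : Fin 2) :
    LinOn V (weakD K.carrier i) :=
  ⟨fun u hu v hv => weakD_add K.isOpen (hV u hu) (hV v hv) i,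
    fun c v hv => weakD_smul K.isOpen c (hV v hv) i⟩

theorem linOn_weakD2 {V : Submodule ℝ (L2 K.carrier)} (hV : ∀ v ∈ V, MemH2 K.carrier v)
    (i j : Fin 2) : LinOn V fun v => weakD K.carrier j (weakD K.carrier i v) :=
  ⟨fun u hu v hv => by
    rw [weakD_add K.isOpen (hV u hu).1 (hV v hv).1,
      weakD_add K.isOpen ((hV u hu).2 i) ((hV v hv).2 i)],
    fun c v hv => by
    rw [weakD_smul K.isOpen c (hV v hv).1, weakD_smul K.isOpen c ((hV v hv).2 i)]⟩

theorem bilinOn_hessForm {V : Submodule ℝ (L2 K.carrier)} (hV : ∀ v ∈ V, MemH2 K.carrier v) :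
    BilinOn V V (hessForm K.carrier) :=
  BilinOn.sum fun i _ => BilinOn.sum fun j _ =>
    BilinOn.inner (linOn_weakD2 hV i j) (linOn_weakD2 hV i j)

theorem bilinOn_gradForm {V : Submodule ℝ (L2 K.carrier)} (hV : ∀ v ∈ V, MemH1 K.carrier v) :
    BilinOn V V (gradForm K.carrier) :=
  BilinOn.sum fun i _ => BilinOn.inner (linOn_weakD hV i) (linOn_weakD hV i)

theorem hessForm_comm (u v : L2 K.carrier) : hessForm K.carrier u v = hessForm K.carrier v u :=
  Finset.sum_congr rfl fun _ _ => Finset.sum_congr rfl fun _ _ => real_inner_comm _ _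

theorem gradForm_comm (u v : L2 K.carrier) : gradForm K.carrier u v = gradForm K.carrier v u :=
  Finset.sum_congr rfl fun _ _ => real_inner_comm _ _

/-- The second derivatives of p are polynomials of degree at most k - 2, so in the product with p
only the projected Hessian of v counts. Young's inequality and absorption give the constant one. -/
theorem hessForm_le_of_orth {k : ℕ} {v p : L2 K.carrier} (hp : p ∈ K.polySpace k)
    (ho : hessForm K.carrier p p = hessForm K.carrier v p) :
    hessForm K.carrier p p ≤
      ∑ i, ∑ j, ‖K.proj (k - 2) (weakD K.carrier j (weakD K.carrier i v))‖ ^ 2 := by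
  have h : hessForm K.carrier v p ≤ ∑ i, ∑ j,
      (‖K.proj (k - 2) (weakD K.carrier j (weakD K.carrier i v))‖ ^ 2 +
        ‖weakD K.carrier j (weakD K.carrier i p)‖ ^ 2) / 2 := by
    refine Finset.sum_le_sum fun i _ => Finset.sum_le_sum fun j _ => ?_
    have hm : weakD K.carrier j (weakD K.carrier i p) ∈ K.polySpace (k - 2) := by
      have := weakD_mem (weakD_mem hp i) j
      rwa [Nat.sub_sub] at this
    rw [← inner_proj _ hm]
    have := real_inner_le_norm (K.proj (k - 2) (weakD K.carrier j (weakD K.carrier i v)))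
      (weakD K.carrier j (weakD K.carrier i p))
    nlinarith [sq_nonneg (‖K.proj (k - 2) (weakD K.carrier j (weakD K.carrier i v))‖ -
      ‖weakD K.carrier j (weakD K.carrier i p)‖)]
  simp only [← Finset.sum_div, Finset.sum_add_distrib] at h
  rw [← ho, ← hessForm_self] at h
  linarith

theorem gradForm_le_of_orth {k : ℕ} {v p : L2 K.carrier} (hp : p ∈ K.polySpace k)
    (ho : gradForm K.carrier p p = gradForm K.carrier v p) :
    gradForm K.carrier p p ≤ ∑ i, ‖K.proj (k - 1) (weakD K.carrier i v)‖ ^ 2 := by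
  have h : gradForm K.carrier v p ≤ ∑ i, (‖K.proj (k - 1) (weakD K.carrier i v)‖ ^ 2 +
        ‖weakD K.carrier i p‖ ^ 2) / 2 := by
    refine Finset.sum_le_sum fun i _ => ?_
    rw [← inner_proj _ (weakD_mem hp i)]
    have := real_inner_le_norm (K.proj (k - 1) (weakD K.carrier i v)) (weakD K.carrier i p)
    nlinarith [sq_nonneg (‖K.proj (k - 1) (weakD K.carrier i v)‖ - ‖weakD K.carrier i p‖)]
  simp only [← Finset.sum_div, Finset.sum_add_distrib] at h
  rw [← ho, ← gradForm_self] at h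
  linarith

end Polygon

section LocalForms

open PlateVEM.Polygon

variable {K : Polygon} {L : LocalScheme K} {k ℓ : ℕ} {S : Stabilisation L} {α β γ : ℝ}
  {C : StabConstants}

theorem LocalScheme.Good.bilinOn_a1h (hL : L.Good k ℓ) (S : Stabilisation L) :
    BilinOn L.V L.V (a1h S k) :=
  (((BilinOn.inner (isProjOn_proj hL.PH.le).lin (isProjOn_proj hL.PH.le).lin).add
    ((isProjOn_proj hL.PH.le).bilinOn_evalOn S.S0)).add
    (BilinOn.sum fun i _ => BilinOn.sum fun j _ => BilinOn.inner
      ((linOn_weakD2 hL.V_H2 i j).comp (K.proj (k - 2) : L2 K.carrier →ₗ[ℝ] L2 K.carrier))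
      ((linOn_weakD2 hL.V_H2 i j).comp (K.proj (k - 2) : L2 K.carrier →ₗ[ℝ] L2 K.carrier)))).add
    (hL.PH.bilinOn_evalOn S.SH)

theorem LocalScheme.Good.bilinOn_a2h (hL : L.Good k ℓ) (α : ℝ) :
    BilinOn L.Q L.V (a2h K k ℓ α) :=
  (BilinOn.sum fun i _ => BilinOn.inner
    ((linOn_weakD hL.Q_H1 i).comp (K.proj (ℓ - 1) : L2 K.carrier →ₗ[ℝ] L2 K.carrier))
    ((linOn_weakD (fun v hv => (hL.V_H2 v hv).1) i).comp
      (K.proj (k - 1) : L2 K.carrier →ₗ[ℝ] L2 K.carrier))).const_mul α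

theorem LocalScheme.Good.bilinOn_a3h (hL : L.Good k ℓ) (S : Stabilisation L) (β γ : ℝ) :
    BilinOn L.Q L.Q (a3h S ℓ β γ) :=
  ((((BilinOn.inner (isProjOn_proj hL.PG.le).lin (isProjOn_proj hL.PG.le).lin).const_mul β).add
    ((isProjOn_proj hL.PG.le).bilinOn_evalOn S.R0)).add
    ((BilinOn.sum fun i _ => BilinOn.inner
      ((linOn_weakD hL.Q_H1 i).comp (K.proj (ℓ - 1) : L2 K.carrier →ₗ[ℝ] L2 K.carrier))
      ((linOn_weakD hL.Q_H1 i).comp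
        (K.proj (ℓ - 1) : L2 K.carrier →ₗ[ℝ] L2 K.carrier))).const_mul γ)).add
    (hL.PG.bilinOn_evalOn S.SG)

theorem Stabilisation.Admissible.a1h_symm (hS : S.Admissible k ℓ β γ C) (u v : L2 K.carrier) :
    a1h S k u v = a1h S k v u := by
  unfold a1h
  rw [real_inner_comm, hS.spd_S0.evalOn_symm, hS.spd_SH.evalOn_symm]
  congr 2
  exact Finset.sum_congr rfl fun _ _ => Finset.sum_congr rfl fun _ _ => real_inner_comm _ _

theorem Stabilisation.Admissible.a3h_symm (hS : S.Admissible k ℓ β γ C) (u v : L2 K.carrier) :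
    a3h S ℓ β γ u v = a3h S ℓ β γ v u := by
  unfold a3h
  rw [real_inner_comm, hS.spd_R0.evalOn_symm, hS.spd_SG.evalOn_symm]
  congr 3
  exact Finset.sum_congr rfl fun _ _ => real_inner_comm _ _

theorem a1h_self (S : Stabilisation L) (k : ℕ) (v : L2 K.carrier) : a1h S k v v =
    ‖K.proj k v‖ ^ 2 + evalOn S.S0 (v - K.proj k v) (v - K.proj k v) +
    (∑ i, ∑ j, ‖K.proj (k - 2) (weakD K.carrier j (weakD K.carrier i v))‖ ^ 2) +
    evalOn S.SH (v - L.PH v) (v - L.PH v) := by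
  unfold a1h
  simp only [real_inner_self_eq_norm_sq]

theorem a3h_self (S : Stabilisation L) (ℓ : ℕ) (β γ : ℝ) (q : L2 K.carrier) : a3h S ℓ β γ q q =
    β * ‖K.proj ℓ q‖ ^ 2 + evalOn S.R0 (q - K.proj ℓ q) (q - K.proj ℓ q) +
    γ * (∑ i, ‖K.proj (ℓ - 1) (weakD K.carrier i q)‖ ^ 2) +
    evalOn S.SG (q - L.PG q) (q - L.PG q) := by
  unfold a3h
  simp only [real_inner_self_eq_norm_sq]

theorem le_mul_of_inv_mul_le {c a b : ℝ} (hc : 0 < c) (h : c⁻¹ * a ≤ b) : a ≤ c * b := by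
  rwa [inv_mul_le_iff₀ hc] at h

theorem LocalScheme.Good.hess_split (hL : L.Good k ℓ) {v : L2 K.carrier} (hv : v ∈ L.V) :
    hessForm K.carrier (v - L.PH v) (v - L.PH v) =
      hessForm K.carrier v v - hessForm K.carrier (L.PH v) (L.PH v) :=
  (bilinOn_hessForm hL.V_H2).sub_self_of_orth hessForm_comm hv (hL.PH.le (hL.PH.mem v hv))
    (hL.PH_orth v hv _ (hL.PH.mem v hv))

theorem LocalScheme.Good.grad_split (hL : L.Good k ℓ) {v : L2 K.carrier} (hv : v ∈ L.Q) :
    gradForm K.carrier (v - L.PG v) (v - L.PG v) =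
      gradForm K.carrier v v - gradForm K.carrier (L.PG v) (L.PG v) :=
  (bilinOn_gradForm hL.Q_H1).sub_self_of_orth gradForm_comm hv (hL.PG.le (hL.PG.mem v hv))
    (hL.PG_orth v hv _ (hL.PG.mem v hv))

/-- The arithmetic of the lower bound: x and d stand for the two consistency terms, a and b for the
two stabilisation terms, each of which enters with its own constant. -/
theorem add_le_mul_of_le {κ c₁ c₂ x a d b n h : ℝ} (h1 : c₁ ≤ κ) (h2 : c₂ ≤ κ) (h3 : 1 ≤ κ)
    (hx : 0 ≤ x) (ha : 0 ≤ a) (hd : 0 ≤ d) (hb : 0 ≤ b) (hn : n ≤ x + c₁ * a)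
    (hh : h ≤ d + c₂ * b) : n + h ≤ κ * (x + a + d + b) := by
  have k1 := mul_le_mul_of_nonneg_right h1 ha
  have k2 := mul_le_mul_of_nonneg_right h2 hb
  have k3 := mul_le_mul_of_nonneg_right h3 hx
  have k4 := mul_le_mul_of_nonneg_right h3 hd
  linarith

/-- Both ‖v‖² and |v|₂² split by Pythagoras into a polynomial part, present in the form through the
projections, and a remainder bounded by the stabilisation. For the Hessian the polynomial part is
estimated by `hessForm_le_of_orth`. -/
theorem Stabilisation.Admissible.le_a1h (hS : S.Admissible k ℓ β γ C) (hL : L.Good k ℓ)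
    {v : L2 K.carrier} (hv : v ∈ L.V) :
    ‖v‖ ^ 2 + hessForm K.carrier v v ≤ C.kappa * a1h S k v v := by
  have hp := isProjOn_proj hL.PH.le
  have g1 := C.CH_pos
  have g2 := C.C0_pos
  have g3 := C.CG_pos
  have g4 := C.D0_pos
  rw [a1h_self]
  refine add_le_mul_of_le (c₁ := C.C0) (c₂ := C.CH) (by unfold StabConstants.kappa; linarith)
    (by unfold StabConstants.kappa; linarith) C.one_le_kappa (by positivity)
    (hS.spd_S0.evalOn_nonneg _) (by positivity) (hS.spd_SH.evalOn_nonneg _) ?_ ?_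
  · have s2 := le_mul_of_inv_mul_le C.C0_pos (hS.s2 ⟨_, hp.sub_mem hv⟩ (hp.apply_sub hv)).1
    rw [evalOn_eq S.S0 (hp.sub_mem hv) (hp.sub_mem hv), norm_sq_proj k v]
    exact add_le_add_right s2 _
  · have s1 := le_mul_of_inv_mul_le C.CH_pos
      (hS.s1 ⟨_, hL.PH.sub_mem hv⟩ (hL.PH.apply_sub hv)).1
    have h3 := hessForm_le_of_orth (hL.PH.mem v hv) (hL.PH_orth v hv _ (hL.PH.mem v hv))
    rw [evalOn_eq S.SH (hL.PH.sub_mem hv) (hL.PH.sub_mem hv)]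
    exact (sub_le_iff_le_add'.1 ((hL.hess_split hv).symm.le.trans s1)).trans
      (add_le_add_left h3 _)

/-- Projections do not increase the norm and, by Pythagoras, neither does passing to the remainder.
The upper stabilisation bounds then apply. -/
theorem Stabilisation.Admissible.a1h_le (hS : S.Admissible k ℓ β γ C) (hL : L.Good k ℓ)
    {v : L2 K.carrier} (hv : v ∈ L.V) :
    a1h S k v v ≤ C.kappa * (‖v‖ ^ 2 + hessForm K.carrier v v) := by
  have hp := isProjOn_proj hL.PH.le
  have e1 := evalOn_eq S.S0 (hp.sub_mem hv) (hp.sub_mem hv)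
  have e2 := evalOn_eq S.SH (hL.PH.sub_mem hv) (hL.PH.sub_mem hv)
  have s2 := (hS.s2 ⟨_, hp.sub_mem hv⟩ (hp.apply_sub hv)).2
  have s1 := (hS.s1 ⟨_, hL.PH.sub_mem hv⟩ (hL.PH.apply_sub hv)).2
  rw [← e1] at s2
  rw [← e2] at s1
  have h1 := norm_sq_proj k v
  have h2 := hL.hess_split hv
  have h3 : ∑ i, ∑ j, ‖K.proj (k - 2) (weakD K.carrier j (weakD K.carrier i v))‖ ^ 2 ≤
      hessForm K.carrier v v := by
    rw [hessForm_self]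
    gcongr
    exact norm_proj_le _ _
  rw [a1h_self]
  simp only at s1 s2
  have g1 := C.CH_pos
  have g2 := C.C0_pos
  have g3 := C.CG_pos
  have g4 := C.D0_pos
  have n1 := sq_nonneg ‖K.proj k v‖
  have n2 := sq_nonneg ‖v - K.proj k v‖
  have n3 := hessForm_nonneg (L.PH v)
  have n4 := hessForm_nonneg v
  have k1 : C.C0 * ‖v - K.proj k v‖ ^ 2 ≤ C.C0 * ‖v‖ ^ 2 :=
    mul_le_mul_of_nonneg_left (by linarith) g2.le
  have k2 : C.CH * hessForm K.carrier (v - L.PH v) (v - L.PH v) ≤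
    C.CH * hessForm K.carrier v v := by gcongr; linarith
  have k3 : 0 ≤ (C.CH + C.CG + C.D0) * ‖v‖ ^ 2 := by positivity
  have k4 : 0 ≤ (C.C0 + C.CG + C.D0) * hessForm K.carrier v v := by positivity
  unfold StabConstants.kappa
  linarith

theorem Stabilisation.Admissible.le_a3h (hS : S.Admissible k ℓ β γ C) (hL : L.Good k ℓ)
    (hβ : 0 ≤ β) (hγ : 0 ≤ γ) {v : L2 K.carrier} (hv : v ∈ L.Q) :
    β * ‖v‖ ^ 2 + γ * gradForm K.carrier v v ≤ C.kappa * a3h S ℓ β γ v v := by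
  have hp := isProjOn_proj hL.PG.le
  have e1 := evalOn_eq S.R0 (hp.sub_mem hv) (hp.sub_mem hv)
  have e2 := evalOn_eq S.SG (hL.PG.sub_mem hv) (hL.PG.sub_mem hv)
  have s2 := le_mul_of_inv_mul_le C.D0_pos (hS.s4 ⟨_, hp.sub_mem hv⟩ (hp.apply_sub hv)).1
  have s1 := le_mul_of_inv_mul_le C.CG_pos (hS.s3 ⟨_, hL.PG.sub_mem hv⟩ (hL.PG.apply_sub hv)).1
  rw [← e1] at s2
  rw [← e2] at s1
  have h1 := congrArg (β * ·) (norm_sq_proj ℓ v)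
  have h2 := congrArg (γ * ·) (hL.grad_split hv)
  have h3 := mul_le_mul_of_nonneg_left
    (gradForm_le_of_orth (hL.PG.mem v hv) (hL.PG_orth v hv _ (hL.PG.mem v hv))) hγ
  have n1 := hS.spd_R0.evalOn_nonneg (v - K.proj ℓ v)
  have n2 := hS.spd_SG.evalOn_nonneg (v - L.PG v)
  rw [a3h_self]
  simp only at s1 s2 h1 h2
  have n3 : 0 ≤ γ * ∑ i, ‖K.proj (ℓ - 1) (weakD K.carrier i v)‖ ^ 2 := by positivity
  generalize evalOn S.R0 (v - K.proj ℓ v) (v - K.proj ℓ v) = a at *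
  generalize evalOn S.SG (v - L.PG v) (v - L.PG v) = b at *
  generalize γ * ∑ i, ‖K.proj (ℓ - 1) (weakD K.carrier i v)‖ ^ 2 = d at *
  have n4 : 0 ≤ β * ‖K.proj ℓ v‖ ^ 2 := by positivity
  have g1 := C.CH_pos
  have g2 := C.C0_pos
  have g3 := C.CG_pos
  have g4 := C.D0_pos
  have k1 : C.D0 * a ≤ C.kappa * a := mul_le_mul_of_nonneg_right (by unfold StabConstants.kappa; linarith) n1
  have k2 : C.CG * b ≤ C.kappa * b := mul_le_mul_of_nonneg_right (by unfold StabConstants.kappa; linarith) n2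
  have k3 : d ≤ C.kappa * d := le_mul_of_one_le_left n3 C.one_le_kappa
  have k4 := le_mul_of_one_le_left n4 C.one_le_kappa
  linarith

theorem Stabilisation.Admissible.a3h_le (hS : S.Admissible k ℓ β γ C) (hL : L.Good k ℓ)
    (hβ : 0 ≤ β) (hγ : 0 ≤ γ) {v : L2 K.carrier} (hv : v ∈ L.Q) :
    a3h S ℓ β γ v v ≤ C.kappa * (β * ‖v‖ ^ 2 + γ * gradForm K.carrier v v) := by
  have hp := isProjOn_proj hL.PG.le
  have e1 := evalOn_eq S.R0 (hp.sub_mem hv) (hp.sub_mem hv)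
  have e2 := evalOn_eq S.SG (hL.PG.sub_mem hv) (hL.PG.sub_mem hv)
  have s2 := (hS.s4 ⟨_, hp.sub_mem hv⟩ (hp.apply_sub hv)).2
  have s1 := (hS.s3 ⟨_, hL.PG.sub_mem hv⟩ (hL.PG.apply_sub hv)).2
  rw [← e1] at s2
  rw [← e2] at s1
  have h1 := norm_sq_proj ℓ v
  have h2 := hL.grad_split hv
  have h3 : γ * ∑ i, ‖K.proj (ℓ - 1) (weakD K.carrier i v)‖ ^ 2 ≤
      γ * gradForm K.carrier v v := by
    rw [gradForm_self]
    gcongr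
    exact norm_proj_le _ _
  rw [a3h_self]
  simp only at s1 s2
  have g1 := C.CH_pos
  have g2 := C.C0_pos
  have g3 := C.CG_pos
  have g4 := C.D0_pos
  have n1 := sq_nonneg ‖K.proj ℓ v‖
  have n2 := sq_nonneg ‖v - K.proj ℓ v‖
  have n3 := gradForm_nonneg (L.PG v)
  have n4 := gradForm_nonneg v
  have k0 : β * ‖K.proj ℓ v‖ ^ 2 ≤ β * ‖v‖ ^ 2 := mul_le_mul_of_nonneg_left (by linarith) hβ
  have k1 : C.D0 * (β * ‖v - K.proj ℓ v‖ ^ 2) ≤ C.D0 * (β * ‖v‖ ^ 2) :=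
    mul_le_mul_of_nonneg_left (mul_le_mul_of_nonneg_left (by linarith) hβ) g4.le
  have k2 : C.CG * (γ * gradForm K.carrier (v - L.PG v) (v - L.PG v)) ≤
    C.CG * (γ * gradForm K.carrier v v) := by gcongr; linarith
  have k3 : 0 ≤ (C.CH + C.CG + C.C0) * (β * ‖v‖ ^ 2) := by positivity
  have k4 : 0 ≤ (C.C0 + C.CH + C.D0) * (γ * gradForm K.carrier v v) := by positivity
  unfold StabConstants.kappa
  linarith

theorem abs_a2h_le (h0 : 0 ≤ α) (h1 : α ≤ 1) (k ℓ : ℕ) (p v : L2 K.carrier) :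
    |a2h K k ℓ α p v| ≤ √(gradForm K.carrier p p) * √(gradForm K.carrier v v) := by
  unfold a2h
  rw [abs_mul, abs_of_nonneg h0]
  refine (mul_le_of_le_one_left (abs_nonneg _) h1).trans ?_
  refine (Finset.abs_sum_le_sum_abs _ _).trans ?_
  rw [gradForm_self, gradForm_self]
  refine (Finset.sum_le_sum fun i _ => (abs_real_inner_le_norm _ _).trans
    (mul_le_mul (norm_proj_le _ _) (norm_proj_le _ _) (norm_nonneg _) (norm_nonneg _))).trans ?_
  exact Real.sum_mul_le_sqrt_mul_sqrt _ _ _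

end LocalForms

/-! ### The discrete problem on a mesh -/

namespace Mesh

variable {D : PlateDomain} (T : Mesh D)

theorem res_ae (a : Fin T.N) (v : L2 D.Ω) :
    T.res a v =ᵐ[volume.restrict (T.cell a).carrier] v :=
  MemLp.coeFn_toLp ((Lp.memLp v).mono_measure
    (Measure.restrict_mono (T.subset a) (le_refl volume)))

/-- The closed cells cover the domain, and they exceed the open cells only by segments, which are
null sets. Integrals over the domain thus split into integrals over cells. -/
theorem ae_eq_iUnion : (D.Ω : Set Plane) =ᵐ[volume] ⋃ a, (T.cell a).carrier := by
  have h0 : volume (⋃ a, frontier (T.cell a).carrier) = 0 :=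
    measure_iUnion_null fun a => (T.cell a).volume_frontier
  refine Filter.EventuallyLE.antisymm ?_ (Filter.Eventually.of_forall (iUnion_subset T.subset))
  rw [ae_le_set]
  refine measure_mono_null ?_ h0
  rintro x ⟨hx, hn⟩
  have := T.cover.le (subset_closure hx)
  obtain ⟨a, ha⟩ := mem_iUnion.1 this
  refine mem_iUnion.2 ⟨a, ha, fun hi => hn (mem_iUnion.2 ⟨a, interior_subset hi⟩)⟩

theorem integral_eq_sum {f : Plane → ℝ} (hf : IntegrableOn f D.Ω) :
    ∫ x in D.Ω, f x = ∑ a, ∫ x in (T.cell a).carrier, f x := by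
  rw [setIntegral_congr_set T.ae_eq_iUnion]
  exact integral_iUnion_fintype (fun a => (T.cell a).isOpen.measurableSet)
    (fun a b hab => T.disjoint a b hab) fun a => hf.mono_set (T.subset a)

theorem inner_eq_sum (u v : L2 D.Ω) : ⟪u, v⟫ = ∑ a, ⟪T.res a u, T.res a v⟫ := by
  rw [L2.inner_def, T.integral_eq_sum (L2.integrable_inner u v)]
  refine Finset.sum_congr rfl fun a _ => ?_
  rw [L2.inner_def]
  refine integral_congr_ae ?_
  filter_upwards [T.res_ae a u, T.res_ae a v] with x h1 h2
  rw [h1, h2]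

theorem norm_sq_eq_sum (u : L2 D.Ω) : ‖u‖ ^ 2 = ∑ a, ‖T.res a u‖ ^ 2 := by
  simp only [← real_inner_self_eq_norm_sq]
  exact T.inner_eq_sum u u

theorem eq_zero_of_res {u : L2 D.Ω} (h : ∀ a, T.res a u = 0) : u = 0 := by
  have := T.norm_sq_eq_sum u
  simpa [h] using this

/-- A test function on a cell is a test function on the domain, so weak derivatives can be
restricted. -/
theorem hasWeakD_res (a : Fin T.N) {i : Fin 2} {v w : L2 D.Ω} (h : HasWeakD D.Ω i v w) :
    HasWeakD (T.cell a).carrier i (T.res a v) (T.res a w) := by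
  intro φ hφ
  have key : ∀ (z : L2 D.Ω) {ψ : Plane → ℝ}, (∀ x ∉ (T.cell a).carrier, ψ x = 0) →
      ∫ x in (T.cell a).carrier, T.res a z x * ψ x = ∫ x in D.Ω, z x * ψ x := by
    intro z ψ hψ
    rw [setIntegral_eq_of_subset_of_forall_sdiff_eq_zero D.isOpen.measurableSet (T.subset a)
      fun x hx => by rw [hψ x hx.2, mul_zero]]
    refine integral_congr_ae ?_
    filter_upwards [T.res_ae a z] with x hx
    rw [hx]
  have hφ' : IsTest D.Ω φ := ⟨hφ.1, hφ.2.1, hφ.2.2.trans (T.subset a)⟩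
  rw [key v (ψ := pd i φ) fun x hx => image_eq_zero_of_notMem_tsupport
      fun hx' => hx (hφ.2.2 ((tsupport_fderiv_apply_subset ℝ _) hx')),
    key w fun x hx => image_eq_zero_of_notMem_tsupport fun hx' => hx (hφ.2.2 hx'), h φ hφ']

theorem weakD_res (a : Fin T.N) {v : L2 D.Ω} (hv : MemH1 D.Ω v) (i : Fin 2) :
    weakD (T.cell a).carrier i (T.res a v) = T.res a (weakD D.Ω i v) :=
  weakD_eq (T.cell a).isOpen (T.hasWeakD_res a (weakD_spec hv i))

theorem gradForm_eq_sum {v : L2 D.Ω} (hv : MemH1 D.Ω v) : gradForm D.Ω v v =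
    ∑ a, gradForm (T.cell a).carrier (T.res a v) (T.res a v) := by
  unfold gradForm
  rw [Finset.sum_comm]
  simp only [T.weakD_res _ hv, T.inner_eq_sum]

theorem hessForm_eq_sum {v : L2 D.Ω} (hv : MemH2 D.Ω v) : hessForm D.Ω v v =
    ∑ a, hessForm (T.cell a).carrier (T.res a v) (T.res a v) := by
  unfold hessForm
  simp only [T.weakD_res _ hv.1, T.weakD_res _ (hv.2 _), T.inner_eq_sum]
  exact (Finset.sum_comm.trans (Finset.sum_congr rfl fun i _ => Finset.sum_comm)).symm

/-- For globally weakly differentiable functions the broken norm is the global one. This lets the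
conforming method be treated with the piecewise norm as well. -/
theorem normH_eq_normPw {β γ : ℝ} {x : L2 D.Ω × L2 D.Ω} (h1 : MemH2 D.Ω x.1)
    (h2 : MemH1 D.Ω x.2) : D.normH β γ x = T.normPw β γ x := by
  unfold PlateDomain.normH normPw normSq
  rw [T.hessForm_eq_sum h1, T.gradForm_eq_sum h2, T.norm_sq_eq_sum, T.norm_sq_eq_sum]
  simp only [Finset.mul_sum, Finset.sum_add_distrib]

/-- Boundedness constant of the discrete problem, given the one of the interpolation inequality. -/
def _root_.PlateVEM.StabConstants.bound (C : StabConstants) (c : ℝ) : ℝ := C.kappa + 2 * (1 + c)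

/-! ### Well-posedness from cellwise properties and an interpolation inequality -/

section Abstract

variable {T} {L : ∀ a, LocalScheme (T.cell a)} {k ℓ : ℕ} {S : ∀ a, Stabilisation (L a)}
  {α β γ : ℝ} {C : StabConstants} {V Q : Submodule ℝ (L2 D.Ω)}

/-- A function is determined by its restrictions to the finitely many cells, so the global space
embeds into a product of finite-dimensional local ones. -/
theorem finiteDimensional_of_res {X : Submodule ℝ (L2 D.Ω)}
    {Y : ∀ a, Submodule ℝ (L2 (T.cell a).carrier)} (hY : ∀ a, FiniteDimensional ℝ (Y a))
    (h : ∀ v ∈ X, ∀ a, T.res a v ∈ Y a) : FiniteDimensional ℝ X := by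
  refine FiniteDimensional.of_injective
    (LinearMap.pi fun a => ((T.res a).comp X.subtype).codRestrict (Y a) fun v => h v v.2 a) ?_
  rw [← LinearMap.ker_eq_bot, LinearMap.ker_eq_bot']
  intro v hv
  refine Subtype.ext (T.eq_zero_of_res fun a => ?_)
  exact congrArg Subtype.val (congrFun hv a)

theorem normPw_sq (hβ : 0 ≤ β) (hγ : 0 ≤ γ) (x : L2 D.Ω × L2 D.Ω) : T.normPw β γ x ^ 2 =
    (∑ a, (‖T.res a x.1‖ ^ 2 + hessForm (T.cell a).carrier (T.res a x.1) (T.res a x.1))) +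
      ∑ a, (β * ‖T.res a x.2‖ ^ 2 +
        γ * gradForm (T.cell a).carrier (T.res a x.2) (T.res a x.2)) := by
  unfold normPw
  rw [Real.sq_sqrt, ← Finset.sum_add_distrib]
  · unfold normSq
    simp only [add_assoc]
  · refine Finset.sum_nonneg fun a _ => ?_
    have h1 := Polygon.hessForm_nonneg (U := (T.cell a).carrier) (T.res a x.1)
    have h2 := Polygon.gradForm_nonneg (U := (T.cell a).carrier) (T.res a x.2)
    unfold normSq
    positivity

/-- The symmetric part of the discrete bilinear form. -/
def symmPart (T : Mesh D) {L : ∀ a, LocalScheme (T.cell a)} (S : ∀ a, Stabilisation (L a))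
    (k ℓ : ℕ) (β γ : ℝ) (x y : L2 D.Ω × L2 D.Ω) : ℝ :=
  (∑ a, a1h (S a) k (T.res a x.1) (T.res a y.1)) + ∑ a, a3h (S a) ℓ β γ (T.res a x.2) (T.res a y.2)

/-- The coupling part of the discrete bilinear form. -/
def coupling (T : Mesh D) (k ℓ : ℕ) (α : ℝ) (x y : L2 D.Ω × L2 D.Ω) : ℝ :=
  ∑ a, a2h (T.cell a) k ℓ α (T.res a x.2) (T.res a y.1)

theorem A_eq (x y : L2 D.Ω × L2 D.Ω) : T.A S k ℓ α β γ x y =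
    T.symmPart S k ℓ β γ x y - T.coupling k ℓ α x y + T.coupling k ℓ α y x := by
  unfold A symmPart coupling
  ring

theorem linOn_fst : LinOn (V.prod Q) (fun x : L2 D.Ω × L2 D.Ω => x.1) :=
  ⟨fun _ _ _ _ => rfl, fun _ _ _ => rfl⟩

theorem linOn_snd : LinOn (V.prod Q) (fun x : L2 D.Ω × L2 D.Ω => x.2) :=
  ⟨fun _ _ _ _ => rfl, fun _ _ _ => rfl⟩

theorem bilinOn_symmPart (hL : ∀ a, (L a).Good k ℓ) (hV : ∀ v ∈ V, ∀ a, T.res a v ∈ (L a).V)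
    (hQ : ∀ q ∈ Q, ∀ a, T.res a q ∈ (L a).Q) (S : ∀ a, Stabilisation (L a)) :
    BilinOn (V.prod Q) (V.prod Q) (T.symmPart S k ℓ β γ) :=
  (BilinOn.sum fun a _ => ((hL a).bilinOn_a1h (S a)).comp (linOn_fst.comp (T.res a))
    (linOn_fst.comp (T.res a)) (fun _ hv => hV _ hv.1 a) fun _ hv => hV _ hv.1 a).add
  (BilinOn.sum fun a _ => ((hL a).bilinOn_a3h (S a) β γ).comp (linOn_snd.comp (T.res a))
    (linOn_snd.comp (T.res a)) (fun _ hv => hQ _ hv.2 a) fun _ hv => hQ _ hv.2 a)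

theorem bilinOn_coupling (hL : ∀ a, (L a).Good k ℓ) (hV : ∀ v ∈ V, ∀ a, T.res a v ∈ (L a).V)
    (hQ : ∀ q ∈ Q, ∀ a, T.res a q ∈ (L a).Q) :
    BilinOn (V.prod Q) (V.prod Q) (T.coupling k ℓ α) :=
  BilinOn.sum fun a _ => ((hL a).bilinOn_a2h α).comp (linOn_snd.comp (T.res a))
    (linOn_fst.comp (T.res a)) (fun _ hv => hQ _ hv.2 a) fun _ hv => hV _ hv.1 a

theorem linOn_F (f g : L2 D.Ω) : LinOn (V.prod Q) (T.F k ℓ f g) := by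
  refine LinOn.add_fun (LinOn.sum fun a _ => ?_) (LinOn.sum fun a _ => ?_)
  · exact (linOn_fst.comp (T.res a)).comp ((innerₗ _ (T.res a f)).comp
      ((T.cell a).proj k : L2 (T.cell a).carrier →ₗ[ℝ] L2 (T.cell a).carrier))
  · exact (linOn_snd.comp (T.res a)).comp ((innerₗ _ (T.res a g)).comp
      ((T.cell a).proj ℓ : L2 (T.cell a).carrier →ₗ[ℝ] L2 (T.cell a).carrier))

theorem norm_res_fst_le (hβ : 0 ≤ β) (hγ : 0 ≤ γ) (x : L2 D.Ω × L2 D.Ω) (a : Fin T.N) :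
    ‖T.res a x.1‖ ≤ T.normPw β γ x := by
  refine Real.le_sqrt_of_sq_le (le_trans ?_ (Finset.single_le_sum (f := fun a =>
    normSq (T.cell a).carrier β γ (T.res a x.1) (T.res a x.2)) (fun a _ => ?_)
    (Finset.mem_univ a)))
  all_goals
    have h1 := Polygon.hessForm_nonneg (U := (T.cell a).carrier) (T.res a x.1)
    have h2 := Polygon.gradForm_nonneg (U := (T.cell a).carrier) (T.res a x.2)
    unfold normSq
  · have h3 : 0 ≤ β * ‖T.res a x.2‖ ^ 2 := by positivity
    have h4 := mul_nonneg hγ h2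
    linarith
  · positivity

theorem sqrt_mul_norm_res_snd_le (hβ : 0 ≤ β) (hγ : 0 ≤ γ) (x : L2 D.Ω × L2 D.Ω) (a : Fin T.N) :
    √β * ‖T.res a x.2‖ ≤ T.normPw β γ x := by
  refine Real.le_sqrt_of_sq_le (le_trans ?_ (Finset.single_le_sum (f := fun a =>
    normSq (T.cell a).carrier β γ (T.res a x.1) (T.res a x.2)) (fun a _ => ?_)
    (Finset.mem_univ a)))
  all_goals
    have h1 := Polygon.hessForm_nonneg (U := (T.cell a).carrier) (T.res a x.1)
    have h2 := Polygon.gradForm_nonneg (U := (T.cell a).carrier) (T.res a x.2)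
    unfold normSq
  · have h4 := mul_nonneg hγ h2
    rw [mul_pow, Real.sq_sqrt hβ]
    have h5 := sq_nonneg ‖T.res a x.1‖
    linarith
  · positivity

theorem exists_bound_F (hβ : 0 < β) (hγ : 0 ≤ γ) (f g : L2 D.Ω) :
    ∃ c : ℝ, 0 ≤ c ∧ ∀ y, |T.F k ℓ f g y| ≤ c * T.normPw β γ y := by
  have hs : 0 < √β := Real.sqrt_pos.2 hβ
  refine ⟨∑ a, ‖T.res a f‖ + ∑ a, ‖T.res a g‖ * (√β)⁻¹, by positivity, fun y => ?_⟩
  unfold F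
  refine (abs_add_le _ _).trans ?_
  rw [add_mul, Finset.sum_mul, Finset.sum_mul]
  refine add_le_add ((Finset.abs_sum_le_sum_abs _ _).trans (Finset.sum_le_sum fun a _ => ?_))
    ((Finset.abs_sum_le_sum_abs _ _).trans (Finset.sum_le_sum fun a _ => ?_))
  · refine (abs_real_inner_le_norm _ _).trans ?_
    exact mul_le_mul_of_nonneg_left ((Polygon.norm_proj_le _ _).trans
      (norm_res_fst_le hβ.le hγ y a)) (norm_nonneg _)
  · refine (abs_real_inner_le_norm _ _).trans ?_
    rw [mul_assoc]
    refine mul_le_mul_of_nonneg_left ((Polygon.norm_proj_le _ _).trans ?_) (norm_nonneg _)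
    rw [le_inv_mul_iff₀ hs]
    exact sqrt_mul_norm_res_snd_le hβ.le hγ y a

theorem eq_zero_of_normPw (hβ : 0 < β) (hγ : 0 ≤ γ) {x : L2 D.Ω × L2 D.Ω}
    (hx : T.normPw β γ x = 0) : x = 0 := by
  refine Prod.ext (T.eq_zero_of_res fun a => ?_) (T.eq_zero_of_res fun a => ?_)
  · have := norm_res_fst_le hβ.le hγ x a
    rw [hx] at this
    exact norm_le_zero_iff.1 this
  · have := sqrt_mul_norm_res_snd_le hβ.le hγ x a
    rw [hx] at this
    exact norm_le_zero_iff.1 (nonpos_of_mul_nonpos_right this (Real.sqrt_pos.2 hβ))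

/-- The coupling is at most the product of the broken H¹ seminorms of pressure and displacement. The
first is part of the norm because γ ≥ 1 and α ≤ 1, so no parameter enters the constant. The second
is controlled by the interpolation inequality `hy`. -/
theorem abs_coupling_le (hα : 0 ≤ α) (hα1 : α ≤ 1) (hβ : 0 ≤ β) (hγ : 1 ≤ γ) {c : ℝ} (hc : 0 ≤ c)
    (x : L2 D.Ω × L2 D.Ω) {y : L2 D.Ω × L2 D.Ω}
    (hy : ∑ a, gradForm (T.cell a).carrier (T.res a y.1) (T.res a y.1) ≤
      c * ∑ a, (‖T.res a y.1‖ ^ 2 + hessForm (T.cell a).carrier (T.res a y.1) (T.res a y.1))) :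
    |T.coupling k ℓ α x y| ≤ (1 + c) * (T.normPw β γ x * T.normPw β γ y) := by
  have hγ0 : 0 ≤ γ := zero_le_one.trans hγ
  have hx2 := normPw_sq (T := T) hβ hγ0 x
  have hy2 := normPw_sq (T := T) hβ hγ0 y
  have g1 : ∀ a, 0 ≤ gradForm (T.cell a).carrier (T.res a x.2) (T.res a x.2) :=
    fun a => Polygon.gradForm_nonneg _
  have g2 : ∀ z : L2 D.Ω × L2 D.Ω, 0 ≤ ∑ a, (‖T.res a z.1‖ ^ 2 +
      hessForm (T.cell a).carrier (T.res a z.1) (T.res a z.1)) := fun z =>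
    Finset.sum_nonneg fun a _ => add_nonneg (sq_nonneg _) (Polygon.hessForm_nonneg _)
  have g3 : ∀ z : L2 D.Ω × L2 D.Ω, 0 ≤ ∑ a, (β * ‖T.res a z.2‖ ^ 2 +
      γ * gradForm (T.cell a).carrier (T.res a z.2) (T.res a z.2)) := fun z =>
    Finset.sum_nonneg fun a _ => add_nonneg (mul_nonneg hβ (sq_nonneg _))
      (mul_nonneg hγ0 (Polygon.gradForm_nonneg _))
  have e1 : ∑ a, gradForm (T.cell a).carrier (T.res a x.2) (T.res a x.2) ≤
      T.normPw β γ x ^ 2 := by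
    refine le_trans (Finset.sum_le_sum fun a _ => ?_) (hx2.symm ▸ le_add_of_nonneg_left (g2 x))
    exact (le_mul_of_one_le_left (g1 a) hγ).trans
      (le_add_of_nonneg_left (mul_nonneg hβ (sq_nonneg _)))
  have e2 : ∑ a, gradForm (T.cell a).carrier (T.res a y.1) (T.res a y.1) ≤
      ((1 + c) * T.normPw β γ y) ^ 2 := by
    refine hy.trans ?_
    have h3 : ∑ a, (‖T.res a y.1‖ ^ 2 +
        hessForm (T.cell a).carrier (T.res a y.1) (T.res a y.1)) ≤ T.normPw β γ y ^ 2 :=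
      hy2.symm ▸ le_add_of_nonneg_right (g3 y)
    rw [mul_pow]
    -- The crude bound c ≤ (1 + c)² avoids a square root in the final constant.
    exact mul_le_mul (by nlinarith) h3 (g2 y) (by positivity)
  have nx : 0 ≤ T.normPw β γ x := Real.sqrt_nonneg _
  have ny : 0 ≤ T.normPw β γ y := Real.sqrt_nonneg _
  calc |T.coupling k ℓ α x y|
      ≤ ∑ a, √(gradForm (T.cell a).carrier (T.res a x.2) (T.res a x.2)) *
          √(gradForm (T.cell a).carrier (T.res a y.1) (T.res a y.1)) :=
        (Finset.abs_sum_le_sum_abs _ _).trans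
          (Finset.sum_le_sum fun a _ => abs_a2h_le hα hα1 _ _ _ _)
    _ ≤ √(∑ a, gradForm (T.cell a).carrier (T.res a x.2) (T.res a x.2)) *
          √(∑ a, gradForm (T.cell a).carrier (T.res a y.1) (T.res a y.1)) :=
        Real.sum_sqrt_mul_sqrt_le _ g1 fun a => Polygon.gradForm_nonneg _
    _ ≤ T.normPw β γ x * ((1 + c) * T.normPw β γ y) :=
        mul_le_mul ((Real.sqrt_le_left nx).2 e1) ((Real.sqrt_le_left (by positivity)).2 e2)
          (Real.sqrt_nonneg _) nx
    _ = (1 + c) * (T.normPw β γ x * T.normPw β γ y) := by ring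

/-- The common argument for both methods. The symmetric part is equivalent to the squared norm, with
constant κ on either side, and bounded by Cauchy-Schwarz. The coupling enters boundedness twice and
coercivity not at all. Only the interpolation inequality `hint` distinguishes the two methods. -/
theorem wellPosed_of_good (hL : ∀ a, (L a).Good k ℓ) (hS : ∀ a, (S a).Admissible k ℓ β γ C)
    (hV : ∀ v ∈ V, ∀ a, T.res a v ∈ (L a).V) (hQ : ∀ q ∈ Q, ∀ a, T.res a q ∈ (L a).Q)
    (hα : 0 ≤ α) (hα1 : α ≤ 1) (hβ : 0 < β) (hγ : 1 ≤ γ) {c : ℝ} (hc : 0 ≤ c)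
    (hint : ∀ v ∈ V, ∑ a, gradForm (T.cell a).carrier (T.res a v) (T.res a v) ≤
      c * ∑ a, (‖T.res a v‖ ^ 2 + hessForm (T.cell a).carrier (T.res a v) (T.res a v))) :
    WellPosed (V.prod Q) (T.normPw β γ) (T.A S k ℓ α β γ)
      (fun d : L2 D.Ω × L2 D.Ω => T.F k ℓ d.1 d.2) (C.bound c) C.kappa⁻¹ := by
  have hγ0 : 0 ≤ γ := zero_le_one.trans hγ
  have hκ : 0 < C.kappa := zero_lt_one.trans_le C.one_le_kappa
  have hB := bilinOn_symmPart (β := β) (γ := γ) hL hV hQ S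
  have hP := bilinOn_coupling (α := α) hL hV hQ
  have fV := finiteDimensional_of_res (fun a => (hL a).fin_V) hV
  have fQ := finiteDimensional_of_res (fun a => (hL a).fin_Q) hQ
  have : FiniteDimensional ℝ (V.prod Q) :=
    Module.Finite.iff_fg.2 ((Module.Finite.iff_fg.1 fV).prod (Module.Finite.iff_fg.1 fQ))
  have lower : ∀ x ∈ V.prod Q, T.normPw β γ x ^ 2 ≤ C.kappa * T.symmPart S k ℓ β γ x x := by
    intro x hx
    rw [normPw_sq hβ.le hγ0, symmPart, mul_add, Finset.mul_sum, Finset.mul_sum]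
    exact add_le_add (Finset.sum_le_sum fun a _ => (hS a).le_a1h (hL a) (hV _ hx.1 a))
      (Finset.sum_le_sum fun a _ => (hS a).le_a3h (hL a) hβ.le hγ0 (hQ _ hx.2 a))
  have upper : ∀ x ∈ V.prod Q, T.symmPart S k ℓ β γ x x ≤ C.kappa * T.normPw β γ x ^ 2 := by
    intro x hx
    rw [normPw_sq hβ.le hγ0, symmPart, mul_add, Finset.mul_sum, Finset.mul_sum]
    exact add_le_add (Finset.sum_le_sum fun a _ => (hS a).a1h_le (hL a) (hV _ hx.1 a))
      (Finset.sum_le_sum fun a _ => (hS a).a3h_le (hL a) hβ.le hγ0 (hQ _ hx.2 a))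
  have nn : ∀ x, 0 ≤ T.normPw β γ x := fun x => Real.sqrt_nonneg _
  have pos : ∀ x ∈ V.prod Q, 0 ≤ T.symmPart S k ℓ β γ x x := fun x hx =>
    nonneg_of_mul_nonneg_right ((sq_nonneg _).trans (lower x hx)) hκ
  have symm : ∀ x ∈ V.prod Q, ∀ y ∈ V.prod Q,
      T.symmPart S k ℓ β γ x y = T.symmPart S k ℓ β γ y x := fun x _ y _ => by
    unfold symmPart
    simp only [(hS _).a1h_symm (T.res _ x.1), (hS _).a3h_symm (T.res _ x.2)]
  refine wellPosed_of_coercive (V.prod Q) (inv_pos.2 hκ) ?_ (fun d => linOn_F d.1 d.2) nn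
    (fun x _ hx => eq_zero_of_normPw hβ hγ0 hx) (fun x hx y hy => ?_) (fun x hx => ?_) fun d => ?_
  · have := (hB.sub hP).add hP.swap
    simp only [← A_eq] at this
    exact this
  · rw [A_eq]
    have h1 : |T.symmPart S k ℓ β γ x y| ≤ C.kappa * (T.normPw β γ x * T.normPw β γ y) := by
      refine abs_le_of_sq_le_sq ?_ (mul_nonneg hκ.le (mul_nonneg (nn x) (nn y)))
      refine (hB.cauchy_schwarz symm pos hx hy).trans ((mul_le_mul (upper x hx) (upper y hy)
        (pos y hy) (by positivity)).trans (le_of_eq (by ring)))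
    have h2 := abs_coupling_le (k := k) (ℓ := ℓ) hα hα1 hβ.le hγ hc x (hint _ hy.1)
    have h3 := abs_coupling_le (k := k) (ℓ := ℓ) hα hα1 hβ.le hγ hc y (hint _ hx.1)
    have h4 := abs_add_le (T.symmPart S k ℓ β γ x y - T.coupling k ℓ α x y) (T.coupling k ℓ α y x)
    have h5 := abs_sub (T.symmPart S k ℓ β γ x y) (T.coupling k ℓ α x y)
    unfold StabConstants.bound
    linarith
  -- On the diagonal the two coupling terms are equal with opposite signs.
  · rw [A_eq, sub_add_cancel, inv_mul_le_iff₀ hκ]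
    exact lower x hx
  · obtain ⟨b, hb, h⟩ := exists_bound_F (T := T) (k := k) (ℓ := ℓ) hβ hγ0 d.1 d.2
    exact ⟨b, hb, fun y _ => h y⟩

end Abstract

end Mesh

/-! ### Interpolation inequalities and well-posedness -/

theorem WellPosed.congr_norm {E J : Type} [AddCommGroup E] [Module ℝ E] {X : Submodule ℝ E}
    {nrm nrm' : E → ℝ} {A : E → E → ℝ} {F : J → E → ℝ} {M c : ℝ}
    (h : WellPosed X nrm A F M c) (he : ∀ x ∈ X, nrm' x = nrm x) : WellPosed X nrm' A F M c := by
  obtain ⟨h1, h2, h3, h4⟩ := h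
  refine ⟨h1, fun x hx y hy => ?_, fun x hx => ?_, fun d => ⟨?_, (h4 d).2.1, fun x hx hs b hb h => ?_⟩⟩
  · rw [he x hx, he y hy]
    exact h2 x hx y hy
  · rw [he x hx]
    exact h3 x hx
  · obtain ⟨b, hb, h⟩ := (h4 d).1
    exact ⟨b, hb, fun y hy => by rw [he y hy]; exact h y hy⟩
  · rw [he x hx]
    exact (h4 d).2.2 x hx hs b hb fun y hy => by rw [← he y hy]; exact h y hy

theorem inner_toLp {U : Set Plane} {φ : Plane → ℝ} (hφ : MemLp φ 2 (volume.restrict U))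
    (w : L2 U) : ⟪w, hφ.toLp⟫ = ∫ x in U, w x * φ x := by
  rw [L2.inner_def]
  refine integral_congr_ae ?_
  filter_upwards [hφ.coeFn_toLp] with x hx
  rw [hx]
  exact mul_comm _ _

theorem norm_sub_toLp_le {U : Set Plane} {φ : Plane → ℝ} (hφ : MemLp φ 2 (volume.restrict U))
    {w : L2 U} {ε : ℝ} (hε : 0 ≤ ε)
    (h : eLpNorm ((w : Plane → ℝ) - φ) 2 (volume.restrict U) ≤ ENNReal.ofReal ε) :
    ‖w - hφ.toLp‖ ≤ ε := by
  rw [Lp.norm_def]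
  refine ENNReal.toReal_le_of_le_ofReal hε (le_trans (le_of_eq ?_) h)
  refine eLpNorm_congr_ae ?_
  filter_upwards [Lp.coeFn_sub w hφ.toLp, hφ.coeFn_toLp] with x h1 h2
  rw [h1, Pi.sub_apply, Pi.sub_apply, h2]

/-- Integration by parts against functions in `H¹₀(Ω)`. -/
theorem PlateDomain.MemH10.inner_weakD {D : PlateDomain} {v : L2 D.Ω} (hv : D.MemH10 v) {i : Fin 2}
    {z w : L2 D.Ω} (h : HasWeakD D.Ω i z w) : ⟪z, weakD D.Ω i v⟫ = -⟪w, v⟫ := by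
  rw [← sub_eq_zero, sub_neg_eq_add, ← abs_nonpos_iff]
  refine le_of_forall_pos_le_add fun ε hε => ?_
  have hN : 0 < ‖z‖ + ‖w‖ + 1 := by positivity
  -- The summand 1 only keeps the denominator positive when z and w vanish.
  set δ := ε / (‖z‖ + ‖w‖ + 1) with hδ
  have hδ0 : 0 < δ := by positivity
  obtain ⟨φ, t, a, b⟩ := hv.2 (ENNReal.ofReal δ) (by simpa using hδ0)
  have h1 := norm_sub_toLp_le t.memLp hδ0.le a
  have h2 := norm_sub_toLp_le (t.memLp_pd i) hδ0.le (b i)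
  have h3 := h φ t
  rw [← inner_toLp (t.memLp_pd i), ← inner_toLp t.memLp] at h3
  have e : ⟪z, weakD D.Ω i v⟫ + ⟪w, v⟫ =
      ⟪z, weakD D.Ω i v - (t.memLp_pd i).toLp⟫ + ⟪w, v - t.memLp.toLp⟫ := by
    rw [inner_sub_right, inner_sub_right]
    linarith
  rw [e, zero_add]
  calc _ ≤ ‖z‖ * δ + ‖w‖ * δ := (abs_add_le _ _).trans (add_le_add
        ((abs_real_inner_le_norm _ _).trans (mul_le_mul_of_nonneg_left h2 (norm_nonneg _)))
        ((abs_real_inner_le_norm _ _).trans (mul_le_mul_of_nonneg_left h1 (norm_nonneg _))))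
    _ ≤ (‖z‖ + ‖w‖ + 1) * δ := by nlinarith
    _ = ε := mul_div_cancel₀ _ hN.ne'

/-- In H¹₀ there is no boundary term: ‖∂ᵢv‖² = -(∂ᵢ∂ᵢv, v), followed by Young's inequality. The two
directions contribute ‖v‖²/2 each. -/
theorem PlateDomain.gradForm_le {D : PlateDomain} {v : L2 D.Ω} (hv : v ∈ D.V) :
    gradForm D.Ω v v ≤ ‖v‖ ^ 2 + hessForm D.Ω v v := by
  have h : ∀ i, ⟪weakD D.Ω i v, weakD D.Ω i v⟫ ≤
      (‖v‖ ^ 2 + ‖weakD D.Ω i (weakD D.Ω i v)‖ ^ 2) / 2 := by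
    intro i
    rw [hv.2.1.inner_weakD (weakD_spec (hv.1.2 i) i)]
    have := neg_le_of_abs_le (abs_real_inner_le_norm (weakD D.Ω i (weakD D.Ω i v)) v)
    nlinarith [sq_nonneg (‖v‖ - ‖weakD D.Ω i (weakD D.Ω i v)‖)]
  have h0 := h 0
  have h1 := h 1
  unfold gradForm hessForm
  simp only [Fin.sum_univ_two, real_inner_self_eq_norm_sq] at *
  have := sq_nonneg ‖weakD D.Ω 1 (weakD D.Ω 0 v)‖
  have := sq_nonneg ‖weakD D.Ω 0 (weakD D.Ω 1 v)‖
  have := sq_nonneg ‖weakD D.Ω 0 (weakD D.Ω 0 v)‖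
  have := sq_nonneg ‖weakD D.Ω 1 (weakD D.Ω 1 v)‖
  linarith

/-! ### Common edges of neighbouring cells and the cancellation of boundary terms -/

section SharedEdge

variable {K K' : Polygon} {i : Fin (K.m + 3)} {j : Fin (K'.m + 3)}

theorem SharedEdge.symm (h : SharedEdge K K' i j) : SharedEdge K' K j i := ⟨h.2.symm, h.1.symm⟩

theorem SharedEdge.len_eq (h : SharedEdge K K' i j) : K.len i = K'.len j := by
  unfold Polygon.len
  rw [h.1, h.2, dist_comm]

theorem SharedEdge.normal_eq (h : SharedEdge K K' i j) (l : Fin 2) :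
    K.normal i l = -K'.normal j l := by
  have ht : K.tangent i = -K'.tangent j := by
    unfold Polygon.tangent
    rw [h.len_eq, h.1, h.2, ← smul_neg, neg_sub]
  unfold Polygon.normal
  fin_cases l <;> simp [ht]

theorem SharedEdge.pt_eq (h : SharedEdge K K' i j) (t : ℝ) : K'.pt j (1 - t) = K.pt i t := by
  unfold Polygon.pt
  rw [h.1, h.2, AffineMap.lineMap_apply_one_sub]

theorem SharedEdge.normalPart_eq (h : SharedEdge K K' i j) (G : Fin 2 → Plane → ℝ) (x : Plane) :
    K.normalPart G i x = -K'.normalPart G j x := by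
  unfold Polygon.normalPart
  simp only [h.normal_eq, mul_neg, Finset.sum_neg_distrib]

theorem SharedEdge.edgeInt_eq (h : SharedEdge K K' i j) (f : Plane → ℝ) :
    K.edgeInt i (fun t => f (K.pt i t)) = K'.edgeInt j fun t => f (K'.pt j t) := by
  unfold Polygon.edgeInt
  have := intervalIntegral.integral_comp_sub_left (a := 0) (b := 1) (fun t => f (K'.pt j t)) 1
  simp only [h.pt_eq, sub_self, sub_zero] at this
  rw [h.len_eq, this]

end SharedEdge

namespace Mesh

variable {D : PlateDomain} {T : Mesh D}

theorem notMem_cell {a b : Fin T.N} (hab : a ≠ b) {x : Plane}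
    (hx : x ∈ closure (T.cell a).carrier) : x ∉ (T.cell b).carrier := fun hb => by
  obtain ⟨y, hy, hy'⟩ := mem_closure_iff.1 hx _ (T.cell b).isOpen hb
  exact (T.disjoint a b hab).le_bot ⟨hy', hy⟩

theorem pt_notMem_ends (K : Polygon) (i : Fin (K.m + 3)) {t : ℝ} (ht : t ∈ Ioo (0 : ℝ) 1) :
    K.pt i t ≠ K.vert i ∧ K.pt i t ≠ K.vert (i + 1) := by
  have h0 : K.pt i 0 = K.vert i := AffineMap.lineMap_apply_zero _ _
  have h1 : K.pt i 1 = K.vert (i + 1) := AffineMap.lineMap_apply_one _ _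
  refine ⟨fun h => ht.1.ne' (K.pt_injective i (h.trans h0.symm)),
    fun h => ht.2.ne (K.pt_injective i (h.trans h1.symm))⟩

/-- An edge with a point inside the domain is shared with a neighbour. -/
theorem exists_shared_of_mem {a : Fin T.N} {x₀ : Plane} {r : ℝ} (hs : (T.cell a).StarBall x₀ r)
    (i : Fin ((T.cell a).m + 3)) {t : ℝ} (ht : t ∈ Ioo (0 : ℝ) 1) (hx : (T.cell a).pt i t ∈ D.Ω) :
    ∃ b, a ≠ b ∧ ∃ j, SharedEdge (T.cell a) (T.cell b) i j := by
  set x := (T.cell a).pt i t with hxd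
  have hc : IsClosed (⋃ b ∈ {b : Fin T.N | a ≠ b}, closure (T.cell b).carrier) :=
    (Set.toFinite _).isClosed_biUnion fun _ _ => isClosed_closure
  have hl : Filter.Tendsto (fun s : ℝ => x + s • (T.cell a).perp i) (𝓝[<] 0) (𝓝 x) := by
    have : ContinuousAt (fun s : ℝ => x + s • (T.cell a).perp i) 0 := by fun_prop
    simpa [ContinuousAt] using this.tendsto.mono_left (nhdsWithin_le_nhds (s := Iio 0))
  -- Points just beyond the edge lie in the domain but not in the closed cell a, hence in other
  -- closed cells. These are finitely many, so their union is closed and contains the limit x.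
  have hm : x ∈ ⋃ b ∈ {b : Fin T.N | a ≠ b}, closure (T.cell b).carrier := by
    refine hc.mem_of_tendsto hl ?_
    filter_upwards [hs.eventually_notMem_closure i ht, hl (D.isOpen.mem_nhds hx)] with s h1 h2
    obtain ⟨b, hb⟩ := mem_iUnion.1 (T.cover.le (subset_closure h2))
    refine mem_biUnion (x := b) ?_ hb
    rintro rfl
    exact h1 hb
  obtain ⟨b, hab, hb⟩ := mem_iUnion₂.1 hm
  have ht' : t ∈ Icc (0 : ℝ) 1 := ⟨ht.1.le, ht.2.le⟩
  have hf : x ∈ frontier (T.cell b).carrier := by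
    rw [(T.cell b).isOpen.frontier_eq]
    exact ⟨hb, notMem_cell hab ((T.cell a).pt_mem_closure i ht')⟩
  rw [(T.cell b).frontier_eq] at hf
  obtain ⟨j, hj⟩ := mem_iUnion.1 hf
  refine ⟨b, hab, j, (T.conformity a b hab i j).resolve_right fun h => ?_⟩
  have hn := pt_notMem_ends (T.cell a) i ht
  exact (h x ((T.cell a).pt_mem_edge i ht') hj).1.elim hn.1 hn.2

/-- No inner point of an unshared edge is in the domain, so they all lie on its boundary, and the
end points follow by closedness. -/
theorem vert_mem_frontier_of_not_shared {a : Fin T.N} {x₀ : Plane} {r : ℝ}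
    (hs : (T.cell a).StarBall x₀ r) (i : Fin ((T.cell a).m + 3))
    (h : ¬ ∃ b, a ≠ b ∧ ∃ j, SharedEdge (T.cell a) (T.cell b) i j) :
    (T.cell a).vert i ∈ frontier D.Ω ∧ (T.cell a).vert (i + 1) ∈ frontier D.Ω := by
  have hpt : ∀ t ∈ Ioo (0 : ℝ) 1, (T.cell a).pt i t ∈ frontier D.Ω := by
    intro t ht
    rw [D.isOpen.frontier_eq]
    exact ⟨closure_mono (T.subset a) ((T.cell a).pt_mem_closure i ⟨ht.1.le, ht.2.le⟩),
      fun hx => h (exists_shared_of_mem hs i ht hx)⟩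
  have hcl : Icc (0 : ℝ) 1 ⊆ (T.cell a).pt i ⁻¹' frontier D.Ω := by
    rw [← closure_Ioo zero_ne_one]
    exact closure_minimal hpt (isClosed_frontier.preimage AffineMap.lineMap_continuous)
  have h0 : (T.cell a).pt i 0 = (T.cell a).vert i := AffineMap.lineMap_apply_zero _ _
  have h1 : (T.cell a).pt i 1 = (T.cell a).vert (i + 1) := AffineMap.lineMap_apply_one _ _
  exact ⟨h0 ▸ hcl ⟨le_rfl, zero_le_one⟩, h1 ▸ hcl ⟨zero_le_one, le_rfl⟩⟩

/-- At most one neighbour shares a given edge. -/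
theorem shared_unique {a b b' : Fin T.N} {i : Fin ((T.cell a).m + 3)}
    {j : Fin ((T.cell b).m + 3)} {j' : Fin ((T.cell b').m + 3)}
    (h : SharedEdge (T.cell a) (T.cell b) i j) (h' : SharedEdge (T.cell a) (T.cell b') i j') :
    (⟨b, j⟩ : Σ c, Fin ((T.cell c).m + 3)) = ⟨b', j'⟩ := by
  by_cases hb : b = b'
  · subst hb
    rw [(T.cell b).vert_injective (h.2.symm.trans h'.2)]
  · exfalso
    have ht : (1 / 2 : ℝ) ∈ Ioo (0 : ℝ) 1 := by norm_num
    -- Both neighbours traverse the edge in the same direction and have their interior on its left,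
    -- so the points just to the left of the midpoint belong to both. Cells are disjoint.
    have e1 := (T.cell b).eventually_perp_mem j ht
    have e2 := (T.cell b').eventually_perp_mem j' ht
    have hp : (T.cell b).pt j (1 / 2) = (T.cell b').pt j' (1 / 2) := by
      have := h.pt_eq (1 / 2)
      rw [← h'.pt_eq] at this
      norm_num at this ⊢
      exact this
    have hq : (T.cell b).perp j = (T.cell b').perp j' := by
      unfold Polygon.perp Polygon.dir
      rw [← h.1, ← h.2, ← h'.1, ← h'.2]
    rw [hp, hq] at e1
    obtain ⟨s, h1, h2⟩ := (e1.and e2).exists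
    exact (T.disjoint b b' hb).le_bot ⟨h1, h2⟩

/-- The jump condition is tested with the constant 1, which is allowed since k ≥ 2. The outward
normals of the two cells are opposite, so continuity of the mean flux appears as a vanishing sum. -/
theorem normalPart_jump {k : ℕ} (hk : 2 ≤ k) {w : Fin T.N → Plane → ℝ}
    {G : Fin T.N → Fin 2 → Plane → ℝ} (hG : ∀ a l, (T.cell a).MemL2Bdry (G a l))
    (hJ : T.VJumps k w G) {a b : Fin T.N} (hab : a ≠ b) {i : Fin ((T.cell a).m + 3)}
    {j : Fin ((T.cell b).m + 3)} (h : SharedEdge (T.cell a) (T.cell b) i j) :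
    (T.cell a).edgeInt i (fun t => (T.cell a).normalPart (G a) i ((T.cell a).pt i t)) +
      (T.cell b).edgeInt j (fun t => (T.cell b).normalPart (G b) j ((T.cell b).pt j t)) = 0 := by
  have h1 : (1 : Polynomial ℝ) ∈ Polynomial.degreeLT ℝ (k - 1) := by
    rw [Polynomial.mem_degreeLT]
    refine lt_of_le_of_lt Polynomial.degree_one_le ?_
    exact_mod_cast (by omega : 0 < k - 1)
  have h2 := hJ.2.2.1 a b i j hab h 1 h1
  have ia := normal_integrable (K := T.cell a) (i := i) (G := G a)
    (fun l f hf => (hG a l).integrable i hf) 1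
  have ib := normal_integrable (K := T.cell a) (i := i) (G := G b)
    (fun l f hf => shared_integrable h (hG b l) hf) 1
  simp only [Polynomial.eval_one, mul_one] at h2 ia ib
  have h3 : ∀ x, (T.cell a).normalPart (G a - G b) i x =
      (T.cell a).normalPart (G a) i x - (T.cell a).normalPart (G b) i x := fun x => by
    simp [Polygon.normalPart, sub_mul]
  simp only [h3] at h2
  unfold Polygon.edgeInt at h2
  rw [intervalIntegral.integral_sub ia ib, mul_sub] at h2
  have h4 := h.edgeInt_eq fun x => (T.cell a).normalPart (G b) i x
  have h5 : (T.cell b).edgeInt j (fun t => (T.cell a).normalPart (G b) i ((T.cell b).pt j t)) =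
      -(T.cell b).edgeInt j (fun t => (T.cell b).normalPart (G b) j ((T.cell b).pt j t)) := by
    unfold Polygon.edgeInt
    simp only [h.normalPart_eq, intervalIntegral.integral_neg, mul_neg]
  rw [h5] at h4
  unfold Polygon.edgeInt at h4 ⊢
  linarith

/-- On a common edge the end point means of the two cells agree by continuity at the vertices, while
the fluxes cancel. On an unshared edge both end points are boundary vertices, where the function
vanishes. Vertex values are used because for k = 2 no moments of v on the edges are under control.
-/
theorem sum_boundary_eq_zero {k : ℕ} (hk : 2 ≤ k) (hs : ∀ a, ∃ x₀ r, (T.cell a).StarBall x₀ r)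
    {w : Fin T.N → Plane → ℝ} {G : Fin T.N → Fin 2 → Plane → ℝ}
    (hG : ∀ a l, (T.cell a).MemL2Bdry (G a l)) (hJ : T.VJumps k w G) :
    ∑ a, ∑ i, (T.cell a).endMean (w a) i *
      (T.cell a).edgeInt i (fun t => (T.cell a).normalPart (G a) i ((T.cell a).pt i t)) = 0 := by
  classical
  rw [Finset.sum_sigma' (s := Finset.univ) (t := fun _ => Finset.univ) (f := fun a i =>
    (T.cell a).endMean (w a) i *
      (T.cell a).edgeInt i (fun t => (T.cell a).normalPart (G a) i ((T.cell a).pt i t)))]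
  let R : (Σ c, Fin ((T.cell c).m + 3)) → (Σ c, Fin ((T.cell c).m + 3)) → Prop := fun p q =>
    p.1 ≠ q.1 ∧ SharedEdge (T.cell p.1) (T.cell q.1) p.2 q.2
  have Rsymm : ∀ {p q}, R p q → R q p := fun h => ⟨h.1.symm, h.2.symm⟩
  have Runique : ∀ {p q q'}, R p q → R p q' → q = q' := fun h h' => shared_unique h.2 h'.2
  -- The pairing of the terms: a pair of a cell and an edge is sent to the same edge seen from the
  -- neighbour, and to itself if there is none. It is an involution because the neighbour is unique,
  -- and the terms at its fixed points are zero.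
  let g : (Σ c, Fin ((T.cell c).m + 3)) → (Σ c, Fin ((T.cell c).m + 3)) := fun p =>
    if h : ∃ q, R p q then h.choose else p
  have hg : ∀ {p q}, R p q → g p = q := fun {p q} h => by
    have h' : ∃ q, R p q := ⟨q, h⟩
    simp only [g, dif_pos h']
    exact Runique h'.choose_spec h
  have hg' : ∀ {p}, (¬ ∃ q, R p q) → g p = p := fun h => by simp only [g, dif_neg h]
  have hz : ∀ p : Σ c, Fin ((T.cell c).m + 3), (¬ ∃ q, R p q) →
      (T.cell p.1).endMean (w p.1) p.2 = 0 := by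
    rintro ⟨a, i⟩ hn
    obtain ⟨x₀, r, hs⟩ := hs a
    have := vert_mem_frontier_of_not_shared hs i
      fun ⟨b, hab, j, h⟩ => hn ⟨⟨b, j⟩, hab, h⟩
    unfold Polygon.endMean
    simp only [hJ.2.1 a _ this.1, hJ.2.1 a _ this.2, add_zero, zero_div]
  refine Finset.sum_involution (fun p _ => g p) (fun p _ => ?_) (fun p _ hne => ?_)
    (fun _ _ => by simp) fun p _ => ?_
  · by_cases h : ∃ q, R p q
    · obtain ⟨q, hq⟩ := h
      rw [hg hq]
      have hw : (T.cell p.1).endMean (w p.1) p.2 = (T.cell q.1).endMean (w q.1) q.2 := by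
        unfold Polygon.endMean
        rw [hJ.1 _ _ _ _ hq.2.1, hJ.1 _ _ _ _ hq.2.2, add_comm]
      rw [hw, ← mul_add, normalPart_jump hk hG hJ hq.1 hq.2, mul_zero]
    · rw [hg' h, hz p h, zero_mul, add_zero]
  · by_cases h : ∃ q, R p q
    · obtain ⟨q, hq⟩ := h
      rw [hg hq]
      exact fun e => hq.1 (congrArg Sigma.fst e.symm)
    · rw [hz p h, zero_mul] at hne
      exact absurd rfl hne
  · by_cases h : ∃ q, R p q
    · obtain ⟨q, hq⟩ := h
      simp only [hg hq, hg (Rsymm hq)]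
    · simp only [hg' h]

theorem ShapeRegular.starBall {ρ : ℝ} (h : T.ShapeRegular ρ) (hρ : 0 < ρ) (a : Fin T.N) :
    ∃ x₀ r, (T.cell a).StarBall x₀ r ∧ ρ * (T.cell a).h ≤ r := by
  obtain ⟨x, r, hr, hst⟩ := (h a).1
  exact ⟨x, r, ⟨(mul_pos hρ Polygon.h_pos).trans_le hr, hst⟩, hr⟩

theorem interpConst_nonneg {ρ H : ℝ} (hρ : 0 < ρ) : 0 ≤ Polygon.interpConst ρ H := by
  unfold Polygon.interpConst
  positivity

/-- Summing `local_interp` over the cells removes the edge terms. Mesh sizes are bounded by the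
diameter of the domain, so the constant depends only on this diameter and ρ. -/
theorem sum_gradForm_le_nonconforming {k : ℕ} (hk : 2 ≤ k) {ρ : ℝ} (hρ : 0 < ρ)
    (hT : T.ShapeRegular ρ) {v : L2 D.Ω} (hv : v ∈ T.Vnc k) :
    ∑ a, gradForm (T.cell a).carrier (T.res a v) (T.res a v) ≤
      (1 + Polygon.interpConst ρ (Metric.diam D.Ω)) *
        ∑ a, (‖T.res a v‖ ^ 2 + hessForm (T.cell a).carrier (T.res a v) (T.res a v)) := by
  obtain ⟨-, w, G, t, hJ⟩ := hv
  have hz := sum_boundary_eq_zero hk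
    (fun a => (hT.starBall hρ a).imp fun _ h => h.imp fun _ h => h.1)
    (fun a l => ((t a).2.2.2.2 l).2.1) hJ
  have hC := interpConst_nonneg (H := Metric.diam D.Ω) hρ
  set c := Polygon.interpConst ρ (Metric.diam D.Ω)
  have h : ∀ a, gradForm (T.cell a).carrier (T.res a v) (T.res a v) ≤
      (1 + c) * (‖T.res a v‖ ^ 2 + hessForm (T.cell a).carrier (T.res a v) (T.res a v)) +
      2 * ∑ i, (T.cell a).endMean (w a) i *
        (T.cell a).edgeInt i (fun t => (T.cell a).normalPart (G a) i ((T.cell a).pt i t)) := by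
    intro a
    obtain ⟨x₀, r, hs, hr⟩ := hT.starBall hρ a
    have h1 := hs.local_interp hρ hr (Metric.diam_mono (T.subset a) D.isBounded) (t a)
    have h2 := Polygon.hessForm_nonneg (U := (T.cell a).carrier) (T.res a v)
    have h3 := mul_nonneg hC (sq_nonneg ‖T.res a v‖)
    linarith
  refine (Finset.sum_le_sum fun a _ => h a).trans (le_of_eq ?_)
  rw [Finset.sum_add_distrib, ← Finset.mul_sum, ← Finset.mul_sum, hz, mul_zero, add_zero]

theorem sum_gradForm_le_conforming {v : L2 D.Ω} (hv : v ∈ D.V) :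
    ∑ a, gradForm (T.cell a).carrier (T.res a v) (T.res a v) ≤
      ∑ a, (‖T.res a v‖ ^ 2 + hessForm (T.cell a).carrier (T.res a v) (T.res a v)) := by
  have := PlateDomain.gradForm_le hv
  rwa [T.gradForm_eq_sum hv.1.1, T.hessForm_eq_sum hv.1, T.norm_sq_eq_sum,
    ← Finset.sum_add_distrib] at this

/-! ### Well-posedness of the two methods -/

theorem wellPosed_nonconforming (T : Mesh D) {k ℓ : ℕ} (hk : 2 ≤ k) (hℓ : 1 ≤ ℓ) {ρ : ℝ}
    (hρ : 0 < ρ) (hT : T.ShapeRegular ρ) {α β γ : ℝ} (hα : 0 ≤ α) (hα1 : α ≤ 1) (hβ : 0 < β)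
    (hγ : 1 ≤ γ) {C : StabConstants} {S : ∀ a, Stabilisation (T.nonconforming k ℓ a)}
    (hS : ∀ a, (S a).Admissible k ℓ β γ C) :
    WellPosed ((T.Vnc k).prod (T.Qnc ℓ)) (T.normPw β γ) (T.A S k ℓ α β γ)
      (fun d : L2 D.Ω × L2 D.Ω => T.F k ℓ d.1 d.2)
      (C.bound (1 + Polygon.interpConst ρ (Metric.diam D.Ω))) C.kappa⁻¹ := by
  have hI := interpConst_nonneg (H := Metric.diam D.Ω) hρ
  have hL : ∀ a, (T.nonconforming k ℓ a).Good k ℓ := fun a => by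
    obtain ⟨x₀, r, hs, -⟩ := hT.starBall hρ a
    exact hs.good_nonconforming hk hℓ
  have hV : ∀ v ∈ T.Vnc k, ∀ a, T.res a v ∈ (T.nonconforming k ℓ a).V := fun v hv => hv.1
  have hQ : ∀ q ∈ T.Qnc ℓ, ∀ a, T.res a q ∈ (T.nonconforming k ℓ a).Q := fun q hq => hq.1
  exact wellPosed_of_good hL hS hV hQ hα hα1 hβ hγ (by linarith)
    fun v hv => sum_gradForm_le_nonconforming hk hρ hT hv

theorem mem_Vc {k : ℕ} {v : L2 D.Ω} :
    v ∈ T.Vc k ↔ v ∈ D.V ∧ ∀ a, T.res a v ∈ (T.cell a).Vc k := by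
  unfold Vc
  simp only [Submodule.mem_inf, Submodule.mem_iInf, Submodule.mem_comap]

theorem mem_Qc {ℓ : ℕ} {q : L2 D.Ω} :
    q ∈ T.Qc ℓ ↔ q ∈ D.Q ∧ ∀ a, T.res a q ∈ (T.cell a).Qc ℓ := by
  unfold Qc
  simp only [Submodule.mem_inf, Submodule.mem_iInf, Submodule.mem_comap]

theorem wellPosed_conforming (T : Mesh D) {k ℓ : ℕ} (hk : 2 ≤ k) {ρ : ℝ}
    (hρ : 0 < ρ) (hT : T.ShapeRegular ρ) {α β γ : ℝ} (hα : 0 ≤ α) (hα1 : α ≤ 1) (hβ : 0 < β)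
    (hγ : 1 ≤ γ) {C : StabConstants} {S : ∀ a, Stabilisation (T.conforming k ℓ a)}
    (hS : ∀ a, (S a).Admissible k ℓ β γ C) :
    WellPosed ((T.Vc k).prod (T.Qc ℓ)) (D.normH β γ) (T.A S k ℓ α β γ)
      (fun d : L2 D.Ω × L2 D.Ω => T.F k ℓ d.1 d.2)
      (C.bound (1 + Polygon.interpConst ρ (Metric.diam D.Ω))) C.kappa⁻¹ := by
  have hI := interpConst_nonneg (H := Metric.diam D.Ω) hρ
  have hL : ∀ a, (T.conforming k ℓ a).Good k ℓ := fun a => by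
    obtain ⟨x₀, r, hs, -⟩ := hT.starBall hρ a
    exact hs.good_conforming hk
  have hV : ∀ v ∈ T.Vc k, ∀ a, T.res a v ∈ (T.conforming k ℓ a).V := fun v hv =>
    (mem_Vc.1 hv).2
  have hQ : ∀ q ∈ T.Qc ℓ, ∀ a, T.res a q ∈ (T.conforming k ℓ a).Q := fun q hq =>
    (mem_Qc.1 hq).2
  -- Here the constant one would do. It is enlarged to that of the nonconforming case so that both
  -- methods share the same bound.
  have hint : ∀ v ∈ T.Vc k, ∑ a, gradForm (T.cell a).carrier (T.res a v) (T.res a v) ≤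
      (1 + Polygon.interpConst ρ (Metric.diam D.Ω)) *
        ∑ a, (‖T.res a v‖ ^ 2 + hessForm (T.cell a).carrier (T.res a v) (T.res a v)) :=
    fun v hv => (sum_gradForm_le_conforming (mem_Vc.1 hv).1).trans (le_mul_of_one_le_left
      (Finset.sum_nonneg fun a _ => add_nonneg (sq_nonneg _) (Polygon.hessForm_nonneg _))
      (by linarith))
  have hn : ∀ x ∈ (T.Vc k).prod (T.Qc ℓ), D.normH β γ x = T.normPw β γ x := fun x hx =>
    T.normH_eq_normPw (mem_Vc.1 hx.1).1.1 (mem_Qc.1 hx.2).1.1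
  exact (wellPosed_of_good hL hS hV hQ hα hα1 hβ hγ (by linarith) hint).congr_norm hn

end Mesh

end PlateVEM

end

theorem mainTheorem12 (D : PlateVEM.PlateDomain) (k ℓ : ℕ) (hk : 2 ≤ k) (hℓ : 1 ≤ ℓ)
    (hℓk : ℓ ≤ k) (ρ : ℝ) (hρ : 0 < ρ) (C : PlateVEM.StabConstants) :
    ∃ M c : ℝ, 0 < M ∧ 0 < c ∧
      ∀ T : PlateVEM.Mesh D, T.ShapeRegular ρ →
      ∀ α β γ : ℝ, 0 ≤ α → α ≤ 1 → 1 ≤ γ → 0 < β →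
        (∀ S : ∀ a, PlateVEM.Stabilisation (T.conforming k ℓ a),
          (∀ a, (S a).Admissible k ℓ β γ C) →
          PlateVEM.WellPosed ((T.Vc k).prod (T.Qc ℓ)) (D.normH β γ) (T.A S k ℓ α β γ)
            (fun d : PlateVEM.L2 D.Ω × PlateVEM.L2 D.Ω => T.F k ℓ d.1 d.2) M c) ∧
        (∀ S : ∀ a, PlateVEM.Stabilisation (T.nonconforming k ℓ a),
          (∀ a, (S a).Admissible k ℓ β γ C) →
          PlateVEM.WellPosed ((T.Vnc k).prod (T.Qnc ℓ)) (T.normPw β γ) (T.A S k ℓ α β γ)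
            (fun d : PlateVEM.L2 D.Ω × PlateVEM.L2 D.Ω => T.F k ℓ d.1 d.2) M c) := by
  have hκ : 0 < C.kappa := zero_lt_one.trans_le C.one_le_kappa
  have hI := PlateVEM.Mesh.interpConst_nonneg (H := Metric.diam D.Ω) hρ
  have hI1 : 0 ≤ 1 + PlateVEM.Polygon.interpConst ρ (Metric.diam D.Ω) := by linarith
  -- The bound M involves the stabilisation constants, ρ and the diameter of the domain, and the
  -- coercivity constant c = 1/κ only the stabilisation constants. Both are fixed before the mesh
  -- and the parameters α, β, γ.
  refine ⟨C.bound (1 + PlateVEM.Polygon.interpConst ρ (Metric.diam D.Ω)), C.kappa⁻¹, ?_,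
    inv_pos.2 hκ, fun T hT α β γ hα hα1 hγ hβ => ⟨fun S hS => ?_, fun S hS => ?_⟩⟩
  · unfold PlateVEM.StabConstants.bound
    linarith
  · exact T.wellPosed_conforming hk hρ hT hα hα1 hβ hγ hS
  · exact T.wellPosed_nonconforming hk hℓ hρ hT hα hα1 hβ hγ hS
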